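/- Let $N\ge 2$, let $\Omega\subseteq S^{N-1}$ be a nonempty connected open subset of the unit sphere of $\mathbb R^N$, let $\rho\ge 0$, and let $\mathcal C^\rho_\Omega=\{r\omega:\ \omega\in\Omega,\ r>\rho\}\subset\mathbb R^N$. Put $C_H=\frac{(N-2)^2}{4}$. Let $\lambda_1=\lambda_1(\Omega)\ge 0$ be the principal Dirichlet eigenvalue of the Laplace--Beltrami operator $-\Delta_\omega$ on $\Omega$, that is, the infimum of $\int_\Omega|\nabla_\omega\psi|^2\,d\omega\big/\int_\Omega\psi^2\,d\omega$ over $0\ne\psi\in C_c^\infty(\Omega)$. A principal Dirichlet eigenfunction is a function $\phi_1\in H^1_0(\Omega)$ with $\phi_1>0$ a.e. in $\Omega$, $\|\phi_1\|_{L^2(\Omega)}=1$ and $-\Delta_\omega\phi_1=\lambda_1\phi_1$ weakly in $\Omega$. A super-solution of $$-\Delta u-\frac{C_H+\lambda_1}{|x|^2}\,u=0\quad\text{in }\mathcal C^\rho_\Omega\qquad(1)$$ is a function $u\in H^1_{loc}(\mathcal C^\rho_\Omega)$ such that $$\int_{\mathcal C^\rho_\Omega}\Big(\nabla u\cdot\nabla\zeta-\frac{C_H+\lambda_1}{|x|^2}\,u\,\zeta\Big)\,dx\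 \ge 0$$ for all $0\le\zeta\in H^1(\mathcal C^\rho_\Omega)\cap L^\infty(\mathcal C^\rho_\Omega)$ vanishing outside a compact subset of $\mathcal C^\rho_\Omega$. A super-solution of the radial critical Hardy equation $$-v''-\frac{N-1}{r}\,v'-\frac{C_H}{r^2}\,v=0\quad\text{in }(\rho,\infty)\qquad(2)$$ is a function $v\in H^1_{loc}(\rho,\infty)$ such that $\int_\rho^\infty\big(v'\eta'-\frac{C_H}{r^2}v\,\eta\big)r^{N-1}\,dr\ge 0$ for all $0\le\eta\in H^1(\rho,\infty)\cap L^\infty(\rho,\infty)$ vanishing outside a compact subset of $(\rho,\infty)$. Let $u$ be a super-solution of (1) of the form $u(r\omega)=v(r)\varphi(\omega)$ ($r>\rho$, $\omega\in\Omega$), with $u>0$ a.e. in $\mathcal C^\rho_\Omega$. Then $\varphi$ is, up to a multiplicative constant, the principal eigenfunction $\phi_1$, and, up to the reciprocal constant, $v$ is a positive super-solution of (2). Precisely: a principal Dirichlet eigenfunction exists, and for every principal Dirichlet eigenfunction $\phi_1$ there is a constant $c\ne 0$ such that $\varphi=c\,\phi_1$ a.e. in $\Omega$, while $c\,v>0$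 a.e. in $(\rho,\infty)$ and $c\,v$ is a super-solution of (2); thus $u=(c\,v)(r)\,\phi_1(\omega)$. -/

import Mathlib

open MeasureTheory Set Filter Topology
open scoped ContDiff RealInnerProductSpace ENNReal

noncomputable section

namespace ConeHardy

section Sobolev

variable {E : Type*} [NormedAddCommGroup E] [InnerProductSpace ℝ E] [CompleteSpace E]
  [MeasureSpace E]

/-- `G` is the weak gradient of `u` in the open set `U`. -/
def IsWeakGradient (U : Set E) (u : E → ℝ) (G : E → E) : Prop :=
  ∀ η : E → ℝ, ContDiff ℝ ∞ η → HasCompactSupport η → tsupport η ⊆ U →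
    ∫ x in U, u x • gradient η x = -∫ x in U, η x • G x

/-- `u ∈ H¹_loc(U)`, with weak gradient `G`. -/
structure MemH1Loc (U : Set E) (u : E → ℝ) (G : E → E) : Prop where
  memLp : ∀ K : Set E, IsCompact K → K ⊆ U → MemLp u 2 (volume.restrict K)
  memLp_grad : ∀ K : Set E, IsCompact K → K ⊆ U → MemLp G 2 (volume.restrict K)
  weak : IsWeakGradient U u G

/-- `ζ ∈ H¹_c(U) ∩ L^∞_c(U)`, with weak gradient `Z`: a bounded `H¹` function that vanishes outside
a compact subset of `U`. -/
structure IsSobolevTest (U : Set E) (ζ : E → ℝ) (Z : E → E) : Prop where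
  memLp : MemLp ζ 2 (volume.restrict U)
  memLp_grad : MemLp Z 2 (volume.restrict U)
  weak : IsWeakGradient U ζ Z
  bounded : MemLp ζ ∞ (volume.restrict U)
  support : ∃ K : Set E, IsCompact K ∧ K ⊆ U ∧ ∀ x, x ∉ K → ζ x = 0

/-- `u ∈ H¹_loc(U)` is a (weak) super-solution of `-∇·(w ∇u) - w V u = 0` in `U`. -/
def IsSuperSolution (U : Set E) (w V : E → ℝ) (u : E → ℝ) : Prop :=
  ∃ G : E → E, MemH1Loc U u G ∧
    ∀ (ζ : E → ℝ) (Z : E → E), IsSobolevTest U ζ Z →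
      (∀ᵐ x ∂(volume.restrict U), 0 ≤ ζ x) →
      0 ≤ ∫ x in U, w x * (⟪G x, Z x⟫ - V x * u x * ζ x)

end Sobolev

/-- The unit sphere `S^{N-1}` of `ℝ^N`. -/
abbrev Sph (N : ℕ) : Type := Metric.sphere (0 : EuclideanSpace ℝ (Fin N)) 1

/-- The surface measure of `S^{N-1}`. -/
def surf (N : ℕ) : Measure (Sph N) :=
  (volume : Measure (EuclideanSpace ℝ (Fin N))).toSphere

/-- The cone-like domain `{(r, θ) : θ ∈ Ω, r > ρ}`. -/
def cone {N : ℕ} (Ω : Set (Sph N)) (ρ : ℝ) : Set (EuclideanSpace ℝ (Fin N)) :=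
  {x | ρ < ‖x‖ ∧ ∃ θ ∈ Ω, x = ‖x‖ • (θ : EuclideanSpace ℝ (Fin N))}

/-- The restriction of `Ψ` to the sphere belongs to `C_c^∞(Ω)`. (Every smooth function on the sphere
is the restriction of a smooth function on `ℝ^N`.) -/
def IsSphereTest {N : ℕ} (Ω : Set (Sph N)) (Ψ : EuclideanSpace ℝ (Fin N) → ℝ) : Prop :=
  ContDiff ℝ ∞ Ψ ∧ tsupport (fun θ : Sph N => Ψ θ) ⊆ Ω

/-- The gradient on the sphere of the restriction of `Ψ`: the tangential part of `∇Ψ`. -/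
def sphereGrad {N : ℕ} (Ψ : EuclideanSpace ℝ (Fin N) → ℝ) (θ : Sph N) :
    EuclideanSpace ℝ (Fin N) :=
  gradient Ψ (θ : EuclideanSpace ℝ (Fin N)) -
    ⟪gradient Ψ (θ : EuclideanSpace ℝ (Fin N)), (θ : EuclideanSpace ℝ (Fin N))⟫ •
      (θ : EuclideanSpace ℝ (Fin N))

/-- The principal Dirichlet eigenvalue `λ₁(Ω)` of the Laplace–Beltrami operator `-Δ_S` on `Ω`: the
infimum of the Rayleigh quotient over `C_c^∞(Ω)`. -/
def dirichletEigenvalue {N : ℕ} (Ω : Set (Sph N)) : ℝ :=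
  sInf {R : ℝ | ∃ Ψ : EuclideanSpace ℝ (Fin N) → ℝ, IsSphereTest Ω Ψ ∧
    (∃ θ : Sph N, Ψ θ ≠ 0) ∧
    R = (∫ θ in Ω, ‖sphereGrad Ψ θ‖ ^ 2 ∂(surf N)) / ∫ θ in Ω, Ψ θ ^ 2 ∂(surf N)}

/-- `φ ∈ H¹_0(Ω)`, with gradient `G`: the closure of `C_c^∞(Ω)` in the `H¹` norm. -/
structure MemH10 {N : ℕ} (Ω : Set (Sph N)) (φ : Sph N → ℝ)
    (G : Sph N → EuclideanSpace ℝ (Fin N)) : Prop where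
  memLp : MemLp φ 2 ((surf N).restrict Ω)
  memLp_grad : MemLp G 2 ((surf N).restrict Ω)
  approx : ∃ Ψ : ℕ → EuclideanSpace ℝ (Fin N) → ℝ, (∀ n, IsSphereTest Ω (Ψ n)) ∧
    Tendsto (fun n => eLpNorm (fun θ : Sph N => Ψ n θ - φ θ) 2 ((surf N).restrict Ω))
      atTop (𝓝 0) ∧
    Tendsto (fun n => eLpNorm (fun θ : Sph N => sphereGrad (Ψ n) θ - G θ) 2
      ((surf N).restrict Ω)) atTop (𝓝 0)

/-- `φ` is the principal Dirichlet eigenfunction `φ₁` of `-Δ_S` on `Ω`: it lies in `H¹_0(Ω)`, is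
positive, has unit norm in `L²(Ω)`, and satisfies `-Δ_S φ = λ₁ φ` weakly. -/
def IsPrincipalEigenfunction {N : ℕ} (Ω : Set (Sph N)) (φ : Sph N → ℝ) : Prop :=
  (∀ᵐ θ ∂((surf N).restrict Ω), 0 < φ θ) ∧
  ∫ θ in Ω, φ θ ^ 2 ∂(surf N) = 1 ∧
  ∃ G : Sph N → EuclideanSpace ℝ (Fin N), MemH10 Ω φ G ∧
    ∀ Ψ : EuclideanSpace ℝ (Fin N) → ℝ, IsSphereTest Ω Ψ →
      ∫ θ in Ω, ⟪G θ, sphereGrad Ψ θ⟫ ∂(surf N) =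
        dirichletEigenvalue Ω * ∫ θ in Ω, φ θ * Ψ θ ∂(surf N)

/-- The Hardy constant `C_H = (N-2)²/4`. -/
def hardyConst (N : ℕ) : ℝ := ((N : ℝ) - 2) ^ 2 / 4

/-- `u` is a super-solution of `-Δu - (C_H + λ₁) |x|⁻² u = 0` in the cone-like domain. -/
def IsConeSuperSolution {N : ℕ} (Ω : Set (Sph N)) (ρ : ℝ)
    (u : EuclideanSpace ℝ (Fin N) → ℝ) : Prop :=
  IsSuperSolution (cone Ω ρ) (fun _ => 1)
    (fun x => (hardyConst N + dirichletEigenvalue Ω) / ‖x‖ ^ 2) u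

/-- `v` is a super-solution of `-v'' - ((N-1)/r) v' - (C_H/r²) v = 0` in `(ρ, ∞)`, in the divergence
form `-(r^{N-1} v')' - r^{N-1} (C_H/r²) v = 0`. -/
def IsRadialSuperSolution (N : ℕ) (ρ : ℝ) (v : ℝ → ℝ) : Prop :=
  IsSuperSolution (Ioi ρ) (fun r => r ^ (N - 1)) (fun r => hardyConst N / r ^ 2) v

end ConeHardy

end

/-!
Write points of the cone as `x = r θ` with `r = |x|`, and let `u(r θ) = v(r) φ(θ)` be the given
positive super-solution; after multiplying both factors by a common sign they are positive
(`exists_sign`). The proof rests on Picone's inequality (`picone`): for a positive super-solution of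
`-Δu - V u = 0` with `V ≥ 0` and a smooth compactly supported `w`,
`∫ |∇w - (w/u) ∇u|² ≤ ∫ |∇w|² - V w²`, which comes from the test function `w² / (u + ε)`.

*Reduction to the sphere.* Nothing is assumed on the regularity of `φ`, so its gradient has to be
extracted from that of `u`. Averaging `∇u` over dilations shows that `φ(x/|x|)` has a weak gradient
`|x|⁻¹ A(x/|x|)` (`isWeakPair_angular`); comparing derivatives along rotation fields, which do not
see `v(|x|)`, shows that the tangential part of `∇u` is `(v(r)/r) A(θ)` (`tangential_gradient`).
Now use `w = η(r) Ψ(θ)` in Picone's inequality. The function `η` can be chosen such that the Hardy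
inequality `∫ η'² r^{N-1} ≥ C_H ∫ η² r^{N-3}` is sharp up to `ε` (`exists_hardy_test`); such `η`
exist on every half-line `(ρ, ∞)`, since the Hardy quotient is almost attained by logarithmically
stretched functions. The Hardy constant is thereby used up by the radial variable, and what remains
is Picone's inequality on `Ω` (`sphere_picone`):
`∫ |∇Ψ - (Ψ/φ) A|² ≤ ∫ |∇Ψ|² - λ₁ Ψ²` for every `Ψ ∈ C_c^∞(Ω)`.

*Uniqueness.* By Rellich's theorem the Rayleigh quotient attains its infimum `λ₁` on `H¹₀(Ω)`, and a
minimizer solves the eigenvalue equation (`exists_minimizer`). For `φ₁ ∈ H¹₀(Ω)` that attains `λ₁`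
the right-hand side of the inequality on `Ω` vanishes, so that `φ ∇φ₁ = φ₁ A`: the quotient `φ₁/φ`
has gradient zero. To make sense of this for functions that are merely weakly differentiable, the
bounded quotient `arctan (φ₁/φ)` is used (`eq_const_mul_of_gradients`); since the cone over `Ω` is
connected, `φ₁` is a multiple of `φ` (`eq_const_mul`). In particular a minimizer has a constant sign,
which gives a principal eigenfunction, and every principal eigenfunction is a positive multiple of
`φ`.

*The radial equation.* As a multiple of an eigenfunction, `φ` solves the eigenvalue equation with
gradient `A`. Testing the inequality for `u` with `η(r) Ψ(θ)`, where `Ψ ≥ 0` and `∫ φ Ψ = 1`, the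
angular terms contribute `λ₁ ∫ v η r^{N-3}`, which cancels the `λ₁` in the potential and leaves the
radial inequality for smooth `η` (`radial_inequality`). Here the weak derivative of `v` is the
spherical mean of the radial derivative of `u` with weight `Ψ` (`isWeakPair_radial`). Mollification
extends the inequality to all admissible `η` (`isRadialSuperSolution`).
-/


namespace ConeHardy

set_option linter.unusedSectionVars false

variable {N : ℕ}

/-! ### Polar coordinates -/

/-- Polar coordinates `(r, θ) ↦ r θ`. -/
def pol (p : ℝ × Sph N) : EuclideanSpace ℝ (Fin N) := p.1 • (p.2 : EuclideanSpace ℝ (Fin N))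

lemma continuous_pol : Continuous (pol (N := N)) := by unfold pol; fun_prop

lemma norm_sph (θ : Sph N) : ‖(θ : EuclideanSpace ℝ (Fin N))‖ = 1 := by
  simp

lemma norm_pol (p : ℝ × Sph N) (h : 0 ≤ p.1) : ‖pol p‖ = p.1 := by
  simp [pol, norm_smul, abs_of_nonneg h]

instance nontrivialEuclidean [Fact (2 ≤ N)] : Nontrivial (EuclideanSpace ℝ (Fin N)) := by
  have : 2 ≤ N := Fact.out
  have : Nonempty (Fin N) := ⟨⟨0, by omega⟩⟩
  infer_instance

instance nonemptySph [Fact (2 ≤ N)] : Nonempty (Sph N) :=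
  (NormedSpace.sphere_nonempty.2 zero_le_one).to_subtype

open Classical in
/-- The direction `x / |x|` of a nonzero vector, as a point of the sphere; the value at `0` is an
arbitrary point. -/
noncomputable def dir [Fact (2 ≤ N)] (x : EuclideanSpace ℝ (Fin N)) : Sph N :=
  if h : x = 0 then Classical.arbitrary _ else ⟨‖x‖⁻¹ • x, by simp [norm_smul, h]⟩

section
variable [Fact (2 ≤ N)]

lemma coe_dir {x : EuclideanSpace ℝ (Fin N)} (h : x ≠ 0) :
    (dir x : EuclideanSpace ℝ (Fin N)) = ‖x‖⁻¹ • x := by simp [dir, h]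

lemma pol_norm_dir (x : EuclideanSpace ℝ (Fin N)) : pol (‖x‖, dir x) = x := by
  by_cases h : x = 0
  · simp [pol, h]
  · simp [pol, coe_dir h, smul_smul, h]

lemma dir_smul {r : ℝ} (hr : 0 < r) (θ : Sph N) :
    dir (r • (θ : EuclideanSpace ℝ (Fin N))) = θ := by
  have h0 : r • (θ : EuclideanSpace ℝ (Fin N)) ≠ 0 :=
    smul_ne_zero hr.ne' (by rw [← norm_ne_zero_iff, norm_sph]; norm_num)
  apply Subtype.ext
  rw [coe_dir h0, norm_smul, norm_sph, smul_smul]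
  simp [abs_of_pos hr, hr.ne']

lemma dir_pol {p : ℝ × Sph N} (hr : 0 < p.1) : dir (pol p) = p.2 := dir_smul hr p.2

lemma measurable_dir : Measurable (dir (N := N)) := by
  have hm : Measurable fun x : EuclideanSpace ℝ (Fin N) => (dir x : EuclideanSpace ℝ (Fin N)) := by
    have : (fun x : EuclideanSpace ℝ (Fin N) => (dir x : EuclideanSpace ℝ (Fin N))) =
        fun x => if x = 0 then (dir (0 : EuclideanSpace ℝ (Fin N)) : EuclideanSpace ℝ (Fin N))
          else ‖x‖⁻¹ • x := by
      ext1 x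
      split_ifs with h
      · rw [h]
      · rw [coe_dir h]
    rw [this]
    exact Measurable.ite (measurableSet_singleton _) measurable_const (by fun_prop)
  exact hm.subtype_mk

lemma continuousAt_dir {x : EuclideanSpace ℝ (Fin N)} (h : x ≠ 0) : ContinuousAt dir x := by
  rw [Topology.IsInducing.subtypeVal.continuousAt_iff]
  have : ContinuousAt (fun x : EuclideanSpace ℝ (Fin N) => ‖x‖⁻¹ • x) x :=
    (continuousAt_id.norm.inv₀ (by simpa using h)).smul continuousAt_id
  refine this.congr ?_
  filter_upwards [isOpen_ne.mem_nhds h] with y hy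
  exact (coe_dir hy).symm

lemma mem_cone_iff {Ω : Set (Sph N)} {ρ : ℝ} (hρ : 0 ≤ ρ) {x : EuclideanSpace ℝ (Fin N)} :
    x ∈ cone Ω ρ ↔ ρ < ‖x‖ ∧ dir x ∈ Ω := by
  constructor
  · rintro ⟨h1, θ, hθ, hx⟩
    refine ⟨h1, ?_⟩
    rw [hx, dir_smul (hρ.trans_lt h1)]
    exact hθ
  · rintro ⟨h1, h2⟩
    exact ⟨h1, dir x, h2, (pol_norm_dir x).symm⟩

lemma pol_mem_cone {Ω : Set (Sph N)} {ρ : ℝ} (hρ : 0 ≤ ρ) {p : ℝ × Sph N}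
    (h1 : ρ < p.1) (h2 : p.2 ∈ Ω) : pol p ∈ cone Ω ρ := by
  rw [mem_cone_iff hρ, norm_pol _ (hρ.trans h1.le), dir_pol (hρ.trans_lt h1)]
  exact ⟨h1, h2⟩

lemma ne_zero_of_mem_cone {Ω : Set (Sph N)} {ρ : ℝ} (hρ : 0 ≤ ρ) {x : EuclideanSpace ℝ (Fin N)}
    (hx : x ∈ cone Ω ρ) : x ≠ 0 := norm_pos_iff.1 (hρ.trans_lt hx.1)

lemma isOpen_cone {Ω : Set (Sph N)} (hΩ : IsOpen Ω) {ρ : ℝ} (hρ : 0 ≤ ρ) :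
    IsOpen (cone Ω ρ) := by
  rw [isOpen_iff_mem_nhds]
  intro x hx
  have hx0 := ne_zero_of_mem_cone hρ hx
  have hx' := (mem_cone_iff hρ).1 hx
  filter_upwards [continuous_norm.continuousAt.eventually_const_lt hx'.1,
    (continuousAt_dir hx0).preimage_mem_nhds (hΩ.mem_nhds hx'.2)] with y h1 h2
  exact (mem_cone_iff hρ).2 ⟨h1, h2⟩

lemma cone_eq_image {Ω : Set (Sph N)} {ρ : ℝ} (hρ : 0 ≤ ρ) :
    cone Ω ρ = pol '' (Ioi ρ ×ˢ Ω) := by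
  ext x
  constructor
  · intro hx
    exact ⟨(‖x‖, dir x), (mem_cone_iff hρ).1 hx, pol_norm_dir x⟩
  · rintro ⟨p, ⟨h1, h2⟩, rfl⟩
    exact pol_mem_cone hρ h1 h2

lemma isPreconnected_cone {Ω : Set (Sph N)} (hΩ : IsConnected Ω) {ρ : ℝ} (hρ : 0 ≤ ρ) :
    IsPreconnected (cone Ω ρ) := by
  rw [cone_eq_image hρ]
  exact (isPreconnected_Ioi.prod hΩ.isPreconnected).image _ continuous_pol.continuousOn

/-- The product of the Lebesgue measure of `(ρ, ∞)` and the surface measure of `Ω`. -/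
noncomputable def polMeasure (Ω : Set (Sph N)) (ρ : ℝ) : Measure (ℝ × Sph N) :=
  (volume.restrict (Ioi ρ)).prod ((surf N).restrict Ω)

instance : IsFiniteMeasure (surf N) := by unfold surf; infer_instance

instance : (surf N).IsOpenPosMeasure := by unfold surf; infer_instance

instance (Ω : Set (Sph N)) (ρ : ℝ) : SFinite (polMeasure Ω ρ) := by
  unfold polMeasure; infer_instance

instance (Ω : Set (Sph N)) (ρ : ℝ) : SigmaFinite (polMeasure Ω ρ) := by
  unfold polMeasure; infer_instance

lemma ae_polMeasure_mem {Ω : Set (Sph N)} (hΩ : MeasurableSet Ω) (ρ : ℝ) :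
    ∀ᵐ p ∂(polMeasure Ω ρ), ρ < p.1 ∧ p.2 ∈ Ω := by
  rw [polMeasure, Measure.prod_restrict]
  exact ae_restrict_mem (measurableSet_Ioi.prod hΩ)

/-- Integration in polar coordinates, with the Jacobian `r^{N-1}` written out. -/
lemma lintegral_eq_polar (f : EuclideanSpace ℝ (Fin N) → ℝ≥0∞) (hf : Measurable f) :
    ∫⁻ x, f x = ∫⁻ p, ENNReal.ofReal (p.1 ^ (N - 1)) * f (pol p) ∂(polMeasure univ 0) := by
  have h1 := (volume : Measure (EuclideanSpace ℝ (Fin N))).measurePreserving_homeomorphUnitSphereProd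
  have h2 := h1.lintegral_comp_emb (Homeomorph.measurableEmbedding _)
    (fun q => f (pol ((q.2 : ℝ), q.1)))
  have h3 : ∀ x : ({0}ᶜ : Set (EuclideanSpace ℝ (Fin N))),
      pol (((homeomorphUnitSphereProd (EuclideanSpace ℝ (Fin N)) x).2 : ℝ),
        (homeomorphUnitSphereProd (EuclideanSpace ℝ (Fin N)) x).1) = x := by
    intro x
    have := x.2
    simp only [pol, homeomorphUnitSphereProd_apply_snd_coe, homeomorphUnitSphereProd_apply_fst_coe]
    rw [smul_smul, mul_inv_cancel₀ (norm_ne_zero_iff.2 this), one_smul]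
  simp only [h3] at h2
  have hfp : Measurable fun p : ℝ × Sph N => f (pol p) := hf.comp continuous_pol.measurable
  have hpr : Measurable fun p : ℝ × Sph N => ENNReal.ofReal (p.1 ^ (N - 1)) * f (pol p) :=
    Measurable.mul (by fun_prop) hfp
  have hsw : Measurable fun q : Sph N × Ioi (0:ℝ) => ((q.2 : ℝ), q.1) :=
    (measurable_subtype_coe.comp measurable_snd).prodMk measurable_fst
  have hfs : Measurable fun q : Sph N × Ioi (0:ℝ) => f (pol ((q.2 : ℝ), q.1)) := hfp.comp hsw
  have hdim : Module.finrank ℝ (EuclideanSpace ℝ (Fin N)) = N := by simp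
  rw [lintegral_subtype_comap (measurableSet_singleton _).compl, restrict_compl_singleton] at h2
  rw [h2, hdim, lintegral_prod_symm' _ hfs, polMeasure, lintegral_prod _ hpr.aemeasurable,
    Measure.restrict_univ, Measure.volumeIoiPow,
    lintegral_withDensity_eq_lintegral_mul₀ (by fun_prop) hfs.lintegral_prod_left'.aemeasurable]
  simp only [Pi.mul_apply]
  rw [lintegral_subtype_comap measurableSet_Ioi (fun y : ℝ => ENNReal.ofReal (y ^ (N-1)) *
      ∫⁻ x, f (pol (y, x)) ∂ (volume.toSphere))]
  refine lintegral_congr fun r => ?_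
  exact (lintegral_const_mul _ (hfp.comp (measurable_prodMk_left (x := r)))).symm

lemma measurePreserving_pol {Ω : Set (Sph N)} (hΩ : MeasurableSet Ω) {ρ : ℝ} (hρ : 0 ≤ ρ) :
    MeasurePreserving pol
      ((polMeasure Ω ρ).withDensity fun p => ENNReal.ofReal (p.1 ^ (N - 1)))
      (volume.restrict (cone Ω ρ)) := by
  refine ⟨continuous_pol.measurable, ?_⟩
  have hcone : MeasurableSet (cone Ω ρ) := by
    have : cone Ω ρ = {x | ρ < ‖x‖ ∧ dir x ∈ Ω} := by ext x; exact mem_cone_iff hρ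
    rw [this]
    exact (measurableSet_lt measurable_const measurable_norm).inter (measurable_dir hΩ)
  have hsub : polMeasure Ω ρ = (polMeasure univ 0).restrict (Ioi ρ ×ˢ Ω) := by
    rw [polMeasure, polMeasure, Measure.prod_restrict, Measure.prod_restrict,
      Measure.restrict_restrict (measurableSet_Ioi.prod hΩ)]
    congr 1
    ext p
    simp only [mem_prod, mem_Ioi, mem_inter_iff, mem_univ, and_true]
    constructor
    · rintro ⟨a, b⟩; exact ⟨⟨a, b⟩, hρ.trans_lt a⟩
    · rintro ⟨a, _⟩; exact a
  refine Measure.ext fun s hs => ?_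
  rw [Measure.map_apply continuous_pol.measurable hs,
    withDensity_apply _ (continuous_pol.measurable hs), Measure.restrict_apply hs,
    ← lintegral_indicator_one (hs.inter hcone),
    lintegral_eq_polar _ (measurable_one.indicator (hs.inter hcone)), hsub,
    Measure.restrict_restrict (continuous_pol.measurable hs),
    ← lintegral_indicator ((continuous_pol.measurable hs).inter (measurableSet_Ioi.prod hΩ))]
  refine lintegral_congr_ae ?_
  filter_upwards [ae_polMeasure_mem MeasurableSet.univ 0] with p hp
  have : pol p ∈ s ∩ cone Ω ρ ↔ p ∈ pol ⁻¹' s ∩ Ioi ρ ×ˢ Ω := by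
    simp only [mem_inter_iff, mem_preimage, mem_prod, mem_Ioi]
    rw [mem_cone_iff hρ, norm_pol _ hp.1.le, dir_pol hp.1]
  by_cases h : p ∈ pol ⁻¹' s ∩ Ioi ρ ×ˢ Ω
  · rw [indicator_of_mem h, indicator_of_mem (this.2 h)]; simp
  · rw [indicator_of_notMem h, indicator_of_notMem (fun h' => h (this.1 h'))]; simp

lemma polMeasure_ac {Ω : Set (Sph N)} (hΩ : MeasurableSet Ω) {ρ : ℝ} (hρ : 0 ≤ ρ) :
    polMeasure Ω ρ ≪ (polMeasure Ω ρ).withDensity fun p => ENNReal.ofReal (p.1 ^ (N - 1)) := by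
  refine withDensity_absolutelyContinuous' (by fun_prop) ?_
  filter_upwards [ae_polMeasure_mem hΩ ρ] with p hp
  simpa using pow_pos (hρ.trans_lt hp.1) _

lemma quasiMeasurePreserving_pol {Ω : Set (Sph N)} (hΩ : MeasurableSet Ω) {ρ : ℝ} (hρ : 0 ≤ ρ) :
    Measure.QuasiMeasurePreserving pol (polMeasure Ω ρ) (volume.restrict (cone Ω ρ)) :=
  ((measurePreserving_pol hΩ hρ).quasiMeasurePreserving).mono_left (polMeasure_ac hΩ hρ)

lemma quasiMeasurePreserving_norm_dir {Ω : Set (Sph N)} (hΩ : MeasurableSet Ω) {ρ : ℝ}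
    (hρ : 0 ≤ ρ) : Measure.QuasiMeasurePreserving (fun x => (‖x‖, dir x))
      (volume.restrict (cone Ω ρ)) (polMeasure Ω ρ) := by
  have hm : Measurable fun x : EuclideanSpace ℝ (Fin N) => (‖x‖, dir x) :=
    measurable_norm.prodMk measurable_dir
  refine ⟨hm, ?_⟩
  rw [← (measurePreserving_pol hΩ hρ).map_eq, Measure.map_map hm continuous_pol.measurable]
  rw [Measure.map_congr (g := id)]
  · rw [Measure.map_id]; exact withDensity_absolutelyContinuous _ _
  · refine (withDensity_absolutelyContinuous _ _).ae_le ?_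
    filter_upwards [ae_polMeasure_mem hΩ ρ] with p hp
    have h0 := hρ.trans_lt hp.1
    simp [norm_pol _ h0.le, dir_pol h0]

section transfer
variable {Ω : Set (Sph N)} {ρ : ℝ} {F : Type*} [NormedAddCommGroup F]

lemma ae_cone_iff (hΩ : MeasurableSet Ω) (hρ : 0 ≤ ρ) {p : EuclideanSpace ℝ (Fin N) → Prop} :
    (∀ᵐ x ∂(volume.restrict (cone Ω ρ)), p x) ↔ ∀ᵐ q ∂(polMeasure Ω ρ), p (pol q) := by
  constructor
  · exact fun h => (quasiMeasurePreserving_pol hΩ hρ).ae h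
  · intro h
    filter_upwards [(quasiMeasurePreserving_norm_dir hΩ hρ).ae h] with x hx
    rwa [pol_norm_dir] at hx

lemma aestronglyMeasurable_cone_iff (hΩ : MeasurableSet Ω) (hρ : 0 ≤ ρ)
    {f : EuclideanSpace ℝ (Fin N) → F} :
    AEStronglyMeasurable f (volume.restrict (cone Ω ρ)) ↔
      AEStronglyMeasurable (fun q => f (pol q)) (polMeasure Ω ρ) := by
  constructor
  · exact fun h => h.comp_quasiMeasurePreserving (quasiMeasurePreserving_pol hΩ hρ)
  · intro h
    have := h.comp_quasiMeasurePreserving (quasiMeasurePreserving_norm_dir hΩ hρ)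
    refine this.congr (ae_of_all _ fun x => ?_)
    simp [pol_norm_dir]

variable [NormedSpace ℝ F]

lemma integrable_cone_iff (hΩ : MeasurableSet Ω) (hρ : 0 ≤ ρ)
    {f : EuclideanSpace ℝ (Fin N) → F} :
    Integrable f (volume.restrict (cone Ω ρ)) ↔
      Integrable (fun q => q.1 ^ (N - 1) • f (pol q)) (polMeasure Ω ρ) := by
  by_cases hf : AEStronglyMeasurable f (volume.restrict (cone Ω ρ))
  · rw [← (measurePreserving_pol hΩ hρ).integrable_comp hf,
      integrable_withDensity_iff_integrable_smul' (by fun_prop) (by simp)]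
    refine integrable_congr ?_
    filter_upwards [ae_polMeasure_mem hΩ ρ] with q hq
    simp [ENNReal.toReal_ofReal (pow_nonneg (hρ.trans hq.1.le) (N-1))]
  · refine iff_of_false (fun h => hf h.1) fun h => hf ?_
    rw [aestronglyMeasurable_cone_iff hΩ hρ]
    have h2 : AEStronglyMeasurable (fun q : ℝ × Sph N => (q.1 ^ (N - 1))⁻¹) (polMeasure Ω ρ) :=
      (by fun_prop : Measurable fun q : ℝ × Sph N => (q.1 ^ (N - 1))⁻¹).aestronglyMeasurable
    refine (h2.smul h.1).congr ?_
    filter_upwards [ae_polMeasure_mem hΩ ρ] with q hq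
    simp only [Pi.smul_apply', smul_smul]
    rw [inv_mul_cancel₀ (pow_pos (hρ.trans_lt hq.1) _).ne', one_smul]

lemma integral_cone (hΩ : MeasurableSet Ω) (hρ : 0 ≤ ρ)
    (f : EuclideanSpace ℝ (Fin N) → F) :
    ∫ x in cone Ω ρ, f x = ∫ q, q.1 ^ (N - 1) • f (pol q) ∂(polMeasure Ω ρ) := by
  by_cases hf : Integrable f (volume.restrict (cone Ω ρ))
  · have hm := measurePreserving_pol hΩ hρ
    rw [← hm.map_eq, integral_map continuous_pol.aemeasurable (by rw [hm.map_eq]; exact hf.1),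
      integral_withDensity_eq_integral_toReal_smul (by fun_prop) (by simp)]
    refine integral_congr_ae ?_
    filter_upwards [ae_polMeasure_mem hΩ ρ] with q hq
    simp [ENNReal.toReal_ofReal (pow_nonneg (hρ.trans hq.1.le) (N-1))]
  · rw [integral_undef hf, integral_undef (fun h => hf ((integrable_cone_iff hΩ hρ).2 h))]

lemma lintegral_cone (hΩ : MeasurableSet Ω) (hρ : 0 ≤ ρ)
    {f : EuclideanSpace ℝ (Fin N) → ℝ≥0∞} (hf : AEMeasurable f (volume.restrict (cone Ω ρ))) :
    ∫⁻ x in cone Ω ρ, f x =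
      ∫⁻ q, ENNReal.ofReal (q.1 ^ (N - 1)) * f (pol q) ∂(polMeasure Ω ρ) := by
  have hm := measurePreserving_pol hΩ hρ
  rw [← hm.map_eq, lintegral_map' (by rw [hm.map_eq]; exact hf) continuous_pol.aemeasurable,
    lintegral_withDensity_eq_lintegral_mul₀ (by fun_prop)]
  · rfl
  · exact hf.comp_quasiMeasurePreserving (quasiMeasurePreserving_pol hΩ hρ)

end transfer

end


/-! ### Mollification in `L^p` -/

section Mollify

open scoped Convolution
open ContinuousLinearMap (lsmul)

variable {E : Type*} [NormedAddCommGroup E] [InnerProductSpace ℝ E] [CompleteSpace E]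
  [FiniteDimensional ℝ E] [MeasureSpace E] [BorelSpace E] [(volume : Measure E).IsAddHaarMeasure]
variable {F : Type*} [NormedAddCommGroup F] [NormedSpace ℝ F] [CompleteSpace F]

set_option linter.unusedSectionVars false

/-- Translation is continuous in `L^p`, `p < ∞`. -/
lemma tendsto_eLpNorm_translate {f : E → F} {p : ℝ≥0∞} [Fact (1 ≤ p)] (hp : p ≠ ⊤)
    (hf : MemLp f p volume) :
    Tendsto (fun t : E => eLpNorm (fun x => f (x - t) - f x) p volume) (𝓝 0) (𝓝 0) := by
  let g : E → C(E, E) := fun t => ⟨fun x => x - t, by fun_prop⟩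
  have hgc : Tendsto g (𝓝 0) (𝓝 (g 0)) :=
    ((ContinuousMap.curry ⟨fun q : E × E => q.2 - q.1, by fun_prop⟩).continuous).tendsto 0
  have hgm : ∀ t, MeasurePreserving (g t) volume volume :=
    fun t => measurePreserving_sub_right volume t
  have h := (tendsto_const_nhds (x := hf.toLp f) (f := 𝓝 (0:E))).compMeasurePreservingLp
    hgc hgm (hgm 0) hp
  rw [tendsto_iff_edist_tendsto_0] at h
  refine h.congr fun t => ?_
  rw [Lp.toLp_compMeasurePreserving, Lp.toLp_compMeasurePreserving, Lp.edist_toLp_toLp]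
  refine eLpNorm_congr_ae (ae_of_all _ fun x => ?_)
  simp [g]

/-- A mollification is as close to `f` in `L^p` as the translates by vectors in the support of the
kernel are: the kernel is a probability density, so that Jensen's inequality and Tonelli's theorem
apply. -/
lemma eLpNorm_convolution_sub_le (φ : ContDiffBump (0 : E)) {f : E → F} (hfm : StronglyMeasurable f)
    {p : ℝ≥0∞} [hp1 : Fact (1 ≤ p)] (hp : p ≠ ⊤) (hf : MemLp f p volume) {ε : ℝ≥0∞}
    (hε : ∀ t ∈ Metric.ball (0 : E) φ.rOut, eLpNorm (fun x => f (x - t) - f x) p volume ≤ ε) :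
    eLpNorm ((φ.normed volume ⋆[lsmul ℝ ℝ, volume] f) - f) p volume ≤ ε := by
  have hp0 : p ≠ 0 := (one_pos.trans_le hp1.out).ne'
  have hpr : 0 < p.toReal := ENNReal.toReal_pos hp0 hp
  set ρ := φ.normed (volume : Measure E) with hρ
  have hρm : Measurable fun t => ENNReal.ofReal (ρ t) :=
    (φ.continuous_normed).measurable.ennreal_ofReal
  set ν : Measure E := volume.withDensity fun t => ENNReal.ofReal (ρ t) with hν
  have hνp : IsProbabilityMeasure ν := ⟨by
    rw [hν, withDensity_apply _ MeasurableSet.univ, Measure.restrict_univ,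
      ← ofReal_integral_eq_lintegral_ofReal φ.integrable_normed
        (ae_of_all _ fun x => φ.nonneg_normed x), φ.integral_normed, ENNReal.ofReal_one]⟩
  have hloc : LocallyIntegrable f volume := hf.locallyIntegrable hp1.out
  have hpt : ∀ x, ‖((ρ ⋆[lsmul ℝ ℝ, volume] f) - f) x‖ₑ ≤
      eLpNorm (fun t => f (x - t) - f x) p ν := by
    intro x
    have hi1 : Integrable (fun t => ρ t • f (x - t)) volume := by
      refine LocallyIntegrable.integrable_smul_left_of_hasCompactSupport ?_
        φ.continuous_normed φ.hasCompactSupport_normed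
      intro y
      obtain ⟨s, hs, hsi⟩ := hloc (x - y)
      refine ⟨(fun t => x - t) ⁻¹' s, (continuous_const.sub continuous_id).continuousAt hs, ?_⟩
      exact ((Measure.measurePreserving_sub_left volume x).integrableOn_comp_preimage
        (MeasurableEquiv.subLeft x).measurableEmbedding).2 hsi
    have hi2 : Integrable (fun t => ρ t • f x) volume := φ.integrable_normed.smul_const _
    have e1 : ((ρ ⋆[lsmul ℝ ℝ, volume] f) - f) x = ∫ t, ρ t • (f (x - t) - f x) := by
      simp only [smul_sub]
      rw [integral_sub hi1 hi2, integral_smul_const, φ.integral_normed, one_smul]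
      rfl
    rw [e1]
    calc ‖∫ t, ρ t • (f (x - t) - f x)‖ₑ ≤ ∫⁻ t, ‖ρ t • (f (x - t) - f x)‖ₑ :=
          enorm_integral_le_lintegral_enorm _
      _ = ∫⁻ t, ‖f (x - t) - f x‖ₑ ∂ν := by
          rw [hν, lintegral_withDensity_eq_lintegral_mul₀ hρm.aemeasurable]
          · refine lintegral_congr fun t => ?_
            simp only [Pi.mul_apply, enorm_smul]
            rw [Real.enorm_of_nonneg (φ.nonneg_normed t)]
          · exact ((hfm.comp_measurable (by fun_prop)).sub
              stronglyMeasurable_const).enorm.aemeasurable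
      _ = eLpNorm (fun t => f (x - t) - f x) 1 ν := eLpNorm_one_eq_lintegral_enorm.symm
      _ ≤ _ := eLpNorm_le_eLpNorm_of_exponent_le hp1.out
          ((hfm.comp_measurable (by fun_prop)).sub stronglyMeasurable_const).aestronglyMeasurable
  have hjm : Measurable fun q : E × E => ‖f (q.1 - q.2) - f q.1‖ₑ ^ p.toReal :=
    (((hfm.comp_measurable (by fun_prop)).sub (hfm.comp_measurable measurable_fst)).enorm).pow_const _
  rw [eLpNorm_eq_lintegral_rpow_enorm_toReal hp0 hp]
  rw [one_div, ENNReal.rpow_inv_le_iff hpr]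
  calc ∫⁻ x, ‖((ρ ⋆[lsmul ℝ ℝ, volume] f) - f) x‖ₑ ^ p.toReal
      ≤ ∫⁻ x, ∫⁻ t, ‖f (x - t) - f x‖ₑ ^ p.toReal ∂ν := by
        refine lintegral_mono fun x => ?_
        have := hpt x
        rw [eLpNorm_eq_lintegral_rpow_enorm_toReal hp0 hp, one_div,
          ENNReal.le_rpow_inv_iff hpr] at this
        exact this
    _ = ∫⁻ t, (∫⁻ x, ‖f (x - t) - f x‖ₑ ^ p.toReal) ∂ν :=
        lintegral_lintegral_swap hjm.aemeasurable
    _ ≤ ∫⁻ _t, ε ^ p.toReal ∂ν := by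
        refine lintegral_mono_ae ?_
        rw [hν, ae_withDensity_iff hρm]
        refine ae_of_all _ fun t ht => ?_
        have htb : t ∈ Metric.ball (0 : E) φ.rOut := by
          rw [← φ.support_normed_eq (μ := volume)]
          intro h0
          exact ht (by rw [← hρ] at h0; simp [h0])
        have := hε t htb
        rwa [eLpNorm_eq_lintegral_rpow_enorm_toReal hp0 hp, one_div,
          ENNReal.rpow_inv_le_iff hpr] at this
    _ = ε ^ p.toReal := by simp

/-- Mollifications converge in `L^p`, `1 ≤ p < ∞`. -/
lemma tendsto_eLpNorm_convolution_sub {φ : ℕ → ContDiffBump (0 : E)}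
    (hφ : Tendsto (fun n => (φ n).rOut) atTop (𝓝 0)) {f : E → F}
    {p : ℝ≥0∞} [hp1 : Fact (1 ≤ p)] (hp : p ≠ ⊤) (hf : MemLp f p volume) :
    Tendsto (fun n => eLpNorm (((φ n).normed volume ⋆[lsmul ℝ ℝ, volume] f) - f) p volume)
      atTop (𝓝 0) := by
  wlog hfm : StronglyMeasurable f generalizing f
  · have h := this ((memLp_congr_ae hf.1.ae_eq_mk).1 hf) hf.1.stronglyMeasurable_mk
    refine h.congr fun n => eLpNorm_congr_ae ?_
    have : ((φ n).normed volume ⋆[lsmul ℝ ℝ, volume] (hf.1.mk f)) =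
        ((φ n).normed volume ⋆[lsmul ℝ ℝ, volume] f) :=
      convolution_congr _ (ae_eq_refl _) hf.1.ae_eq_mk.symm
    filter_upwards [hf.1.ae_eq_mk] with x hx
    simp [this, hx]
  rw [ENNReal.tendsto_nhds_zero]
  intro ε hε
  have h1 := (ENNReal.tendsto_nhds_zero.1 (tendsto_eLpNorm_translate hp hf)) ε hε
  obtain ⟨δ, hδ, hball⟩ := Metric.eventually_nhds_iff_ball.1 h1
  filter_upwards [hφ.eventually_lt_const hδ] with n hn
  exact eLpNorm_convolution_sub_le (φ n) hfm hp hf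
    fun t ht => hball t (Metric.ball_subset_ball hn.le ht)

end Mollify


/-! ### Weak gradients -/

section WeakGradient

open scoped Convolution
open ContinuousLinearMap (lsmul)

variable {E : Type*} [NormedAddCommGroup E] [InnerProductSpace ℝ E] [CompleteSpace E]
  [FiniteDimensional ℝ E] [MeasureSpace E] [BorelSpace E] [(volume : Measure E).IsAddHaarMeasure]

set_option linter.unusedSectionVars false

/-- The test functions `C_c^∞(U)`. -/
structure IsTest (U : Set E) (η : E → ℝ) : Prop where
  smooth : ContDiff ℝ ∞ η
  compact : HasCompactSupport η
  supp : tsupport η ⊆ U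

/-- `u` and `G` are locally integrable in `U`, and `G` is the weak gradient of `u`. -/
structure IsWeakPair (U : Set E) (u : E → ℝ) (G : E → E) : Prop where
  locU : LocallyIntegrableOn u U
  locG : LocallyIntegrableOn G U
  weak : IsWeakGradient U u G

variable {U : Set E} {u : E → ℝ} {G : E → E}

lemma locallyIntegrableOn_of_memLp {F : Type*} [NormedAddCommGroup F] {f : E → F} (hU : IsOpen U)
    {p : ℝ≥0∞} (hp : 1 ≤ p)
    (h : ∀ K : Set E, IsCompact K → K ⊆ U → MemLp f p (volume.restrict K)) :
    LocallyIntegrableOn f U := by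
  rw [locallyIntegrableOn_iff hU.isLocallyClosed]
  intro K hKU hK
  have : IsFiniteMeasure (volume.restrict K) := ⟨by simpa using hK.measure_lt_top⟩
  exact (h K hK hKU).integrable hp

lemma MemH1Loc.isWeakPair (hU : IsOpen U) (h : MemH1Loc U u G) : IsWeakPair U u G :=
  ⟨locallyIntegrableOn_of_memLp hU one_le_two h.memLp,
    locallyIntegrableOn_of_memLp hU one_le_two h.memLp_grad, h.weak⟩

lemma LocallyIntegrableOn.integrable_smul {F : Type*} [NormedAddCommGroup F] [NormedSpace ℝ F]
    {f : E → F} (hf : LocallyIntegrableOn f U) {g : E → ℝ} (hg : Continuous g)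
    (hgc : HasCompactSupport g) (hgU : tsupport g ⊆ U) : Integrable (fun x => g x • f x) := by
  have h1 : IntegrableOn f (tsupport g) := hf.integrableOn_compact_subset hgU hgc
  have h2 : IntegrableOn (fun x => g x • f x) (tsupport g) :=
    h1.continuousOn_smul hg.continuousOn hgc
  refine (integrableOn_iff_integrable_of_support_subset ?_).1 h2
  intro x hx
  by_contra h
  exact hx (by simp [image_eq_zero_of_notMem_tsupport h])

lemma LocallyIntegrableOn.integrable_mul {f : E → ℝ} (hf : LocallyIntegrableOn f U) {g : E → ℝ}
    (hg : Continuous g) (hgc : HasCompactSupport g) (hgU : tsupport g ⊆ U) :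
    Integrable (fun x => f x * g x) := by
  simpa [mul_comm] using LocallyIntegrableOn.integrable_smul hf hg hgc hgU

lemma LocallyIntegrableOn.inner_const {f : E → E} (hf : LocallyIntegrableOn f U) (e : E) :
    LocallyIntegrableOn (fun x => ⟪f x, e⟫) U := fun x hx => by
  obtain ⟨s, hs, h⟩ := hf x hx
  exact ⟨s, hs, Integrable.inner_const h e⟩

lemma LocallyIntegrableOn.congr_on {F : Type*} [NormedAddCommGroup F] {f f' : E → F}
    (hf : LocallyIntegrableOn f U) (hff : ∀ᵐ x ∂(volume.restrict U), f x = f' x) :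
    LocallyIntegrableOn f' U := by
  intro x hx
  obtain ⟨s, hs, hi⟩ := hf x hx
  refine ⟨s ∩ U, inter_mem hs self_mem_nhdsWithin, ?_⟩
  exact (hi.mono_set inter_subset_left).congr
    (ae_mono (Measure.restrict_mono inter_subset_right le_rfl) hff)

namespace IsTest

variable {η : E → ℝ}

lemma differentiable (h : IsTest U η) : Differentiable ℝ η := h.smooth.differentiable (by simp)

lemma mono {V : Set E} (h : IsTest U η) (hUV : U ⊆ V) : IsTest V η :=
  ⟨h.smooth, h.compact, h.supp.trans hUV⟩

lemma mul_smooth (h : IsTest U η) {f : E → ℝ} (hf : ∀ x ∈ U, ContDiffAt ℝ ∞ f x) :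
    IsTest U (fun x => η x * f x) := by
  have hs : tsupport (fun x => η x * f x) ⊆ tsupport η := tsupport_mul_subset_left
  refine ⟨contDiff_iff_contDiffAt.2 fun x => ?_, ?_, hs.trans h.supp⟩
  · by_cases hx : x ∈ tsupport (fun x => η x * f x)
    swap
    · exact contDiffAt_const.congr_of_eventuallyEq (notMem_tsupport_iff_eventuallyEq.1 hx)
    exact h.smooth.contDiffAt.mul (hf x (h.supp (hs hx)))
  · exact h.compact.mul_right

lemma fderiv_cont (h : IsTest U η) (e : E) : Continuous fun x => fderiv ℝ η x e :=
  (h.smooth.continuous_fderiv (by simp)).clm_apply continuous_const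

lemma fderiv_supp (e : E) : tsupport (fun x => fderiv ℝ η x e) ⊆ tsupport η :=
  (tsupport_fderiv_apply_subset ℝ e)

lemma fderiv_compact (h : IsTest U η) (e : E) : HasCompactSupport fun x => fderiv ℝ η x e :=
  h.compact.fderiv_apply ℝ e

lemma integrable_smul (h : IsTest U η) {F : Type*} [NormedAddCommGroup F] [NormedSpace ℝ F]
    {f : E → F} (hf : LocallyIntegrableOn f U) : Integrable (fun x => η x • f x) :=
  LocallyIntegrableOn.integrable_smul hf h.smooth.continuous h.compact h.supp

lemma integrable_mul_fderiv (h : IsTest U η) {f : E → ℝ} (hf : LocallyIntegrableOn f U) (e : E) :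
    Integrable (fun x => f x * fderiv ℝ η x e) :=
  LocallyIntegrableOn.integrable_mul hf (h.fderiv_cont e) (h.fderiv_compact e)
    ((fderiv_supp e).trans h.supp)

lemma gradient_cont (h : IsTest U η) : Continuous (gradient η) := by
  unfold gradient
  exact (LinearIsometryEquiv.continuous _).comp (h.smooth.continuous_fderiv (by simp))

lemma gradient_eq_zero {x : E} (hx : x ∉ tsupport η) : gradient η x = 0 := by
  have h0 : fderiv ℝ η x = 0 := image_eq_zero_of_notMem_tsupport
    fun h' => hx (tsupport_fderiv_subset ℝ h')
  rw [gradient, h0, map_zero]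

lemma integrable_smul_gradient (h : IsTest U η) {f : E → ℝ} (hf : LocallyIntegrableOn f U) :
    Integrable (fun x => f x • gradient η x) := by
  have h1 : IntegrableOn f (tsupport η) := hf.integrableOn_compact_subset h.supp h.compact
  have h2 : IntegrableOn (fun x => f x • gradient η x) (tsupport η) :=
    h1.smul_continuousOn h.gradient_cont.continuousOn h.compact
  refine (integrableOn_iff_integrable_of_support_subset ?_).1 h2
  intro x hx
  by_contra h'
  exact hx (by simp [gradient_eq_zero h'])

end IsTest

lemma isTest_iff_weak (hu : LocallyIntegrableOn u U) (hG : LocallyIntegrableOn G U) {η : E → ℝ}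
    (hη : IsTest U η) :
    (∫ x in U, u x • gradient η x = -∫ x in U, η x • G x) ↔
      ∀ e, ∫ x in U, u x * fderiv ℝ η x e = -∫ x in U, η x * ⟪G x, e⟫ := by
  have i1 := (hη.integrable_smul_gradient hu).integrableOn (s := U)
  have i2 := (hη.integrable_smul hG).integrableOn (s := U)
  have e1 : ∀ e, ⟪e, ∫ x in U, u x • gradient η x⟫ = ∫ x in U, u x * fderiv ℝ η x e := by
    intro e
    rw [← integral_inner i1]
    refine integral_congr_ae (ae_of_all _ fun x => ?_)
    simp [inner_smul_right, inner_gradient_right]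
  have e2 : ∀ e, ⟪e, -∫ x in U, η x • G x⟫ = -∫ x in U, η x * ⟪G x, e⟫ := by
    intro e
    rw [inner_neg_right, ← integral_inner i2]
    congr 1
    refine integral_congr_ae (ae_of_all _ fun x => ?_)
    simp [inner_smul_right, real_inner_comm]
  constructor
  · intro h e
    rw [← e1, h, e2]
  · intro h
    refine ext_inner_left ℝ fun e => ?_
    rw [e1, h, e2]

namespace IsWeakPair

lemma integral_fderiv (h : IsWeakPair U u G) {η : E → ℝ} (hη : IsTest U η) (e : E) :
    ∫ x in U, u x * fderiv ℝ η x e = -∫ x in U, η x * ⟪G x, e⟫ :=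
  (isTest_iff_weak h.locU h.locG hη).1 (h.weak η hη.smooth hη.compact hη.supp) e

lemma of_integral_fderiv (hu : LocallyIntegrableOn u U) (hG : LocallyIntegrableOn G U)
    (h : ∀ η, IsTest U η → ∀ e, ∫ x in U, u x * fderiv ℝ η x e = -∫ x in U, η x * ⟪G x, e⟫) :
    IsWeakPair U u G :=
  ⟨hu, hG, fun η h1 h2 h3 => (isTest_iff_weak hu hG ⟨h1, h2, h3⟩).2 (h η ⟨h1, h2, h3⟩)⟩

lemma mono {V : Set E} (h : IsWeakPair U u G) (hVU : V ⊆ U) : IsWeakPair V u G := by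
  refine ⟨h.locU.mono_set hVU, h.locG.mono_set hVU, fun η h1 h2 h3 => ?_⟩
  have := h.weak η h1 h2 (h3.trans hVU)
  have a1 : ∀ W, V ⊆ W → ∫ x in W, u x • gradient η x = ∫ x, u x • gradient η x := fun W hW =>
    setIntegral_eq_integral_of_forall_compl_eq_zero fun x hx => by
      rw [IsTest.gradient_eq_zero fun h' => hx (hW (h3 h')), smul_zero]
  have a2 : ∀ W, V ⊆ W → ∫ x in W, η x • G x = ∫ x, η x • G x := fun W hW =>
    setIntegral_eq_integral_of_forall_compl_eq_zero fun x hx => by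
      rw [image_eq_zero_of_notMem_tsupport fun h' => hx (hW (h3 h')), zero_smul]
  rw [a1 U hVU, a2 U hVU] at this
  rw [a1 V le_rfl, a2 V le_rfl, this]

lemma congr {u' : E → ℝ} {G' : E → E} (h : IsWeakPair U u G)
    (hu : ∀ᵐ x ∂(volume.restrict U), u x = u' x)
    (hG : ∀ᵐ x ∂(volume.restrict U), G x = G' x) : IsWeakPair U u' G' := by
  refine ⟨LocallyIntegrableOn.congr_on h.locU hu, LocallyIntegrableOn.congr_on h.locG hG, fun η h1 h2 h3 => ?_⟩
  have := h.weak η h1 h2 h3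
  have e1 : ∫ x in U, u x • gradient η x = ∫ x in U, u' x • gradient η x :=
    integral_congr_ae (by filter_upwards [hu] with x hx; rw [hx])
  have e2 : ∫ x in U, η x • G x = ∫ x in U, η x • G' x :=
    integral_congr_ae (by filter_upwards [hG] with x hx; rw [hx])
  rw [← e1, this, e2]

/-- Weak gradients are unique. -/
lemma unique {G' : E → E} (hU : IsOpen U) (h : IsWeakPair U u G) (h' : IsWeakPair U u G') :
    ∀ᵐ x ∂(volume.restrict U), G x = G' x := by
  rw [ae_restrict_iff' hU.measurableSet]
  have := hU.ae_eq_zero_of_integral_contDiff_smul_eq_zero (h.locG.sub h'.locG) (μ := volume)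
    fun η h1 h2 h3 => by
      have hη : IsTest U η := ⟨h1, h2, h3⟩
      have e := (h.weak η h1 h2 h3).symm.trans (h'.weak η h1 h2 h3)
      rw [neg_inj] at e
      have a2 : ∀ G : E → E, ∫ x in U, η x • G x = ∫ x, η x • G x := fun G =>
        setIntegral_eq_integral_of_forall_compl_eq_zero fun x hx => by
          rw [image_eq_zero_of_notMem_tsupport fun h' => hx (h3 h'), zero_smul]
      rw [a2, a2] at e
      simp only [Pi.sub_apply, smul_sub]
      rw [integral_sub (hη.integrable_smul h.locG) (hη.integrable_smul h'.locG), e, sub_self]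
  filter_upwards [this] with x hx hxU
  exact sub_eq_zero.1 (hx hxU)

end IsWeakPair

/-- On `K`, the gradient of the mollification of `u` is the mollification of `G`. -/
lemma gradient_convolution (h : IsWeakPair U u G) {K' : Set E} (hK' : IsCompact K')
    (hK'U : K' ⊆ U) (φ : ContDiffBump (0 : E)) {x : E}
    (hx : Metric.closedBall x φ.rOut ⊆ K') :
    gradient (φ.normed volume ⋆[lsmul ℝ ℝ, volume] (K'.indicator u)) x =
      (φ.normed volume ⋆[lsmul ℝ ℝ, volume] (K'.indicator G)) x := by
  set ρ := φ.normed (volume : Measure E) with hρ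
  have hρc : HasCompactSupport ρ := φ.hasCompactSupport_normed
  have hρs : ContDiff ℝ ∞ ρ := φ.contDiff_normed
  have hu1 : Integrable (K'.indicator u) :=
    (integrable_indicator_iff hK'.measurableSet).2 (h.locU.integrableOn_compact_subset hK'U hK')
  have hG1 : Integrable (K'.indicator G) :=
    (integrable_indicator_iff hK'.measurableSet).2 (h.locG.integrableOn_compact_subset hK'U hK')
  set η : E → ℝ := fun y => ρ (x - y) with hη
  have hηsupp : tsupport η ⊆ Metric.closedBall x φ.rOut := by
    refine closure_minimal (fun y hy => ?_) Metric.isClosed_closedBall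
    have : x - y ∈ Function.support ρ := hy
    rw [hρ, φ.support_normed_eq, mem_ball_zero_iff] at this
    rw [Metric.mem_closedBall, dist_comm, dist_eq_norm]
    exact this.le
  have hηT : IsTest U η := ⟨hρs.comp (contDiff_const.sub contDiff_id),
    HasCompactSupport.intro (isCompact_closedBall x φ.rOut) fun y hy =>
      image_eq_zero_of_notMem_tsupport fun h' => hy (hηsupp h'),
    hηsupp.trans (hx.trans hK'U)⟩
  have hηd : ∀ y e, fderiv ℝ η y e = - fderiv ℝ ρ (x - y) e := by
    intro y e
    have h1 : HasFDerivAt (fun y : E => x - y) (-ContinuousLinearMap.id ℝ E) y := by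
      exact (hasFDerivAt_id y).const_sub x
    have h2 := ((hρs.differentiable (by simp)) (x - y)).hasFDerivAt.comp y h1
    rw [show η = ρ ∘ fun y => x - y from rfl, h2.fderiv]
    simp
  have hd := (hρc.hasFDerivAt_convolution_left (lsmul ℝ ℝ) (μ := volume)
    (hρs.of_le (by norm_cast)) hu1.locallyIntegrable x)
  refine ext_inner_right ℝ fun e => ?_
  rw [inner_gradient_left, hd.fderiv]
  have hcd : Continuous (fderiv ℝ ρ) := hρs.continuous_fderiv (by simp)
  have hex : ConvolutionExistsAt (fderiv ℝ ρ) (K'.indicator u) x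
      (ContinuousLinearMap.precompL E (lsmul ℝ ℝ)) volume :=
    (hρc.fderiv ℝ).convolutionExists_left _ hcd hu1.locallyIntegrable x
  have hex2 : ConvolutionExistsAt ρ (K'.indicator G) x (lsmul ℝ ℝ) volume :=
    hρc.convolutionExists_left _ hρs.continuous hG1.locallyIntegrable x
  have l1 : (fderiv ℝ ρ ⋆[ContinuousLinearMap.precompL E (lsmul ℝ ℝ), volume] K'.indicator u) x e =
      ∫ t, fderiv ℝ ρ t e * K'.indicator u (x - t) := by
    rw [convolution, ContinuousLinearMap.integral_apply hex]
    rfl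
  have l2 : ⟪(ρ ⋆[lsmul ℝ ℝ, volume] (K'.indicator G)) x, e⟫ =
      ∫ t, ρ t * ⟪K'.indicator G (x - t), e⟫ := by
    rw [real_inner_comm, convolution, ← integral_inner hex2]
    refine integral_congr_ae (ae_of_all _ fun t => ?_)
    simp [inner_smul_right, real_inner_comm]
  rw [l1, l2, ← integral_sub_left_eq_self (fun t => fderiv ℝ ρ t e * K'.indicator u (x - t)) _ x,
    ← integral_sub_left_eq_self (fun t => ρ t * ⟪K'.indicator G (x - t), e⟫) _ x]
  simp only [sub_sub_cancel]
  have key := h.integral_fderiv hηT e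
  rw [setIntegral_eq_integral_of_forall_compl_eq_zero, setIntegral_eq_integral_of_forall_compl_eq_zero]
    at key
  · have c1 : ∀ y, fderiv ℝ ρ (x - y) e * K'.indicator u y = -(u y * fderiv ℝ η y e) := by
      intro y
      rw [hηd]
      by_cases hy : y ∈ K'
      · rw [indicator_of_mem hy]; ring
      · have h0 : fderiv ℝ η y e = 0 := by
          exact image_eq_zero_of_notMem_tsupport (f := fun y => fderiv ℝ η y e)
            (fun h' => hy (hx (hηsupp (IsTest.fderiv_supp e h'))))
        rw [hηd] at h0
        rw [indicator_of_notMem hy, h0]; simp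
    have c2 : ∀ y, ρ (x - y) * ⟪K'.indicator G y, e⟫ = η y * ⟪G y, e⟫ := by
      intro y
      by_cases hy : y ∈ K'
      · rw [indicator_of_mem hy]
      · have h0 : η y = 0 := image_eq_zero_of_notMem_tsupport (fun h' => hy (hx (hηsupp h')))
        rw [indicator_of_notMem hy, h0]; simp
    simp only [c1, c2]
    rw [integral_neg, key, neg_neg]
  · intro y hy
    rw [image_eq_zero_of_notMem_tsupport (fun h' => hy (hηT.supp h')), zero_mul]
  · intro y hy
    have : fderiv ℝ η y e = 0 :=
      image_eq_zero_of_notMem_tsupport (f := fun y => fderiv ℝ η y e)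
        (fun h' => hy (hηT.supp (IsTest.fderiv_supp e h')))
    rw [this, mul_zero]

/-- A shrinking sequence of bump functions at the origin. -/
noncomputable def bumpSeq (E : Type*) [NormedAddCommGroup E] [InnerProductSpace ℝ E] (δ : ℝ)
    (hδ : 0 < δ) (n : ℕ) : ContDiffBump (0 : E) where
  rIn := δ / (2 * (n + 1))
  rOut := δ / (n + 1)
  rIn_pos := by positivity
  rIn_lt_rOut := by
    have : (0:ℝ) < n + 1 := by positivity
    rw [div_lt_div_iff₀ (by positivity) this]
    nlinarith [mul_pos hδ this]

lemma bumpSeq_rOut (δ : ℝ) (hδ : 0 < δ) :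
    Tendsto (fun n => (bumpSeq E δ hδ n).rOut) atTop (𝓝 0) := by
  have := (tendsto_one_div_add_atTop_nhds_zero_nat (𝕜 := ℝ)).const_mul δ
  simp only [mul_zero, mul_one_div] at this
  exact this

lemma bumpSeq_rOut_le (δ : ℝ) (hδ : 0 < δ) (n : ℕ) : (bumpSeq E δ hδ n).rOut ≤ δ := by
  show δ / (n + 1) ≤ δ
  exact div_le_self hδ.le (by linarith [n.cast_nonneg (α := ℝ)])

lemma bumpSeq_ae_tendsto (δ : ℝ) (hδ : 0 < δ) {f : E → ℝ} (hf : LocallyIntegrable f) :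
    ∀ᵐ x, Tendsto (fun n => ((bumpSeq E δ hδ n).normed volume ⋆[lsmul ℝ ℝ, volume] f) x) atTop
      (𝓝 (f x)) := by
  refine ContDiffBump.ae_convolution_tendsto_right_of_locallyIntegrable (K := 2)
    (bumpSeq_rOut δ hδ) (Eventually.of_forall fun n => ?_) hf
  show δ / (n + 1) ≤ 2 * (δ / (2 * (n + 1)))
  have : (0:ℝ) < n + 1 := by positivity
  apply le_of_eq; field_simp

/-- A function with a weak gradient in `L^p` is, near a compact set, a limit of smooth functions
with convergence in `L^p` of the gradients; nonnegativity is preserved. -/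
lemma exists_smooth_approx (hU : IsOpen U) {K : Set E} (hK : IsCompact K) (hKU : K ⊆ U)
    {p : ℝ≥0∞} [hp1 : Fact (1 ≤ p)] (hp : p ≠ ⊤)
    (hu : ∀ K' : Set E, IsCompact K' → K' ⊆ U → MemLp u p (volume.restrict K'))
    (hG : ∀ K' : Set E, IsCompact K' → K' ⊆ U → MemLp G p (volume.restrict K'))
    (hw : IsWeakGradient U u G) :
    ∃ f : ℕ → E → ℝ, (∀ n, ContDiff ℝ ∞ (f n)) ∧
      Tendsto (fun n => eLpNorm (fun x => f n x - u x) p (volume.restrict K)) atTop (𝓝 0) ∧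
      Tendsto (fun n => eLpNorm (fun x => gradient (f n) x - G x) p (volume.restrict K))
        atTop (𝓝 0) ∧
      (∀ᵐ x ∂(volume.restrict K), Tendsto (fun n => f n x) atTop (𝓝 (u x))) ∧
      ((∀ᵐ x ∂(volume.restrict U), 0 ≤ u x) → ∀ n x, 0 ≤ f n x) ∧
      ((∀ᵐ x ∂(volume.restrict U), G x = 0) → ∀ n, ∀ x ∈ K, gradient (f n) x = 0) := by
  have hpair : IsWeakPair U u G := ⟨locallyIntegrableOn_of_memLp hU hp1.out hu,
    locallyIntegrableOn_of_memLp hU hp1.out hG, hw⟩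
  obtain ⟨δ, hδ, hδU⟩ := hK.exists_cthickening_subset_open hU hKU
  set K' := Metric.cthickening δ K with hK'def
  have hK' : IsCompact K' := hK.cthickening
  have hKK' : K ⊆ K' := Metric.self_subset_cthickening K
  have hu' : MemLp (K'.indicator u) p volume :=
    (memLp_indicator_iff_restrict hK'.measurableSet).2 (hu K' hK' hδU)
  have hG' : MemLp (K'.indicator G) p volume :=
    (memLp_indicator_iff_restrict hK'.measurableSet).2 (hG K' hK' hδU)
  set f : ℕ → E → ℝ := fun n =>
    ((bumpSeq E δ hδ n).normed volume ⋆[lsmul ℝ ℝ, volume] K'.indicator u) with hf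
  have hgrad : ∀ n, ∀ x ∈ K, gradient (f n) x =
      ((bumpSeq E δ hδ n).normed volume ⋆[lsmul ℝ ℝ, volume] K'.indicator G) x := by
    intro n x hx
    refine gradient_convolution hpair hK' hδU _ ?_
    exact (Metric.closedBall_subset_closedBall (bumpSeq_rOut_le δ hδ n)).trans
      (Metric.closedBall_subset_cthickening hx δ)
  refine ⟨f, fun n => ?_, ?_, ?_, ?_, ?_, ?_⟩
  · exact (ContDiffBump.hasCompactSupport_normed _).contDiff_convolution_left _
      (ContDiffBump.contDiff_normed _) (hu'.locallyIntegrable hp1.out)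
  · refine tendsto_of_tendsto_of_tendsto_of_le_of_le tendsto_const_nhds
      (tendsto_eLpNorm_convolution_sub (bumpSeq_rOut δ hδ) hp hu') (fun _ => zero_le) fun n => ?_
    refine le_trans (le_of_eq ?_) (eLpNorm_mono_measure _ (Measure.restrict_le_self (s := K)))
    refine eLpNorm_congr_ae ?_
    filter_upwards [ae_restrict_mem hK.measurableSet] with x hx
    simp [hf, indicator_of_mem (hKK' hx)]
  · refine tendsto_of_tendsto_of_tendsto_of_le_of_le tendsto_const_nhds
      (tendsto_eLpNorm_convolution_sub (bumpSeq_rOut δ hδ) hp hG') (fun _ => zero_le) fun n => ?_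
    refine le_trans (le_of_eq ?_) (eLpNorm_mono_measure _ (Measure.restrict_le_self (s := K)))
    refine eLpNorm_congr_ae ?_
    filter_upwards [ae_restrict_mem hK.measurableSet] with x hx
    simp [hgrad n x hx, indicator_of_mem (hKK' hx)]
  · have := ae_restrict_of_ae (s := K) (bumpSeq_ae_tendsto δ hδ (hu'.locallyIntegrable hp1.out))
    filter_upwards [this, ae_restrict_mem hK.measurableSet] with x hx hxK
    rwa [indicator_of_mem (hKK' hxK)] at hx
  · intro h0 n x
    refine integral_nonneg_of_ae ?_
    have h1 : ∀ᵐ y : E, 0 ≤ K'.indicator u y := by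
      rw [ae_restrict_iff' hU.measurableSet] at h0
      filter_upwards [h0] with y hy
      by_cases hyK : y ∈ K'
      · rw [indicator_of_mem hyK]; exact hy (hδU hyK)
      · rw [indicator_of_notMem hyK]
    filter_upwards [(Measure.measurePreserving_sub_left volume x).quasiMeasurePreserving.ae h1] with t ht
    exact mul_nonneg (ContDiffBump.nonneg_normed _ _) ht
  · intro h0 n x hx
    rw [hgrad n x hx]
    refine integral_eq_zero_of_ae ?_
    have h1 : ∀ᵐ y : E, K'.indicator G y = 0 := by
      rw [ae_restrict_iff' hU.measurableSet] at h0
      filter_upwards [h0] with y hy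
      by_cases hyK : y ∈ K'
      · rw [indicator_of_mem hyK]; exact hy (hδU hyK)
      · rw [indicator_of_notMem hyK]
    filter_upwards [(Measure.measurePreserving_sub_left volume x).quasiMeasurePreserving.ae h1] with t ht
    simp only [ht, map_zero, Pi.zero_apply]

/-- On a ball, the mollifications of a function with zero weak gradient are constant. -/
lemma eq_const_of_weakGradient_zero_ball (hU : IsOpen U) (h : IsWeakPair U u 0) {x : E} {r : ℝ}
    (hr : 0 < r) (hx : Metric.closedBall x r ⊆ U) :
    ∃ c, ∀ᵐ y ∂(volume.restrict (Metric.ball x r)), u y = c := by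
  obtain ⟨f, hf, -, -, hae, -, h0⟩ := exists_smooth_approx hU (isCompact_closedBall x r) hx
    (p := 1) (by simp)
    (fun K hK hKU => memLp_one_iff_integrable.2 (h.locU.integrableOn_compact_subset hKU hK))
    (fun K hK hKU => memLp_one_iff_integrable.2 (h.locG.integrableOn_compact_subset hKU hK)) h.weak
  have h1 := h0 (ae_of_all _ fun _ => rfl)
  have hconst : ∀ n, ∀ y ∈ Metric.ball x r, f n y = f n x := by
    intro n y hy
    refine (Metric.isOpen_ball.is_const_of_fderiv_eq_zero (convex_ball x r).isPreconnected
      ((hf n).differentiable (by simp)).differentiableOn (fun z hz => ?_) hy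
      (Metric.mem_ball_self hr))
    rw [← toDual_gradient, h1 n z (Metric.ball_subset_closedBall hz), map_zero]; rfl
  have hae' := ae_mono (Measure.restrict_mono Metric.ball_subset_closedBall le_rfl) hae
  have hne : (ae (volume.restrict (Metric.ball x r))).NeBot := by
    rw [ae_neBot, Ne, Measure.restrict_eq_zero]
    exact (Metric.measure_ball_pos volume x hr).ne'
  obtain ⟨y₀, hy₀, hy₀'⟩ := (Eventually.and hae' (ae_restrict_mem Metric.isOpen_ball.measurableSet)).exists
  refine ⟨u y₀, ?_⟩
  filter_upwards [hae', ae_restrict_mem Metric.isOpen_ball.measurableSet] with y hy hyb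
  refine tendsto_nhds_unique (hy.congr fun n => ?_) hy₀
  rw [hconst n y hyb, hconst n y₀ hy₀']

/-- A function with zero weak gradient is constant on a connected open set. -/
lemma eq_const_of_weakGradient_zero (hU : IsOpen U) (hUc : IsPreconnected U)
    (h : IsWeakPair U u 0) : ∃ c, ∀ᵐ y ∂(volume.restrict U), u y = c := by
  rcases U.eq_empty_or_nonempty with rfl | ⟨x₀, hx₀⟩
  · exact ⟨0, by simp⟩
  have hb : ∀ x ∈ U, ∃ r > 0, Metric.closedBall x r ⊆ U := fun x hx =>
    Metric.nhds_basis_closedBall.mem_iff.1 (hU.mem_nhds hx)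
  have hb' : ∀ x, ∃ r c : ℝ, x ∈ U → 0 < r ∧ ∀ᵐ y ∂(volume.restrict (Metric.ball x r)), u y = c := by
    intro x
    by_cases hx : x ∈ U
    · obtain ⟨r, hr, hrU⟩ := hb x hx
      obtain ⟨c, hc⟩ := eq_const_of_weakGradient_zero_ball hU h hr hrU
      exact ⟨r, c, fun _ => ⟨hr, hc⟩⟩
    · exact ⟨0, 0, fun h => absurd h hx⟩
  choose r c hrc using hb'
  have hloc : ∀ x ∈ U, ∀ y ∈ U, y ∈ Metric.ball x (r x) → c x = c y := by
    intro x hx y hy hyx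
    have ho : IsOpen (Metric.ball x (r x) ∩ Metric.ball y (r y)) :=
      Metric.isOpen_ball.inter Metric.isOpen_ball
    have hne : (ae (volume.restrict (Metric.ball x (r x) ∩ Metric.ball y (r y)))).NeBot := by
      rw [ae_neBot, Ne, Measure.restrict_eq_zero]
      exact (ho.measure_pos volume ⟨y, hyx, Metric.mem_ball_self (hrc y hy).1⟩).ne'
    have a1 := ae_mono (Measure.restrict_mono (s := Metric.ball x (r x) ∩ Metric.ball y (r y))
      inter_subset_left le_rfl) (hrc x hx).2
    have a2 := ae_mono (Measure.restrict_mono (s := Metric.ball x (r x) ∩ Metric.ball y (r y))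
      inter_subset_right le_rfl) (hrc y hy).2
    obtain ⟨z, h1, h2⟩ := (Eventually.and a1 a2).exists
    exact h1.symm.trans h2
  have hall : ∀ x ∈ U, c x₀ = c x := by
    intro x hx
    refine hUc.induction₂ (fun x y => c x = c y) (fun y hy => ?_) (fun a b d _ _ _ h1 h2 => h1.trans h2)
      (fun a b _ _ h => h.symm) hx₀ hx
    filter_upwards [self_mem_nhdsWithin,
      mem_nhdsWithin_of_mem_nhds (Metric.ball_mem_nhds y (hrc y hy).1)] with z hz hzb
    exact hloc y hy z hz hzb
  refine ⟨c x₀, ?_⟩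
  rw [ae_restrict_iff' hU.measurableSet]
  refine measure_null_of_locally_null _ fun x hx => ?_
  have hxU : x ∈ U := by
    by_contra hn
    exact hx fun h' => absurd h' hn
  refine ⟨{y | ¬ (y ∈ U → u y = c x₀)} ∩ Metric.ball x (r x), ?_, ?_⟩
  · exact inter_mem self_mem_nhdsWithin
      (mem_nhdsWithin_of_mem_nhds (Metric.ball_mem_nhds x (hrc x hxU).1))
  · have := (hrc x hxU).2
    rw [ae_restrict_iff' Metric.isOpen_ball.measurableSet] at this
    refine measure_mono_null ?_ this
    rintro y ⟨hy1, hy2⟩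
    simp only [mem_compl_iff, mem_ofPred_eq, Classical.not_imp] at hy1 ⊢
    exact ⟨hy2, by rw [← hall x hxU]; exact hy1.2⟩

end WeakGradient


/-! ### Picone's inequality -/

section Picone

variable {E : Type*} [NormedAddCommGroup E] [InnerProductSpace ℝ E] [CompleteSpace E]
  [FiniteDimensional ℝ E] [MeasureSpace E] [BorelSpace E] [(volume : Measure E).IsAddHaarMeasure]
  {U : Set E} {u : E → ℝ} {G : E → E}

set_option linter.unusedSectionVars false

lemma IsTest.memLp {w : E → ℝ} (hw : IsTest U w) (p : ℝ≥0∞) (μ : Measure E)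
    [IsFiniteMeasureOnCompacts μ] : MemLp w p μ :=
  hw.smooth.continuous.memLp_of_hasCompactSupport hw.compact

lemma IsTest.hasCompactSupport_gradient {w : E → ℝ} (hw : IsTest U w) :
    HasCompactSupport (gradient w) :=
  HasCompactSupport.intro hw.compact fun _ hx => IsTest.gradient_eq_zero hx

lemma IsTest.memLp_gradient {w : E → ℝ} (hw : IsTest U w) (p : ℝ≥0∞) (μ : Measure E)
    [IsFiniteMeasureOnCompacts μ] : MemLp (gradient w) p μ :=
  hw.gradient_cont.memLp_of_hasCompactSupport hw.hasCompactSupport_gradient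

/-- The classical gradient of a smooth function is its weak gradient. -/
lemma isWeakPair_of_contDiffOn (hU : IsOpen U) {f : E → ℝ} (hf : ∀ x ∈ U, ContDiffAt ℝ ∞ f x) :
    IsWeakPair U f (gradient f) := by
  have hfc : ContinuousOn f U := fun x hx => (hf x hx).continuousAt.continuousWithinAt
  have hgc : ContinuousOn (gradient f) U := by
    have : ContinuousOn (fderiv ℝ f) U := by
      have h1 : ContDiffOn ℝ ∞ f U := fun x hx => (hf x hx).contDiffWithinAt
      exact h1.continuousOn_fderiv_of_isOpen hU (by simp)
    exact (LinearIsometryEquiv.continuous _).comp_continuousOn this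
  have l1 := hfc.locallyIntegrableOn hU.measurableSet (μ := volume)
  have l2 := hgc.locallyIntegrableOn hU.measurableSet (μ := volume)
  refine IsWeakPair.of_integral_fderiv l1 l2 fun η hη e => ?_
  rw [setIntegral_eq_integral_of_forall_compl_eq_zero,
    setIntegral_eq_integral_of_forall_compl_eq_zero]
  · have i1 := hη.integrable_smul (LocallyIntegrableOn.inner_const l2 e)
    rw [integral_mul_fderiv_eq_neg_fderiv_mul_of_integrable _ (hη.integrable_mul_fderiv l1 e)
      (LocallyIntegrableOn.integrable_mul l1 hη.smooth.continuous hη.compact hη.supp)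
      (fun x hx => (hf x (hη.supp hx)).differentiableAt (by simp))
      (fun x _ => hη.differentiable x)]
    · simp only [inner_gradient_left, mul_comm]
    · refine i1.congr (ae_of_all _ fun x => ?_)
      simp [inner_gradient_left, mul_comm]
  · intro x hx
    rw [image_eq_zero_of_notMem_tsupport (fun h' => hx (hη.supp h')), zero_mul]
  · intro x hx
    have : fderiv ℝ η x e = 0 :=
      image_eq_zero_of_notMem_tsupport (f := fun y => fderiv ℝ η y e)
        (fun h' => hx (hη.supp (IsTest.fderiv_supp e h')))
    rw [this, mul_zero]

/-- Test functions are admissible in the definition of super-solutions. -/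
lemma IsTest.isSobolevTest (hU : IsOpen U) {w : E → ℝ} (hw : IsTest U w) :
    IsSobolevTest U w (gradient w) where
  memLp := hw.memLp 2 _
  memLp_grad := hw.memLp_gradient 2 _
  weak := (isWeakPair_of_contDiffOn hU fun _ _ => hw.smooth.contDiffAt).weak
  bounded := hw.memLp ⊤ _
  support := ⟨tsupport w, hw.compact, hw.supp, fun _ hx => image_eq_zero_of_notMem_tsupport hx⟩

lemma integrable_inner_of_memLp {α : Type*} {mα : MeasurableSpace α} {μ : Measure α}
    {F : Type*} [NormedAddCommGroup F] [InnerProductSpace ℝ F] {f g : α → F} (hf : MemLp f 2 μ)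
    (hg : MemLp g 2 μ) : Integrable (fun x => ⟪f x, g x⟫) μ :=
  (hf.norm.integrable_mul hg.norm).mono' (hf.1.inner hg.1)
    (ae_of_all _ fun x => norm_inner_le_norm (f x) (g x))

/-- Hölder's inequality for a sequence that tends to zero in `L²`. -/
lemma tendsto_integral_inner_zero {α : Type*} {mα : MeasurableSpace α} {μ : Measure α}
    {F : Type*} [NormedAddCommGroup F] [InnerProductSpace ℝ F] {f : α → F} (hf : MemLp f 2 μ)
    {h : ℕ → α → F} (hm : ∀ n, AEStronglyMeasurable (h n) μ)
    (h0 : Tendsto (fun n => eLpNorm (h n) 2 μ) atTop (𝓝 0))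
    {b : ℕ → α → ℝ} {C : ℝ} (hb : ∀ n, ∀ᵐ x ∂μ, |b n x| ≤ C) :
    Tendsto (fun n => ∫ x, b n x * ⟪f x, h n x⟫ ∂μ) atTop (𝓝 0) := by
  rw [tendsto_zero_iff_enorm_tendsto_zero]
  have hbound : ∀ n, ‖∫ x, b n x * ⟪f x, h n x⟫ ∂μ‖ₑ ≤
      ENNReal.ofReal |C| * (eLpNorm f 2 μ * eLpNorm (h n) 2 μ) := by
    intro n
    calc ‖∫ x, b n x * ⟪f x, h n x⟫ ∂μ‖ₑ ≤ ∫⁻ x, ‖b n x * ⟪f x, h n x⟫‖ₑ ∂μ :=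
          enorm_integral_le_lintegral_enorm _
      _ ≤ ∫⁻ x, ENNReal.ofReal |C| * ‖⟪f x, h n x⟫‖ₑ ∂μ := by
          refine lintegral_mono_ae ?_
          filter_upwards [hb n] with x hx
          rw [enorm_mul]
          gcongr
          rw [Real.enorm_eq_ofReal_abs]
          exact ENNReal.ofReal_le_ofReal (hx.trans (le_abs_self C))
      _ = ENNReal.ofReal |C| * ∫⁻ x, ‖⟪f x, h n x⟫‖ₑ ∂μ :=
          lintegral_const_mul' _ _ ENNReal.ofReal_ne_top
      _ ≤ _ := by
          gcongr
          rw [← eLpNorm_one_eq_lintegral_enorm]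
          have := eLpNorm_le_eLpNorm_mul_eLpNorm_of_nnnorm hf.1 (hm n)
            (fun a b : F => ⟪a, b⟫) 1 (ae_of_all _ fun x => by
              simpa using nnnorm_inner_le_nnnorm (𝕜 := ℝ) (f x) (h n x)) (p := 2) (q := 2) (r := 1)
          simpa using this
  have hlim : Tendsto (fun n => ENNReal.ofReal |C| * (eLpNorm f 2 μ * eLpNorm (h n) 2 μ))
      atTop (𝓝 0) := by
    have h1 := ENNReal.Tendsto.const_mul h0 (Or.inr hf.2.ne) (a := eLpNorm f 2 μ)
    have h2 := ENNReal.Tendsto.const_mul h1 (Or.inr (ENNReal.ofReal_ne_top (r := |C|)))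
    simpa using h2
  exact tendsto_of_tendsto_of_tendsto_of_le_of_le tendsto_const_nhds hlim (fun _ => zero_le)
    hbound

/-- A positive super-solution tested with `w² / (u + ε)`. This is not known to be a Sobolev test
function a priori; `u` is replaced in it by mollifications `f n`, which gives smooth test functions,
and the limit is taken in the integrals. -/
lemma integral_test_nonneg (hU : IsOpen U) {V : E → ℝ} (hV : ContinuousOn V U)
    (huG : MemH1Loc U u G) (hsuper : ∀ (ζ : E → ℝ) (Z : E → E), IsSobolevTest U ζ Z →
      (∀ᵐ x ∂(volume.restrict U), 0 ≤ ζ x) →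
      0 ≤ ∫ x in U, (1:ℝ) * (⟪G x, Z x⟫ - V x * u x * ζ x))
    (hpos : ∀ᵐ x ∂(volume.restrict U), 0 < u x) {w : E → ℝ} (hw : IsTest U w) {ε : ℝ}
    (hε : 0 < ε) :
    Integrable (fun x => 2 * w x / (u x + ε) * ⟪G x, gradient w x⟫
      - w x ^ 2 / (u x + ε) ^ 2 * ‖G x‖ ^ 2 - V x * u x * (w x ^ 2 / (u x + ε)))
      (volume.restrict (tsupport w)) ∧
    0 ≤ ∫ x in tsupport w, (2 * w x / (u x + ε) * ⟪G x, gradient w x⟫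
      - w x ^ 2 / (u x + ε) ^ 2 * ‖G x‖ ^ 2 - V x * u x * (w x ^ 2 / (u x + ε))) := by
  set K := tsupport w with hKdef
  have hK : IsCompact K := hw.compact
  have hKU : K ⊆ U := hw.supp
  obtain ⟨f, hfs, -, hfG, hfae, hfpos, -⟩ := exists_smooth_approx hU hK hKU (p := 2) (by simp)
    huG.memLp huG.memLp_grad huG.weak
  have hf0 := hfpos (hpos.mono fun x hx => hx.le)
  have hne : ∀ n x, f n x + ε ≠ 0 := fun n x => (by linarith [hf0 n x] : 0 < f n x + ε).ne'
  have hle : ∀ n x, ε ≤ f n x + ε := fun n x => by linarith [hf0 n x]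
  have hposK : ∀ᵐ x ∂(volume.restrict K), 0 < u x :=
    ae_mono (Measure.restrict_mono hKU le_rfl) hpos
  have hGK : MemLp G 2 (volume.restrict K) := huG.memLp_grad K hK hKU
  have huK : MemLp u 2 (volume.restrict K) := huG.memLp K hK hKU
  have hfin : IsFiniteMeasure (volume.restrict K) := ⟨by simpa using hK.measure_lt_top⟩
  -- bounds of `w` and `V` on `K`
  obtain ⟨Cw, hCw⟩ := hK.exists_bound_of_continuousOn hw.smooth.continuous.continuousOn
  obtain ⟨CV, hCV⟩ := hK.exists_bound_of_continuousOn (hV.mono hKU)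
  -- the integrand as a function of the value `s` of `u` or of `f n`, and its dominating function
  set A : ℝ → E → ℝ := fun s x => 2 * w x / (s + ε) * ⟪G x, gradient w x⟫
      - w x ^ 2 / (s + ε) ^ 2 * ‖G x‖ ^ 2 - V x * u x * (w x ^ 2 / (s + ε)) with hA
  set B : E → ℝ := fun x => 2 * |Cw| / ε * (‖G x‖ * ‖gradient w x‖) + Cw ^ 2 / ε ^ 2 * ‖G x‖ ^ 2
      + |CV| * |u x| * (Cw ^ 2 / ε) with hB
  have hwG : MemLp (gradient w) 2 (volume.restrict K) := hw.memLp_gradient 2 _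
  have hBi : Integrable B (volume.restrict K) := by
    refine ((Integrable.const_mul ?_ _).add (Integrable.const_mul ?_ _)).add ?_
    · exact hGK.norm.integrable_mul hwG.norm
    · exact hGK.norm.integrable_sq
    · exact (((huK.integrable one_le_two).abs).const_mul _).mul_const _
  have hAB : ∀ s, 0 ≤ s → ∀ x ∈ K, ‖A s x‖ ≤ B x := by
    intro s hs x hx
    have hw1 : |w x| ≤ |Cw| := (hCw x hx).trans (le_abs_self _)
    have hw2 : w x ^ 2 ≤ Cw ^ 2 := sq_le_sq.2 hw1
    have hV1 : |V x| ≤ |CV| := (hCV x hx).trans (le_abs_self _)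
    have hsε : ε ≤ s + ε := by linarith
    have hsp : 0 < s + ε := by linarith
    have hsε2 : ε ^ 2 ≤ (s + ε) ^ 2 := by gcongr
    have b1 : |2 * w x / (s + ε) * ⟪G x, gradient w x⟫| ≤
        2 * |Cw| / ε * (‖G x‖ * ‖gradient w x‖) := by
      rw [abs_mul, abs_div, abs_mul, abs_of_pos hsp, abs_two]
      have := abs_real_inner_le_norm (G x) (gradient w x)
      gcongr
    have b2 : |w x ^ 2 / (s + ε) ^ 2 * ‖G x‖ ^ 2| ≤ Cw ^ 2 / ε ^ 2 * ‖G x‖ ^ 2 := by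
      rw [abs_of_nonneg (by positivity)]
      gcongr
    have b3 : |V x * u x * (w x ^ 2 / (s + ε))| ≤ |CV| * |u x| * (Cw ^ 2 / ε) := by
      rw [abs_mul, abs_mul, abs_of_nonneg (a := w x ^ 2 / (s + ε)) (by positivity)]
      gcongr
    rw [Real.norm_eq_abs]
    calc |A s x| ≤ |2 * w x / (s + ε) * ⟪G x, gradient w x⟫ - w x ^ 2 / (s + ε) ^ 2 * ‖G x‖ ^ 2|
          + |V x * u x * (w x ^ 2 / (s + ε))| := abs_sub _ _
      _ ≤ (|2 * w x / (s + ε) * ⟪G x, gradient w x⟫| + |w x ^ 2 / (s + ε) ^ 2 * ‖G x‖ ^ 2|)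
          + |V x * u x * (w x ^ 2 / (s + ε))| := by gcongr; exact abs_sub _ _
      _ ≤ B x := by rw [hB]; linarith
  have hVm : AEStronglyMeasurable V (volume.restrict K) :=
    (hV.mono hKU).aestronglyMeasurable hK.measurableSet
  have hwm : Continuous w := hw.smooth.continuous
  have hAm : ∀ g : E → ℝ, AEStronglyMeasurable g (volume.restrict K) →
      AEStronglyMeasurable (fun x => A (g x) x) (volume.restrict K) := by
    intro g hg
    have hg1 : AEStronglyMeasurable (fun x => (g x + ε)⁻¹) (volume.restrict K) :=
      ((hg.aemeasurable.add_const ε).inv).aestronglyMeasurable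
    have hw' := hwm.aestronglyMeasurable (μ := volume.restrict K)
    have hinn : AEStronglyMeasurable (fun x => ⟪G x, gradient w x⟫) (volume.restrict K) :=
      hGK.1.inner hwG.1
    simp only [hA, div_eq_mul_inv, ← inv_pow]
    exact ((((hw'.const_mul 2).mul hg1).mul hinn).sub
      (((hw'.pow 2).mul (hg1.pow 2)).mul (hGK.1.norm.pow 2))).sub
      ((hVm.mul huK.1).mul ((hw'.pow 2).mul hg1))
  have hAi : Integrable (fun x => A (u x) x) (volume.restrict K) := by
    refine hBi.mono' (hAm u huK.1) ?_
    filter_upwards [hposK, ae_restrict_mem hK.measurableSet] with x hx hxK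
    exact hAB _ hx.le x hxK
  have hAni : ∀ n, Integrable (fun x => A (f n x) x) (volume.restrict K) := fun n => by
    refine hBi.mono' (hAm _ (hfs n).continuous.aestronglyMeasurable) ?_
    filter_upwards [ae_restrict_mem hK.measurableSet] with x hxK
    exact hAB _ (hf0 n x) x hxK
  refine ⟨hAi, ?_⟩
  have lim1 : Tendsto (fun n => ∫ x in K, A (f n x) x) atTop (𝓝 (∫ x in K, A (u x) x)) := by
    refine tendsto_integral_of_dominated_convergence B
      (fun n => hAm _ (hfs n).continuous.aestronglyMeasurable) hBi (fun n => ?_) ?_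
    · filter_upwards [ae_restrict_mem hK.measurableSet] with x hxK
      exact hAB _ (hf0 n x) x hxK
    · filter_upwards [hfae, hposK] with x hx hux
      have hx' : Tendsto (fun n => f n x + ε) atTop (𝓝 (u x + ε)) := hx.add_const ε
      have h0 : u x + ε ≠ 0 := by positivity
      exact (((tendsto_const_nhds.div hx' h0).mul_const _).sub
        ((tendsto_const_nhds.div (hx'.pow 2) (pow_ne_zero 2 h0)).mul_const _)).sub
        ((tendsto_const_nhds.div hx' h0).const_mul _)
  have hgm : ∀ n, Continuous (gradient (f n)) := fun n =>
    (LinearIsometryEquiv.continuous _).comp ((hfs n).continuous_fderiv (by simp))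
  have hbb : ∀ n, ∀ᵐ x ∂(volume.restrict K), |-(w x ^ 2 / (f n x + ε) ^ 2)| ≤ Cw ^ 2 / ε ^ 2 := by
    intro n
    filter_upwards [ae_restrict_mem hK.measurableSet] with x hx
    have hw2 : w x ^ 2 ≤ Cw ^ 2 := sq_le_sq.2 ((hCw x hx).trans (le_abs_self _))
    have := hle n x
    rw [abs_neg, abs_of_nonneg (by positivity)]
    gcongr
  -- the test functions contain `∇(f n)` in place of `G`; the difference tends to zero
  have lim2 : Tendsto (fun n => ∫ x in K, -(w x ^ 2 / (f n x + ε) ^ 2) *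
      ⟪G x, gradient (f n) x - G x⟫) atTop (𝓝 0) :=
    tendsto_integral_inner_zero hGK
      (fun n => (hgm n).aestronglyMeasurable.sub hGK.1) hfG hbb
  have hlim := lim1.add lim2
  rw [add_zero] at hlim
  refine ge_of_tendsto' hlim fun n => ?_
  -- the test function `w² / (f n + ε)`
  have hζ : IsTest U (fun x => w x * (w x / (f n x + ε))) :=
    hw.mul_smooth fun x _ => hw.smooth.contDiffAt.div
      ((hfs n).contDiffAt.add contDiffAt_const) (hne n x)
  have hζ0 := hsuper _ _ (hζ.isSobolevTest hU) (ae_of_all _ fun x => by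
    have := hle n x
    have : 0 < f n x + ε := hε.trans_le this
    rw [← mul_div_assoc, ← sq]; positivity)
  have hgrad : ∀ x, gradient (fun x => w x * (w x / (f n x + ε))) x =
      (2 * w x / (f n x + ε)) • gradient w x - (w x ^ 2 / (f n x + ε) ^ 2) • gradient (f n) x := by
    intro x
    have d1 : HasFDerivAt w (fderiv ℝ w x) x := (hw.differentiable x).hasFDerivAt
    have d2 : HasFDerivAt (f n) (fderiv ℝ (f n) x) x :=
      ((hfs n).differentiable (by simp) x).hasFDerivAt
    have d3 := d1.mul (d1.mul ((hasDerivAt_inv (hne n x)).comp_hasFDerivAt x (d2.add_const ε)))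
    refine HasGradientAt.gradient ?_
    rw [hasGradientAt_iff_hasFDerivAt]
    refine HasFDerivAt.congr_fderiv (f := fun x => w x * (w x / (f n x + ε))) d3 ?_
    ext e
    have := hne n x
    simp only [map_sub, map_smul, toDual_gradient]
    simp
    field_simp
    ring
  rw [setIntegral_eq_of_subset_of_forall_sdiff_eq_zero hU.measurableSet hKU] at hζ0
  · have hBni : Integrable (fun x => -(w x ^ 2 / (f n x + ε) ^ 2) * ⟪G x, gradient (f n) x - G x⟫)
        (volume.restrict K) := by
      have i0 : Integrable (fun x => ⟪G x, gradient (f n) x - G x⟫) (volume.restrict K) := by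
        obtain ⟨C, hC⟩ := hK.exists_bound_of_continuousOn (hgm n).continuousOn
        have hfn : MemLp (gradient (f n)) 2 (volume.restrict K) :=
          MemLp.of_bound (hgm n).aestronglyMeasurable C
            (by filter_upwards [ae_restrict_mem hK.measurableSet] with x hx using hC x hx)
        exact integrable_inner_of_memLp hGK (hfn.sub hGK)
      exact i0.bdd_mul (c := Cw ^ 2 / ε ^ 2) ((hwm.pow 2).div ((hfs n).continuous.add
        continuous_const |>.pow 2) fun x => pow_ne_zero 2 (hne n x)).neg.aestronglyMeasurable (hbb n)
    rw [← integral_add (hAni n) hBni]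
    refine hζ0.trans_eq (integral_congr_ae (ae_of_all _ fun x => ?_))
    simp only [hA, hgrad, inner_sub_right, inner_smul_right, real_inner_self_eq_norm_sq]
    ring
  · intro x hx
    have h1 : x ∉ tsupport w := hx.2
    have h2 : w x = 0 := image_eq_zero_of_notMem_tsupport h1
    simp [hgrad, h2]

/-- Picone's inequality for a positive super-solution. -/
theorem picone (hU : IsOpen U) {V : E → ℝ} (hV : ContinuousOn V U) (hV0 : ∀ x ∈ U, 0 ≤ V x)
    (huG : MemH1Loc U u G) (hsuper : ∀ (ζ : E → ℝ) (Z : E → E), IsSobolevTest U ζ Z →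
      (∀ᵐ x ∂(volume.restrict U), 0 ≤ ζ x) →
      0 ≤ ∫ x in U, (1:ℝ) * (⟪G x, Z x⟫ - V x * u x * ζ x))
    (hpos : ∀ᵐ x ∂(volume.restrict U), 0 < u x) {w : E → ℝ} (hw : IsTest U w) :
    ∫⁻ x in U, ‖gradient w x - (w x / u x) • G x‖ₑ ^ 2 ≤
      ENNReal.ofReal (∫ x in U, (‖gradient w x‖ ^ 2 - V x * w x ^ 2)) := by
  set K := tsupport w with hKdef
  have hK : IsCompact K := hw.compact
  have hKU : K ⊆ U := hw.supp
  have hposK : ∀ᵐ x ∂(volume.restrict K), 0 < u x :=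
    ae_mono (Measure.restrict_mono hKU le_rfl) hpos
  have hGK : MemLp G 2 (volume.restrict K) := huG.memLp_grad K hK hKU
  have huK : MemLp u 2 (volume.restrict K) := huG.memLp K hK hKU
  have hwG : MemLp (gradient w) 2 (volume.restrict K) := hw.memLp_gradient 2 _
  have hfin : IsFiniteMeasure (volume.restrict K) := ⟨by simpa using hK.measure_lt_top⟩
  have hwc : Continuous w := hw.smooth.continuous
  have hVw : Integrable (fun x => V x * w x ^ 2) (volume.restrict K) :=
    ((hV.mono hKU).mul (hwc.pow 2).continuousOn).integrableOn_compact hK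
  have hgw : Integrable (fun x => ‖gradient w x‖ ^ 2) (volume.restrict K) := hwG.norm.integrable_sq
  set e : ℕ → ℝ := fun n => 1 / ((n : ℝ) + 1) with he
  have he0 : ∀ n, 0 < e n := fun n => by simp only [he]; positivity
  have hel : Tendsto e atTop (𝓝 0) := tendsto_one_div_add_atTop_nhds_zero_nat
  have z1 : ∀ x ∈ U \ K, ‖gradient w x - (w x / u x) • G x‖ₑ ^ 2 = 0 := by
    intro x hx
    rw [IsTest.gradient_eq_zero hx.2, image_eq_zero_of_notMem_tsupport hx.2]; simp
  have z2 : ∀ x ∈ U \ K, ‖gradient w x‖ ^ 2 - V x * w x ^ 2 = 0 := by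
    intro x hx
    rw [IsTest.gradient_eq_zero hx.2, image_eq_zero_of_notMem_tsupport hx.2]; simp
  rw [setIntegral_eq_of_subset_of_forall_sdiff_eq_zero hU.measurableSet hKU z2]
  have hl : ∫⁻ x in U, ‖gradient w x - (w x / u x) • G x‖ₑ ^ 2 =
      ∫⁻ x in K, ‖gradient w x - (w x / u x) • G x‖ₑ ^ 2 := by
    rw [← lintegral_indicator hU.measurableSet, ← lintegral_indicator hK.measurableSet]
    refine lintegral_congr fun x => ?_
    by_cases hxK : x ∈ K
    · rw [indicator_of_mem hxK, indicator_of_mem (hKU hxK)]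
    · rw [indicator_of_notMem hxK]
      by_cases hxU : x ∈ U
      · rw [indicator_of_mem hxU, z1 x ⟨hxU, hxK⟩]
      · rw [indicator_of_notMem hxU]
  rw [hl]
  -- the inequality with `u + ε` in place of `u`
  have step : ∀ n, ∫⁻ x in K, ‖gradient w x - (w x / (u x + e n)) • G x‖ₑ ^ 2 ≤
      ENNReal.ofReal (∫ x in K, (‖gradient w x‖ ^ 2 - V x * w x ^ 2 * (u x / (u x + e n)))) := by
    intro n
    obtain ⟨hi, hn⟩ := integral_test_nonneg hU hV huG hsuper hpos hw (he0 n)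
    have hVi : Integrable (fun x => V x * w x ^ 2 * (u x / (u x + e n))) (volume.restrict K) := by
      refine hVw.mul_bdd (c := 1) ?_ ?_
      · exact (huK.1.aemeasurable.div (huK.1.aemeasurable.add_const _)).aestronglyMeasurable
      · filter_upwards [hposK] with x hx
        have := he0 n
        rw [Real.norm_of_nonneg (by positivity), div_le_one (by positivity)]
        linarith
    have hid : ∀ x, ‖gradient w x - (w x / (u x + e n)) • G x‖ ^ 2 =
        (‖gradient w x‖ ^ 2 - V x * w x ^ 2 * (u x / (u x + e n))) -
        (2 * w x / (u x + e n) * ⟪G x, gradient w x⟫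
      - w x ^ 2 / (u x + e n) ^ 2 * ‖G x‖ ^ 2 - V x * u x * (w x ^ 2 / (u x + e n))) := by
      intro x
      rw [norm_sub_sq_real, inner_smul_right, norm_smul, mul_pow, Real.norm_eq_abs, sq_abs,
        real_inner_comm]
      generalize u x + e n = s
      ring
    have hsq : Integrable (fun x => ‖gradient w x - (w x / (u x + e n)) • G x‖ ^ 2)
        (volume.restrict K) := by
      simp only [hid]
      exact (hgw.sub hVi).sub hi
    have e1 : ∫⁻ x in K, ‖gradient w x - (w x / (u x + e n)) • G x‖ₑ ^ 2 =
        ENNReal.ofReal (∫ x in K, ‖gradient w x - (w x / (u x + e n)) • G x‖ ^ 2) := by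
      rw [ofReal_integral_eq_lintegral_ofReal hsq (ae_of_all _ fun x => by positivity)]
      refine lintegral_congr fun x => ?_
      rw [ENNReal.ofReal_pow (norm_nonneg _), ofReal_norm]
    rw [e1]
    refine ENNReal.ofReal_le_ofReal ?_
    simp only [hid]
    have := integral_sub (hgw.sub hVi) hi
    simp only [Pi.sub_apply] at this
    rw [this]
    linarith
  have lim : Tendsto (fun n => ENNReal.ofReal
      (∫ x in K, (‖gradient w x‖ ^ 2 - V x * w x ^ 2 * (u x / (u x + e n))))) atTop
      (𝓝 (ENNReal.ofReal (∫ x in K, (‖gradient w x‖ ^ 2 - V x * w x ^ 2)))) := by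
    refine ENNReal.tendsto_ofReal (tendsto_integral_of_dominated_convergence
      (fun x => ‖gradient w x‖ ^ 2 + V x * w x ^ 2) (fun n => ?_) (hgw.add hVw) (fun n => ?_) ?_)
    · exact hgw.1.sub (hVw.1.mul
        (huK.1.aemeasurable.div (huK.1.aemeasurable.add_const _)).aestronglyMeasurable)
    · filter_upwards [hposK, ae_restrict_mem hK.measurableSet] with x hx hxK
      have h1 := he0 n
      have h2 : u x / (u x + e n) ≤ 1 := by rw [div_le_one (by positivity)]; linarith
      have h3 : 0 ≤ u x / (u x + e n) := by positivity
      have h4 : 0 ≤ V x * w x ^ 2 := mul_nonneg (hV0 x (hKU hxK)) (sq_nonneg _)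
      rw [Real.norm_eq_abs]
      refine (abs_sub _ _).trans ?_
      rw [abs_of_nonneg (sq_nonneg _), abs_of_nonneg (mul_nonneg h4 h3)]
      nlinarith
    · filter_upwards [hposK] with x hx
      have h1 : Tendsto (fun n => u x / (u x + e n)) atTop (𝓝 (u x / (u x + 0))) :=
        tendsto_const_nhds.div (hel.const_add (u x)) (by simpa using hx.ne')
      rw [add_zero, div_self hx.ne'] at h1
      simpa using (h1.const_mul (V x * w x ^ 2)).const_sub (‖gradient w x‖ ^ 2)
  -- `ε → 0`, by Fatou's lemma on the left and dominated convergence on the right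
  calc ∫⁻ x in K, ‖gradient w x - (w x / u x) • G x‖ₑ ^ 2
      ≤ ∫⁻ x in K, liminf (fun n => ‖gradient w x - (w x / (u x + e n)) • G x‖ₑ ^ 2) atTop := by
        refine lintegral_mono_ae ?_
        filter_upwards [hposK] with x hx
        have h1 : Tendsto (fun n => w x / (u x + e n)) atTop (𝓝 (w x / (u x + 0))) :=
          tendsto_const_nhds.div (hel.const_add (u x)) (by simpa using hx.ne')
        rw [add_zero] at h1
        have h2 := ((h1.smul_const (G x)).const_sub (gradient w x)).enorm
        exact (((ENNReal.continuous_pow 2).tendsto _).comp h2).liminf_eq.ge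
    _ ≤ liminf (fun n => ∫⁻ x in K, ‖gradient w x - (w x / (u x + e n)) • G x‖ₑ ^ 2) atTop := by
        refine lintegral_liminf_le' fun n => ?_
        refine (AEStronglyMeasurable.enorm ?_).pow_const _
        exact hwG.1.sub (AEStronglyMeasurable.smul (hwc.aestronglyMeasurable.aemeasurable.div
          (huK.1.aemeasurable.add_const _)).aestronglyMeasurable hGK.1)
    _ ≤ liminf (fun n => ENNReal.ofReal (∫ x in K, (‖gradient w x‖ ^ 2 -
          V x * w x ^ 2 * (u x / (u x + e n))))) atTop := liminf_le_liminf (Eventually.of_forall step)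
    _ = _ := lim.liminf_eq

end Picone


/-! ### Test functions in polar coordinates -/

section SphereTests

variable {N : ℕ} [Fact (2 ≤ N)]

set_option linter.unusedSectionVars false

lemma hasFDerivAt_norm {x : EuclideanSpace ℝ (Fin N)} (hx : x ≠ 0) :
    HasFDerivAt (fun y : EuclideanSpace ℝ (Fin N) => ‖y‖) (‖x‖⁻¹ • innerSL ℝ x) x := by
  have h1 := (hasStrictFDerivAt_norm_sq x).hasFDerivAt
  have h2 := h1.sqrt (by positivity)
  have h3 : (fun y : EuclideanSpace ℝ (Fin N) => √(‖y‖ ^ 2)) = fun y => ‖y‖ := by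
    ext y; exact Real.sqrt_sq (norm_nonneg y)
  rw [h3] at h2
  refine h2.congr_fderiv ?_
  ext e
  have : ‖x‖ ≠ 0 := norm_ne_zero_iff.2 hx
  simp [Real.sqrt_sq (norm_nonneg x)]
  field_simp

/-- The extension, homogeneous of degree `0`, of the restriction of `Ψ` to the sphere. -/
noncomputable def hom (Ψ : EuclideanSpace ℝ (Fin N) → ℝ) (x : EuclideanSpace ℝ (Fin N)) : ℝ :=
  Ψ (‖x‖⁻¹ • x)

variable {Ω : Set (Sph N)} {Ψ Ψ' : EuclideanSpace ℝ (Fin N) → ℝ}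

lemma hom_eq_dir {x : EuclideanSpace ℝ (Fin N)} (hx : x ≠ 0) : hom Ψ x = Ψ (dir x) := by
  rw [coe_dir hx]; rfl

lemma hom_pol {p : ℝ × Sph N} (hp : 0 < p.1) : hom Ψ (pol p) = Ψ p.2 := by
  have h0 : pol p ≠ 0 := by rw [← norm_pos_iff, norm_pol _ hp.le]; exact hp
  rw [hom_eq_dir h0, dir_pol hp]

lemma contDiffAt_hom (hΨ : ContDiff ℝ ∞ Ψ) {x : EuclideanSpace ℝ (Fin N)} (hx : x ≠ 0) :
    ContDiffAt ℝ ∞ (hom Ψ) x := by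
  have h1 : ContDiffAt ℝ ∞ (fun x : EuclideanSpace ℝ (Fin N) => ‖x‖⁻¹ • x) x :=
    ((contDiffAt_norm ℝ hx).inv (norm_ne_zero_iff.2 hx)).smul contDiffAt_id
  exact hΨ.contDiffAt.comp x h1

lemma gradient_hom (hΨ : ContDiff ℝ ∞ Ψ) {x : EuclideanSpace ℝ (Fin N)} (hx : x ≠ 0) :
    gradient (hom Ψ) x = ‖x‖⁻¹ • sphereGrad Ψ (dir x) := by
  have hn : ‖x‖ ≠ 0 := norm_ne_zero_iff.2 hx
  have h1 := ((hasDerivAt_inv hn).comp_hasFDerivAt x (hasFDerivAt_norm hx)).smul (hasFDerivAt_id x)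
  have h2 : HasFDerivAt Ψ (fderiv ℝ Ψ (‖x‖⁻¹ • x)) (‖x‖⁻¹ • x) :=
    (hΨ.differentiable (by simp) _).hasFDerivAt
  have h3 := h2.comp (f := fun y : EuclideanSpace ℝ (Fin N) => ‖y‖⁻¹ • y) x h1
  refine HasGradientAt.gradient ?_
  rw [hasGradientAt_iff_hasFDerivAt]
  refine HasFDerivAt.congr_fderiv (f := hom Ψ) h3 ?_
  ext e
  simp [sphereGrad, coe_dir hx, inner_gradient_left]
  field_simp
  ring

lemma inner_sphereGrad_self (Ψ : EuclideanSpace ℝ (Fin N) → ℝ) (θ : Sph N) :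
    ⟪sphereGrad Ψ θ, (θ : EuclideanSpace ℝ (Fin N))⟫ = 0 := by
  rw [sphereGrad, inner_sub_left, inner_smul_left, real_inner_self_eq_norm_sq, norm_sph]
  simp

lemma continuous_sphereGrad (hΨ : ContDiff ℝ ∞ Ψ) : Continuous (sphereGrad Ψ) := by
  have : Continuous (gradient Ψ) :=
    (LinearIsometryEquiv.continuous _).comp (hΨ.continuous_fderiv (by simp))
  unfold sphereGrad
  fun_prop

lemma coe_sph_ne_zero (θ : Sph N) : (θ : EuclideanSpace ℝ (Fin N)) ≠ 0 := by
  rw [← norm_ne_zero_iff, norm_sph]; norm_num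

lemma dir_coe (θ : Sph N) : dir (θ : EuclideanSpace ℝ (Fin N)) = θ := by
  simpa using dir_smul one_pos θ

lemma sphereGrad_eq_gradient_hom (hΨ : ContDiff ℝ ∞ Ψ) (θ : Sph N) :
    sphereGrad Ψ θ = gradient (hom Ψ) (θ : EuclideanSpace ℝ (Fin N)) := by
  rw [gradient_hom hΨ (coe_sph_ne_zero θ), norm_sph, dir_coe]; simp

lemma sphereGrad_eq_zero (hΨ : ContDiff ℝ ∞ Ψ) {θ : Sph N}
    (hθ : θ ∉ tsupport fun θ : Sph N => Ψ θ) : sphereGrad Ψ θ = 0 := by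
  rw [sphereGrad_eq_gradient_hom hΨ]
  have h1 : ∀ᶠ x in 𝓝 (θ : EuclideanSpace ℝ (Fin N)), hom Ψ x = 0 := by
    have h2 := notMem_tsupport_iff_eventuallyEq.1 hθ
    have h3 := continuousAt_dir (coe_sph_ne_zero θ)
    rw [ContinuousAt, dir_coe] at h3
    filter_upwards [h3.eventually h2, isOpen_ne.mem_nhds (coe_sph_ne_zero θ)] with x hx hx0
    rw [hom_eq_dir hx0]; exact hx
  have h4 : hom Ψ =ᶠ[𝓝 (θ : EuclideanSpace ℝ (Fin N))] fun _ => (0:ℝ) := h1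
  rw [h4.gradient_eq, gradient_fun_const]

lemma sphereGrad_add_smul (hΨ : ContDiff ℝ ∞ Ψ) (hΨ' : ContDiff ℝ ∞ Ψ') (t : ℝ) (θ : Sph N) :
    sphereGrad (fun x => Ψ x + t * Ψ' x) θ = sphereGrad Ψ θ + t • sphereGrad Ψ' θ := by
  have h : gradient (fun x => Ψ x + t * Ψ' x) (θ : EuclideanSpace ℝ (Fin N)) =
      gradient Ψ (θ : EuclideanSpace ℝ (Fin N)) +
        t • gradient Ψ' (θ : EuclideanSpace ℝ (Fin N)) := by
    simp only [gradient]
    rw [fderiv_fun_add (hΨ.differentiable (by simp) _)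
      ((hΨ'.differentiable (by simp) _).const_mul t),
      fderiv_const_mul (hΨ'.differentiable (by simp) _), map_add, map_smul]
  rw [sphereGrad, h, inner_add_left, inner_smul_left]
  simp only [sphereGrad, smul_sub, add_smul, smul_smul, RCLike.conj_to_real]
  abel

lemma IsSphereTest.add_smul (h : IsSphereTest Ω Ψ) (h' : IsSphereTest Ω Ψ') (t : ℝ) :
    IsSphereTest Ω (fun x => Ψ x + t * Ψ' x) := by
  refine ⟨h.1.add (contDiff_const.mul h'.1), ?_⟩
  have h1 : tsupport (fun θ : Sph N => t * Ψ' θ) ⊆ tsupport fun θ : Sph N => Ψ' θ :=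
    tsupport_mul_subset_right (f := fun _ => t) (g := fun θ : Sph N => Ψ' θ)
  exact (tsupport_add (fun θ : Sph N => Ψ θ) (fun θ : Sph N => t * Ψ' θ)).trans
    (union_subset h.2 (h1.trans h'.2))

lemma IsSphereTest.continuous (h : IsSphereTest Ω Ψ) : Continuous fun θ : Sph N => Ψ θ :=
  h.1.continuous.comp continuous_subtype_val

lemma memLp_of_continuous {F : Type*} [NormedAddCommGroup F] {f : Sph N → F} (hf : Continuous f)
    [SecondCountableTopologyEither (Sph N) F]
    (p : ℝ≥0∞) (Ω : Set (Sph N)) : MemLp f p ((surf N).restrict Ω) := by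
  obtain ⟨C, hC⟩ := isCompact_univ.exists_bound_of_continuousOn hf.continuousOn
  exact MemLp.of_bound hf.aestronglyMeasurable C (ae_of_all _ fun x => hC x (mem_univ x))

/-- The product `η(|x|) Ψ(x/|x|)`. -/
noncomputable def prodTest (η : ℝ → ℝ) (Ψ : EuclideanSpace ℝ (Fin N) → ℝ)
    (x : EuclideanSpace ℝ (Fin N)) : ℝ := η ‖x‖ * hom Ψ x

lemma gradient_radial {η : ℝ → ℝ} {x : EuclideanSpace ℝ (Fin N)} (hx : x ≠ 0)
    (hη : DifferentiableAt ℝ η ‖x‖) :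
    gradient (fun y : EuclideanSpace ℝ (Fin N) => η ‖y‖) x = (deriv η ‖x‖ * ‖x‖⁻¹) • x := by
  refine HasGradientAt.gradient ?_
  rw [hasGradientAt_iff_hasFDerivAt]
  refine (hη.hasDerivAt.comp_hasFDerivAt x (hasFDerivAt_norm hx)).congr_fderiv ?_
  ext e
  simp [mul_assoc]

lemma gradient_mul {f g : EuclideanSpace ℝ (Fin N) → ℝ} {x : EuclideanSpace ℝ (Fin N)}
    (hf : DifferentiableAt ℝ f x) (hg : DifferentiableAt ℝ g x) :
    gradient (fun y => f y * g y) x = f x • gradient g x + g x • gradient f x := by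
  simp only [gradient]
  rw [fderiv_fun_mul hf hg, map_add, map_smul, map_smul]

lemma gradient_prodTest {η : ℝ → ℝ} (hΨ : ContDiff ℝ ∞ Ψ) {p : ℝ × Sph N} (hp : 0 < p.1)
    (hη : DifferentiableAt ℝ η p.1) :
    gradient (prodTest η Ψ) (pol p) = (deriv η p.1 * Ψ p.2) • (p.2 : EuclideanSpace ℝ (Fin N)) +
      (η p.1 / p.1) • sphereGrad Ψ p.2 := by
  have hn := norm_pol p hp.le
  have h0 : pol p ≠ 0 := by rw [← norm_pos_iff, hn]; exact hp
  have hη' : DifferentiableAt ℝ η ‖pol p‖ := by rwa [hn]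
  have : prodTest η Ψ = fun y => (fun z : EuclideanSpace ℝ (Fin N) => η ‖z‖) y * hom Ψ y := rfl
  rw [this, gradient_mul (f := fun z : EuclideanSpace ℝ (Fin N) => η ‖z‖) (hη'.comp (pol p) (hasFDerivAt_norm h0).differentiableAt)
    ((contDiffAt_hom hΨ h0).differentiableAt (by simp)), gradient_radial h0 hη', gradient_hom hΨ h0,
    hn, dir_pol hp, hom_pol hp, add_comm]
  congr 1
  · simp only [pol, smul_smul]
    congr 1
    field_simp
  · rw [smul_smul, div_eq_mul_inv]

lemma isTest_prodTest {ρ : ℝ} (hρ : 0 ≤ ρ) {η : ℝ → ℝ} (hη : IsTest (Ioi ρ) η)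
    (hΨ : IsSphereTest Ω Ψ) : IsTest (cone Ω ρ) (prodTest η Ψ) := by
  set K : Set (EuclideanSpace ℝ (Fin N)) :=
    pol '' (tsupport η ×ˢ tsupport fun θ : Sph N => Ψ θ) with hKdef
  have hK : IsCompact K := by
    refine (IsCompact.prod hη.compact ?_).image continuous_pol
    exact (isClosed_tsupport _).isCompact
  have hKc : K ⊆ cone Ω ρ := by
    rintro x ⟨p, ⟨h1, h2⟩, rfl⟩
    exact pol_mem_cone hρ (hη.supp h1) (hΨ.2 h2)
  have hz : ∀ x, x ∉ K → prodTest η Ψ x = 0 := by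
    intro x hx
    by_contra h
    have h1 : η ‖x‖ ≠ 0 := left_ne_zero_of_mul h
    have h2 : hom Ψ x ≠ 0 := right_ne_zero_of_mul h
    have h3 : ‖x‖ ∈ tsupport η := subset_tsupport _ h1
    have h4 : x ≠ 0 := norm_pos_iff.1 (hρ.trans_lt (hη.supp h3))
    rw [hom_eq_dir h4] at h2
    exact hx ⟨(‖x‖, dir x), ⟨h3, subset_tsupport (fun θ : Sph N => Ψ θ) h2⟩, pol_norm_dir x⟩
  have hsupp : tsupport (prodTest η Ψ) ⊆ K :=
    closure_minimal (fun x hx => by_contra fun h => hx (hz x h)) hK.isClosed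
  refine ⟨contDiff_iff_contDiffAt.2 fun x => ?_, HasCompactSupport.intro hK hz, hsupp.trans hKc⟩
  by_cases hx : x ∈ tsupport (prodTest η Ψ)
  · have hx0 := ne_zero_of_mem_cone hρ (hKc (hsupp hx))
    exact (hη.smooth.contDiffAt.comp x (contDiffAt_norm ℝ hx0)).mul (contDiffAt_hom hΨ.1 hx0)
  · exact contDiffAt_const.congr_of_eventuallyEq (notMem_tsupport_iff_eventuallyEq.1 hx)

lemma prodTest_pol {η : ℝ → ℝ} {p : ℝ × Sph N} (hp : 0 < p.1) :
    prodTest η Ψ (pol p) = η p.1 * Ψ p.2 := by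
  rw [prodTest, hom_pol hp, norm_pol _ hp.le]

/-- Every nonempty open set of the sphere carries a nonnegative test function that is not zero. -/
lemma exists_sphereTest (hΩ : IsOpen Ω) (hne : Ω.Nonempty) :
    ∃ Ψ : EuclideanSpace ℝ (Fin N) → ℝ, IsSphereTest Ω Ψ ∧ (∀ x, 0 ≤ Ψ x) ∧
      ∃ U : Set (Sph N), IsOpen U ∧ U.Nonempty ∧ U ⊆ Ω ∧ ∀ θ ∈ U, 0 < Ψ θ := by
  obtain ⟨θ₀, hθ₀⟩ := hne
  obtain ⟨ε, hε, hball⟩ := Metric.isOpen_iff.1 hΩ θ₀ hθ₀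
  let f : ContDiffBump (θ₀ : EuclideanSpace ℝ (Fin N)) :=
    { rIn := ε / 4, rOut := ε / 2, rIn_pos := by positivity, rIn_lt_rOut := by linarith }
  have hcl : tsupport (fun θ : Sph N => f θ) ⊆ Metric.closedBall θ₀ (ε / 2) := by
    refine closure_minimal (fun θ hθ => ?_) Metric.isClosed_closedBall
    have : (θ : EuclideanSpace ℝ (Fin N)) ∈ Function.support f := hθ
    rw [f.support_eq] at this
    exact (Metric.mem_ball.1 this).le
  refine ⟨f, ⟨f.contDiff, hcl.trans ((Metric.closedBall_subset_ball (by linarith)).trans hball)⟩,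
    fun x => f.nonneg, Metric.ball θ₀ (ε / 2), Metric.isOpen_ball,
    ⟨θ₀, Metric.mem_ball_self (by positivity)⟩,
    (Metric.ball_subset_ball (by linarith)).trans hball, fun θ hθ => ?_⟩
  exact f.pos_of_mem_ball hθ

end SphereTests


/-! ### Separated functions on a cone -/

section Separated

variable {N : ℕ} [Fact (2 ≤ N)]

set_option linter.unusedSectionVars false

variable {Ω : Set (Sph N)} {ρ : ℝ}

lemma polMeasure_restrict {I : Set ℝ} {L : Set (Sph N)} (hI : MeasurableSet I)
    (hIρ : I ⊆ Ioi ρ) (hL : MeasurableSet L) (hLΩ : L ⊆ Ω) :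
    (polMeasure Ω ρ).restrict (I ×ˢ L) = (volume.restrict I).prod ((surf N).restrict L) := by
  rw [polMeasure, Measure.prod_restrict, Measure.restrict_restrict (hI.prod hL),
    Measure.prod_restrict, inter_eq_left.2 (prod_mono hIρ hLΩ)]

lemma pol_mem_image_iff {I : Set ℝ} {L : Set (Sph N)} (hI : I ⊆ Ioi 0) {p : ℝ × Sph N}
    (hp : 0 < p.1) : pol p ∈ pol '' (I ×ˢ L) ↔ p ∈ I ×ˢ L := by
  constructor
  · rintro ⟨q, hq, h⟩
    have hq0 : 0 < q.1 := hI hq.1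
    have h1 : q.1 = p.1 := by rw [← norm_pol q hq0.le, h, norm_pol p hp.le]
    have h2 : q.2 = p.2 := by rw [← dir_pol hq0, h, dir_pol hp]
    rw [← Prod.ext h1 h2]
    exact hq
  · exact fun h => ⟨p, h, rfl⟩

lemma integrableOn_pol_image_iff {F : Type*} [NormedAddCommGroup F] [NormedSpace ℝ F]
    (hΩ : MeasurableSet Ω) (hρ : 0 ≤ ρ) {I : Set ℝ} {L : Set (Sph N)} (hI : IsCompact I)
    (hIρ : I ⊆ Ioi ρ) (hL : IsCompact L) (hLΩ : L ⊆ Ω) {f : EuclideanSpace ℝ (Fin N) → F} :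
    IntegrableOn f (pol '' (I ×ˢ L)) ↔
      Integrable (fun p => f (pol p)) ((volume.restrict I).prod ((surf N).restrict L)) := by
  have hP : IsCompact (pol '' (I ×ˢ L)) := (hI.prod hL).image continuous_pol
  have hPC : pol '' (I ×ˢ L) ⊆ cone Ω ρ := by
    rintro x ⟨p, hp, rfl⟩
    exact pol_mem_cone hρ (hIρ hp.1) (hLΩ hp.2)
  have hI0 : I ⊆ Ioi 0 := hIρ.trans (Ioi_subset_Ioi hρ)
  have hIL : MeasurableSet (I ×ˢ L) := hI.measurableSet.prod hL.measurableSet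
  have e1 : IntegrableOn f (pol '' (I ×ˢ L)) ↔
      Integrable ((pol '' (I ×ˢ L)).indicator f) (volume.restrict (cone Ω ρ)) := by
    rw [integrable_indicator_iff hP.measurableSet, IntegrableOn, IntegrableOn,
      Measure.restrict_restrict hP.measurableSet, inter_eq_left.2 hPC]
  have e2 : (fun q : ℝ × Sph N => q.1 ^ (N - 1) • (pol '' (I ×ˢ L)).indicator f (pol q))
      =ᵐ[polMeasure Ω ρ] (I ×ˢ L).indicator fun q => q.1 ^ (N - 1) • f (pol q) := by
    filter_upwards [ae_polMeasure_mem hΩ ρ] with q hq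
    have hiff := pol_mem_image_iff (L := L) hI0 (hρ.trans_lt hq.1)
    by_cases h : q ∈ I ×ˢ L
    · rw [indicator_of_mem h, indicator_of_mem (hiff.2 h)]
    · rw [indicator_of_notMem h, indicator_of_notMem fun h' => h (hiff.1 h'), smul_zero]
  rw [e1, integrable_cone_iff hΩ hρ, integrable_congr e2, integrable_indicator_iff hIL, IntegrableOn,
    polMeasure_restrict hI.measurableSet hIρ hL.measurableSet hLΩ, Measure.prod_restrict]
  have hc : ContinuousOn (fun q : ℝ × Sph N => q.1 ^ (N - 1)) (I ×ˢ L) := by fun_prop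
  have hc' : ContinuousOn (fun q : ℝ × Sph N => (q.1 ^ (N - 1))⁻¹) (I ×ˢ L) :=
    hc.inv₀ fun q hq => (pow_pos (hI0 hq.1) _).ne'
  constructor
  · intro h
    refine (IntegrableOn.continuousOn_smul (K := I ×ˢ L) h hc' (hI.prod hL)).congr ?_
    filter_upwards [ae_restrict_mem hIL] with q hq
    rw [smul_smul, inv_mul_cancel₀ (pow_pos (hI0 hq.1) _).ne', one_smul]
  · exact fun h => IntegrableOn.continuousOn_smul (K := I ×ˢ L) h hc (hI.prod hL)

lemma exists_compact_pol {K : Set (EuclideanSpace ℝ (Fin N))} (hρ : 0 ≤ ρ) (hK : IsCompact K)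
    (hKC : K ⊆ cone Ω ρ) : ∃ I : Set ℝ, ∃ L : Set (Sph N), IsCompact I ∧ I ⊆ Ioi ρ ∧ IsCompact L ∧
      L ⊆ Ω ∧ K ⊆ pol '' (I ×ˢ L) := by
  refine ⟨(fun x => ‖x‖) '' K, dir '' K, hK.image continuous_norm, ?_, hK.image_of_continuousOn
    fun x hx => (continuousAt_dir (ne_zero_of_mem_cone hρ (hKC hx))).continuousWithinAt, ?_, ?_⟩
  · rintro _ ⟨x, hx, rfl⟩; exact (hKC hx).1
  · rintro _ ⟨x, hx, rfl⟩; exact ((mem_cone_iff hρ).1 (hKC hx)).2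
  · intro x hx
    exact ⟨(‖x‖, dir x), ⟨⟨x, hx, rfl⟩, ⟨x, hx, rfl⟩⟩, pol_norm_dir x⟩

/-- Products of a radial and an angular locally integrable function are locally integrable. -/
lemma locallyIntegrableOn_polar_prod {F : Type*} [NormedAddCommGroup F] [NormedSpace ℝ F]
    (hΩ : IsOpen Ω) (hρ : 0 ≤ ρ) {a : ℝ → ℝ} {f : Sph N → F}
    (ha : ∀ I, IsCompact I → I ⊆ Ioi ρ → IntegrableOn a I)
    (hf : ∀ L, IsCompact L → L ⊆ Ω → IntegrableOn f L (surf N)) :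
    LocallyIntegrableOn (fun x => a ‖x‖ • f (dir x)) (cone Ω ρ) := by
  rw [locallyIntegrableOn_iff (isOpen_cone hΩ hρ).isLocallyClosed]
  intro K hKC hK
  obtain ⟨I, L, hI, hIρ, hL, hLΩ, hKIL⟩ := exists_compact_pol hρ hK hKC
  refine IntegrableOn.mono_set ?_ hKIL
  rw [integrableOn_pol_image_iff hΩ.measurableSet hρ hI hIρ hL hLΩ]
  refine ((ha I hI hIρ).smul_prod (hf L hL hLΩ)).congr ?_
  rw [Measure.prod_restrict]
  filter_upwards [ae_restrict_mem (hI.measurableSet.prod hL.measurableSet)] with p hp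
  have : 0 < p.1 := hρ.trans_lt (hIρ hp.1)
  rw [norm_pol p this.le, dir_pol this]

/-- `u(rθ) = v(r) φ(θ)` with positive factors, and `G` is the weak gradient of `u` in the cone. -/
structure IsSeparated (Ω : Set (Sph N)) (ρ : ℝ) (u : EuclideanSpace ℝ (Fin N) → ℝ)
    (G : EuclideanSpace ℝ (Fin N) → EuclideanSpace ℝ (Fin N)) (v : ℝ → ℝ) (φ : Sph N → ℝ) :
    Prop where
  weak : IsWeakPair (cone Ω ρ) u G
  eq : ∀ r : ℝ, ρ < r → ∀ θ ∈ Ω, u (r • (θ : EuclideanSpace ℝ (Fin N))) = v r * φ θ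
  vpos : ∀ᵐ r ∂(volume.restrict (Ioi ρ)), 0 < v r
  φpos : ∀ᵐ θ ∂((surf N).restrict Ω), 0 < φ θ

namespace IsSeparated

variable {u : EuclideanSpace ℝ (Fin N) → ℝ}
  {G : EuclideanSpace ℝ (Fin N) → EuclideanSpace ℝ (Fin N)} {v : ℝ → ℝ} {φ : Sph N → ℝ}

lemma integrable_pol {F : Type*} [NormedAddCommGroup F] [NormedSpace ℝ F]
    {f : EuclideanSpace ℝ (Fin N) → F} (hf : LocallyIntegrableOn f (cone Ω ρ)) (hΩ : IsOpen Ω)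
    (hρ : 0 ≤ ρ) {I : Set ℝ} {L : Set (Sph N)} (hI : IsCompact I)
    (hIρ : I ⊆ Ioi ρ) (hL : IsCompact L) (hLΩ : L ⊆ Ω) :
    Integrable (fun p => f (pol p)) ((volume.restrict I).prod ((surf N).restrict L)) := by
  rw [← integrableOn_pol_image_iff hΩ.measurableSet hρ hI hIρ hL hLΩ]
  refine hf.integrableOn_compact_subset ?_ ((hI.prod hL).image continuous_pol)
  rintro x ⟨p, hp, rfl⟩
  exact pol_mem_cone hρ (hIρ hp.1) (hLΩ hp.2)

lemma integrable_prod (h : IsSeparated Ω ρ u G v φ) (hΩ : IsOpen Ω) (hρ : 0 ≤ ρ) {I : Set ℝ}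
    {L : Set (Sph N)} (hI : IsCompact I) (hIρ : I ⊆ Ioi ρ) (hL : IsCompact L) (hLΩ : L ⊆ Ω) :
    Integrable (fun p : ℝ × Sph N => v p.1 * φ p.2)
      ((volume.restrict I).prod ((surf N).restrict L)) := by
  refine (integrable_pol h.weak.locU hΩ hρ hI hIρ hL hLΩ).congr ?_
  rw [Measure.prod_restrict]
  filter_upwards [ae_restrict_mem (hI.measurableSet.prod hL.measurableSet)] with p hp
  exact h.eq p.1 (hIρ hp.1) p.2 (hLΩ hp.2)

lemma integrableOn_v (h : IsSeparated Ω ρ u G v φ) (hΩ : IsOpen Ω) (hΩne : Ω.Nonempty)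
    (hρ : 0 ≤ ρ) (I : Set ℝ) (hI : IsCompact I) (hIρ : I ⊆ Ioi ρ) : IntegrableOn v I := by
  obtain ⟨θ₀, hθ₀⟩ := hΩne
  obtain ⟨ε, hε, hball⟩ := Metric.nhds_basis_closedBall.mem_iff.1 (hΩ.mem_nhds hθ₀)
  set L := Metric.closedBall θ₀ ε with hL
  have hLc : IsCompact L := Metric.isClosed_closedBall.isCompact
  have hi := (h.integrable_prod hΩ hρ hI hIρ hLc hball).prod_left_ae
  have hne : (ae ((surf N).restrict L)).NeBot := by
    rw [ae_neBot, Ne, Measure.restrict_eq_zero]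
    exact (Metric.measure_closedBall_pos (surf N) θ₀ hε).ne'
  have hp : ∀ᵐ θ ∂((surf N).restrict L), 0 < φ θ :=
    ae_mono (Measure.restrict_mono hball le_rfl) h.φpos
  obtain ⟨θ, h1, h2⟩ := (Eventually.and hi hp).exists
  refine (h1.mul_const (φ θ)⁻¹).congr (ae_of_all _ fun r => ?_)
  simp only
  rw [mul_assoc, mul_inv_cancel₀ h2.ne', mul_one]

lemma integrableOn_φ (h : IsSeparated Ω ρ u G v φ) (hΩ : IsOpen Ω)
    (hρ : 0 ≤ ρ) (L : Set (Sph N)) (hL : IsCompact L) (hLΩ : L ⊆ Ω) :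
    IntegrableOn φ L (surf N) := by
  have hIρ : Icc (ρ + 1) (ρ + 2) ⊆ Ioi ρ := fun x hx => by
    have := hx.1; simp only [mem_Ioi]; linarith
  have hi := (h.integrable_prod hΩ hρ isCompact_Icc hIρ hL hLΩ).prod_right_ae
  have hne : (ae ((volume : Measure ℝ).restrict (Icc (ρ + 1) (ρ + 2)))).NeBot := by
    rw [ae_neBot, Ne, Measure.restrict_eq_zero, Real.volume_Icc]
    simp
  have hp := ae_mono (Measure.restrict_mono hIρ le_rfl) h.vpos
  obtain ⟨r, h1, h2⟩ := (Eventually.and hi hp).exists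
  refine (h1.const_mul (v r)⁻¹).congr (ae_of_all _ fun θ => ?_)
  simp only
  rw [← mul_assoc, inv_mul_cancel₀ h2.ne', one_mul]

lemma locallyIntegrableOn_v (h : IsSeparated Ω ρ u G v φ) (hΩ : IsOpen Ω) (hΩne : Ω.Nonempty)
    (hρ : 0 ≤ ρ) : LocallyIntegrableOn v (Ioi ρ) := by
  rw [locallyIntegrableOn_iff isOpen_Ioi.isLocallyClosed]
  exact fun K hK hKc => h.integrableOn_v hΩ hΩne hρ K hKc hK

end IsSeparated

end Separated


/-! ### The angular gradient of a separated function -/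

section Angular

variable {N : ℕ} [Fact (2 ≤ N)]

set_option linter.unusedSectionVars false

variable {Ω : Set (Sph N)} {ρ : ℝ} {u : EuclideanSpace ℝ (Fin N) → ℝ}
  {G : EuclideanSpace ℝ (Fin N) → EuclideanSpace ℝ (Fin N)} {v : ℝ → ℝ} {φ : Sph N → ℝ}

/-- The gradient on the sphere of the angular factor `φ` of `u(rθ) = v(r) φ(θ)`, obtained from the
gradient `G` of `u` by averaging over `r` with the weight `m(r) = r κ(r)`, `∫ κ v = 1`. The second
summand removes the radial component. -/
noncomputable def angGrad (ρ : ℝ) (m : ℝ → ℝ)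
    (G : EuclideanSpace ℝ (Fin N) → EuclideanSpace ℝ (Fin N)) (v : ℝ → ℝ) (φ : Sph N → ℝ)
    (θ : Sph N) : EuclideanSpace ℝ (Fin N) :=
  (∫ t in Ioi ρ, m t • G (pol (t, θ))) +
    ((∫ t in Ioi ρ, v t * deriv m t) * φ θ) • (θ : EuclideanSpace ℝ (Fin N))

lemma fderiv_radial {m : ℝ → ℝ} {x : EuclideanSpace ℝ (Fin N)} (hx : x ≠ 0)
    (hm : DifferentiableAt ℝ m ‖x‖) (e : EuclideanSpace ℝ (Fin N)) :
    fderiv ℝ (fun y : EuclideanSpace ℝ (Fin N) => m ‖y‖) x e =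
      deriv m ‖x‖ * (‖x‖⁻¹ * ⟪x, e⟫) := by
  rw [← inner_gradient_left, gradient_radial hx hm, inner_smul_left]
  simp [mul_assoc]

/-- The dilated test function `m(|y|) ξ(s y)` is supported in the cone for every `s > 0`: the factor
`m` controls the radius, and the support of `ξ` controls the direction. -/
lemma isTest_scaled (hρ : 0 ≤ ρ) {m : ℝ → ℝ} (hm : IsTest (Ioi ρ) m)
    {ξ : EuclideanSpace ℝ (Fin N) → ℝ} (hξ : IsTest (cone Ω ρ) ξ) {s : ℝ} (hs : 0 < s) :
    IsTest (cone Ω ρ) (fun y => m ‖y‖ * ξ (s • y)) := by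
  set K : Set (EuclideanSpace ℝ (Fin N)) :=
    {y | ‖y‖ ∈ tsupport m} ∩ (fun y => s • y) ⁻¹' tsupport ξ with hKdef
  have hKcl : IsClosed K := ((isClosed_tsupport m).preimage continuous_norm).inter
    ((isClosed_tsupport ξ).preimage (continuous_const_smul s))
  have hK : IsCompact K := by
    refine IsCompact.of_isClosed_subset (hξ.compact.image (continuous_const_smul s⁻¹)) hKcl ?_
    rintro y ⟨-, hy⟩
    exact ⟨s • y, hy, by simp [smul_smul, hs.ne']⟩
  have hKC : K ⊆ cone Ω ρ := by
    rintro y ⟨h1, h2⟩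
    have h3 : ρ < ‖y‖ := hm.supp h1
    have hy0 : 0 < ‖y‖ := hρ.trans_lt h3
    have h4 := ((mem_cone_iff hρ).1 (hξ.supp h2)).2
    have h5 : s • y = (s * ‖y‖) • ((dir y : Sph N) : EuclideanSpace ℝ (Fin N)) := by
      rw [mul_smul]; congr 1; exact (pol_norm_dir y).symm
    change dir (s • y) ∈ Ω at h4
    rw [h5, dir_smul (by positivity)] at h4
    exact (mem_cone_iff hρ).2 ⟨h3, h4⟩
  have hz : ∀ y, y ∉ K → m ‖y‖ * ξ (s • y) = 0 := by
    intro y hy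
    by_contra h
    exact hy ⟨subset_tsupport _ (left_ne_zero_of_mul h), subset_tsupport ξ (right_ne_zero_of_mul h)⟩
  have hsupp : tsupport (fun y => m ‖y‖ * ξ (s • y)) ⊆ K :=
    closure_minimal (fun x hx => by_contra fun h => hx (hz x h)) hKcl
  refine ⟨contDiff_iff_contDiffAt.2 fun x => ?_, HasCompactSupport.intro hK hz, hsupp.trans hKC⟩
  by_cases hx : x ∈ tsupport (fun y => m ‖y‖ * ξ (s • y))
  · have hx0 := ne_zero_of_mem_cone hρ (hKC (hsupp hx))
    exact (hm.smooth.contDiffAt.comp x (contDiffAt_norm ℝ hx0)).mul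
      ((hξ.smooth.comp (contDiff_const_smul s)).contDiffAt)
  · exact contDiffAt_const.congr_of_eventuallyEq (notMem_tsupport_iff_eventuallyEq.1 hx)

lemma fderiv_scaled {m : ℝ → ℝ} (hm : Differentiable ℝ m) {ξ : EuclideanSpace ℝ (Fin N) → ℝ}
    (hξ : Differentiable ℝ ξ) (s : ℝ) {p : ℝ × Sph N} (hp : 0 < p.1)
    (e : EuclideanSpace ℝ (Fin N)) :
    fderiv ℝ (fun y => m ‖y‖ * ξ (s • y)) (pol p) e =
      deriv m p.1 * ⟪(p.2 : EuclideanSpace ℝ (Fin N)), e⟫ * ξ (s • pol p) +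
        m p.1 * (s * fderiv ℝ ξ (s • pol p) e) := by
  have hn := norm_pol p hp.le
  have h0 : pol p ≠ 0 := by rw [← norm_pos_iff, hn]; exact hp
  have d1 : DifferentiableAt ℝ (fun y : EuclideanSpace ℝ (Fin N) => m ‖y‖) (pol p) :=
    (hm _).comp (pol p) (hasFDerivAt_norm h0).differentiableAt
  have d2 : HasFDerivAt (fun y => ξ (s • y)) ((fderiv ℝ ξ (s • pol p)).comp
      (s • ContinuousLinearMap.id ℝ _)) (pol p) :=
    (hξ _).hasFDerivAt.comp (pol p) ((hasFDerivAt_id (pol p)).const_smul s)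
  rw [fderiv_fun_mul d1 d2.differentiableAt, d2.fderiv]
  simp only [add_apply, smul_apply, smul_eq_mul,
    ContinuousLinearMap.comp_apply, ContinuousLinearMap.id_apply, map_smul]
  rw [fderiv_radial h0 (hm _), hn]
  simp only [pol, inner_smul_left, RCLike.conj_to_real]
  field_simp
  ring

/-- Integrability over `(s, t, θ)` of a locally integrable function of `(t, θ)` times a continuous
function vanishing outside a compact set. -/
lemma integrable_triple (hΩ : MeasurableSet Ω) {S I : Set ℝ} {L : Set (Sph N)}
    (hS : IsCompact S) (hS0 : S ⊆ Ioi 0) (hI : IsCompact I) (hIρ : I ⊆ Ioi ρ) (hL : IsCompact L)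
    (hLΩ : L ⊆ Ω) {f : ℝ × Sph N → ℝ}
    (hf : Integrable f ((volume.restrict I).prod ((surf N).restrict L)))
    {b : ℝ × (ℝ × Sph N) → ℝ} (hb : Continuous b)
    (hb0 : ∀ s t θ, 0 < s → ρ < t → θ ∈ Ω → b (s, t, θ) ≠ 0 → s ∈ S ∧ t ∈ I ∧ θ ∈ L) :
    Integrable (fun q => b q * f q.2) ((volume.restrict (Ioi 0)).prod (polMeasure Ω ρ)) := by
  have hILm : MeasurableSet (I ×ˢ L) := hI.measurableSet.prod hL.measurableSet
  have hm : MeasurableSet (S ×ˢ (I ×ˢ L)) := hS.measurableSet.prod hILm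
  have hc : IsCompact (S ×ˢ (I ×ˢ L)) := hS.prod (hI.prod hL)
  have e1 : (fun q : ℝ × (ℝ × Sph N) => b q * f q.2)
      =ᵐ[(volume.restrict (Ioi 0)).prod (polMeasure Ω ρ)]
      (S ×ˢ (I ×ˢ L)).indicator fun q => b q * f q.2 := by
    have hae : ∀ᵐ q ∂((volume.restrict (Ioi 0)).prod (polMeasure Ω ρ)),
        (0 : ℝ) < q.1 ∧ ρ < q.2.1 ∧ q.2.2 ∈ Ω := by
      rw [polMeasure, Measure.prod_restrict, Measure.prod_restrict]
      exact ae_restrict_mem (measurableSet_Ioi.prod (measurableSet_Ioi.prod hΩ))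
    filter_upwards [hae] with q hq
    by_cases h : q ∈ S ×ˢ (I ×ˢ L)
    · rw [indicator_of_mem h]
    · rw [indicator_of_notMem h]
      by_contra h'
      have := hb0 q.1 q.2.1 q.2.2 hq.1 hq.2.1 hq.2.2 (left_ne_zero_of_mul h')
      exact h ⟨this.1, this.2.1, this.2.2⟩
  rw [integrable_congr e1, integrable_indicator_iff hm, IntegrableOn, ← Measure.prod_restrict,
    polMeasure_restrict hI.measurableSet hIρ hL.measurableSet hLΩ,
    Measure.restrict_restrict hS.measurableSet, inter_eq_left.2 hS0]
  have hfin : IsFiniteMeasure ((volume : Measure ℝ).restrict S) :=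
    ⟨by simpa using hS.measure_lt_top⟩
  obtain ⟨C, hC⟩ := hc.exists_bound_of_continuousOn hb.continuousOn
  refine (hf.comp_snd _).bdd_mul (c := C) hb.aestronglyMeasurable ?_
  rw [Measure.prod_restrict, Measure.prod_restrict]
  filter_upwards [ae_restrict_mem hm] with q hq using hC q hq

lemma integral_Ioi_scale {t : ℝ} (ht : 0 < t) (g : ℝ → ℝ) :
    ∫ s in Ioi (0:ℝ), g (s * t) = t⁻¹ * ∫ r in Ioi (0:ℝ), g r := by
  have := integral_comp_mul_right_Ioi g 0 ht
  simpa using this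

namespace IsSeparated

lemma integrable_m_smul_G (h : IsSeparated Ω ρ u G v φ) (hΩ : IsOpen Ω) (hρ : 0 ≤ ρ) {m : ℝ → ℝ}
    (hm : IsTest (Ioi ρ) m) {L : Set (Sph N)} (hL : IsCompact L) (hLΩ : L ⊆ Ω) :
    Integrable (fun p : ℝ × Sph N => m p.1 • G (pol p))
      ((volume.restrict (Ioi ρ)).prod ((surf N).restrict L)) := by
  have hG := integrable_pol h.weak.locG hΩ hρ hm.compact hm.supp hL hLΩ
  obtain ⟨C, hC⟩ := hm.compact.exists_bound_of_continuousOn hm.smooth.continuous.continuousOn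
  have h1 : Integrable (fun p : ℝ × Sph N => m p.1 • G (pol p))
      ((volume.restrict (tsupport m)).prod ((surf N).restrict L)) := by
    refine hG.bdd_smul (φ := fun p : ℝ × Sph N => m p.1) C
      (hm.smooth.continuous.comp continuous_fst).aestronglyMeasurable ?_
    rw [Measure.prod_restrict]
    filter_upwards [ae_restrict_mem (hm.compact.measurableSet.prod hL.measurableSet)] with p hp
    exact hC _ hp.1
  have hI : MeasurableSet (tsupport m ×ˢ L) := hm.compact.measurableSet.prod hL.measurableSet
  have h2 : ((volume.restrict (tsupport m)).prod ((surf N).restrict L)) =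
      ((volume.restrict (Ioi ρ)).prod ((surf N).restrict L)).restrict (tsupport m ×ˢ univ) := by
    rw [Measure.prod_restrict, Measure.prod_restrict,
      Measure.restrict_restrict (hm.compact.measurableSet.prod MeasurableSet.univ), prod_inter_prod,
      inter_eq_left.2 hm.supp, univ_inter]
  rw [h2] at h1
  refine (integrableOn_iff_integrable_of_support_subset ?_).1 h1
  intro p hp
  refine ⟨subset_tsupport _ ?_, mem_univ _⟩
  intro h0
  exact hp (by simp [h0])

lemma integrableOn_angGrad (h : IsSeparated Ω ρ u G v φ) (hΩ : IsOpen Ω) (hρ : 0 ≤ ρ) {m : ℝ → ℝ}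
    (hm : IsTest (Ioi ρ) m) (L : Set (Sph N)) (hL : IsCompact L) (hLΩ : L ⊆ Ω) :
    IntegrableOn (angGrad ρ m G v φ) L (surf N) := by
  refine Integrable.add ?_ ?_
  · exact (h.integrable_m_smul_G hΩ hρ hm hL hLΩ).integral_prod_right
  · have h1 := (h.integrableOn_φ hΩ hρ L hL hLΩ).const_mul (∫ t in Ioi ρ, v t * deriv m t)
    refine h1.smul_bdd 1 continuous_subtype_val.aestronglyMeasurable (ae_of_all _ fun θ => ?_)
    exact (norm_sph θ).le

/-- The function `x ↦ φ(x/|x|)` has a weak gradient, homogeneous of degree `-1`. The weak gradient of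
`u` is tested with `m(|y|) ξ(s y)` for all dilations `s > 0`, and the identities are integrated in `s`
with the weight `s^{N-2}`. With this weight the substitution `r = s t` separates the variables: `ξ`
enters through integrals over whole rays, and `v`, `G` through integrals in `t` with weight `m`. -/
theorem isWeakPair_angular (h : IsSeparated Ω ρ u G v φ) (hΩ : IsOpen Ω) (hρ : 0 ≤ ρ) {m : ℝ → ℝ}
    (hm : IsTest (Ioi ρ) m) (hm1 : ∫ t in Ioi ρ, v t * (m t * t⁻¹) = 1) :
    IsWeakPair (cone Ω ρ) (fun x => φ (dir x)) (fun x => ‖x‖⁻¹ • angGrad ρ m G v φ (dir x)) := by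
  have lΦ : LocallyIntegrableOn (fun x => φ (dir x)) (cone Ω ρ) := by
    have := locallyIntegrableOn_polar_prod hΩ hρ (a := fun _ => 1) (f := φ)
      (fun I hI _ => integrableOn_const hI.measure_lt_top.ne) (h.integrableOn_φ hΩ hρ)
    simpa using this
  have lH : LocallyIntegrableOn (fun x => ‖x‖⁻¹ • angGrad ρ m G v φ (dir x)) (cone Ω ρ) := by
    refine locallyIntegrableOn_polar_prod hΩ hρ (a := fun r => r⁻¹) (fun I hI hIρ => ?_)
      (h.integrableOn_angGrad hΩ hρ hm)
    refine ContinuousOn.integrableOn_compact hI (fun r hr => ?_)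
    exact (continuousAt_inv₀ (hρ.trans_lt (hIρ hr)).ne').continuousWithinAt
  have hN : 2 ≤ N := Fact.out
  refine IsWeakPair.of_integral_fderiv lΦ lH fun ξ hξ e => ?_
  -- compact sets carrying all integrands
  set I : Set ℝ := tsupport m with hIdef
  have hI : IsCompact I := hm.compact
  have hIρ : I ⊆ Ioi ρ := hm.supp
  have hI0 : ∀ t ∈ I, 0 < t := fun t ht => hρ.trans_lt (hIρ ht)
  set L : Set (Sph N) := dir '' tsupport ξ with hLdef
  have hL : IsCompact L := hξ.compact.image_of_continuousOn
    fun x hx => (continuousAt_dir (ne_zero_of_mem_cone hρ (hξ.supp hx))).continuousWithinAt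
  have hLΩ : L ⊆ Ω := by
    rintro _ ⟨x, hx, rfl⟩; exact ((mem_cone_iff hρ).1 (hξ.supp hx)).2
  set S : Set ℝ := (fun q : EuclideanSpace ℝ (Fin N) × ℝ => ‖q.1‖ / q.2) '' (tsupport ξ ×ˢ I)
    with hSdef
  have hS : IsCompact S := by
    refine (IsCompact.prod hξ.compact hI).image_of_continuousOn ?_
    exact continuous_fst.norm.continuousOn.div continuous_snd.continuousOn
      fun q hq => (hI0 _ hq.2).ne'
  have hS0 : S ⊆ Ioi 0 := by
    rintro _ ⟨q, hq, rfl⟩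
    exact div_pos (hρ.trans_lt (hξ.supp hq.1).1) (hI0 _ hq.2)
  have hSIL : ∀ s t θ, 0 < s → ρ < t → t ∈ I → s • pol (t, θ) ∈ tsupport ξ →
      s ∈ S ∧ t ∈ I ∧ θ ∈ L := by
    intro s t θ hs ht htI hx
    have ht0 := hρ.trans_lt ht
    refine ⟨⟨(s • pol (t, θ), t), ⟨hx, htI⟩, ?_⟩, htI, ⟨_, hx, ?_⟩⟩
    · simp only [norm_smul, norm_pol (t, θ) ht0.le, Real.norm_of_nonneg hs.le]
      field_simp
    · have : s • pol (t, θ) = (s * t) • (θ : EuclideanSpace ℝ (Fin N)) := by simp [pol, mul_smul]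
      rw [this, dir_smul (by positivity)]
  -- the angular weights
  set X : Sph N → ℝ := fun θ => ∫ r in Ioi (0:ℝ), r ^ (N - 2) * ξ (r • (θ : EuclideanSpace ℝ (Fin N)))
    with hX
  set Y : Sph N → ℝ := fun θ => ∫ r in Ioi (0:ℝ), r ^ (N - 1) *
    fderiv ℝ ξ (r • (θ : EuclideanSpace ℝ (Fin N))) e with hY
  have hξd := hξ.differentiable
  have hξc := hξ.smooth.continuous
  have hdc := hξ.fderiv_cont e
  have hmc := hm.smooth.continuous
  have hm'c : Continuous (deriv m) := hm.smooth.continuous_deriv (by simp)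
  have hm's : ∀ t, deriv m t ≠ 0 → t ∈ I := fun t ht => by
    by_contra hn
    exact ht (image_eq_zero_of_notMem_tsupport fun h' => hn (tsupport_deriv_subset h'))
  set b1 : ℝ × (ℝ × Sph N) → ℝ := fun q => q.1 ^ (N - 2) * q.2.1 ^ (N - 1) * (deriv m q.2.1 *
    ⟪(q.2.2 : EuclideanSpace ℝ (Fin N)), e⟫ * ξ (q.1 • pol q.2)) with hb1
  set b2 : ℝ × (ℝ × Sph N) → ℝ := fun q => q.1 ^ (N - 2) * q.2.1 ^ (N - 1) * (m q.2.1 *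
    (q.1 * fderiv ℝ ξ (q.1 • pol q.2) e)) with hb2
  set b3 : ℝ × (ℝ × Sph N) → ℝ := fun q => q.1 ^ (N - 2) * q.2.1 ^ (N - 1) * (m q.2.1 *
    ξ (q.1 • pol q.2)) with hb3
  have hpc := continuous_pol (N := N)
  have b1c : Continuous b1 := by fun_prop
  have b2c : Continuous b2 := by
    have : Continuous fun q : ℝ × (ℝ × Sph N) => fderiv ℝ ξ (q.1 • pol q.2) e :=
      hdc.comp (by fun_prop)
    fun_prop
  have b3c : Continuous b3 := by fun_prop
  have i1 : Integrable (fun q : ℝ × (ℝ × Sph N) => b1 q * (v q.2.1 * φ q.2.2))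
      ((volume.restrict (Ioi 0)).prod (polMeasure Ω ρ)) := by
    refine integrable_triple hΩ.measurableSet hS hS0 hI hIρ hL hLΩ
      (h.integrable_prod hΩ hρ hI hIρ hL hLΩ) b1c fun s t θ hs ht _ hne => ?_
    have h1 := right_ne_zero_of_mul hne
    exact hSIL s t θ hs ht (hm's t (left_ne_zero_of_mul (left_ne_zero_of_mul h1)))
      (subset_tsupport _ (right_ne_zero_of_mul h1))
  have i2 : Integrable (fun q : ℝ × (ℝ × Sph N) => b2 q * (v q.2.1 * φ q.2.2))
      ((volume.restrict (Ioi 0)).prod (polMeasure Ω ρ)) := by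
    refine integrable_triple hΩ.measurableSet hS hS0 hI hIρ hL hLΩ
      (h.integrable_prod hΩ hρ hI hIρ hL hLΩ) b2c fun s t θ hs ht _ hne => ?_
    have h1 := right_ne_zero_of_mul hne
    exact hSIL s t θ hs ht (subset_tsupport _ (left_ne_zero_of_mul h1))
      (IsTest.fderiv_supp e (subset_tsupport (fun x => fderiv ℝ ξ x e)
        (right_ne_zero_of_mul (right_ne_zero_of_mul h1))))
  have i3 : Integrable (fun q : ℝ × (ℝ × Sph N) => b3 q * ⟪G (pol q.2), e⟫)
      ((volume.restrict (Ioi 0)).prod (polMeasure Ω ρ)) := by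
    refine integrable_triple (f := fun p => ⟪G (pol p), e⟫) hΩ.measurableSet hS hS0 hI hIρ hL hLΩ
      ((integrable_pol h.weak.locG hΩ hρ hI hIρ hL hLΩ).inner_const e)
      b3c fun s t θ hs ht _ hne => ?_
    have h1 := right_ne_zero_of_mul hne
    exact hSIL s t θ hs ht (subset_tsupport _ (left_ne_zero_of_mul h1))
      (subset_tsupport _ (right_ne_zero_of_mul h1))
  -- the equation of `u`, tested with the dilated functions, for each `s`
  have hslice : ∀ s, 0 < s → ∫ p, (b1 (s, p) * (v p.1 * φ p.2) + b2 (s, p) * (v p.1 * φ p.2) +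
      b3 (s, p) * ⟪G (pol p), e⟫) ∂(polMeasure Ω ρ) = 0 := by
    intro s hs
    have hT := isTest_scaled hρ hm hξ hs
    have hw := h.weak.integral_fderiv hT e
    have w1 := (hT.integrable_mul_fderiv h.weak.locU e).integrableOn (s := cone Ω ρ)
    have w2 : IntegrableOn (fun x => m ‖x‖ * ξ (s • x) * ⟪G x, e⟫) (cone Ω ρ) :=
      (hT.integrable_smul (LocallyIntegrableOn.inner_const h.weak.locG e)).integrableOn
    rw [eq_neg_iff_add_eq_zero, ← integral_add w1 w2, integral_cone hΩ.measurableSet hρ] at hw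
    rw [← mul_zero (s ^ (N - 2)), ← hw, ← integral_const_mul]
    refine integral_congr_ae ?_
    filter_upwards [ae_polMeasure_mem hΩ.measurableSet ρ] with p hp
    have hp0 := hρ.trans_lt hp.1
    have hup : u (pol p) = v p.1 * φ p.2 := h.eq p.1 hp.1 p.2 hp.2
    rw [fderiv_scaled hm.differentiable hξd s hp0, hup, norm_pol p hp0.le]
    simp only [hb1, hb2, hb3, smul_eq_mul]
    ring
  have i12 : Integrable (fun q : ℝ × (ℝ × Sph N) => b1 q * (v q.2.1 * φ q.2.2) +
      b2 q * (v q.2.1 * φ q.2.2)) ((volume.restrict (Ioi 0)).prod (polMeasure Ω ρ)) := i1.add i2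
  have i123 : Integrable (fun q : ℝ × (ℝ × Sph N) => b1 q * (v q.2.1 * φ q.2.2) +
      b2 q * (v q.2.1 * φ q.2.2) + b3 q * ⟪G (pol q.2), e⟫)
      ((volume.restrict (Ioi 0)).prod (polMeasure Ω ρ)) := i12.add i3
  have hsum : ∫ q, (b1 q * (v q.2.1 * φ q.2.2) + b2 q * (v q.2.1 * φ q.2.2) +
      b3 q * ⟪G (pol q.2), e⟫) ∂((volume.restrict (Ioi 0)).prod (polMeasure Ω ρ)) = 0 := by
    rw [integral_prod _ i123]
    rw [setIntegral_congr_fun (g := fun _ => (0:ℝ)) measurableSet_Ioi fun s hs => hslice s hs]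
    simp
  rw [integral_add i12 i3, integral_add i1 i2] at hsum
  -- integration in `s`
  have s1 : ∀ p : ℝ × Sph N, 0 < p.1 → ∫ s in Ioi (0:ℝ), b1 (s, p) * (v p.1 * φ p.2) =
      (v p.1 * deriv m p.1) * (φ p.2 * ⟪(p.2 : EuclideanSpace ℝ (Fin N)), e⟫ * X p.2) := by
    intro p hp
    have e1 : ∀ s, b1 (s, p) * (v p.1 * φ p.2) = (p.1 * (deriv m p.1 *
        ⟪(p.2 : EuclideanSpace ℝ (Fin N)), e⟫ * (v p.1 * φ p.2))) *
        ((s * p.1) ^ (N - 2) * ξ ((s * p.1) • (p.2 : EuclideanSpace ℝ (Fin N)))) := by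
      intro s
      have : N - 1 = (N - 2) + 1 := by omega
      simp only [hb1, this, pow_succ, pol, mul_smul, mul_pow]
      ring
    simp only [e1]
    rw [integral_const_mul, integral_Ioi_scale hp
      (fun r => r ^ (N - 2) * ξ (r • (p.2 : EuclideanSpace ℝ (Fin N))))]
    simp only [hX]
    field_simp
  have s2 : ∀ p : ℝ × Sph N, 0 < p.1 → ∫ s in Ioi (0:ℝ), b2 (s, p) * (v p.1 * φ p.2) =
      (v p.1 * (m p.1 * p.1⁻¹)) * (φ p.2 * Y p.2) := by
    intro p hp
    have e1 : ∀ s, b2 (s, p) * (v p.1 * φ p.2) = (m p.1 * (v p.1 * φ p.2)) *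
        ((s * p.1) ^ (N - 1) * fderiv ℝ ξ ((s * p.1) • (p.2 : EuclideanSpace ℝ (Fin N))) e) := by
      intro s
      have : N - 1 = (N - 2) + 1 := by omega
      simp only [hb2, this, pow_succ, pol, mul_smul, mul_pow]
      ring
    simp only [e1]
    rw [integral_const_mul, integral_Ioi_scale hp
      (fun r => r ^ (N - 1) * fderiv ℝ ξ (r • (p.2 : EuclideanSpace ℝ (Fin N))) e)]
    simp only [hY]
    ring
  have s3 : ∀ p : ℝ × Sph N, 0 < p.1 → ∫ s in Ioi (0:ℝ), b3 (s, p) * ⟪G (pol p), e⟫ =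
      (m p.1 * ⟪G (pol p), e⟫) * X p.2 := by
    intro p hp
    have e1 : ∀ s, b3 (s, p) * ⟪G (pol p), e⟫ = (p.1 * (m p.1 * ⟪G (pol p), e⟫)) *
        ((s * p.1) ^ (N - 2) * ξ ((s * p.1) • (p.2 : EuclideanSpace ℝ (Fin N)))) := by
      intro s
      have : N - 1 = (N - 2) + 1 := by omega
      simp only [hb3, this, pow_succ, pol, mul_smul, mul_pow]
      ring
    simp only [e1]
    rw [integral_const_mul, integral_Ioi_scale hp
      (fun r => r ^ (N - 2) * ξ (r • (p.2 : EuclideanSpace ℝ (Fin N))))]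
    simp only [hX]
    field_simp
  have hpos : ∀ᵐ p ∂(polMeasure Ω ρ), 0 < p.1 := by
    filter_upwards [ae_polMeasure_mem hΩ.measurableSet ρ] with p hp using hρ.trans_lt hp.1
  have j1 := i1.integral_prod_right.congr (hpos.mono fun p hp => s1 p hp)
  have j2 := i2.integral_prod_right.congr (hpos.mono fun p hp => s2 p hp)
  have j3 := i3.integral_prod_right.congr (hpos.mono fun p hp => s3 p hp)
  rw [integral_prod_symm _ i1, integral_prod_symm _ i2, integral_prod_symm _ i3,
    integral_congr_ae (hpos.mono fun p hp => s1 p hp),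
    integral_congr_ae (hpos.mono fun p hp => s2 p hp),
    integral_congr_ae (hpos.mono fun p hp => s3 p hp)] at hsum
  -- integration in `t`
  unfold polMeasure at hsum j1 j2 j3
  rw [integral_prod_symm _ j1, integral_prod_symm _ j2, integral_prod_symm _ j3] at hsum
  have hXL : ∀ θ, θ ∉ L → X θ = 0 := by
    intro θ hθ
    refine setIntegral_eq_zero_of_forall_eq_zero fun r hr => ?_
    rw [image_eq_zero_of_notMem_tsupport (f := ξ), mul_zero]
    exact fun h' => hθ ⟨_, h', dir_smul hr θ⟩
  have hGint : ∀ᵐ θ ∂((surf N).restrict Ω), (∫ t in Ioi ρ, (m t * ⟪G (pol (t, θ)), e⟫) * X θ) =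
      ⟪∫ t in Ioi ρ, m t • G (pol (t, θ)), e⟫ * X θ := by
    have hL' := (h.integrable_m_smul_G hΩ hρ hm hL hLΩ).prod_left_ae
    rw [ae_restrict_iff' hL.measurableSet] at hL'
    filter_upwards [ae_restrict_of_ae hL'] with θ hθ
    by_cases hθL : θ ∈ L
    · rw [integral_mul_const]
      congr 1
      rw [real_inner_comm, ← integral_inner (hθ hθL)]
      simp only [inner_smul_right, real_inner_comm]
    · simp [hXL θ hθL]
  have k1 := j1.integral_prod_right
  have k2 := j2.integral_prod_right
  have k3 := j3.integral_prod_right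
  have k12 := Integrable.add k1 k2
  dsimp only at k1 k2 k3 hsum
  simp only [Pi.add_def] at k12
  rw [← integral_add k1 k2, ← integral_add k12 k3] at hsum
  have hfinal : ∫ θ in Ω, (φ θ * Y θ + ⟪angGrad ρ m G v φ θ, e⟫ * X θ) ∂(surf N) = 0 := by
    rw [← hsum]
    refine integral_congr_ae ?_
    filter_upwards [hGint] with θ hθ
    rw [hθ, integral_mul_const, integral_mul_const, hm1, angGrad, inner_add_left, inner_smul_left]
    simp only [RCLike.conj_to_real]
    ring
  -- comparison with the integrals over the cone
  have c1 : ∀ θ ∈ Ω, ∫ r in Ioi ρ, r ^ (N - 1) * (φ θ * fderiv ℝ ξ (pol (r, θ)) e) = φ θ * Y θ := by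
    intro θ hθ
    rw [hY, ← integral_const_mul]
    rw [setIntegral_eq_of_subset_of_forall_sdiff_eq_zero measurableSet_Ioi (Ioi_subset_Ioi hρ)
      (fun r hr => ?_)]
    · refine integral_congr_ae (ae_of_all _ fun r => ?_)
      simp only [pol]; ring
    · have hr0 : (0:ℝ) < r := hr.1
      rw [image_eq_zero_of_notMem_tsupport (f := fun x => fderiv ℝ ξ x e)
        (x := r • (θ : EuclideanSpace ℝ (Fin N))), mul_zero, mul_zero]
      intro h'
      have h2 := (hξ.supp (IsTest.fderiv_supp e h')).1
      rw [norm_smul, norm_sph, mul_one, Real.norm_of_nonneg hr0.le] at h2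
      exact hr.2 h2
  have c2 : ∀ θ ∈ Ω, ∫ r in Ioi ρ, r ^ (N - 1) * (ξ (pol (r, θ)) *
      ⟪r⁻¹ • angGrad ρ m G v φ θ, e⟫) = ⟪angGrad ρ m G v φ θ, e⟫ * X θ := by
    intro θ hθ
    rw [hX, ← integral_const_mul]
    rw [setIntegral_eq_of_subset_of_forall_sdiff_eq_zero measurableSet_Ioi (Ioi_subset_Ioi hρ)
      (fun r hr => ?_)]
    · refine setIntegral_congr_fun measurableSet_Ioi fun r hr => ?_
      have hr0 : (0:ℝ) < r := hρ.trans_lt hr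
      have : N - 1 = (N - 2) + 1 := by omega
      simp only [pol, inner_smul_left, RCLike.conj_to_real, this, pow_succ]
      field_simp
    · have hr0 : (0:ℝ) < r := hr.1
      rw [image_eq_zero_of_notMem_tsupport (f := ξ)
        (x := r • (θ : EuclideanSpace ℝ (Fin N))), mul_zero, mul_zero]
      intro h'
      have h2 := (hξ.supp h').1
      rw [norm_smul, norm_sph, mul_one, Real.norm_of_nonneg hr0.le] at h2
      exact hr.2 h2
  have a1 := (hξ.integrable_mul_fderiv lΦ e).integrableOn (s := cone Ω ρ)
  have a2 : IntegrableOn (fun x => ξ x * ⟪‖x‖⁻¹ • angGrad ρ m G v φ (dir x), e⟫) (cone Ω ρ) :=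
    (hξ.integrable_smul (LocallyIntegrableOn.inner_const lH e)).integrableOn
  rw [eq_neg_iff_add_eq_zero, ← integral_add a1 a2, integral_cone hΩ.measurableSet hρ]
  have a3 := (integrable_cone_iff hΩ.measurableSet hρ).1 (Integrable.add a1 a2)
  simp only [Pi.add_apply] at a3
  have a1' := (integrable_cone_iff hΩ.measurableSet hρ).1 a1
  have a2' := (integrable_cone_iff hΩ.measurableSet hρ).1 a2
  unfold polMeasure at a1' a2' a3 ⊢
  rw [← hfinal, integral_prod_symm _ a3]
  refine integral_congr_ae ?_
  filter_upwards [a1'.prod_left_ae, a2'.prod_left_ae, ae_restrict_mem hΩ.measurableSet]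
    with θ h1 h2 hθ
  rw [← c1 θ hθ, ← c2 θ hθ]
  have q1 : ∀ r ∈ Ioi ρ, r ^ (N - 1) • (φ (dir (pol (r, θ))) * fderiv ℝ ξ (pol (r, θ)) e) =
      r ^ (N - 1) * (φ θ * fderiv ℝ ξ (pol (r, θ)) e) := fun r hr => by
    rw [dir_pol (p := (r, θ)) (hρ.trans_lt hr), smul_eq_mul]
  have q2 : ∀ r ∈ Ioi ρ, r ^ (N - 1) • (ξ (pol (r, θ)) *
      ⟪‖pol (r, θ)‖⁻¹ • angGrad ρ m G v φ (dir (pol (r, θ))), e⟫) =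
      r ^ (N - 1) * (ξ (pol (r, θ)) * ⟪r⁻¹ • angGrad ρ m G v φ θ, e⟫) := fun r hr => by
    rw [dir_pol (p := (r, θ)) (hρ.trans_lt hr), norm_pol (r, θ) (hρ.trans_lt hr).le, smul_eq_mul]
  rw [← setIntegral_congr_fun measurableSet_Ioi q1, ← setIntegral_congr_fun measurableSet_Ioi q2,
    ← integral_add h1 h2]
  simp only [smul_eq_mul, mul_add]

end IsSeparated

end Angular


/-! ### Rotation fields and the tangential gradient -/

section Tangential

variable {N : ℕ} [Fact (2 ≤ N)]

set_option linter.unusedSectionVars false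

variable {Ω : Set (Sph N)} {ρ : ℝ} {u : EuclideanSpace ℝ (Fin N) → ℝ}
  {G : EuclideanSpace ℝ (Fin N) → EuclideanSpace ℝ (Fin N)} {v : ℝ → ℝ} {φ : Sph N → ℝ}

lemma contDiff_inner_left (a : EuclideanSpace ℝ (Fin N)) :
    ContDiff ℝ ∞ fun x : EuclideanSpace ℝ (Fin N) => ⟪a, x⟫ := contDiff_const.inner ℝ contDiff_id

lemma fderiv_inner_mul {f : EuclideanSpace ℝ (Fin N) → ℝ} (hf : Differentiable ℝ f)
    (a e x : EuclideanSpace ℝ (Fin N)) :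
    fderiv ℝ (fun x => f x * ⟪a, x⟫) x e = ⟪a, x⟫ * fderiv ℝ f x e + f x * ⟪a, e⟫ := by
  have h1 : HasFDerivAt (fun x : EuclideanSpace ℝ (Fin N) => ⟪a, x⟫) (innerSL ℝ a) x :=
    (innerSL ℝ a).hasFDerivAt
  rw [fderiv_fun_mul (hf x) h1.differentiableAt, h1.fderiv]
  simp only [add_apply, smul_apply, smul_eq_mul, innerSL_apply_apply]
  ring

/-- Integration by parts along the rotation field `⟪a, x⟫ ∂_b - ⟪b, x⟫ ∂_a`. -/
lemma IsWeakPair.integral_rot {U : Set (EuclideanSpace ℝ (Fin N))} (h : IsWeakPair U u G)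
    {f : EuclideanSpace ℝ (Fin N) → ℝ} (hf : IsTest U f) (a b : EuclideanSpace ℝ (Fin N)) :
    ∫ x in U, (u x * (⟪a, x⟫ * fderiv ℝ f x b - ⟪b, x⟫ * fderiv ℝ f x a) +
      f x * (⟪a, x⟫ * ⟪G x, b⟫ - ⟪b, x⟫ * ⟪G x, a⟫)) = 0 := by
  have ta : IsTest U fun x => f x * ⟪a, x⟫ := hf.mul_smooth fun x _ => (contDiff_inner_left a).contDiffAt
  have tb : IsTest U fun x => f x * ⟪b, x⟫ := hf.mul_smooth fun x _ => (contDiff_inner_left b).contDiffAt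
  have ea := h.integral_fderiv ta b
  have eb := h.integral_fderiv tb a
  have a1 := (ta.integrable_mul_fderiv h.locU b).integrableOn (s := U)
  have b1 := (tb.integrable_mul_fderiv h.locU a).integrableOn (s := U)
  have a2 : IntegrableOn (fun x => f x * ⟪a, x⟫ * ⟪G x, b⟫) U :=
    (ta.integrable_smul (LocallyIntegrableOn.inner_const h.locG b)).integrableOn
  have b2 : IntegrableOn (fun x => f x * ⟪b, x⟫ * ⟪G x, a⟫) U :=
    (tb.integrable_smul (LocallyIntegrableOn.inner_const h.locG a)).integrableOn
  rw [eq_neg_iff_add_eq_zero, ← integral_add a1 a2] at ea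
  rw [eq_neg_iff_add_eq_zero, ← integral_add b1 b2] at eb
  have e := integral_sub (Integrable.add a1 a2) (Integrable.add b1 b2)
  simp only [Pi.add_apply] at e
  rw [ea, eb, sub_zero] at e
  rw [← e]
  refine integral_congr_ae (ae_of_all _ fun x => ?_)
  simp only [fderiv_inner_mul hf.differentiable]
  rw [real_inner_comm a b]
  ring

lemma isTest_radial_mul (hρ : 0 ≤ ρ) {η : ℝ → ℝ} (hη : IsTest (Ioi ρ) η)
    {f : EuclideanSpace ℝ (Fin N) → ℝ} (hf : IsTest (cone Ω ρ) f) :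
    IsTest (cone Ω ρ) (fun x => f x * η ‖x‖) :=
  hf.mul_smooth fun x hx => hη.smooth.contDiffAt.comp x
    (contDiffAt_norm ℝ (ne_zero_of_mem_cone hρ hx))

lemma fderiv_radial_mul {η : ℝ → ℝ} (hη : Differentiable ℝ η)
    {f : EuclideanSpace ℝ (Fin N) → ℝ} (hf : Differentiable ℝ f)
    {x : EuclideanSpace ℝ (Fin N)} (hx : x ≠ 0) (e : EuclideanSpace ℝ (Fin N)) :
    fderiv ℝ (fun x => f x * η ‖x‖) x e =
      η ‖x‖ * fderiv ℝ f x e + f x * (deriv η ‖x‖ * (‖x‖⁻¹ * ⟪x, e⟫)) := by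
  have d1 : DifferentiableAt ℝ (fun y : EuclideanSpace ℝ (Fin N) => η ‖y‖) x :=
    (hη _).comp x (hasFDerivAt_norm hx).differentiableAt
  rw [fderiv_fun_mul (hf x) d1]
  simp only [add_apply, smul_apply, smul_eq_mul]
  rw [fderiv_radial hx (hη _)]
  ring

/-- A function on the cone that is orthogonal to all radial test functions has vanishing spherical
means. -/
lemma integral_slice_eq_zero (hΩ : MeasurableSet Ω) (hρ : 0 ≤ ρ) {k : EuclideanSpace ℝ (Fin N) → ℝ}
    (hk : IntegrableOn k (cone Ω ρ))
    (h : ∀ η : ℝ → ℝ, IsTest (Ioi ρ) η → ∫ x in cone Ω ρ, η ‖x‖ * k x = 0) :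
    ∀ᵐ r ∂(volume.restrict (Ioi ρ)), ∫ θ in Ω, k (pol (r, θ)) ∂(surf N) = 0 := by
  have i1 := (integrable_cone_iff hΩ hρ).1 hk
  have i2 : IntegrableOn (fun r => r ^ (N - 1) * ∫ θ in Ω, k (pol (r, θ)) ∂(surf N)) (Ioi ρ) := by
    unfold polMeasure at i1
    have := i1.integral_prod_left
    simp only [smul_eq_mul, integral_const_mul] at this
    exact this
  have key := isOpen_Ioi.ae_eq_zero_of_integral_contDiff_smul_eq_zero
    (i2.locallyIntegrableOn) fun η h1 h2 h3 => by
      have hη : IsTest (Ioi ρ) η := ⟨h1, h2, h3⟩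
      have e := h η hη
      rw [integral_cone hΩ hρ] at e
      rw [← setIntegral_eq_integral_of_forall_compl_eq_zero (s := Ioi ρ), ← e]
      · have i3 : Integrable (fun q : ℝ × Sph N => q.1 ^ (N - 1) • (η ‖pol q‖ * k (pol q)))
            (polMeasure Ω ρ) := by
          obtain ⟨C, hC⟩ := h2.exists_bound_of_continuousOn h1.continuous.continuousOn
          have hC' : ∀ t, ‖η t‖ ≤ max C 0 := fun t => by
            by_cases ht : t ∈ tsupport η
            · exact (hC t ht).trans (le_max_left _ _)
            · rw [image_eq_zero_of_notMem_tsupport ht]; simp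
          refine (i1.bdd_mul (c := max C 0) (f := fun q => η ‖pol q‖)
            (h1.continuous.comp continuous_pol.norm).aestronglyMeasurable
            (ae_of_all _ fun q => hC' _)).congr (ae_of_all _ fun q => ?_)
          simp only [smul_eq_mul]; ring
        unfold polMeasure at i3 ⊢
        rw [integral_prod _ i3]
        refine setIntegral_congr_fun measurableSet_Ioi fun r hr => ?_
        have hr0 : 0 < r := hρ.trans_lt hr
        have hn : ∀ θ : Sph N, ‖pol (r, θ)‖ = r := fun θ => norm_pol (r, θ) hr0.le
        simp only [hn, smul_eq_mul, integral_const_mul]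
        ring
      · intro r hr
        rw [image_eq_zero_of_notMem_tsupport (fun h' => hr (h3 h')), zero_smul]
  rw [ae_restrict_iff' measurableSet_Ioi]
  filter_upwards [key] with r hr hrρ
  have := hr hrρ
  exact (mul_eq_zero.1 this).resolve_left (pow_pos (hρ.trans_lt hrρ) _).ne'

lemma integrable_rot {U : Set (EuclideanSpace ℝ (Fin N))} (h : IsWeakPair U u G)
    {f : EuclideanSpace ℝ (Fin N) → ℝ} (hf : IsTest U f) (a b : EuclideanSpace ℝ (Fin N)) :
    IntegrableOn (fun x => u x * (⟪a, x⟫ * fderiv ℝ f x b - ⟪b, x⟫ * fderiv ℝ f x a)) U ∧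
    IntegrableOn (fun x => f x * (⟪a, x⟫ * ⟪G x, b⟫ - ⟪b, x⟫ * ⟪G x, a⟫)) U := by
  have ta : IsTest U fun x => f x * ⟪a, x⟫ := hf.mul_smooth fun x _ => (contDiff_inner_left a).contDiffAt
  have tb : IsTest U fun x => f x * ⟪b, x⟫ := hf.mul_smooth fun x _ => (contDiff_inner_left b).contDiffAt
  have a1 := (ta.integrable_mul_fderiv h.locU b).integrableOn (s := U)
  have b1 := (tb.integrable_mul_fderiv h.locU a).integrableOn (s := U)
  have a2 : IntegrableOn (fun x => f x * ⟪a, x⟫ * ⟪G x, b⟫) U :=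
    (ta.integrable_smul (LocallyIntegrableOn.inner_const h.locG b)).integrableOn
  have b2 : IntegrableOn (fun x => f x * ⟪b, x⟫ * ⟪G x, a⟫) U :=
    (tb.integrable_smul (LocallyIntegrableOn.inner_const h.locG a)).integrableOn
  refine ⟨(Integrable.sub a1 b1).congr (ae_of_all _ fun x => ?_),
    (Integrable.sub a2 b2).congr (ae_of_all _ fun x => ?_)⟩
  · simp only [Pi.sub_apply, fderiv_inner_mul hf.differentiable]
    rw [real_inner_comm a b]
    ring
  · simp only [Pi.sub_apply]; ring

/-- Integration by parts along a rotation field on almost every sphere. -/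
lemma IsWeakPair.integral_rot_slice (h : IsWeakPair (cone Ω ρ) u G) (hΩ : MeasurableSet Ω)
    (hρ : 0 ≤ ρ)
    {f : EuclideanSpace ℝ (Fin N) → ℝ} (hf : IsTest (cone Ω ρ) f) (a b : EuclideanSpace ℝ (Fin N)) :
    ∀ᵐ r ∂(volume.restrict (Ioi ρ)), ∫ θ in Ω, (fun x =>
      (u x * (⟪a, x⟫ * fderiv ℝ f x b - ⟪b, x⟫ * fderiv ℝ f x a) +
      f x * (⟪a, x⟫ * ⟪G x, b⟫ - ⟪b, x⟫ * ⟪G x, a⟫))) (pol (r, θ)) ∂(surf N) = 0 := by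
  obtain ⟨i1, i2⟩ := integrable_rot h hf a b
  refine integral_slice_eq_zero hΩ hρ (Integrable.add i1 i2) fun η hη => ?_
  rw [← h.integral_rot (isTest_radial_mul hρ hη hf) a b]
  have hcm : MeasurableSet (cone Ω ρ) := by
    have : cone Ω ρ = (fun x => (‖x‖, dir x)) ⁻¹' (Ioi ρ ×ˢ Ω) := by
      ext x; exact mem_cone_iff hρ
    rw [this]
    exact (measurable_norm.prodMk measurable_dir) (measurableSet_Ioi.prod hΩ)
  refine setIntegral_congr_fun hcm fun x hx => ?_
  have hx0 := ne_zero_of_mem_cone hρ hx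
  simp only [fderiv_radial_mul hη.differentiable hf.differentiable hx0, Pi.add_apply]
  rw [real_inner_comm a x, real_inner_comm b x]
  ring

lemma IsWeakPair.locallyIntegrableOn_inner_self {U : Set (EuclideanSpace ℝ (Fin N))} (hU : IsOpen U)
    (h : IsWeakPair U u G) : LocallyIntegrableOn (fun x => ⟪G x, x⟫) U := by
  rw [locallyIntegrableOn_iff hU.isLocallyClosed]
  intro K hK hKc
  have h1 := h.locG.integrableOn_compact_subset hK hKc
  obtain ⟨C, hC⟩ := hKc.isBounded.exists_norm_le
  refine (h1.norm.mul_const C).mono' (h1.1.inner continuous_id.aestronglyMeasurable) ?_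
  filter_upwards [ae_restrict_mem hKc.measurableSet] with x hx
  exact (norm_inner_le_norm _ _).trans (mul_le_mul_of_nonneg_left (hC x hx) (norm_nonneg _))

/-- The weak form of Euler's relation: the coordinates of `f(x) x` are test functions. -/
lemma IsWeakPair.integral_euler {U : Set (EuclideanSpace ℝ (Fin N))} (h : IsWeakPair U u G)
    {f : EuclideanSpace ℝ (Fin N) → ℝ} (hf : IsTest U f) :
    IntegrableOn (fun x => u x * (fderiv ℝ f x x + N * f x)) U ∧
      ∫ x in U, u x * (fderiv ℝ f x x + N * f x) = -∫ x in U, f x * ⟪G x, x⟫ := by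
  set B := EuclideanSpace.basisFun (Fin N) ℝ with hB
  have hsum : ∀ x, ∑ i, ⟪B i, x⟫ * ⟪G x, B i⟫ = ⟪G x, x⟫ := fun x => by
    have := B.sum_inner_mul_inner (G x) x
    rw [← this]; exact Finset.sum_congr rfl fun i _ => mul_comm _ _
  have ti : ∀ i, IsTest U fun x => f x * ⟪B i, x⟫ := fun i =>
    hf.mul_smooth fun x _ => (contDiff_inner_left (B i)).contDiffAt
  have e1 : ∫ x in U, f x * ⟪G x, x⟫ = ∑ i, ∫ x in U, (f x * ⟪B i, x⟫) * ⟪G x, B i⟫ := by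
    rw [← integral_finsetSum]
    · refine integral_congr_ae (ae_of_all _ fun x => ?_)
      simp only [← hsum, Finset.mul_sum, mul_assoc]
    · exact fun i _ => ((ti i).integrable_smul
        (LocallyIntegrableOn.inner_const h.locG (B i))).integrableOn
  have e2 : ∀ i, ∫ x in U, (f x * ⟪B i, x⟫) * ⟪G x, B i⟫ =
      -∫ x in U, u x * fderiv ℝ (fun x => f x * ⟪B i, x⟫) x (B i) := fun i => by
    rw [h.integral_fderiv (ti i) (B i), neg_neg]
  have e3 : ∀ x, ∑ i, u x * fderiv ℝ (fun x => f x * ⟪B i, x⟫) x (B i) =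
      u x * (fderiv ℝ f x x + N * f x) := by
    intro x
    rw [← Finset.mul_sum]
    congr 1
    simp only [fderiv_inner_mul hf.differentiable, Finset.sum_add_distrib]
    congr 1
    · have e5 := congrArg (fderiv ℝ f x) (B.sum_repr' x)
      rw [map_sum] at e5
      simpa only [map_smul, smul_eq_mul] using e5
    · simp [mul_comm]
  have ii : ∀ i, IntegrableOn (fun x => u x * fderiv ℝ (fun x => f x * ⟪B i, x⟫) x (B i)) U :=
    fun i => ((ti i).integrable_mul_fderiv h.locU (B i)).integrableOn
  constructor
  · exact (integrable_finsetSum Finset.univ fun i _ => ii i).congr (ae_of_all _ fun x => e3 x)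
  · rw [e1, Finset.sum_congr rfl fun i _ => e2 i, Finset.sum_neg_distrib, neg_neg,
      ← integral_finsetSum _ fun i _ => ii i]
    simp only [e3]

/-- The weak gradient of a function that is homogeneous of degree `0` is orthogonal to `x`. -/
lemma IsWeakPair.inner_self_eq_zero (hΩ : IsOpen Ω) (hρ : 0 ≤ ρ)
    {H : EuclideanSpace ℝ (Fin N) → EuclideanSpace ℝ (Fin N)}
    (h : IsWeakPair (cone Ω ρ) (fun x => φ (dir x)) H) :
    ∀ᵐ x ∂(volume.restrict (cone Ω ρ)), ⟪H x, x⟫ = 0 := by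
  have hN : 2 ≤ N := Fact.out
  rw [ae_restrict_iff' (isOpen_cone hΩ hρ).measurableSet]
  have := (isOpen_cone hΩ hρ).ae_eq_zero_of_integral_contDiff_smul_eq_zero
    (h.locallyIntegrableOn_inner_self (isOpen_cone hΩ hρ)) (μ := volume)
    fun f h1 h2 h3 => by
      have hf : IsTest (cone Ω ρ) f := ⟨h1, h2, h3⟩
      rw [← setIntegral_eq_integral_of_forall_compl_eq_zero (s := cone Ω ρ)
        (fun x hx => by rw [image_eq_zero_of_notMem_tsupport fun h' => hx (h3 h'), zero_smul])]
      obtain ⟨i3, e3⟩ := h.integral_euler hf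
      simp only [smul_eq_mul]
      rw [← neg_eq_zero, ← e3]
      rw [integral_cone hΩ.measurableSet hρ]
      have i4 := (integrable_cone_iff hΩ.measurableSet hρ).1 i3
      unfold polMeasure at i4 ⊢
      rw [integral_prod_symm _ i4]
      refine setIntegral_eq_zero_of_forall_eq_zero fun θ hθ => ?_
      -- the radial integrand is the derivative of `r ↦ r ^ N * f (r • θ)`
      set g : ℝ → ℝ := fun r => r ^ N * f (r • (θ : EuclideanSpace ℝ (Fin N))) with hg
      have hfr : ∀ r, HasDerivAt (fun r : ℝ => f (r • (θ : EuclideanSpace ℝ (Fin N))))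
          (fderiv ℝ f (r • (θ : EuclideanSpace ℝ (Fin N))) θ) r := fun r => by
        have a1 : HasDerivAt (fun r : ℝ => r • (θ : EuclideanSpace ℝ (Fin N)))
          ((1:ℝ) • (θ : EuclideanSpace ℝ (Fin N))) r := (hasDerivAt_id r).smul_const _
        rw [one_smul] at a1
        exact (hf.differentiable _).hasFDerivAt.comp_hasDerivAt r a1
      have hgd : ∀ r, HasDerivAt g (N * r ^ (N - 1) * f (r • (θ : EuclideanSpace ℝ (Fin N))) +
          r ^ N * fderiv ℝ f (r • (θ : EuclideanSpace ℝ (Fin N))) θ) r := fun r =>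
        (hasDerivAt_pow N r).mul (hfr r)
      have hgρ : g ρ = 0 := by
        rw [hg]
        simp only
        rw [image_eq_zero_of_notMem_tsupport (f := f), mul_zero]
        intro h'
        have h'' := (h3 h').1
        rw [norm_smul, norm_sph, mul_one, Real.norm_of_nonneg hρ] at h''
        exact lt_irrefl _ h''
      have hgT : Tendsto g atTop (𝓝 0) := by
        obtain ⟨R, hR⟩ := h2.isBounded.exists_norm_le
        refine tendsto_const_nhds.congr' ?_
        filter_upwards [eventually_gt_atTop (max R 0)] with r hr
        rw [hg]
        simp only
        rw [image_eq_zero_of_notMem_tsupport (f := f), mul_zero]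
        intro h'
        have h'' := hR _ h'
        rw [norm_smul, norm_sph, mul_one,
          Real.norm_of_nonneg ((le_max_right _ _).trans hr.le)] at h''
        exact absurd h'' (not_le.2 ((le_max_left _ _).trans_lt hr))
      have e4 : ∀ r ∈ Ioi ρ, r ^ (N - 1) • (φ (dir (pol (r, θ))) *
          (fderiv ℝ f (pol (r, θ)) (pol (r, θ)) + N * f (pol (r, θ)))) =
          φ θ * (N * r ^ (N - 1) * f (r • (θ : EuclideanSpace ℝ (Fin N))) +
          r ^ N * fderiv ℝ f (r • (θ : EuclideanSpace ℝ (Fin N))) θ) := fun r hr => by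
        have hr0 : 0 < r := hρ.trans_lt hr
        have e5 : N = (N - 1) + 1 := by omega
        have e6 : r ^ N = r ^ (N - 1) * r := by conv_lhs => rw [e5, pow_succ]
        rw [dir_pol (p := (r, θ)) hr0, e6]
        simp only [pol, map_smul, smul_eq_mul]
        ring
      rw [setIntegral_congr_fun measurableSet_Ioi e4, integral_const_mul]
      by_cases hi : IntegrableOn (fun r => N * r ^ (N - 1) * f (r • (θ : EuclideanSpace ℝ (Fin N))) +
          r ^ N * fderiv ℝ f (r • (θ : EuclideanSpace ℝ (Fin N))) θ) (Ioi ρ)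
      · rw [integral_Ioi_of_hasDerivAt_of_tendsto (hgd ρ).continuousAt.continuousWithinAt
          (fun r _ => hgd r) hi hgT, hgρ, sub_zero, mul_zero]
      · rw [integral_undef hi, mul_zero]
  filter_upwards [this] with x hx hxC using hx hxC

/-- For a separated function the tangential part of the gradient is `v(|x|) ∇(φ(x/|x|))`. Rotation
fields are tangential to spheres, so that integration by parts along them holds on almost every
sphere, where `v` is a constant; no differentiability of `v` is needed. -/
theorem IsSeparated.tangential_gradient (h : IsSeparated Ω ρ u G v φ) (hΩ : IsOpen Ω)
    (hΩne : Ω.Nonempty) (hρ : 0 ≤ ρ) {A : Sph N → EuclideanSpace ℝ (Fin N)}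
    (hA : ∀ L, IsCompact L → L ⊆ Ω → IntegrableOn A L (surf N))
    (hH : IsWeakPair (cone Ω ρ) (fun x => φ (dir x)) (fun x => ‖x‖⁻¹ • A (dir x))) :
    ∀ᵐ x ∂(volume.restrict (cone Ω ρ)),
      ‖x‖ ^ 2 • G x - ⟪G x, x⟫ • x = (v ‖x‖ * ‖x‖) • A (dir x) := by
  have hm := hΩ.measurableSet
  set H : EuclideanSpace ℝ (Fin N) → EuclideanSpace ℝ (Fin N) := fun x => ‖x‖⁻¹ • A (dir x) with hHdef
  have hvH : LocallyIntegrableOn (fun x => v ‖x‖ • H x) (cone Ω ρ) := by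
    have := locallyIntegrableOn_polar_prod hΩ hρ (a := fun r => v r * r⁻¹) (f := A)
      (fun I hI hIρ => (h.integrableOn_v hΩ hΩne hρ I hI hIρ).mul_continuousOn
        (fun r hr => (continuousAt_inv₀ (hρ.trans_lt (hIρ hr)).ne').continuousWithinAt) hI) hA
    simpa only [hHdef, smul_smul] using this
  -- the components of the two fields along the rotation fields agree
  have key : ∀ a b : EuclideanSpace ℝ (Fin N), ∀ᵐ x ∂(volume.restrict (cone Ω ρ)),
      ⟪a, x⟫ * ⟪G x - v ‖x‖ • H x, b⟫ - ⟪b, x⟫ * ⟪G x - v ‖x‖ • H x, a⟫ = 0 := by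
    intro a b
    have lD : LocallyIntegrableOn (fun x => G x - v ‖x‖ • H x) (cone Ω ρ) :=
      LocallyIntegrableOn.sub h.weak.locG hvH
    have lW : LocallyIntegrableOn (fun x => ⟪a, x⟫ * ⟪G x - v ‖x‖ • H x, b⟫ -
        ⟪b, x⟫ * ⟪G x - v ‖x‖ • H x, a⟫) (cone Ω ρ) := by
      have h1 := fun e => LocallyIntegrableOn.inner_const lD e
      simp only [locallyIntegrableOn_iff (isOpen_cone hΩ hρ).isLocallyClosed] at h1 ⊢
      intro K hK hKc
      exact Integrable.sub ((h1 b K hK hKc).continuousOn_mul (by fun_prop) hKc)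
        ((h1 a K hK hKc).continuousOn_mul (by fun_prop) hKc)
    rw [ae_restrict_iff' (isOpen_cone hΩ hρ).measurableSet]
    have := (isOpen_cone hΩ hρ).ae_eq_zero_of_integral_contDiff_smul_eq_zero lW (μ := volume)
      fun f h1 h2 h3 => by
        have hf : IsTest (cone Ω ρ) f := ⟨h1, h2, h3⟩
        rw [← setIntegral_eq_integral_of_forall_compl_eq_zero (s := cone Ω ρ)
          (fun x hx => by rw [image_eq_zero_of_notMem_tsupport fun h' => hx (h3 h'), zero_smul]),
          integral_cone hm hρ]
        have i0 := (integrable_cone_iff hm hρ).1 (hf.integrable_smul lW).integrableOn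
        obtain ⟨iu1, iu2⟩ := integrable_rot h.weak hf a b
        obtain ⟨iφ1, iφ2⟩ := integrable_rot hH hf a b
        have iu := (integrable_cone_iff hm hρ).1 (Integrable.add iu1 iu2)
        have iφ := (integrable_cone_iff hm hρ).1 (Integrable.add iφ1 iφ2)
        unfold polMeasure at i0 iu iφ ⊢
        rw [integral_prod _ i0]
        refine integral_eq_zero_of_ae ?_
        filter_upwards [h.weak.integral_rot_slice hm hρ hf a b, hH.integral_rot_slice hm hρ hf a b,
          iu.prod_right_ae, iφ.prod_right_ae, ae_restrict_mem measurableSet_Ioi]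
          with r hu hφ ju jφ hr
        have hr0 : 0 < r := hρ.trans_lt hr
        have hu' : ∫ θ in Ω, r ^ (N - 1) • (fun x =>
          (u x * (⟪a, x⟫ * fderiv ℝ f x b - ⟪b, x⟫ * fderiv ℝ f x a) +
          f x * (⟪a, x⟫ * ⟪G x, b⟫ - ⟪b, x⟫ * ⟪G x, a⟫))) (pol (r, θ)) ∂(surf N) = 0 := by
          simp only [smul_eq_mul] at hu ⊢
          rw [integral_const_mul, hu, mul_zero]
        have hφ' : ∫ θ in Ω, v r * (r ^ (N - 1) • (fun x =>
          (φ (dir x) * (⟪a, x⟫ * fderiv ℝ f x b - ⟪b, x⟫ * fderiv ℝ f x a) +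
          f x * (⟪a, x⟫ * ⟪H x, b⟫ - ⟪b, x⟫ * ⟪H x, a⟫))) (pol (r, θ))) ∂(surf N) = 0 := by
          simp only [smul_eq_mul] at hφ ⊢
          rw [integral_const_mul, integral_const_mul, hφ, mul_zero, mul_zero]
        have e := integral_sub ju (jφ.const_mul (v r))
        rw [show (0:ℝ → ℝ) r = 0 from rfl]
        refine Eq.trans ?_ (e.trans (sub_eq_zero.2 (hu'.trans hφ'.symm)))
        refine setIntegral_congr_fun hm fun θ hθ => ?_
        have e1 : u (pol (r, θ)) = v r * φ θ := h.eq r hr θ hθ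
        have hn : ‖pol (r, θ)‖ = r := norm_pol (r, θ) hr0.le
        have hd : dir (pol (r, θ)) = θ := dir_pol (p := (r, θ)) hr0
        simp only [Pi.add_apply, e1, hn, hd, smul_eq_mul, inner_sub_left, inner_smul_left,
          RCLike.conj_to_real]
        ring
    filter_upwards [this] with x hx hxC using hx hxC
  -- the rotation fields span the tangent space, so the difference of the fields is radial
  set B := EuclideanSpace.basisFun (Fin N) ℝ with hB
  have key' : ∀ᵐ x ∂(volume.restrict (cone Ω ρ)), ∀ i j,
      ⟪B i, x⟫ * ⟪G x - v ‖x‖ • H x, B j⟫ - ⟪B j, x⟫ * ⟪G x - v ‖x‖ • H x, B i⟫ = 0 := by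
    rw [ae_all_iff]; intro i
    rw [ae_all_iff]; exact fun j => key _ _
  filter_upwards [key', hH.inner_self_eq_zero hΩ hρ,
    ae_restrict_mem (isOpen_cone hΩ hρ).measurableSet] with x hx hHx hxC
  have hx0 : ‖x‖ ≠ 0 := norm_ne_zero_iff.2 (ne_zero_of_mem_cone hρ hxC)
  set D := G x - v ‖x‖ • H x with hD
  have h1 : ‖x‖ ^ 2 • D = ⟪D, x⟫ • x := by
    refine InnerProductSpace.ext_inner_right_basis B.toBasis fun j => ?_
    rw [B.coe_toBasis]
    have e1 : ∑ i, ⟪B i, x⟫ * (⟪B i, x⟫ * ⟪D, B j⟫) = ∑ i, ⟪B i, x⟫ * (⟪B j, x⟫ * ⟪D, B i⟫) :=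
      Finset.sum_congr rfl fun i _ => by rw [sub_eq_zero.1 (hx i j)]
    have e2 : ∑ i, ⟪B i, x⟫ * (⟪B i, x⟫ * ⟪D, B j⟫) = ‖x‖ ^ 2 * ⟪D, B j⟫ := by
      rw [← B.sum_sq_inner_right x, Finset.sum_mul]
      exact Finset.sum_congr rfl fun i _ => by ring
    have e3 : ∑ i, ⟪B i, x⟫ * (⟪B j, x⟫ * ⟪D, B i⟫) = ⟪B j, x⟫ * ⟪D, x⟫ := by
      rw [← B.sum_inner_mul_inner D x, Finset.mul_sum]
      exact Finset.sum_congr rfl fun i _ => by ring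
    rw [inner_smul_left, inner_smul_left]
    simp only [RCLike.conj_to_real]
    rw [← e2, e1, e3, real_inner_comm x (B j), mul_comm]
  have h2 : ⟪D, x⟫ = ⟪G x, x⟫ := by
    have hHx' : ⟪H x, x⟫ = 0 := hHx
    rw [hD, inner_sub_left, inner_smul_left, hHx']; simp
  rw [h2] at h1
  rw [← h1, hD, smul_sub, sub_sub_cancel, smul_smul, hHdef]
  simp only [smul_smul]
  congr 1
  field_simp

end Tangential


/-! ### Sharpness of the Hardy constant on a half-line -/

section Hardy

/-- The test function `r ↦ h (log r)` on the half-line. -/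
noncomputable def logTest (h : ℝ → ℝ) (r : ℝ) : ℝ := (Ioi (0:ℝ)).indicator (fun r => h (Real.log r)) r

variable {h χ : ℝ → ℝ}

lemma logTest_eventuallyEq {r : ℝ} (hr : 0 < r) : logTest h =ᶠ[𝓝 r] fun r => h (Real.log r) := by
  filter_upwards [lt_mem_nhds hr] with y hy
  exact indicator_of_mem (s := Ioi (0:ℝ)) hy _

lemma logTest_exp (s : ℝ) : logTest h (Real.exp s) = h s := by
  rw [(logTest_eventuallyEq (Real.exp_pos s)).eq_of_nhds, Real.log_exp]

lemma isTest_logTest {L : ℝ} (hh : IsTest (Ioi L) h) : IsTest (Ioi (Real.exp L)) (logTest h) := by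
  set K := Real.exp '' tsupport h with hK
  have hKc : IsCompact K := IsCompact.image hh.compact Real.continuous_exp
  have hK0 : K ⊆ Ioi (Real.exp L) := by
    rintro _ ⟨s, hs, rfl⟩
    exact Real.exp_lt_exp.2 (hh.supp hs)
  have hz : ∀ r, r ∉ K → logTest h r = 0 := by
    intro r hr
    by_contra h0
    have hr0 : 0 < r := mem_of_indicator_ne_zero h0
    rw [(logTest_eventuallyEq hr0).eq_of_nhds] at h0
    exact hr ⟨Real.log r, subset_tsupport _ h0, Real.exp_log hr0⟩
  have hsupp : tsupport (logTest h) ⊆ K :=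
    closure_minimal (fun x hx => by_contra fun h' => hx (hz x h')) hKc.isClosed
  refine ⟨contDiff_iff_contDiffAt.2 fun r => ?_, HasCompactSupport.intro hKc hz, hsupp.trans hK0⟩
  by_cases hr : r ∈ tsupport (logTest h)
  · have hr0 : 0 < r := (Real.exp_pos L).trans (hK0 (hsupp hr))
    refine ContDiffAt.congr_of_eventuallyEq ?_ (logTest_eventuallyEq hr0)
    exact hh.smooth.contDiffAt.comp r (Real.contDiffAt_log.2 hr0.ne')
  · exact contDiffAt_const.congr_of_eventuallyEq (notMem_tsupport_iff_eventuallyEq.1 hr)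

lemma deriv_logTest_exp (hh : Differentiable ℝ h) (s : ℝ) :
    deriv (logTest h) (Real.exp s) = deriv h s * Real.exp (-s) := by
  rw [(logTest_eventuallyEq (Real.exp_pos s)).deriv_eq]
  have h1 := (Real.hasDerivAt_log (Real.exp_pos s).ne')
  have h2 : HasDerivAt h (deriv h s) (Real.log (Real.exp s)) := by
    rw [Real.log_exp]; exact (hh s).hasDerivAt
  have h3 : HasDerivAt (fun r => h (Real.log r)) _ _ := h2.comp (Real.exp s) h1
  rw [h3.deriv, Real.exp_neg]

lemma integral_Ioi_exp (f : ℝ → ℝ) :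
    ∫ r in Ioi (0:ℝ), f r = ∫ s, Real.exp s * f (Real.exp s) := by
  have := integral_image_eq_integral_abs_deriv_smul (s := univ) (f := Real.exp) (f' := Real.exp)
    MeasurableSet.univ (fun x _ => (Real.hasDerivAt_exp x).hasDerivWithinAt)
    Real.exp_injective.injOn f
  rw [image_univ, Real.range_exp] at this
  simpa [abs_of_pos (Real.exp_pos _)] using this

lemma hasCompactSupport_sq (hc : HasCompactSupport χ) : HasCompactSupport fun s => χ s ^ 2 :=
  HasCompactSupport.intro hc fun s hs => by rw [image_eq_zero_of_notMem_tsupport hs]; simp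

/-- The one-dimensional identity behind the sharpness of the Hardy constant: the mixed term is the
integral of the derivative of `-α χ²`. -/
lemma integral_sq_deriv_sub (hχ : ContDiff ℝ ∞ χ) (hc : HasCompactSupport χ) (α : ℝ) :
    ∫ s, (deriv χ s - α * χ s) ^ 2 = (∫ s, deriv χ s ^ 2) + α ^ 2 * ∫ s, χ s ^ 2 := by
  have c1 : Continuous (deriv χ) := hχ.continuous_deriv (by simp)
  have s1 : HasCompactSupport (deriv χ) := hc.deriv
  have i1 : Integrable fun s => deriv χ s ^ 2 :=
    (c1.pow 2).integrable_of_hasCompactSupport (hasCompactSupport_sq s1)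
  have i2 : Integrable fun s => χ s ^ 2 :=
    (hχ.continuous.pow 2).integrable_of_hasCompactSupport
      (hasCompactSupport_sq hc)
  have i3 : Integrable fun s => χ s * deriv χ s :=
    (hχ.continuous.mul c1).integrable_of_hasCompactSupport hc.mul_right
  have i4 : Integrable fun s => deriv χ s * χ s := by simpa only [mul_comm] using i3
  have e := integral_mul_deriv_eq_deriv_mul_of_integrable (u := χ) (v := χ) (u' := deriv χ)
    (v' := deriv χ) (fun x _ => (hχ.differentiable (by simp) x).hasDerivAt)
    (fun x _ => (hχ.differentiable (by simp) x).hasDerivAt) i3 i4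
    (i2.congr (ae_of_all _ fun s => pow_two (χ s)))
  have e0 : ∫ s, χ s * deriv χ s = 0 := by
    have : ∫ s, deriv χ s * χ s = ∫ s, χ s * deriv χ s := by simp only [mul_comm]
    rw [this] at e; linarith
  have : ∀ s, (deriv χ s - α * χ s) ^ 2 =
      deriv χ s ^ 2 + (α ^ 2 * χ s ^ 2 - 2 * α * (χ s * deriv χ s)) := fun s => by ring
  simp only [this]
  have i5 : Integrable fun s => α ^ 2 * χ s ^ 2 - 2 * α * (χ s * deriv χ s) :=
    (i2.const_mul _).sub (i3.const_mul _)
  rw [integral_add i1 i5, integral_sub (i2.const_mul _) (i3.const_mul _), integral_const_mul, integral_const_mul, e0]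
  ring

/-- The Hardy constant is sharp on the half-line `(ρ, ∞)`. With `r = e^s` and
`η(r) = r^{-(N-2)/2} χ(log r)` the Hardy quotient is `C_H + ∫ χ'² / ∫ χ²`, and `χ` is a bump function
stretched by a large factor `k`. -/
theorem exists_hardy_test {N : ℕ} (hN : 2 ≤ N) {ρ : ℝ} (hρ : 0 ≤ ρ) {ε : ℝ} (hε : 0 < ε) :
    ∃ η : ℝ → ℝ, IsTest (Ioi ρ) η ∧
      0 < ∫ r in Ioi ρ, r ^ (N - 1) * (η r ^ 2 / r ^ 2) ∧
      ∫ r in Ioi ρ, r ^ (N - 1) * deriv η r ^ 2 ≤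
        (hardyConst N + ε) * ∫ r in Ioi ρ, r ^ (N - 1) * (η r ^ 2 / r ^ 2) := by
  let b : ContDiffBump (2:ℝ) := ⟨1/2, 1, by norm_num, by norm_num⟩
  set L := Real.log (ρ + 1) with hL
  set α : ℝ := ((N:ℝ) - 2) / 2 with hα
  have hbc : Continuous b := b.continuous
  have hbd : Continuous (deriv b) := (b.contDiff (n := 1)).continuous_deriv le_rfl
  set A : ℝ := ∫ s, deriv b s ^ 2 with hA
  set B : ℝ := ∫ s, b s ^ 2 with hB
  have hA0 : 0 ≤ A := integral_nonneg fun s => sq_nonneg _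
  have hB0 : 0 < B := by
    refine (hbc.pow 2).integral_pos_of_hasCompactSupport_nonneg_nonzero
      (hasCompactSupport_sq b.hasCompactSupport) (fun s => sq_nonneg _)
      (x := 2) ?_
    rw [b.one_of_mem_closedBall (by simp [b])]; norm_num
  obtain ⟨k, hk⟩ : ∃ k : ℝ, 0 < k ∧ A / k ≤ ε * (k * B) := by
    refine ⟨max 1 (A / (ε * B)), by positivity, ?_⟩
    set k := max 1 (A / (ε * B))
    have h1 : 1 ≤ k := le_max_left _ _
    have h2 : A / (ε * B) ≤ k := le_max_right _ _
    rw [div_le_iff₀ (by positivity)] at h2 ⊢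
    nlinarith [mul_pos hε hB0, mul_nonneg (mul_nonneg (by linarith : (0:ℝ) ≤ k) (sub_nonneg.2 h1)) (mul_pos hε hB0).le]
  obtain ⟨hk0, hkA⟩ := hk
  -- stretching in the logarithmic variable makes the derivative negligible
  set χ : ℝ → ℝ := fun s => b ((s - L) / k) with hχ
  have hχs : ContDiff ℝ ∞ χ := b.contDiff.comp (by fun_prop)
  have hχsupp : ∀ s, χ s ≠ 0 → s ∈ Icc (L + k) (L + 3 * k) := fun s hs => by
    have h1 : (s - L) / k ∈ Function.support b := hs
    rw [b.support_eq, Metric.mem_ball, Real.dist_eq, abs_lt] at h1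
    have h2 : b.rOut = 1 := rfl
    rw [h2] at h1
    have h3 : 1 < (s - L) / k := by linarith [h1.1]
    have h4 : (s - L) / k < 3 := by linarith [h1.2]
    rw [lt_div_iff₀ hk0] at h3
    rw [div_lt_iff₀ hk0] at h4
    constructor <;> linarith
  have hχt : tsupport χ ⊆ Icc (L + k) (L + 3 * k) := closure_minimal hχsupp isClosed_Icc
  have hχc : HasCompactSupport χ := IsCompact.of_isClosed_subset isCompact_Icc (isClosed_tsupport _) hχt
  have hχ2 : ∫ s, χ s ^ 2 = k * B := by
    rw [hχ, hB, integral_sub_right_eq_self (fun s => b (s / k) ^ 2) L,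
      Measure.integral_comp_div (fun s => b s ^ 2) k, abs_of_pos hk0, smul_eq_mul]
  have hχd : ∀ s, deriv χ s = deriv b ((s - L) / k) / k := fun s => by
    have h1 : HasDerivAt (fun s : ℝ => (s - L) / k) (1 / k) s :=
      ((hasDerivAt_id s).sub_const L).div_const k
    have h2 : HasDerivAt b (deriv b ((s - L) / k)) ((s - L) / k) :=
      ((b.contDiff (n := 1)).differentiable (by simp) _).hasDerivAt
    have h3 : HasDerivAt (b ∘ fun s => (s - L) / k) _ s := HasDerivAt.comp s h2 h1
    have h4 : deriv χ s = deriv b ((s - L) / k) * (1 / k) := h3.deriv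
    rw [h4]; ring
  have hχ'2 : ∫ s, deriv χ s ^ 2 = A / k := by
    simp only [hχd, div_pow]
    rw [integral_div, integral_sub_right_eq_self (fun s => deriv b (s / k) ^ 2) L,
      Measure.integral_comp_div (fun s => deriv b s ^ 2) k, abs_of_pos hk0, smul_eq_mul, ← hA]
    field_simp
  set h : ℝ → ℝ := fun s => Real.exp (-α * s) * χ s with hh
  have hht : IsTest (Ioi L) h := by
    refine ⟨(Real.contDiff_exp.comp (by fun_prop)).mul hχs, hχc.mul_left, ?_⟩
    refine (tsupport_mul_subset_right (f := fun s => Real.exp (-α * s))).trans (hχt.trans ?_)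
    intro s hs
    have := hs.1
    simp only [mem_Ioi]; linarith
  have hhd : ∀ s, deriv h s = Real.exp (-α * s) * (deriv χ s - α * χ s) := fun s => by
    have h1 : HasDerivAt (fun s => Real.exp (-α * s)) (Real.exp (-α * s) * (-α)) s := by
      have := ((hasDerivAt_id s).const_mul (-α)).exp
      simpa using this
    have h2 : HasDerivAt h _ s := h1.mul (hχs.differentiable (by simp) s).hasDerivAt
    rw [h2.deriv]; ring
  have hT : IsTest (Ioi ρ) (logTest h) := by
    refine (isTest_logTest hht).mono (Ioi_subset_Ioi ?_)
    rw [hL, Real.exp_log (by linarith)]; linarith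
  have hN' : (N - 1 : ℕ) = (2 * α + 1 : ℝ) := by
    rw [Nat.cast_sub (by omega), hα]; push_cast; ring
  have p1 : ∀ s, Real.exp s ^ (N - 1) = Real.exp ((2 * α + 1) * s) := fun s => by
    rw [← Real.exp_nat_mul, hN']
  have e1 : ∫ r in Ioi ρ, r ^ (N - 1) * (logTest h r ^ 2 / r ^ 2) = k * B := by
    rw [← hχ2, ← setIntegral_eq_of_subset_of_forall_sdiff_eq_zero measurableSet_Ioi
      (Ioi_subset_Ioi hρ) (fun r hr => ?_), integral_Ioi_exp]
    · refine integral_congr_ae (ae_of_all _ fun s => ?_)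
      simp only [logTest_exp, p1, hh]
      rw [mul_pow, ← Real.exp_nat_mul, ← Real.exp_nat_mul]
      have : Real.exp s * (Real.exp ((2 * α + 1) * s) * (Real.exp ((2:ℕ) * (-α * s)) * χ s ^ 2 /
          Real.exp ((2:ℕ) * s))) = Real.exp (s + (2 * α + 1) * s + (2:ℕ) * (-α * s) - (2:ℕ) * s) *
          χ s ^ 2 := by
        rw [Real.exp_sub, Real.exp_add, Real.exp_add]; ring
      rw [this]
      have : s + (2 * α + 1) * s + (2:ℕ) * (-α * s) - (2:ℕ) * s = 0 := by push_cast; ring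
      rw [this, Real.exp_zero, one_mul]
    · rw [image_eq_zero_of_notMem_tsupport (f := logTest h) fun h' => hr.2 (hT.supp h')]; simp
  have e2 : ∫ r in Ioi ρ, r ^ (N - 1) * deriv (logTest h) r ^ 2 = A / k + α ^ 2 * (k * B) := by
    rw [← hχ2, ← hχ'2, ← integral_sq_deriv_sub hχs hχc,
      ← setIntegral_eq_of_subset_of_forall_sdiff_eq_zero measurableSet_Ioi
      (Ioi_subset_Ioi hρ) (fun r hr => ?_), integral_Ioi_exp]
    · refine integral_congr_ae (ae_of_all _ fun s => ?_)
      simp only [deriv_logTest_exp hht.differentiable, p1, hhd]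
      rw [mul_pow, mul_pow, ← Real.exp_nat_mul, ← Real.exp_nat_mul]
      have : Real.exp s * (Real.exp ((2 * α + 1) * s) * (Real.exp ((2:ℕ) * (-α * s)) *
          (deriv χ s - α * χ s) ^ 2 * Real.exp ((2:ℕ) * -s))) =
          Real.exp (s + (2 * α + 1) * s + (2:ℕ) * (-α * s) + (2:ℕ) * -s) *
          (deriv χ s - α * χ s) ^ 2 := by
        rw [Real.exp_add, Real.exp_add, Real.exp_add]; ring
      rw [this]
      have : s + (2 * α + 1) * s + (2:ℕ) * (-α * s) + (2:ℕ) * -s = 0 := by push_cast; ring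
      rw [this, Real.exp_zero, one_mul]
    · rw [image_eq_zero_of_notMem_tsupport (f := deriv (logTest h))
        fun h' => hr.2 (hT.supp (tsupport_deriv_subset h'))]; simp
  refine ⟨logTest h, hT, ?_, ?_⟩
  · rw [e1]; positivity
  · rw [e1, e2]
    have : hardyConst N = α ^ 2 := by rw [hardyConst, hα]; ring
    rw [this]; linarith

end Hardy


/-! ### Picone's inequality on the sphere -/

section SpherePicone

variable {N : ℕ} [Fact (2 ≤ N)]

set_option linter.unusedSectionVars false

variable {Ω : Set (Sph N)} {ρ : ℝ} {u : EuclideanSpace ℝ (Fin N) → ℝ}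
  {G : EuclideanSpace ℝ (Fin N) → EuclideanSpace ℝ (Fin N)} {v : ℝ → ℝ} {φ : Sph N → ℝ}
  {A : Sph N → EuclideanSpace ℝ (Fin N)}

/-- `u(rθ) = v(r) φ(θ)`, with positive factors, is a super-solution in the cone over the domain `Ω`,
`G` is the weak gradient of `u`, and `|x|⁻¹ A(x/|x|)` is that of `φ(x/|x|)`; that is, `A` is the
gradient of `φ` on the sphere. -/
structure IsSeparatedSuper (Ω : Set (Sph N)) (ρ : ℝ) (u : EuclideanSpace ℝ (Fin N) → ℝ)
    (G : EuclideanSpace ℝ (Fin N) → EuclideanSpace ℝ (Fin N)) (v : ℝ → ℝ) (φ : Sph N → ℝ)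
    (A : Sph N → EuclideanSpace ℝ (Fin N)) : Prop extends IsSeparated Ω ρ u G v φ where
  isOpen : IsOpen Ω
  isConnected : IsConnected Ω
  nonneg : 0 ≤ ρ
  mem : MemH1Loc (cone Ω ρ) u G
  super : ∀ (ζ : EuclideanSpace ℝ (Fin N) → ℝ)
    (Z : EuclideanSpace ℝ (Fin N) → EuclideanSpace ℝ (Fin N)), IsSobolevTest (cone Ω ρ) ζ Z →
      (∀ᵐ x ∂(volume.restrict (cone Ω ρ)), 0 ≤ ζ x) →
      0 ≤ ∫ x in cone Ω ρ, (1:ℝ) * (⟪G x, Z x⟫ -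
        (hardyConst N + dirichletEigenvalue Ω) / ‖x‖ ^ 2 * u x * ζ x)
  pos : ∀ᵐ x ∂(volume.restrict (cone Ω ρ)), 0 < u x
  integrableOn_grad : ∀ L, IsCompact L → L ⊆ Ω → IntegrableOn A L (surf N)
  angular : IsWeakPair (cone Ω ρ) (fun x => φ (dir x)) (fun x => ‖x‖⁻¹ • A (dir x))

lemma ae_of_ae_polMeasure_snd {p : Sph N → Prop} (h : ∀ᵐ q ∂(polMeasure Ω ρ), p q.2) :
    ∀ᵐ θ ∂((surf N).restrict Ω), p θ := by
  unfold polMeasure at h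
  have h1 := Measure.ae_ae_of_ae_prod h
  have hne : (ae ((volume : Measure ℝ).restrict (Ioi ρ))).NeBot := by
    rw [ae_neBot, Ne, Measure.restrict_eq_zero, Real.volume_Ioi]; simp
  obtain ⟨r, hr⟩ := h1.exists
  exact hr

lemma aestronglyMeasurable_of_integrableOn_compact {F : Type*} [NormedAddCommGroup F]
    (hΩ : IsOpen Ω) {f : Sph N → F} (hf : ∀ L, IsCompact L → L ⊆ Ω → IntegrableOn f L (surf N)) :
    AEStronglyMeasurable f ((surf N).restrict Ω) := by
  have : LocallyIntegrableOn f Ω (surf N) := by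
    rw [locallyIntegrableOn_iff hΩ.isLocallyClosed]
    exact fun K hK hKc => hf K hKc hK
  exact this.aestronglyMeasurable

lemma dirichletEigenvalue_nonneg (Ω : Set (Sph N)) : 0 ≤ dirichletEigenvalue Ω := by
  refine Real.sInf_nonneg ?_
  rintro _ ⟨Ψ, -, -, rfl⟩
  exact div_nonneg (integral_nonneg fun _ => by positivity) (integral_nonneg fun _ => by positivity)

/-- The tangential component of a vector bounds its norm from below. -/
lemma sq_norm_picone_ge {a b : EuclideanSpace ℝ (Fin N)} {θ : Sph N}
    (hb : ⟪b, (θ : EuclideanSpace ℝ (Fin N))⟫ = 0) (t s : ℝ)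
    (ha : a = t • (θ : EuclideanSpace ℝ (Fin N)) + s • b) : s ^ 2 * ‖b‖ ^ 2 ≤ ‖a‖ ^ 2 := by
  rw [ha, norm_add_sq_real, inner_smul_left, inner_smul_right, real_inner_comm, hb, norm_smul,
    norm_smul, mul_pow, mul_pow]
  simp only [mul_zero, add_zero, Real.norm_eq_abs, sq_abs]
  have : 0 ≤ t ^ 2 * ‖(θ : EuclideanSpace ℝ (Fin N))‖ ^ 2 := by positivity
  linarith

lemma integrable_sq_test {η : ℝ → ℝ} (hη : IsTest (Ioi ρ) η) (hρ : 0 ≤ ρ) :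
    IntegrableOn (fun r => r ^ (N - 1) * deriv η r ^ 2) (Ioi ρ) ∧
    IntegrableOn (fun r => r ^ (N - 1) * (η r ^ 2 / r ^ 2)) (Ioi ρ) := by
  have key : ∀ f : ℝ → ℝ, ContinuousOn f (tsupport η) → (∀ r, r ∉ tsupport η → f r = 0) →
      IntegrableOn f (Ioi ρ) := fun f hf h0 => by
    have h1 : IntegrableOn f (tsupport η) := hf.integrableOn_compact hη.compact
    exact ((integrableOn_iff_integrable_of_support_subset
      fun r hr => by_contra fun h => hr (h0 r h)).1 h1).integrableOn
  have hd : Continuous (deriv η) := hη.smooth.continuous_deriv (by simp)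
  refine ⟨key _ (by fun_prop) fun r hr => ?_, key _ ?_ fun r hr => ?_⟩
  · rw [image_eq_zero_of_notMem_tsupport (f := deriv η) fun h => hr (tsupport_deriv_subset h)]; simp
  · refine (continuous_pow _).continuousOn.mul ((hη.smooth.continuous.pow 2).continuousOn.div
      (continuous_pow 2).continuousOn fun r hr => ?_)
    exact pow_ne_zero _ (hρ.trans_lt (hη.supp hr)).ne'
  · rw [image_eq_zero_of_notMem_tsupport hr]; simp

namespace IsSeparatedSuper

lemma inner_grad_self (h : IsSeparatedSuper Ω ρ u G v φ A) :
    ∀ᵐ θ ∂((surf N).restrict Ω), ⟪A θ, (θ : EuclideanSpace ℝ (Fin N))⟫ = 0 := by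
  have h1 := h.angular.inner_self_eq_zero h.isOpen h.nonneg
  rw [ae_cone_iff h.isOpen.measurableSet h.nonneg] at h1
  refine ae_of_ae_polMeasure_snd (ρ := ρ) ?_
  filter_upwards [h1, ae_polMeasure_mem h.isOpen.measurableSet ρ] with q hq hq'
  have h0 : 0 < q.1 := h.nonneg.trans_lt hq'.1
  rw [norm_pol _ h0.le, dir_pol h0, inner_smul_left, pol, inner_smul_right] at hq
  simpa [h0.ne'] using hq

lemma gradient_eq (h : IsSeparatedSuper Ω ρ u G v φ A) : ∀ᵐ q ∂(polMeasure Ω ρ),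
    G (pol q) = ⟪G (pol q), (q.2 : EuclideanSpace ℝ (Fin N))⟫ • (q.2 : EuclideanSpace ℝ (Fin N)) +
      (v q.1 / q.1) • A q.2 := by
  have h1 := h.toIsSeparated.tangential_gradient h.isOpen h.isConnected.nonempty h.nonneg
    h.integrableOn_grad h.angular
  rw [ae_cone_iff h.isOpen.measurableSet h.nonneg] at h1
  filter_upwards [h1, ae_polMeasure_mem h.isOpen.measurableSet ρ] with q hq hq'
  have h0 : 0 < q.1 := h.nonneg.trans_lt hq'.1
  rw [norm_pol _ h0.le, dir_pol h0] at hq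
  have e1 : ⟪G (pol q), pol q⟫ • pol q = q.1 ^ 2 •
      (⟪G (pol q), (q.2 : EuclideanSpace ℝ (Fin N))⟫ • (q.2 : EuclideanSpace ℝ (Fin N))) := by
    simp only [pol, inner_smul_right, smul_smul]
    congr 1; ring
  have e2 : (v q.1 * q.1) • A q.2 = q.1 ^ 2 • ((v q.1 / q.1) • A q.2) := by
    rw [smul_smul]; congr 1; field_simp
  rw [e1, e2, ← smul_sub] at hq
  have := smul_right_injective _ (pow_ne_zero 2 h0.ne') hq
  rw [← this, add_sub_cancel]

lemma φ_aesm (h : IsSeparatedSuper Ω ρ u G v φ A) :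
    AEStronglyMeasurable φ ((surf N).restrict Ω) :=
  aestronglyMeasurable_of_integrableOn_compact h.isOpen (h.integrableOn_φ h.isOpen h.nonneg)

lemma A_aesm (h : IsSeparatedSuper Ω ρ u G v φ A) :
    AEStronglyMeasurable A ((surf N).restrict Ω) :=
  aestronglyMeasurable_of_integrableOn_compact h.isOpen h.integrableOn_grad

/-- Picone's inequality on the sphere: the super-solution in the cone is tested with `w = η(r) Ψ(θ)`,
and `η` runs through a sequence that exhausts the Hardy inequality on the half-line. -/
theorem sphere_picone (h : IsSeparatedSuper Ω ρ u G v φ A)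
    {Ψ : EuclideanSpace ℝ (Fin N) → ℝ} (hΨ : IsSphereTest Ω Ψ) :
    ∫⁻ θ in Ω, ‖sphereGrad Ψ θ - (Ψ θ / φ θ) • A θ‖ₑ ^ 2 ∂(surf N) ≤
      ENNReal.ofReal ((∫ θ in Ω, ‖sphereGrad Ψ θ‖ ^ 2 ∂(surf N)) -
        dirichletEigenvalue Ω * ∫ θ in Ω, Ψ θ ^ 2 ∂(surf N)) := by
  have hN : 2 ≤ N := Fact.out
  have hΩm := h.isOpen.measurableSet
  have hρ := h.nonneg
  set lam := dirichletEigenvalue Ω with hlam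
  set S := ∫ θ in Ω, Ψ θ ^ 2 ∂(surf N) with hS
  set T := ∫ θ in Ω, ‖sphereGrad Ψ θ‖ ^ 2 ∂(surf N) with hT
  have hS0 : 0 ≤ S := integral_nonneg fun _ => sq_nonneg _
  have iS : Integrable (fun θ : Sph N => Ψ θ ^ 2) ((surf N).restrict Ω) :=
    (memLp_of_continuous hΨ.continuous 2 Ω).integrable_sq
  have iT : Integrable (fun θ : Sph N => ‖sphereGrad Ψ θ‖ ^ 2) ((surf N).restrict Ω) :=
    (memLp_of_continuous (continuous_sphereGrad hΨ.1) 2 Ω).norm.integrable_sq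
  have hFm : AEMeasurable (fun θ : Sph N => ‖sphereGrad Ψ θ - (Ψ θ / φ θ) • A θ‖ₑ ^ 2)
      ((surf N).restrict Ω) := by
    have h1 : AEStronglyMeasurable (fun θ : Sph N => Ψ θ / φ θ) ((surf N).restrict Ω) :=
      (hΨ.continuous.measurable.aemeasurable.div h.φ_aesm.aemeasurable).aestronglyMeasurable
    exact (((continuous_sphereGrad hΨ.1).aestronglyMeasurable.sub
      (h1.smul h.A_aesm)).enorm.pow_const 2)
  have main : ∀ ε > 0, ∫⁻ θ in Ω, ‖sphereGrad Ψ θ - (Ψ θ / φ θ) • A θ‖ₑ ^ 2 ∂(surf N) ≤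
      ENNReal.ofReal (T - lam * S + ε * S) := by
    intro ε hε
    obtain ⟨η, hη, ha, hHardy⟩ := exists_hardy_test hN hρ hε
    set a := ∫ r in Ioi ρ, r ^ (N - 1) * (η r ^ 2 / r ^ 2) with hadef
    obtain ⟨j1, j2⟩ := integrable_sq_test (N := N) hη hρ
    have hw := isTest_prodTest hρ hη hΨ
    have hP := picone (isOpen_cone h.isOpen hρ)
      (V := fun x => (hardyConst N + lam) / ‖x‖ ^ 2)
      (continuousOn_const.div (by fun_prop) fun x hx =>
        pow_ne_zero 2 (norm_ne_zero_iff.2 (ne_zero_of_mem_cone hρ hx)))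
      (fun x _ => div_nonneg (add_nonneg (by unfold hardyConst; positivity)
        (dirichletEigenvalue_nonneg Ω)) (by positivity)) h.mem h.super h.pos hw
    -- the right-hand side separates into radial and angular integrals; the Hardy constant cancels
    have hR : ∫ x in cone Ω ρ, (‖gradient (prodTest η Ψ) x‖ ^ 2 -
        (hardyConst N + lam) / ‖x‖ ^ 2 * prodTest η Ψ x ^ 2) ≤ a * (T - lam * S + ε * S) := by
      rw [integral_cone hΩm hρ]
      have e1 : ∀ᵐ q ∂(polMeasure Ω ρ), q.1 ^ (N - 1) • (‖gradient (prodTest η Ψ) (pol q)‖ ^ 2 -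
          (hardyConst N + lam) / ‖pol q‖ ^ 2 * prodTest η Ψ (pol q) ^ 2) =
          (q.1 ^ (N - 1) * deriv η q.1 ^ 2) * Ψ q.2 ^ 2 +
          ((q.1 ^ (N - 1) * (η q.1 ^ 2 / q.1 ^ 2)) * ‖sphereGrad Ψ q.2‖ ^ 2 -
          (hardyConst N + lam) * ((q.1 ^ (N - 1) * (η q.1 ^ 2 / q.1 ^ 2)) * Ψ q.2 ^ 2)) := by
        filter_upwards [ae_polMeasure_mem hΩm ρ] with q hq
        have h0 : 0 < q.1 := hρ.trans_lt hq.1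
        rw [gradient_prodTest hΨ.1 h0 (hη.differentiable _), prodTest_pol h0, norm_pol _ h0.le,
          norm_add_sq_real, inner_smul_left, inner_smul_right, real_inner_comm,
          inner_sphereGrad_self, norm_smul, norm_smul, norm_sph, mul_pow, mul_pow]
        simp only [mul_zero, add_zero, Real.norm_eq_abs, sq_abs, smul_eq_mul]
        ring
      have k1 := j1.mul_prod iS
      have k2 := j2.mul_prod iT
      have k3 := (j2.mul_prod iS).const_mul (hardyConst N + lam)
      have k23 := Integrable.sub k2 k3
      simp only [Pi.sub_def] at k23
      rw [integral_congr_ae e1]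
      unfold polMeasure
      rw [integral_add k1 k23, integral_sub k2 k3, integral_const_mul,
        integral_prod_mul (fun r => r ^ (N - 1) * deriv η r ^ 2) (fun θ : Sph N => Ψ θ ^ 2),
        integral_prod_mul (fun r => r ^ (N - 1) * (η r ^ 2 / r ^ 2))
          (fun θ : Sph N => ‖sphereGrad Ψ θ‖ ^ 2),
        integral_prod_mul (fun r => r ^ (N - 1) * (η r ^ 2 / r ^ 2)) (fun θ : Sph N => Ψ θ ^ 2),
        ← hS, ← hT, ← hadef]
      nlinarith [mul_le_mul_of_nonneg_right hHardy hS0]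
    -- on the left-hand side only the tangential component is kept
    have hL : ENNReal.ofReal a * ∫⁻ θ in Ω, ‖sphereGrad Ψ θ - (Ψ θ / φ θ) • A θ‖ₑ ^ 2 ∂(surf N) ≤
        ∫⁻ x in cone Ω ρ, ‖gradient (prodTest η Ψ) x - (prodTest η Ψ x / u x) • G x‖ₑ ^ 2 := by
      have hm : AEMeasurable (fun x => ‖gradient (prodTest η Ψ) x -
          (prodTest η Ψ x / u x) • G x‖ₑ ^ 2) (volume.restrict (cone Ω ρ)) := by
        have hu := h.weak.locU.aestronglyMeasurable
        have hG := h.weak.locG.aestronglyMeasurable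
        have h1 : AEStronglyMeasurable (fun x => prodTest η Ψ x / u x)
            (volume.restrict (cone Ω ρ)) :=
          (hw.smooth.continuous.measurable.aemeasurable.div hu.aemeasurable).aestronglyMeasurable
        exact ((hw.gradient_cont.aestronglyMeasurable.sub (h1.smul hG)).enorm.pow_const 2)
      have j0 : ∀ r ∈ Ioi ρ, 0 ≤ r ^ (N - 1) * (η r ^ 2 / r ^ 2) := fun r hr => by
        have : 0 < r := hρ.trans_lt hr
        positivity
      rw [lintegral_cone hΩm hρ hm, hadef, ofReal_integral_eq_lintegral_ofReal j2
        ((ae_restrict_iff' measurableSet_Ioi).2 (ae_of_all _ j0)),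
        ← lintegral_prod_mul j2.1.aemeasurable.ennreal_ofReal hFm]
      refine lintegral_mono_ae ?_
      have hA := (Measure.quasiMeasurePreserving_snd (μ := (volume : Measure ℝ).restrict (Ioi ρ))
        (ν := (surf N).restrict Ω)).ae h.inner_grad_self
      have hv := (Measure.quasiMeasurePreserving_fst (μ := (volume : Measure ℝ).restrict (Ioi ρ))
        (ν := (surf N).restrict Ω)).ae h.vpos
      filter_upwards [ae_polMeasure_mem hΩm ρ, h.gradient_eq, hA, hv] with q hq hGq hAq hvq
      have h0 : 0 < q.1 := hρ.trans_lt hq.1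
      have hu : u (pol q) = v q.1 * φ q.2 := h.eq q.1 hq.1 q.2 hq.2
      have hle : (η q.1 / q.1) ^ 2 * ‖sphereGrad Ψ q.2 - (Ψ q.2 / φ q.2) • A q.2‖ ^ 2 ≤
          ‖gradient (prodTest η Ψ) (pol q) - (prodTest η Ψ (pol q) / u (pol q)) • G (pol q)‖ ^ 2 := by
        refine sq_norm_picone_ge (θ := q.2) ?_ (deriv η q.1 * Ψ q.2 -
          prodTest η Ψ (pol q) / u (pol q) * ⟪G (pol q), (q.2 : EuclideanSpace ℝ (Fin N))⟫) _ ?_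
        · rw [inner_sub_left, inner_smul_left, inner_sphereGrad_self, hAq]; simp
        · conv_lhs => rw [hGq]
          rw [gradient_prodTest hΨ.1 h0 (hη.differentiable _), prodTest_pol h0, hu, smul_add,
            smul_smul, smul_smul, sub_smul, smul_sub, smul_smul]
          have : η q.1 * Ψ q.2 / (v q.1 * φ q.2) * (v q.1 / q.1) =
            η q.1 / q.1 * (Ψ q.2 / φ q.2) := by field_simp
          rw [this]
          abel
      rw [← ofReal_norm, ← ofReal_norm, ← ENNReal.ofReal_pow (norm_nonneg _),
        ← ENNReal.ofReal_pow (norm_nonneg _), ← ENNReal.ofReal_mul (j0 _ hq.1),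
        ← ENNReal.ofReal_mul (by positivity)]
      refine ENNReal.ofReal_le_ofReal ?_
      rw [mul_assoc, ← div_pow]
      exact mul_le_mul_of_nonneg_left hle (by positivity)
    have hfin := hL.trans (hP.trans (ENNReal.ofReal_le_ofReal hR))
    rw [ENNReal.ofReal_mul ha.le] at hfin
    exact (ENNReal.mul_le_mul_iff_right (by simpa using ha) ENNReal.ofReal_ne_top).1 hfin
  have hlim : Tendsto (fun ε : ℝ => ENNReal.ofReal (T - lam * S + ε * S)) (𝓝[>] 0)
      (𝓝 (ENNReal.ofReal (T - lam * S))) := by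
    refine (ENNReal.continuous_ofReal.tendsto _).comp ?_
    have : Tendsto (fun ε : ℝ => T - lam * S + ε * S) (𝓝 0) (𝓝 (T - lam * S + 0 * S)) :=
      (by fun_prop : Continuous fun ε : ℝ => T - lam * S + ε * S).tendsto 0
    rw [zero_mul, add_zero] at this
    exact this.mono_left nhdsWithin_le_nhds
  exact ge_of_tendsto hlim (eventually_mem_nhdsWithin.mono fun ε hε => main ε hε)

end IsSeparatedSuper

end SpherePicone


/-! ### Rellich's theorem -/

section Rellich

open scoped Convolution
open ContinuousLinearMap (lsmul)

variable {E : Type*} [NormedAddCommGroup E] [InnerProductSpace ℝ E] [CompleteSpace E]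
  [FiniteDimensional ℝ E] [MeasureSpace E] [BorelSpace E] [(volume : Measure E).IsAddHaarMeasure]

set_option linter.unusedSectionVars false

lemma eLpNorm_two_eq {α F : Type*} {mα : MeasurableSpace α} {μ : Measure α} [NormedAddCommGroup F]
    (f : α → F) : eLpNorm f 2 μ ^ 2 = ∫⁻ x, ‖f x‖ₑ ^ 2 ∂μ := by
  have h := eLpNorm_nnreal_pow_eq_lintegral (f := f) (μ := μ) (p := 2) (by norm_num)
  simpa using h

/-- The `L²` modulus of continuity is controlled by the gradient. -/
lemma eLpNorm_translate_sub_le {f : E → ℝ} (hf : IsTest univ f) (t : E) :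
    eLpNorm (fun x => f (x - t) - f x) 2 volume ≤ ‖t‖ₑ * eLpNorm (gradient f) 2 volume := by
  rw [← ENNReal.pow_le_pow_left_iff (n := 2) (by norm_num), mul_pow, eLpNorm_two_eq, eLpNorm_two_eq]
  have hν : IsProbabilityMeasure ((volume : Measure ℝ).restrict (Ioc 0 1)) := ⟨by simp⟩
  have hc : Continuous fun q : E × ℝ => gradient f (q.1 - q.2 • t) :=
    hf.gradient_cont.comp (by fun_prop)
  have hpt : ∀ x, ‖f (x - t) - f x‖ₑ ^ 2 ≤
      ‖t‖ₑ ^ 2 * ∫⁻ s in Ioc (0:ℝ) 1, ‖gradient f (x - s • t)‖ₑ ^ 2 := by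
    intro x
    have hd : ∀ s : ℝ, HasDerivAt (fun s : ℝ => f (x - s • t)) (-⟪gradient f (x - s • t), t⟫) s := by
      intro s
      have h1 : HasDerivAt (fun s : ℝ => x - s • t) (-((1:ℝ) • t)) s :=
        ((hasDerivAt_id s).smul_const t).const_sub x
      have h2 := (hf.differentiable (x - s • t)).hasFDerivAt.comp_hasDerivAt s h1
      rw [inner_gradient_left]
      have h3 : fderiv ℝ f (x - s • t) (-((1:ℝ) • t)) = -fderiv ℝ f (x - s • t) t := by simp
      rw [h3] at h2
      exact h2
    have hcx : Continuous fun s : ℝ => gradient f (x - s • t) := hf.gradient_cont.comp (by fun_prop)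
    have e1 := intervalIntegral.integral_eq_sub_of_hasDerivAt (a := 0) (b := 1) (fun s _ => hd s)
      ((by fun_prop : Continuous fun s : ℝ => -⟪gradient f (x - s • t), t⟫).intervalIntegrable 0 1)
    rw [one_smul, zero_smul, sub_zero] at e1
    have e2 : ‖f (x - t) - f x‖ₑ ≤ ‖t‖ₑ * eLpNorm (fun s => gradient f (x - s • t)) 2
        ((volume : Measure ℝ).restrict (Ioc 0 1)) := by
      rw [← e1, intervalIntegral.integral_of_le zero_le_one]
      calc _ ≤ ∫⁻ s in Ioc (0:ℝ) 1, ‖-⟪gradient f (x - s • t), t⟫‖ₑ :=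
            enorm_integral_le_lintegral_enorm _
        _ ≤ ∫⁻ s in Ioc (0:ℝ) 1, ‖t‖ₑ * ‖gradient f (x - s • t)‖ₑ := by
            refine lintegral_mono fun s => ?_
            rw [enorm_neg, mul_comm]
            rw [← ofReal_norm, ← ofReal_norm, ← ofReal_norm, ← ENNReal.ofReal_mul (norm_nonneg _)]
            exact ENNReal.ofReal_le_ofReal (norm_inner_le_norm _ _)
        _ = ‖t‖ₑ * eLpNorm (fun s => gradient f (x - s • t)) 1
              ((volume : Measure ℝ).restrict (Ioc 0 1)) := by
            rw [lintegral_const_mul' _ _ enorm_ne_top, eLpNorm_one_eq_lintegral_enorm]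
        _ ≤ _ := by
            gcongr
            exact eLpNorm_le_eLpNorm_of_exponent_le one_le_two hcx.aestronglyMeasurable
    calc _ ≤ _ := pow_le_pow_left' e2 2
      _ = _ := by rw [mul_pow, eLpNorm_two_eq]
  calc ∫⁻ x, ‖f (x - t) - f x‖ₑ ^ 2
      ≤ ∫⁻ x, ‖t‖ₑ ^ 2 * ∫⁻ s in Ioc (0:ℝ) 1, ‖gradient f (x - s • t)‖ₑ ^ 2 := lintegral_mono hpt
    _ = ‖t‖ₑ ^ 2 * ∫⁻ x, ∫⁻ s in Ioc (0:ℝ) 1, ‖gradient f (x - s • t)‖ₑ ^ 2 :=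
        lintegral_const_mul' _ _ (by simp)
    _ = ‖t‖ₑ ^ 2 * ∫⁻ s in Ioc (0:ℝ) 1, ∫⁻ x, ‖gradient f (x - s • t)‖ₑ ^ 2 := by
        rw [lintegral_lintegral_swap]
        exact (hc.enorm.measurable.pow_const 2).aemeasurable
    _ = ‖t‖ₑ ^ 2 * ∫⁻ _s in Ioc (0:ℝ) 1, ∫⁻ x, ‖gradient f x‖ₑ ^ 2 := by
        congr 1
        refine lintegral_congr fun s => ?_
        exact lintegral_sub_right_eq_self (fun x => ‖gradient f x‖ₑ ^ 2) (s • t)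
    _ = _ := by simp

/-- A bounded sequence in `L²(E)` has a subsequence that converges weakly. -/
lemma exists_weak_subseq {f : ℕ → E → ℝ} (hf : ∀ n, MemLp (f n) 2 (volume : Measure E)) {C : ℝ}
    (hC : ∀ n, eLpNorm (f n) 2 volume ≤ ENNReal.ofReal C) :
    ∃ σ : ℕ → ℕ, StrictMono σ ∧ ∀ g : E → ℝ, MemLp g 2 (volume : Measure E) →
      ∃ l : ℝ, Tendsto (fun n => ∫ x, f (σ n) x * g x) atTop (𝓝 l) := by
  have : Fact ((2 : ℝ≥0∞) ≠ ⊤) := ⟨by simp⟩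
  let T : ℕ → WeakDual ℝ (Lp ℝ 2 (volume : Measure E)) := fun n =>
    StrongDual.toWeakDual (InnerProductSpace.toDual ℝ _ ((hf n).toLp (f n)))
  have hT : ∀ n, T n ∈ WeakDual.toStrongDual ⁻¹' Metric.closedBall
      (0 : StrongDual ℝ (Lp ℝ 2 (volume : Measure E))) (max C 0) := by
    intro n
    rw [mem_preimage, mem_closedBall_zero_iff]
    change ‖InnerProductSpace.toDual ℝ _ ((hf n).toLp (f n))‖ ≤ _
    rw [LinearIsometryEquiv.norm_map, Lp.norm_toLp]
    refine ENNReal.toReal_le_of_le_ofReal (le_max_right _ _) ((hC n).trans ?_)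
    exact ENNReal.ofReal_le_ofReal (le_max_left _ _)
  obtain ⟨a, -, σ, hσ, ha⟩ := WeakDual.isSeqCompact_closedBall ℝ _ _ _ hT
  refine ⟨σ, hσ, fun g hg => ⟨a (hg.toLp g), ?_⟩⟩
  have h1 := ((WeakBilin.eval_continuous _ (hg.toLp g)).tendsto a).comp ha
  refine h1.congr fun n => ?_
  change ⟪(hf (σ n)).toLp (f (σ n)), hg.toLp g⟫ = _
  rw [L2.inner_def]
  refine integral_congr_ae ?_
  filter_upwards [(hf (σ n)).coeFn_toLp, hg.coeFn_toLp] with x h2 h3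
  rw [h2, h3]
  simp [mul_comm]

lemma enorm_integral_mul_le {f g : E → ℝ} (hf : MemLp f 2 (volume : Measure E))
    (hg : MemLp g 2 (volume : Measure E)) :
    ‖∫ y, f y * g y‖ₑ ≤ eLpNorm f 2 volume * eLpNorm g 2 volume := by
  calc _ ≤ ∫⁻ y, ‖f y * g y‖ₑ := enorm_integral_le_lintegral_enorm _
    _ = eLpNorm (fun y => f y * g y) 1 volume := eLpNorm_one_eq_lintegral_enorm.symm
    _ ≤ _ := eLpNorm_smul_le_mul_eLpNorm (𝕜 := ℝ) (p := 2) (q := 2) (r := 1) hg.1 hf.1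

/-- The convolutions of a weakly convergent sequence with a fixed kernel converge strongly. -/
lemma tendsto_convolution_of_weak {f : ℕ → E → ℝ} (hfL : ∀ n, MemLp (f n) 2 (volume : Measure E))
    {R C : ℝ} (hR : ∀ n, tsupport (f n) ⊆ Metric.closedBall 0 R)
    (hC : ∀ n, eLpNorm (f n) 2 volume ≤ ENNReal.ofReal C)
    (hw : ∀ g : E → ℝ, MemLp g 2 (volume : Measure E) →
      ∃ l : ℝ, Tendsto (fun n => ∫ x, f n x * g x) atTop (𝓝 l))
    {k : E → ℝ} (hkc : Continuous k) (hks : Function.support k ⊆ Metric.closedBall 0 1) :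
    ∃ l : E → ℝ, AEStronglyMeasurable l (volume : Measure E) ∧
      Tendsto (fun n => ∫⁻ x, ‖(k ⋆[lsmul ℝ ℝ, volume] f n) x - l x‖ₑ ^ 2) atTop (𝓝 0) := by
  have hkC : HasCompactSupport k := HasCompactSupport.intro (isCompact_closedBall 0 1)
    fun x hx => by_contra fun h => hx (hks h)
  have hkL : MemLp k 2 (volume : Measure E) := hkc.memLp_of_hasCompactSupport hkC
  set g : ℕ → E → ℝ := fun n => (k ⋆[lsmul ℝ ℝ, volume] f n) with hg
  have hgx : ∀ n x, g n x = ∫ y, f n y * k (x - y) := fun n x => by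
    rw [hg]
    simp only
    rw [convolution_lsmul_swap]
    exact integral_congr_ae (ae_of_all _ fun y => mul_comm _ _)
  have hmp : ∀ x : E, MeasurePreserving (fun y => x - y) (volume : Measure E) volume :=
    fun x => Measure.measurePreserving_sub_left volume x
  have hkx : ∀ x, MemLp (fun y => k (x - y)) 2 (volume : Measure E) := fun x =>
    hkL.comp_measurePreserving (hmp x)
  have hkn : ∀ x, eLpNorm (fun y => k (x - y)) 2 volume = eLpNorm k 2 (volume : Measure E) :=
    fun x => eLpNorm_comp_measurePreserving (g := k) hkL.1 (hmp x)
  choose l hl using fun x => hw _ (hkx x)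
  have hgl : ∀ x, Tendsto (fun n => g n x) atTop (𝓝 (l x)) := fun x => by
    simpa only [hgx] using hl x
  have hgc : ∀ n, Continuous (g n) := fun n =>
    hkC.continuous_convolution_left _ hkc ((hfL n).locallyIntegrable one_le_two)
  have hgz : ∀ n, ∀ x ∉ Metric.closedBall (0:E) (R + 1), g n x = 0 := by
    intro n x hx
    rw [hgx]
    refine integral_eq_zero_of_ae (ae_of_all _ fun y => ?_)
    by_contra h0
    have h1 : y ∈ Metric.closedBall (0:E) R := hR _ (subset_tsupport _ (left_ne_zero_of_mul h0))
    have h2 : x - y ∈ Metric.closedBall (0:E) 1 := hks (right_ne_zero_of_mul h0)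
    rw [mem_closedBall_zero_iff] at h1 h2 hx
    have : ‖x‖ ≤ ‖x - y‖ + ‖y‖ := by simpa using norm_add_le (x - y) y
    linarith
  set D : ℝ≥0∞ := ENNReal.ofReal C * eLpNorm k 2 volume with hD
  have hDt : D ≠ ⊤ := ENNReal.mul_ne_top ENNReal.ofReal_ne_top hkL.2.ne
  have hgb : ∀ n x, ‖g n x‖ₑ ≤ D := by
    intro n x
    rw [hgx, hD, ← hkn x]
    exact (enorm_integral_mul_le (hfL n) (hkx x)).trans (mul_le_mul' (hC n) le_rfl)
  have hlm : Measurable l := measurable_of_tendsto_metrizable (fun n => (hgc n).measurable)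
    (tendsto_pi_nhds.2 hgl)
  have hlb : ∀ x, ‖l x‖ₑ ≤ D := fun x =>
    le_of_tendsto (hgl x).enorm (Eventually.of_forall fun n => hgb n x)
  have hlz : ∀ x ∉ Metric.closedBall (0:E) (R + 1), l x = 0 := fun x hx =>
    tendsto_nhds_unique (hgl x) (by simp only [hgz _ x hx]; exact tendsto_const_nhds)
  refine ⟨l, hlm.aestronglyMeasurable, ?_⟩
  have := tendsto_lintegral_of_dominated_convergence (μ := (volume : Measure E))
    (F := fun n x => ‖g n x - l x‖ₑ ^ 2) (f := fun _ => 0)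
    ((Metric.closedBall (0:E) (R + 1)).indicator fun _ => (D + D) ^ 2)
    (fun n => ((hgc n).measurable.sub hlm).enorm.pow_const 2) (fun n => ae_of_all _ fun x => ?_)
    ?_ (ae_of_all _ fun x => ?_)
  · simpa using this
  · by_cases hx : x ∈ Metric.closedBall (0:E) (R + 1)
    · simp only [indicator_of_mem hx]
      exact pow_le_pow_left' ((enorm_sub_le).trans (add_le_add (hgb n x) (hlb x))) 2
    · simp [hgz n x hx, hlz x hx]
  · rw [lintegral_indicator Metric.isClosed_closedBall.measurableSet, setLIntegral_const]
    exact ENNReal.mul_ne_top (by simp [hDt]) measure_closedBall_lt_top.ne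
  · have h1 : Tendsto (fun n => ‖g n x - l x‖ₑ) atTop (𝓝 0) := by
      have := ((hgl x).sub_const (l x)).enorm
      simpa using this
    have h2 := ((ENNReal.continuous_pow 2).tendsto 0).comp h1
    rw [zero_pow two_ne_zero] at h2
    exact h2

/-- Rellich's theorem: test functions supported in a fixed ball and bounded in `H¹` have a
subsequence that is Cauchy in `L²`. -/
theorem rellich {f : ℕ → E → ℝ} (hf : ∀ n, IsTest univ (f n)) {R C : ℝ}
    (hR : ∀ n, tsupport (f n) ⊆ Metric.closedBall 0 R)
    (hC : ∀ n, eLpNorm (f n) 2 volume ≤ ENNReal.ofReal C)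
    (hC' : ∀ n, eLpNorm (gradient (f n)) 2 volume ≤ ENNReal.ofReal C) :
    ∃ σ : ℕ → ℕ, StrictMono σ ∧ ∀ ε : ℝ≥0∞, 0 < ε → ∃ M, ∀ n ≥ M, ∀ m ≥ M,
      eLpNorm (fun x => f (σ n) x - f (σ m) x) 2 volume ≤ ε := by
  have hfL : ∀ n, MemLp (f n) 2 (volume : Measure E) := fun n => (hf n).memLp 2 _
  obtain ⟨σ, hσ, hw⟩ := exists_weak_subseq hfL hC
  refine ⟨σ, hσ, fun ε hε => ?_⟩
  -- mollification at a scale where the mollified functions are uniformly close to the original ones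
  obtain ⟨δ, hδ, hδ1, hδε⟩ : ∃ δ : ℝ, 0 < δ ∧ δ ≤ 1 ∧
      ENNReal.ofReal δ * ENNReal.ofReal C ≤ ε / 4 := by
    have h1 : Tendsto (fun δ : ℝ => ENNReal.ofReal δ * ENNReal.ofReal C) (𝓝 0)
        (𝓝 (ENNReal.ofReal 0 * ENNReal.ofReal C)) :=
      ENNReal.Tendsto.mul_const ((ENNReal.continuous_ofReal).tendsto 0)
        (Or.inr ENNReal.ofReal_ne_top)
    rw [ENNReal.ofReal_zero, zero_mul] at h1
    have h2 : ∀ᶠ δ in 𝓝[>] (0:ℝ), ENNReal.ofReal δ * ENNReal.ofReal C ≤ ε / 4 :=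
      (h1.mono_left nhdsWithin_le_nhds).eventually
        (Iic_mem_nhds (ENNReal.div_pos hε.ne' (by simp)))
    have h3 : ∀ᶠ δ in 𝓝[>] (0:ℝ), δ ≤ 1 := nhdsWithin_le_nhds (Iic_mem_nhds one_pos)
    obtain ⟨δ, ha, hb, hc⟩ := (Eventually.and h2 (Eventually.and h3 eventually_mem_nhdsWithin)).exists
    exact ⟨δ, hc, hb, ha⟩
  let φ := bumpSeq E δ hδ 0
  have hφr : φ.rOut ≤ δ := bumpSeq_rOut_le δ hδ 0
  have hgf : ∀ n, eLpNorm ((φ.normed volume ⋆[lsmul ℝ ℝ, volume] f (σ n)) - f (σ n)) 2 volume ≤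
      ε / 4 := fun n => by
    have : Fact ((1:ℝ≥0∞) ≤ 2) := ⟨one_le_two⟩
    refine eLpNorm_convolution_sub_le φ (hf _).smooth.continuous.stronglyMeasurable (by simp)
      (hfL _) fun t ht => (eLpNorm_translate_sub_le (hf _) t).trans (le_trans ?_ hδε)
    refine mul_le_mul' ?_ (hC' _)
    rw [← ofReal_norm]
    refine ENNReal.ofReal_le_ofReal ?_
    rw [Metric.mem_ball, dist_zero_right] at ht
    exact ht.le.trans hφr
  obtain ⟨l, hlm, hlim⟩ := tendsto_convolution_of_weak (fun n => hfL (σ n)) (fun n => hR (σ n))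
    (fun n => hC (σ n)) hw (k := φ.normed volume) φ.continuous_normed (by
      rw [φ.support_normed_eq]
      exact Metric.ball_subset_closedBall.trans (Metric.closedBall_subset_closedBall (hφr.trans hδ1)))
  have hgm : ∀ n, AEStronglyMeasurable (φ.normed volume ⋆[lsmul ℝ ℝ, volume] f (σ n))
      (volume : Measure E) := fun n =>
    ((φ.hasCompactSupport_normed).continuous_convolution_left _ φ.continuous_normed
      ((hfL _).locallyIntegrable one_le_two)).aestronglyMeasurable
  generalize hg : (fun n => (φ.normed volume ⋆[lsmul ℝ ℝ, volume] f (σ n))) = g at *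
  have hg' : ∀ n, (φ.normed volume ⋆[lsmul ℝ ℝ, volume] f (σ n)) = g n := fun n => congrFun hg n
  simp only [hg'] at hgf hgm hlim
  have hpos : 0 < (ε / 4) ^ 2 := ENNReal.pow_pos (ENNReal.div_pos hε.ne' ENNReal.ofNat_ne_top) 2
  have hev := hlim.eventually (Iic_mem_nhds hpos)
  obtain ⟨M, hM⟩ := eventually_atTop.1 hev
  have hgM : ∀ n ≥ M, eLpNorm (g n - l) 2 volume ≤ ε / 4 := fun n hn => by
    rw [← ENNReal.pow_le_pow_left_iff (n := 2) (by norm_num), eLpNorm_two_eq]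
    exact hM n hn
  refine ⟨M, fun n hn m hm => ?_⟩
  have hfm := fun n => (hfL n).1
  have e1 : (fun x => f (σ n) x - f (σ m) x) =
      ((g n - l) - (g n - f (σ n))) - ((g m - l) - (g m - f (σ m))) := by
    ext x; simp only [Pi.sub_apply]; ring
  rw [e1]
  calc _ ≤ eLpNorm ((g n - l) - (g n - f (σ n))) 2 volume +
        eLpNorm ((g m - l) - (g m - f (σ m))) 2 volume :=
        eLpNorm_sub_le (((hgm n).sub hlm).sub ((hgm n).sub (hfm _)))
          (((hgm m).sub hlm).sub ((hgm m).sub (hfm _))) one_le_two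
    _ ≤ (ε / 4 + ε / 4) + (ε / 4 + ε / 4) := by
        refine add_le_add ?_ ?_
        · exact (eLpNorm_sub_le ((hgm n).sub hlm) ((hgm n).sub (hfm _)) one_le_two).trans
            (add_le_add (hgM n hn) (hgf n))
        · exact (eLpNorm_sub_le ((hgm m).sub hlm) ((hgm m).sub (hfm _)) one_le_two).trans
            (add_le_add (hgM m hm) (hgf m))
    _ = ε := by
        have : ε / 4 + ε / 4 + (ε / 4 + ε / 4) = 4 * (ε / 4) := by ring
        rw [this, ENNReal.mul_div_cancel (by simp) (by simp)]

end Rellich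


/-! ### The minimizer of the Rayleigh quotient -/

section Minimizer

variable {N : ℕ} [Fact (2 ≤ N)]

set_option linter.unusedSectionVars false

variable {Ω : Set (Sph N)} {Ψ Ψ' : EuclideanSpace ℝ (Fin N) → ℝ}

/-- The `L²` norm of `χ(|x|) Ψ(x/|x|)` over the whole space; `Ω` may be any open set that contains the
support of `Ψ` on the sphere. -/
lemma integral_prodTest_sq (hΩ : IsOpen Ω) {χ : ℝ → ℝ} (hχ : IsTest (Ioi 0) χ)
    (hΨ : IsSphereTest Ω Ψ) :
    ∫ x, prodTest χ Ψ x ^ 2 =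
      (∫ r in Ioi (0:ℝ), r ^ (N - 1) * χ r ^ 2) * ∫ θ in Ω, Ψ θ ^ 2 ∂(surf N) := by
  have hw := isTest_prodTest le_rfl hχ hΨ
  rw [← setIntegral_eq_integral_of_forall_compl_eq_zero (s := cone Ω 0) (fun x hx => by
    rw [image_eq_zero_of_notMem_tsupport fun h' => hx (hw.supp h')]; simp),
    integral_cone hΩ.measurableSet le_rfl,
    ← integral_prod_mul (fun r => r ^ (N - 1) * χ r ^ 2) (fun θ : Sph N => Ψ θ ^ 2)]
  refine integral_congr_ae ?_
  filter_upwards [ae_polMeasure_mem hΩ.measurableSet 0] with q hq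
  rw [prodTest_pol hq.1, smul_eq_mul]
  ring

lemma integral_gradient_prodTest_sq (hΩ : IsOpen Ω) {χ : ℝ → ℝ} (hχ : IsTest (Ioi 0) χ)
    (hΨ : IsSphereTest Ω Ψ) :
    ∫ x, ‖gradient (prodTest χ Ψ) x‖ ^ 2 =
      (∫ r in Ioi (0:ℝ), r ^ (N - 1) * deriv χ r ^ 2) * (∫ θ in Ω, Ψ θ ^ 2 ∂(surf N)) +
      (∫ r in Ioi (0:ℝ), r ^ (N - 1) * (χ r ^ 2 / r ^ 2)) *
        ∫ θ in Ω, ‖sphereGrad Ψ θ‖ ^ 2 ∂(surf N) := by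
  have hw := isTest_prodTest le_rfl hχ hΨ
  obtain ⟨j1, j2⟩ := integrable_sq_test (N := N) hχ le_rfl
  have iS : Integrable (fun θ : Sph N => Ψ θ ^ 2) ((surf N).restrict Ω) :=
    (memLp_of_continuous hΨ.continuous 2 Ω).integrable_sq
  have iT : Integrable (fun θ : Sph N => ‖sphereGrad Ψ θ‖ ^ 2) ((surf N).restrict Ω) :=
    (memLp_of_continuous (continuous_sphereGrad hΨ.1) 2 Ω).norm.integrable_sq
  rw [← setIntegral_eq_integral_of_forall_compl_eq_zero (s := cone Ω 0) (fun x hx => by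
    rw [IsTest.gradient_eq_zero fun h' => hx (hw.supp h')]; simp),
    integral_cone hΩ.measurableSet le_rfl,
    ← integral_prod_mul (fun r => r ^ (N - 1) * deriv χ r ^ 2) (fun θ : Sph N => Ψ θ ^ 2),
    ← integral_prod_mul (fun r => r ^ (N - 1) * (χ r ^ 2 / r ^ 2))
      (fun θ : Sph N => ‖sphereGrad Ψ θ‖ ^ 2),
    ← integral_add (j1.mul_prod iS) (j2.mul_prod iT)]
  refine integral_congr_ae ?_
  filter_upwards [ae_polMeasure_mem hΩ.measurableSet 0] with q hq
  have h0 : 0 < q.1 := hq.1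
  rw [gradient_prodTest hΨ.1 h0 (hχ.differentiable _),
    norm_add_sq_real, inner_smul_left, inner_smul_right, real_inner_comm,
    inner_sphereGrad_self, norm_smul, norm_smul, norm_sph, mul_pow, mul_pow]
  simp only [mul_zero, add_zero, Real.norm_eq_abs, sq_abs, smul_eq_mul]
  ring

lemma eLpNorm_sq_eq_ofReal {α F : Type*} {mα : MeasurableSpace α} {μ : Measure α}
    [NormedAddCommGroup F] {f : α → F} (hf : MemLp f 2 μ) :
    eLpNorm f 2 μ ^ 2 = ENNReal.ofReal (∫ x, ‖f x‖ ^ 2 ∂μ) := by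
  rw [eLpNorm_two_eq, ofReal_integral_eq_lintegral_ofReal hf.norm.integrable_sq
    (ae_of_all _ fun x => by positivity)]
  refine lintegral_congr fun x => ?_
  rw [ENNReal.ofReal_pow (norm_nonneg _), ofReal_norm]

/-- A test function, as an element of `L²(Ω)`. -/
noncomputable def IsSphereTest.toL2 (h : IsSphereTest Ω Ψ) : Lp ℝ 2 ((surf N).restrict Ω) :=
  (memLp_of_continuous h.continuous 2 Ω).toLp (fun θ : Sph N => Ψ θ)

/-- The gradient of a test function, as an element of `L²(Ω)`. -/
noncomputable def IsSphereTest.gradL2 (h : IsSphereTest Ω Ψ) :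
    Lp (EuclideanSpace ℝ (Fin N)) 2 ((surf N).restrict Ω) :=
  (memLp_of_continuous (continuous_sphereGrad h.1) 2 Ω).toLp (sphereGrad Ψ)

lemma norm_toLp_sq {α F : Type*} {mα : MeasurableSpace α} {μ : Measure α}
    [NormedAddCommGroup F] {f : α → F} (hf : MemLp f 2 μ) :
    ‖hf.toLp f‖ ^ 2 = ∫ x, ‖f x‖ ^ 2 ∂μ := by
  rw [Lp.norm_toLp, ← ENNReal.toReal_pow, eLpNorm_sq_eq_ofReal hf,
    ENNReal.toReal_ofReal (integral_nonneg fun x => by positivity)]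

namespace IsSphereTest

lemma norm_toL2_sq (h : IsSphereTest Ω Ψ) : ‖h.toL2‖ ^ 2 = ∫ θ in Ω, Ψ θ ^ 2 ∂(surf N) := by
  rw [toL2, norm_toLp_sq]; simp

lemma norm_gradL2_sq (h : IsSphereTest Ω Ψ) :
    ‖h.gradL2‖ ^ 2 = ∫ θ in Ω, ‖sphereGrad Ψ θ‖ ^ 2 ∂(surf N) := norm_toLp_sq _

lemma toL2_add_smul (h : IsSphereTest Ω Ψ) (h' : IsSphereTest Ω Ψ') (t : ℝ) :
    (h.add_smul h' t).toL2 = h.toL2 + t • h'.toL2 := by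
  rw [toL2, toL2, toL2, ← MemLp.toLp_const_smul, ← MemLp.toLp_add]; rfl

lemma gradL2_add_smul (h : IsSphereTest Ω Ψ) (h' : IsSphereTest Ω Ψ') (t : ℝ) :
    (h.add_smul h' t).gradL2 = h.gradL2 + t • h'.gradL2 := by
  rw [gradL2, gradL2, gradL2, ← MemLp.toLp_const_smul, ← MemLp.toLp_add, MemLp.toLp_eq_toLp_iff]
  exact ae_of_all _ fun θ => sphereGrad_add_smul h.1 h'.1 t θ

/-- The Rayleigh quotient is at least `λ₁`. -/
lemma rayleigh (h : IsSphereTest Ω Ψ) :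
    dirichletEigenvalue Ω * ‖h.toL2‖ ^ 2 ≤ ‖h.gradL2‖ ^ 2 := by
  rcases eq_or_ne ‖h.toL2‖ 0 with h0 | h0
  · rw [h0]; simp
  · have hpos : 0 < ‖h.toL2‖ ^ 2 := by positivity
    rw [← le_div_iff₀ hpos]
    refine csInf_le ⟨0, ?_⟩ ⟨Ψ, h, ?_, by rw [norm_gradL2_sq, norm_toL2_sq]⟩
    · rintro _ ⟨Ψ, -, -, rfl⟩
      exact div_nonneg (integral_nonneg fun _ => by positivity)
        (integral_nonneg fun _ => by positivity)
    · by_contra! hz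
      rw [norm_toL2_sq] at hpos
      simp [hz] at hpos

lemma integral_sq_pos (h : IsSphereTest Ω Ψ) (hne : ∃ θ : Sph N, Ψ θ ≠ 0) :
    0 < ∫ θ in Ω, Ψ θ ^ 2 ∂(surf N) := by
  obtain ⟨θ, hθ⟩ := hne
  rw [setIntegral_eq_integral_of_forall_compl_eq_zero (fun x hx => by
    rw [image_eq_zero_of_notMem_tsupport (f := fun θ : Sph N => Ψ θ) fun h' => hx (h.2 h')]; simp)]
  exact (h.continuous.pow 2).integral_pos_of_hasCompactSupport_nonneg_nonzero
    ((HasCompactSupport.of_compactSpace _)) (fun _ => sq_nonneg _) (x := θ) (pow_ne_zero 2 hθ)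

end IsSphereTest

/-- There are normalized test functions whose Rayleigh quotient is arbitrarily close to `λ₁`. -/
lemma exists_almost_minimizer (hΩ : IsOpen Ω) (hne : Ω.Nonempty) {ε : ℝ} (hε : 0 < ε) :
    ∃ (Ψ : EuclideanSpace ℝ (Fin N) → ℝ) (h : IsSphereTest Ω Ψ), ‖h.toL2‖ = 1 ∧
      ‖h.gradL2‖ ^ 2 ≤ dirichletEigenvalue Ω + ε := by
  obtain ⟨_, ⟨Ψ, hΨ, hΨ0, rfl⟩, hlt⟩ := Real.lt_sInf_add_pos (s := {R : ℝ |
    ∃ Ψ : EuclideanSpace ℝ (Fin N) → ℝ, IsSphereTest Ω Ψ ∧ (∃ θ : Sph N, Ψ θ ≠ 0) ∧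
    R = (∫ θ in Ω, ‖sphereGrad Ψ θ‖ ^ 2 ∂(surf N)) / ∫ θ in Ω, Ψ θ ^ 2 ∂(surf N)}) (by
      obtain ⟨Ψ, hΨ, -, U, -, ⟨θ, hθ⟩, -, hU⟩ := exists_sphereTest hΩ hne
      exact ⟨_, Ψ, hΨ, ⟨θ, (hU θ hθ).ne'⟩, rfl⟩) hε
  have hpos := hΨ.integral_sq_pos hΨ0
  rw [← hΨ.norm_toL2_sq] at hpos hlt
  rw [← hΨ.norm_gradL2_sq] at hlt
  have hz : IsSphereTest Ω (fun _ : EuclideanSpace ℝ (Fin N) => (0:ℝ)) :=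
    ⟨contDiff_const, by simp⟩
  have hz1 : hz.toL2 = 0 := by
    rw [← norm_eq_zero, ← sq_eq_zero_iff, hz.norm_toL2_sq]; simp
  have hz2 : hz.gradL2 = 0 := by
    have : ∀ θ : Sph N, sphereGrad (fun _ : EuclideanSpace ℝ (Fin N) => (0:ℝ)) θ = 0 := fun θ => by
      simp [sphereGrad, gradient_fun_const]
    rw [← norm_eq_zero, ← sq_eq_zero_iff, hz.norm_gradL2_sq]; simp [this]
  refine ⟨_, hz.add_smul hΨ (‖hΨ.toL2‖⁻¹), ?_, ?_⟩
  · rw [IsSphereTest.toL2_add_smul hz hΨ, hz1, zero_add, norm_smul, norm_inv, norm_norm,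
      inv_mul_cancel₀ fun h0 => by rw [h0] at hpos; norm_num at hpos]
  · rw [IsSphereTest.gradL2_add_smul hz hΨ, hz2, zero_add, norm_smul, norm_inv, norm_norm, mul_pow, inv_pow,
      ← div_eq_inv_mul]
    exact hlt.le

/-- Compactness of the embedding `H¹₀(Ω) → L²(Ω)`, from Rellich's theorem in an annulus: a test
function `Ψ` on the sphere is extended to `b(|x|) Ψ(x/|x|)` with a fixed radial bump function `b`. -/
lemma exists_cauchy_subseq (hΩ : IsOpen Ω) {Ψ : ℕ → EuclideanSpace ℝ (Fin N) → ℝ}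
    (h : ∀ n, IsSphereTest Ω (Ψ n)) (h1 : ∀ n, ‖(h n).toL2‖ = 1) {B : ℝ}
    (hB : ∀ n, ‖(h n).gradL2‖ ^ 2 ≤ B) :
    ∃ σ : ℕ → ℕ, StrictMono σ ∧ CauchySeq fun n => (h (σ n)).toL2 := by
  let b : ContDiffBump (2:ℝ) := ⟨1/2, 1, by norm_num, by norm_num⟩
  have hbt : tsupport b = Metric.closedBall 2 1 := b.tsupport_eq
  have hb : IsTest (Ioi 0) (b : ℝ → ℝ) := by
    refine ⟨b.contDiff, b.hasCompactSupport, ?_⟩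
    rw [hbt, Real.closedBall_eq_Icc]
    intro r hr
    have := hr.1
    simp only [mem_Ioi]; linarith
  obtain ⟨j1, j2⟩ := integrable_sq_test (N := N) hb le_rfl
  set a0 := ∫ r in Ioi (0:ℝ), r ^ (N - 1) * b r ^ 2 with ha0
  set a1 := ∫ r in Ioi (0:ℝ), r ^ (N - 1) * deriv b r ^ 2 with ha1
  set a2 := ∫ r in Ioi (0:ℝ), r ^ (N - 1) * (b r ^ 2 / r ^ 2) with ha2
  have ha0p : 0 < a0 := by
    have hc : Continuous fun r : ℝ => r ^ (N - 1) * b r ^ 2 := by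
      have := b.continuous; fun_prop
    rw [ha0, setIntegral_eq_integral_of_forall_compl_eq_zero (fun r hr => by
      rw [image_eq_zero_of_notMem_tsupport fun h' => hr (hb.supp h')]; simp)]
    refine hc.integral_pos_of_hasCompactSupport_nonneg_nonzero
      (HasCompactSupport.mul_left (hasCompactSupport_sq b.hasCompactSupport)) (fun r => ?_) (x := 2) ?_
    · by_cases hr : r ∈ tsupport b
      · have : 0 < r := hb.supp hr
        simp only [Pi.zero_apply]; positivity
      · simp [image_eq_zero_of_notMem_tsupport hr]
    · rw [b.one_of_mem_closedBall (by simp [b])]; positivity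
  have ha1p : 0 ≤ a1 := setIntegral_nonneg measurableSet_Ioi fun r hr => by
    have : (0:ℝ) < r := hr
    positivity
  have ha2p : 0 ≤ a2 := setIntegral_nonneg measurableSet_Ioi fun r hr => by
    have : (0:ℝ) < r := hr
    positivity
  set f : ℕ → EuclideanSpace ℝ (Fin N) → ℝ := fun n => prodTest b (Ψ n) with hf
  have hft : ∀ n, IsTest univ (f n) := fun n =>
    (isTest_prodTest le_rfl hb (h n)).mono (subset_univ _)
  have hT1 : ∀ n, ∫ θ in Ω, Ψ n θ ^ 2 ∂(surf N) = 1 := fun n => by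
    rw [← (h n).norm_toL2_sq, h1]; norm_num
  have hB0 : 0 ≤ B := (sq_nonneg _).trans (hB 0)
  set C := √(a0 + a1 + a2 * B) with hC
  have hCnn : 0 ≤ a0 + a1 + a2 * B := by positivity
  have hC1 : ∀ n, eLpNorm (f n) 2 volume ≤ ENNReal.ofReal C := fun n => by
    rw [← ENNReal.pow_le_pow_left_iff (n := 2) (by norm_num),
      eLpNorm_sq_eq_ofReal ((hft n).memLp 2 _), ← ENNReal.ofReal_pow (Real.sqrt_nonneg _),
      Real.sq_sqrt hCnn]
    refine ENNReal.ofReal_le_ofReal ?_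
    simp only [Real.norm_eq_abs, sq_abs]
    rw [hf, integral_prodTest_sq hΩ hb (h n), hT1, mul_one]
    linarith [mul_nonneg ha2p hB0]
  have hC2 : ∀ n, eLpNorm (gradient (f n)) 2 volume ≤ ENNReal.ofReal C := fun n => by
    rw [← ENNReal.pow_le_pow_left_iff (n := 2) (by norm_num),
      eLpNorm_sq_eq_ofReal ((hft n).memLp_gradient 2 _), ← ENNReal.ofReal_pow (Real.sqrt_nonneg _),
      Real.sq_sqrt hCnn]
    refine ENNReal.ofReal_le_ofReal ?_
    rw [hf, integral_gradient_prodTest_sq hΩ hb (h n), hT1, mul_one, ← (h n).norm_gradL2_sq]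
    linarith [mul_le_mul_of_nonneg_left (hB n) ha2p]
  have hsupp : ∀ n, tsupport (f n) ⊆ Metric.closedBall 0 3 := fun n => by
    refine closure_minimal (fun x hx => ?_) Metric.isClosed_closedBall
    have h2 : ‖x‖ ∈ tsupport b := subset_tsupport _ (left_ne_zero_of_mul hx)
    rw [hbt, Real.closedBall_eq_Icc] at h2
    rw [mem_closedBall_zero_iff]
    linarith [h2.2]
  obtain ⟨σ, hσ, hcau⟩ := rellich hft hsupp hC1 hC2
  refine ⟨σ, hσ, Metric.cauchySeq_iff.2 fun ε hε => ?_⟩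
  obtain ⟨M, hM⟩ := hcau (ENNReal.ofReal (√a0 * (ε / 2))) (by
    rw [ENNReal.ofReal_pos]; have := Real.sqrt_pos.2 ha0p; positivity)
  refine ⟨M, fun m hm n hn => ?_⟩
  have e1 := hM m hm n hn
  have hs := (h (σ m)).add_smul (h (σ n)) (-1)
  have e2 : (fun x => f (σ m) x - f (σ n) x) =
      prodTest b (fun x => Ψ (σ m) x + -1 * Ψ (σ n) x) := by
    ext x; simp only [hf, prodTest, hom]; ring
  rw [e2, ← ENNReal.pow_le_pow_left_iff (n := 2) (by norm_num),
    eLpNorm_sq_eq_ofReal ((isTest_prodTest le_rfl hb hs).memLp 2 _),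
    ← ENNReal.ofReal_pow (by positivity), ENNReal.ofReal_le_ofReal_iff (by positivity)] at e1
  simp only [Real.norm_eq_abs, sq_abs] at e1
  rw [integral_prodTest_sq hΩ hb hs, ← hs.norm_toL2_sq, mul_pow, Real.sq_sqrt ha0p.le, ← ha0] at e1
  have e3 := le_of_mul_le_mul_left e1 ha0p
  have e4 : ‖hs.toL2‖ ≤ ε / 2 := (pow_le_pow_iff_left₀ (norm_nonneg _) (by positivity) two_ne_zero).1 e3
  rw [IsSphereTest.toL2_add_smul (h (σ m)) (h (σ n)) (-1), neg_one_smul, ← sub_eq_add_neg,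
    ← dist_eq_norm] at e4
  linarith

lemma inner_toLp {α F : Type*} {mα : MeasurableSpace α} {μ : Measure α}
    [NormedAddCommGroup F] [InnerProductSpace ℝ F] {f g : α → F} (hf : MemLp f 2 μ)
    (hg : MemLp g 2 μ) : ⟪hf.toLp f, hg.toLp g⟫ = ∫ x, ⟪f x, g x⟫ ∂μ := by
  rw [L2.inner_def]
  refine integral_congr_ae ?_
  filter_upwards [hf.coeFn_toLp, hg.coeFn_toLp] with x h1 h2
  rw [h1, h2]

/-- The Rayleigh quotient attains its infimum on `H¹₀(Ω)`; the minimizer is a weak solution of the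
eigenvalue equation. The pair `(p, q)` is the limit in `L²` of a minimizing sequence and of its
gradients. -/
theorem exists_minimizer (hΩ : IsOpen Ω) (hne : Ω.Nonempty) :
    ∃ (φ : Sph N → ℝ) (G : Sph N → EuclideanSpace ℝ (Fin N)), MemH10 Ω φ G ∧
      ∫ θ in Ω, φ θ ^ 2 ∂(surf N) = 1 ∧
      ∀ Ψ : EuclideanSpace ℝ (Fin N) → ℝ, IsSphereTest Ω Ψ →
        ∫ θ in Ω, ⟪G θ, sphereGrad Ψ θ⟫ ∂(surf N) =
          dirichletEigenvalue Ω * ∫ θ in Ω, φ θ * Ψ θ ∂(surf N) := by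
  set lam := dirichletEigenvalue Ω with hlam
  have hlam0 : 0 ≤ lam := dirichletEigenvalue_nonneg Ω
  choose Ψ₀ h₀ hn₀ hg₀ using fun n : ℕ =>
    exists_almost_minimizer hΩ hne (ε := 1 / ((n:ℝ) + 1)) (by positivity)
  obtain ⟨σ, hσ, hcau⟩ := exists_cauchy_subseq hΩ h₀ hn₀ (B := lam + 1) fun n =>
    (hg₀ n).trans (by
      have : 1 / ((n:ℝ) + 1) ≤ 1 := by
        rw [div_le_one (by positivity)]; linarith [n.cast_nonneg (α := ℝ)]
      linarith)
  set Ψ : ℕ → EuclideanSpace ℝ (Fin N) → ℝ := fun n => Ψ₀ (σ n) with hΨ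
  have h : ∀ n, IsSphereTest Ω (Ψ n) := fun n => h₀ (σ n)
  have hn : ∀ n, ‖(h n).toL2‖ = 1 := fun n => hn₀ (σ n)
  have hg : ∀ n, ‖(h n).gradL2‖ ^ 2 ≤ lam + 1 / ((n:ℝ) + 1) := fun n => (hg₀ (σ n)).trans (by
    have : (n:ℝ) ≤ σ n := by exact_mod_cast hσ.id_le n
    gcongr)
  have hcau1 : CauchySeq fun n => (h n).toL2 := hcau
  -- the gradients form a Cauchy sequence, by the parallelogram law
  have hpar : ∀ n m, ‖(h n).gradL2 - (h m).gradL2‖ ^ 2 ≤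
      2 * (1 / ((n:ℝ) + 1)) + 2 * (1 / ((m:ℝ) + 1)) + lam * ‖(h n).toL2 - (h m).toL2‖ ^ 2 := by
    intro n m
    have p1 := parallelogram_law_with_norm ℝ (h n).gradL2 (h m).gradL2
    have p2 := parallelogram_law_with_norm ℝ (h n).toL2 (h m).toL2
    have p3 := ((h n).add_smul (h m) 1).rayleigh
    rw [IsSphereTest.toL2_add_smul (h n) (h m), IsSphereTest.gradL2_add_smul (h n) (h m), one_smul,
      one_smul] at p3
    rw [hn, hn] at p2
    have p4 : ‖(h n).toL2 + (h m).toL2‖ ^ 2 = 4 - ‖(h n).toL2 - (h m).toL2‖ ^ 2 := by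
      rw [pow_two, pow_two]; linarith
    rw [p4, mul_sub] at p3
    linarith [hg n, hg m]
  have hcau2 : CauchySeq fun n => (h n).gradL2 := by
    refine Metric.cauchySeq_iff.2 fun ε hε => ?_
    obtain ⟨M1, hM1⟩ := Metric.cauchySeq_iff.1 hcau1 (√(ε ^ 2 / (2 * (lam + 1))))
      (Real.sqrt_pos.2 (by positivity))
    obtain ⟨M2, hM2⟩ := exists_nat_gt (8 / ε ^ 2)
    refine ⟨max M1 M2, fun n hnM m hmM => ?_⟩
    have d1 := hM1 n ((le_max_left _ _).trans hnM) m ((le_max_left _ _).trans hmM)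
    rw [dist_eq_norm, Real.lt_sqrt (norm_nonneg _), lt_div_iff₀ (by positivity)] at d1
    have hM2' : ∀ k ≥ max M1 M2, 1 / ((k:ℝ) + 1) < ε ^ 2 / 8 := fun k hk => by
      have hk' : (M2:ℝ) ≤ k := by exact_mod_cast (le_max_right _ _).trans hk
      rw [div_lt_iff₀ (by positivity)] at hM2 ⊢
      nlinarith [sq_nonneg ε, pow_pos hε 2]
    have d2 := hM2' n hnM
    have d3 := hM2' m hmM
    rw [dist_eq_norm]
    refine lt_of_pow_lt_pow_left₀ 2 hε.le ((hpar n m).trans_lt ?_)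
    nlinarith [sq_nonneg ‖(h n).toL2 - (h m).toL2‖]
  obtain ⟨p, hp⟩ := cauchySeq_tendsto_of_complete hcau1
  obtain ⟨q, hq⟩ := cauchySeq_tendsto_of_complete hcau2
  have hpn : ‖p‖ = 1 := tendsto_nhds_unique hp.norm (by simp only [hn]; exact tendsto_const_nhds)
  have hqn : ‖q‖ ^ 2 ≤ lam := by
    refine le_of_tendsto_of_tendsto' (hq.norm.pow 2) ?_ hg
    simpa using tendsto_one_div_add_atTop_nhds_zero_nat.const_add lam
  have hEL : ∀ Ψ' (h' : IsSphereTest Ω Ψ'), ⟪q, h'.gradL2⟫ = lam * ⟪p, h'.toL2⟫ := by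
    intro Ψ' h'
    -- `t ↦ ‖q + t ∇Ψ'‖² - λ₁ ‖p + t Ψ'‖²` is nonnegative with value at most `0` at `t = 0`
    have hquad : ∀ t : ℝ, 0 ≤ (‖h'.gradL2‖ ^ 2 - lam * ‖h'.toL2‖ ^ 2) * (t * t) +
        (2 * (⟪q, h'.gradL2⟫ - lam * ⟪p, h'.toL2⟫)) * t + 0 := by
      intro t
      have hlim : lam * ‖p + t • h'.toL2‖ ^ 2 ≤ ‖q + t • h'.gradL2‖ ^ 2 := by
        refine le_of_tendsto_of_tendsto' (((hp.add_const _).norm.pow 2).const_mul lam)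
          ((hq.add_const _).norm.pow 2) fun n => ?_
        have := ((h n).add_smul h' t).rayleigh
        rwa [IsSphereTest.toL2_add_smul (h n) h', IsSphereTest.gradL2_add_smul (h n) h'] at this
      rw [norm_add_sq_real, norm_add_sq_real, inner_smul_right, inner_smul_right, norm_smul, norm_smul,
        mul_pow, mul_pow, Real.norm_eq_abs, sq_abs, hpn] at hlim
      nlinarith
    have hd := discrim_le_zero hquad
    rw [discrim] at hd
    have : (2 * (⟪q, h'.gradL2⟫ - lam * ⟪p, h'.toL2⟫)) ^ 2 ≤ 0 := by linarith
    have := pow_eq_zero_iff (two_ne_zero) |>.1 (le_antisymm this (sq_nonneg _))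
    linarith
  have hpm : MemLp p 2 ((surf N).restrict Ω) := Lp.memLp p
  have hqm : MemLp q 2 ((surf N).restrict Ω) := Lp.memLp q
  refine ⟨p, q, ⟨hpm, hqm, Ψ, h, ?_, ?_⟩, ?_, fun Ψ' h' => ?_⟩
  · refine (tendsto_iff_edist_tendsto_0.1 hp).congr fun n => ?_
    have e := Lp.edist_toLp_toLp _ _ (memLp_of_continuous (h n).continuous 2 Ω) hpm
    rw [Lp.toLp_coeFn] at e
    exact e
  · refine (tendsto_iff_edist_tendsto_0.1 hq).congr fun n => ?_
    have e := Lp.edist_toLp_toLp _ _ (memLp_of_continuous (continuous_sphereGrad (h n).1) 2 Ω) hqm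
    rw [Lp.toLp_coeFn] at e
    exact e
  · have := norm_toLp_sq hpm
    rw [Lp.toLp_coeFn, hpn] at this
    simpa using this.symm
  · have := hEL Ψ' h'
    rw [← Lp.toLp_coeFn p hpm, ← Lp.toLp_coeFn q hqm, IsSphereTest.toL2, IsSphereTest.gradL2,
      inner_toLp, inner_toLp] at this
    rw [this]
    congr 1
    exact integral_congr_ae (ae_of_all _ fun θ => by simp [mul_comm])

lemma tendsto_toLp {α F : Type*} {mα : MeasurableSpace α} {μ : Measure α} [NormedAddCommGroup F]
    {f : ℕ → α → F} {g : α → F} (hf : ∀ n, MemLp (f n) 2 μ) (hg : MemLp g 2 μ)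
    (hfg : Tendsto (fun n => eLpNorm (fun x => f n x - g x) 2 μ) atTop (𝓝 0)) :
    Tendsto (fun n => (hf n).toLp (f n)) atTop (𝓝 (hg.toLp g)) := by
  rw [tendsto_iff_edist_tendsto_0]
  refine hfg.congr fun n => ?_
  rw [Lp.edist_toLp_toLp]; rfl

/-- Testing the eigenvalue equation with the eigenfunction itself. -/
lemma MemH10.energy_eq {φ : Sph N → ℝ} {G : Sph N → EuclideanSpace ℝ (Fin N)}
    (h : MemH10 Ω φ G)
    (hEL : ∀ Ψ : EuclideanSpace ℝ (Fin N) → ℝ, IsSphereTest Ω Ψ →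
      ∫ θ in Ω, ⟪G θ, sphereGrad Ψ θ⟫ ∂(surf N) =
        dirichletEigenvalue Ω * ∫ θ in Ω, φ θ * Ψ θ ∂(surf N)) :
    ∫ θ in Ω, ‖G θ‖ ^ 2 ∂(surf N) = dirichletEigenvalue Ω * ∫ θ in Ω, φ θ ^ 2 ∂(surf N) := by
  obtain ⟨Ψ, hΨ, h1, h2⟩ := h.approx
  have c1 : Tendsto (fun n => (hΨ n).toL2) atTop (𝓝 (h.memLp.toLp φ)) := tendsto_toLp _ _ h1
  have c2 : Tendsto (fun n => (hΨ n).gradL2) atTop (𝓝 (h.memLp_grad.toLp G)) := tendsto_toLp _ _ h2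
  have e : ∀ n, ⟪h.memLp_grad.toLp G, (hΨ n).gradL2⟫ =
      dirichletEigenvalue Ω * ⟪h.memLp.toLp φ, (hΨ n).toL2⟫ := fun n => by
    rw [IsSphereTest.toL2, IsSphereTest.gradL2, inner_toLp, inner_toLp, hEL _ (hΨ n)]
    congr 1
    exact integral_congr_ae (ae_of_all _ fun θ => by simp [mul_comm])
  have := tendsto_nhds_unique ((tendsto_const_nhds.inner c2).congr e)
    ((tendsto_const_nhds.inner c1).const_mul _)
  rw [real_inner_self_eq_norm_sq, real_inner_self_eq_norm_sq, norm_toLp_sq, norm_toLp_sq] at this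
  simpa using this

end Minimizer


/-! ### Functions with proportional gradients -/

section Quotient

variable {E : Type*} [NormedAddCommGroup E] [InnerProductSpace ℝ E] [CompleteSpace E]
  [FiniteDimensional ℝ E] [MeasureSpace E] [BorelSpace E] [(volume : Measure E).IsAddHaarMeasure]
  {U : Set E} {u w : E → ℝ} {G W : E → E}

set_option linter.unusedSectionVars false

/-- Products of a bounded, almost everywhere convergent sequence and a sequence converging in
`L¹`. -/
lemma tendsto_integral_mul_of_L1 {α : Type*} {mα : MeasurableSpace α} {μ : Measure α}
    {f : ℕ → α → ℝ} {g : α → ℝ} {b : ℕ → α → ℝ} {β : α → ℝ} {C : ℝ}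
    (hb : ∀ n, AEStronglyMeasurable (b n) μ) (hbC : ∀ n, ∀ᵐ x ∂μ, |b n x| ≤ C)
    (hbl : ∀ᵐ x ∂μ, Tendsto (fun n => b n x) atTop (𝓝 (β x)))
    (hf : ∀ n, AEStronglyMeasurable (f n) μ) (hg : Integrable g μ)
    (hfg : Tendsto (fun n => eLpNorm (fun x => f n x - g x) 1 μ) atTop (𝓝 0)) :
    Tendsto (fun n => ∫ x, b n x * f n x ∂μ) atTop (𝓝 (∫ x, β x * g x ∂μ)) := by
  have h1 : Tendsto (fun n => ∫ x, b n x * g x ∂μ) atTop (𝓝 (∫ x, β x * g x ∂μ)) := by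
    refine tendsto_integral_of_dominated_convergence (fun x => C * ‖g x‖)
      (fun n => (hb n).mul hg.1) (hg.norm.const_mul C) (fun n => ?_) ?_
    · filter_upwards [hbC n] with x hx
      rw [norm_mul]
      exact mul_le_mul_of_nonneg_right hx (norm_nonneg _)
    · filter_upwards [hbl] with x hx using hx.mul_const _
  have hd : ∀ᶠ n in atTop, Integrable (fun x => f n x - g x) μ := by
    filter_upwards [hfg.eventually (gt_mem_nhds (zero_lt_one' ℝ≥0∞))] with n hn
    exact memLp_one_iff_integrable.1 ⟨(hf n).sub hg.1, hn.trans ENNReal.one_lt_top⟩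
  have h2 : Tendsto (fun n => ∫ x, b n x * (f n x - g x) ∂μ) atTop (𝓝 0) := by
    rw [tendsto_zero_iff_enorm_tendsto_zero]
    have hlim : Tendsto (fun n => ENNReal.ofReal |C| * eLpNorm (fun x => f n x - g x) 1 μ)
        atTop (𝓝 0) := by
      simpa using ENNReal.Tendsto.const_mul hfg (Or.inr (ENNReal.ofReal_ne_top (r := |C|)))
    refine tendsto_of_tendsto_of_tendsto_of_le_of_le tendsto_const_nhds hlim (fun _ => zero_le)
      fun n => ?_
    calc _ ≤ ∫⁻ x, ‖b n x * (f n x - g x)‖ₑ ∂μ := enorm_integral_le_lintegral_enorm _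
      _ ≤ ∫⁻ x, ENNReal.ofReal |C| * ‖f n x - g x‖ₑ ∂μ := by
          refine lintegral_mono_ae ?_
          filter_upwards [hbC n] with x hx
          rw [enorm_mul, Real.enorm_eq_ofReal_abs (b n x)]
          exact mul_le_mul' (ENNReal.ofReal_le_ofReal (hx.trans (le_abs_self C))) le_rfl
      _ = _ := by rw [lintegral_const_mul' _ _ ENNReal.ofReal_ne_top, eLpNorm_one_eq_lintegral_enorm]
  have h3 := h1.add h2
  rw [add_zero] at h3
  refine h3.congr' ?_
  filter_upwards [hd] with n hn
  have i1 : Integrable (fun x => b n x * g x) μ := hg.bdd_mul (c := C) (hb n) (hbC n)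
  have i2 : Integrable (fun x => b n x * (f n x - g x)) μ := hn.bdd_mul (c := C) (hb n) (hbC n)
  rw [← integral_add i1 i2]
  refine integral_congr_ae (ae_of_all _ fun x => ?_)
  simp only; ring

lemma hasGradientAt_arctan_div {f g : E → ℝ} {x : E} {ε : ℝ} (hf : DifferentiableAt ℝ f x)
    (hg : DifferentiableAt ℝ g x) (h0 : 0 < f x + ε) :
    gradient (fun y => Real.arctan (g y / (f y + ε))) x =
      ((f x + ε) / ((f x + ε) ^ 2 + g x ^ 2)) • gradient g x -
        (g x / ((f x + ε) ^ 2 + g x ^ 2)) • gradient f x := by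
  refine HasGradientAt.gradient ?_
  rw [hasGradientAt_iff_hasFDerivAt]
  have h1 : HasFDerivAt (fun y => (f y + ε)⁻¹) (-((f x + ε) ^ 2)⁻¹ • fderiv ℝ f x) x :=
    (hasDerivAt_inv h0.ne').comp_hasFDerivAt x (hf.hasFDerivAt.add_const ε)
  have h2 := (hg.hasFDerivAt.mul h1).arctan
  simp only [div_eq_mul_inv (g _)]
  refine HasFDerivAt.congr_fderiv h2 ?_
  ext e
  simp only [map_sub, map_smul, sub_apply, smul_apply, InnerProductSpace.toDual_apply_apply,
    inner_gradient_left, smul_eq_mul]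
  have h5 : (f x + ε) ^ 2 + g x ^ 2 ≠ 0 := by positivity
  have h3 : 1 + (g x / (f x + ε)) ^ 2 ≠ 0 := by positivity
  have h4 : 1 + (g x / (f x + ε)) ^ 2 = ((f x + ε) ^ 2 + g x ^ 2) / (f x + ε) ^ 2 := by
    field_simp
  simp only [Pi.mul_apply, add_apply, smul_apply,
    smul_eq_mul, ← div_eq_mul_inv]
  rw [h4]
  field_simp
  ring

/-- Bounds of the partial derivatives of `arctan (t / s)` in `t` and `s`, for `s ≥ ε`. -/
lemma abs_quotient_le {s t ε : ℝ} (hε : 0 < ε) (hs : ε ≤ s) :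
    |s / (s ^ 2 + t ^ 2)| ≤ 1 / ε ∧ |t / (s ^ 2 + t ^ 2)| ≤ 1 / ε := by
  have h0 : 0 < s := hε.trans_le hs
  have h1 : 0 < s ^ 2 + t ^ 2 := by positivity
  rw [abs_div, abs_div, abs_of_pos h1, abs_of_pos h0, div_le_div_iff₀ h1 hε, div_le_div_iff₀ h1 hε]
  constructor
  · nlinarith [sq_nonneg t]
  · have : |t| * s ≤ s ^ 2 + t ^ 2 := by nlinarith [sq_nonneg (|t| - s), sq_abs t, abs_nonneg t]
    nlinarith [abs_nonneg t]

lemma memLp_one_of_locallyIntegrableOn {F : Type*} [NormedAddCommGroup F] {f : E → F}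
    (hf : LocallyIntegrableOn f U) (K : Set E) (hK : IsCompact K) (hKU : K ⊆ U) :
    MemLp f 1 (volume.restrict K) :=
  memLp_one_iff_integrable.2 (hf.integrableOn_compact_subset hKU hK)

/-- The chain rule for `arctan (w / (u + ε))`, tested with `η`. -/
lemma integral_arctan_div (hU : IsOpen U) (hu : IsWeakPair U u G) (hw : IsWeakPair U w W)
    (hu0 : ∀ᵐ x ∂(volume.restrict U), 0 ≤ u x) {ε : ℝ} (hε : 0 < ε) {η : E → ℝ} (hη : IsTest U η)
    (e : E) :
    ∫ x in tsupport η, Real.arctan (w x / (u x + ε)) * fderiv ℝ η x e =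
      -∫ x in tsupport η, (η x * ((u x + ε) / ((u x + ε) ^ 2 + w x ^ 2)) * ⟪W x, e⟫ -
        η x * (w x / ((u x + ε) ^ 2 + w x ^ 2)) * ⟪G x, e⟫) := by
  set K := tsupport η with hKdef
  have hK : IsCompact K := hη.compact
  have hKU : K ⊆ U := hη.supp
  obtain ⟨f, hfs, -, hfG, hfae, hfpos, -⟩ := exists_smooth_approx hU hK hKU (p := 1) (by simp)
    (memLp_one_of_locallyIntegrableOn hu.locU) (memLp_one_of_locallyIntegrableOn hu.locG) hu.weak
  obtain ⟨g, hgs, -, hgW, hgae, -, -⟩ := exists_smooth_approx hU hK hKU (p := 1) (by simp)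
    (memLp_one_of_locallyIntegrableOn hw.locU) (memLp_one_of_locallyIntegrableOn hw.locG) hw.weak
  have hf0 := hfpos hu0
  have hfe : ∀ n x, ε ≤ f n x + ε := fun n x => by linarith [hf0 n x]
  have hfe0 : ∀ n x, 0 < f n x + ε := fun n x => hε.trans_le (hfe n x)
  have hfd : ∀ n, Differentiable ℝ (f n) := fun n => (hfs n).differentiable (by simp)
  have hgd : ∀ n, Differentiable ℝ (g n) := fun n => (hgs n).differentiable (by simp)
  have hfc := fun n => (hfs n).continuous
  have hgc := fun n => (hgs n).continuous
  have hgradc : ∀ {k : E → ℝ}, ContDiff ℝ ∞ k → Continuous (gradient k) := fun hk =>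
    (LinearIsometryEquiv.continuous _).comp (hk.continuous_fderiv (by simp))
  have hηc := hη.smooth.continuous
  obtain ⟨Cη, hCη⟩ : ∃ C, ∀ x ∈ K, ‖η x‖ ≤ C := hK.exists_bound_of_continuousOn hηc.continuousOn
  have hfin : IsFiniteMeasure (volume.restrict K) := ⟨by simpa using hK.measure_lt_top⟩
  -- the identity for the approximating functions
  have hid : ∀ n, ∫ x in K, Real.arctan (g n x / (f n x + ε)) * fderiv ℝ η x e =
      -∫ x in K, (η x * ((f n x + ε) / ((f n x + ε) ^ 2 + g n x ^ 2)) * ⟪gradient (g n) x, e⟫ -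
        η x * (g n x / ((f n x + ε) ^ 2 + g n x ^ 2)) * ⟪gradient (f n) x, e⟫) := by
    intro n
    have hp := isWeakPair_of_contDiffOn hU (f := fun y => Real.arctan (g n y / (f n y + ε)))
      fun x _ => Real.contDiff_arctan.contDiffAt.comp x ((hgs n).contDiffAt.div
        ((hfs n).contDiffAt.add contDiffAt_const) (hfe0 n x).ne')
    have h1 := hp.integral_fderiv hη e
    rw [← setIntegral_eq_of_subset_of_forall_sdiff_eq_zero hU.measurableSet hKU (fun x hx => ?_),
      ← setIntegral_eq_of_subset_of_forall_sdiff_eq_zero hU.measurableSet hKU (fun x hx => ?_), h1]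
    · congr 1
      refine integral_congr_ae (ae_of_all _ fun x => ?_)
      simp only
      rw [hasGradientAt_arctan_div (hfd n x) (hgd n x) (hfe0 n x), inner_sub_left, inner_smul_left,
        inner_smul_left]
      simp only [RCLike.conj_to_real]
      ring
    · rw [image_eq_zero_of_notMem_tsupport (f := η) hx.2]; simp
    · rw [image_eq_zero_of_notMem_tsupport (f := fun y => fderiv ℝ η y e)
        fun h' => hx.2 (IsTest.fderiv_supp e h'), mul_zero]
  -- passage to the limit
  have hposK : ∀ᵐ x ∂(volume.restrict K), 0 ≤ u x :=
    ae_mono (Measure.restrict_mono hKU le_rfl) hu0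
  have hD : ∀ n x, 0 < (f n x + ε) ^ 2 + g n x ^ 2 := fun n x => by
    have := hfe0 n x; positivity
  have hl : Tendsto (fun n => ∫ x in K, Real.arctan (g n x / (f n x + ε)) * fderiv ℝ η x e) atTop
      (𝓝 (∫ x in K, Real.arctan (w x / (u x + ε)) * fderiv ℝ η x e)) := by
    obtain ⟨C, hC⟩ := hK.exists_bound_of_continuousOn (hη.fderiv_cont e).continuousOn
    refine tendsto_integral_of_dominated_convergence (fun _ => Real.pi / 2 * C) (fun n => ?_)
      (integrable_const _) (fun n => ?_) ?_
    · have c1 : Continuous fun x => g n x / (f n x + ε) :=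
        (hgc n).div ((hfc n).add continuous_const) fun x => (hfe0 n x).ne'
      exact ((Real.continuous_arctan.comp c1).mul (hη.fderiv_cont e)).aestronglyMeasurable
    · filter_upwards [ae_restrict_mem hK.measurableSet] with x hx
      rw [norm_mul]
      refine mul_le_mul ?_ (hC x hx) (norm_nonneg _) (by positivity)
      exact (abs_le.2 ⟨(Real.neg_pi_div_two_lt_arctan _).le, (Real.arctan_lt_pi_div_two _).le⟩)
    · filter_upwards [hfae, hgae, hposK] with x h1 h2 h3
      refine Tendsto.mul_const _ ((Real.continuous_arctan.tendsto _).comp ?_)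
      exact h2.div (h1.add_const ε) (by linarith : 0 < u x + ε).ne'
  have key : ∀ (b : ℕ → E → ℝ) (β : E → ℝ) (h : ℕ → E → ℝ) (H : E → E),
      (∀ n, Continuous (b n)) → (∀ n x, |b n x| ≤ 1 / ε) →
      (∀ᵐ x ∂(volume.restrict K), Tendsto (fun n => b n x) atTop (𝓝 (β x))) →
      (∀ n, ContDiff ℝ ∞ (h n)) → LocallyIntegrableOn H U →
      Tendsto (fun n => eLpNorm (fun x => gradient (h n) x - H x) 1 (volume.restrict K)) atTop
        (𝓝 0) →
      Tendsto (fun n => ∫ x in K, η x * b n x * ⟪gradient (h n) x, e⟫) atTop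
        (𝓝 (∫ x in K, η x * β x * ⟪H x, e⟫)) := by
    intro b β h H hb hbε hbl hh hH hhH
    refine tendsto_integral_mul_of_L1 (C := Cη * (1 / ε)) (fun n => (hηc.mul (hb n)).aestronglyMeasurable)
      (fun n => ?_) ?_ (fun n => ((hgradc (hh n)).inner continuous_const).aestronglyMeasurable)
      ((LocallyIntegrableOn.inner_const hH e).integrableOn_compact_subset hKU hK) ?_
    · filter_upwards [ae_restrict_mem hK.measurableSet] with x hx
      rw [abs_mul]
      exact mul_le_mul (hCη x hx) (hbε n x) (abs_nonneg _) ((norm_nonneg _).trans (hCη x hx))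
    · filter_upwards [hbl] with x hx using hx.const_mul _
    · have h1 : Tendsto (fun n => ENNReal.ofReal ‖e‖ *
          eLpNorm (fun x => gradient (h n) x - H x) 1 (volume.restrict K)) atTop (𝓝 0) := by
        simpa using ENNReal.Tendsto.const_mul hhH (Or.inr (ENNReal.ofReal_ne_top (r := ‖e‖)))
      refine tendsto_of_tendsto_of_tendsto_of_le_of_le tendsto_const_nhds h1 (fun _ => zero_le)
        fun n => ?_
      refine eLpNorm_le_mul_eLpNorm_of_ae_le_mul (ae_of_all _ fun x => ?_) 1
      rw [← inner_sub_left, mul_comm]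
      exact norm_inner_le_norm _ _
  have hα := key (fun n x => (f n x + ε) / ((f n x + ε) ^ 2 + g n x ^ 2))
    (fun x => (u x + ε) / ((u x + ε) ^ 2 + w x ^ 2)) g W
    (fun n => Continuous.div (by fun_prop) (by fun_prop) fun x => (hD n x).ne')
    (fun n x => (abs_quotient_le hε (hfe n x)).1) (by
      filter_upwards [hfae, hgae, hposK] with x h1 h2 h3
      exact (h1.add_const ε).div (((h1.add_const ε).pow 2).add (h2.pow 2))
        (by have : 0 < u x + ε := by linarith
            positivity)) hgs hw.locG hgW
  have hβ := key (fun n x => g n x / ((f n x + ε) ^ 2 + g n x ^ 2))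
    (fun x => w x / ((u x + ε) ^ 2 + w x ^ 2)) f G
    (fun n => Continuous.div (by fun_prop) (by fun_prop) fun x => (hD n x).ne')
    (fun n x => (abs_quotient_le hε (hfe n x)).2) (by
      filter_upwards [hfae, hgae, hposK] with x h1 h2 h3
      exact h2.div (((h1.add_const ε).pow 2).add (h2.pow 2))
        (by have : 0 < u x + ε := by linarith
            positivity)) hfs hu.locG hfG
  have iW := (LocallyIntegrableOn.inner_const hw.locG e).integrableOn_compact_subset hKU hK
  have iG := (LocallyIntegrableOn.inner_const hu.locG e).integrableOn_compact_subset hKU hK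
  have hum : AEStronglyMeasurable u (volume.restrict K) :=
    (hu.locU.integrableOn_compact_subset hKU hK).1
  have hwm : AEStronglyMeasurable w (volume.restrict K) :=
    (hw.locU.integrableOn_compact_subset hKU hK).1
  have hmα : AEStronglyMeasurable (fun x => η x * ((u x + ε) / ((u x + ε) ^ 2 + w x ^ 2)))
      (volume.restrict K) := by
    refine AEMeasurable.aestronglyMeasurable ?_
    have := hum.aemeasurable
    have := hwm.aemeasurable
    have := hηc.measurable
    fun_prop
  have hmβ : AEStronglyMeasurable (fun x => η x * (w x / ((u x + ε) ^ 2 + w x ^ 2)))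
      (volume.restrict K) := by
    refine AEMeasurable.aestronglyMeasurable ?_
    have := hum.aemeasurable
    have := hwm.aemeasurable
    have := hηc.measurable
    fun_prop
  have jα : Integrable (fun x => η x * ((u x + ε) / ((u x + ε) ^ 2 + w x ^ 2)) * ⟪W x, e⟫)
      (volume.restrict K) := by
    refine iW.bdd_mul (c := Cη * (1 / ε)) hmα ?_
    filter_upwards [ae_restrict_mem hK.measurableSet, hposK] with x hx hx0
    rw [norm_mul]
    exact mul_le_mul (hCη x hx) (abs_quotient_le hε (by linarith)).1 (abs_nonneg _)
      ((norm_nonneg _).trans (hCη x hx))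
  have jβ : Integrable (fun x => η x * (w x / ((u x + ε) ^ 2 + w x ^ 2)) * ⟪G x, e⟫)
      (volume.restrict K) := by
    refine iG.bdd_mul (c := Cη * (1 / ε)) hmβ ?_
    filter_upwards [ae_restrict_mem hK.measurableSet, hposK] with x hx hx0
    rw [norm_mul]
    exact mul_le_mul (hCη x hx) (abs_quotient_le hε (by linarith)).2 (abs_nonneg _)
      ((norm_nonneg _).trans (hCη x hx))
  refine tendsto_nhds_unique hl ?_
  rw [integral_sub jα jβ]
  refine (hα.sub hβ).neg.congr fun n => ?_
  rw [hid n, integral_sub]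
  · have c1 : Continuous fun x => η x * ((f n x + ε) / ((f n x + ε) ^ 2 + g n x ^ 2)) *
        ⟪gradient (g n) x, e⟫ := (hηc.mul (Continuous.div (by fun_prop) (by fun_prop)
          fun x => (hD n x).ne')).mul ((hgradc (hgs n)).inner continuous_const)
    exact c1.continuousOn.integrableOn_compact hK
  · have c1 : Continuous fun x => η x * (g n x / ((f n x + ε) ^ 2 + g n x ^ 2)) *
        ⟪gradient (f n) x, e⟫ := (hηc.mul (Continuous.div (by fun_prop) (by fun_prop)
          fun x => (hD n x).ne')).mul ((hgradc (hfs n)).inner continuous_const)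
    exact c1.continuousOn.integrableOn_compact hK

/-- Two functions with proportional gradients, `u W = w G`, are proportional: `arctan (w / u)` has
gradient zero. The chain rule is available only for `arctan (w / (u + s))` with `s > 0`, and the local
integrability of `u⁻¹ G` is what allows `s → 0`. -/
theorem eq_const_mul_of_gradients (hU : IsOpen U) (hUc : IsPreconnected U) (hu : IsWeakPair U u G)
    (hw : IsWeakPair U w W) (hpos : ∀ᵐ x ∂(volume.restrict U), 0 < u x)
    (hprop : ∀ᵐ x ∂(volume.restrict U), u x • W x = w x • G x)
    (hlog : LocallyIntegrableOn (fun x => (u x)⁻¹ • G x) U) :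
    ∃ k : ℝ, ∀ᵐ x ∂(volume.restrict U), w x = k * u x := by
  have hum := hu.locU.aestronglyMeasurable
  have hwm := hw.locU.aestronglyMeasurable
  have hRm : AEStronglyMeasurable (fun x => Real.arctan (w x / u x)) (volume.restrict U) := by
    refine AEMeasurable.aestronglyMeasurable ?_
    have := hum.aemeasurable
    have := hwm.aemeasurable
    exact Real.measurable_arctan.comp_aemeasurable (by fun_prop)
  have hloc : LocallyIntegrableOn (fun x => Real.arctan (w x / u x)) U := by
    rw [locallyIntegrableOn_iff hU.isLocallyClosed]
    intro K hK hKc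
    have hfin : IsFiniteMeasure (volume.restrict K) := ⟨by simpa using hKc.measure_lt_top⟩
    exact Integrable.of_bound (hRm.mono_measure (Measure.restrict_mono hK le_rfl)) (Real.pi / 2)
      (ae_of_all _ fun x => abs_le.2
        ⟨(Real.neg_pi_div_two_lt_arctan _).le, (Real.arctan_lt_pi_div_two _).le⟩)
  have hpair : IsWeakPair U (fun x => Real.arctan (w x / u x)) 0 := by
    refine IsWeakPair.of_integral_fderiv hloc (locallyIntegrable_zero.locallyIntegrableOn U)
      fun η hη e => ?_
    simp only [Pi.zero_apply, inner_zero_left, mul_zero, integral_zero, neg_zero]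
    set K := tsupport η with hKdef
    have hK : IsCompact K := hη.compact
    have hKU : K ⊆ U := hη.supp
    have hfin : IsFiniteMeasure (volume.restrict K) := ⟨by simpa using hK.measure_lt_top⟩
    have hle := Measure.restrict_mono hKU (le_refl (volume : Measure E))
    have hposK := ae_mono hle hpos
    have hpropK := ae_mono hle hprop
    have humK := (hum.mono_measure hle).aemeasurable
    have hwmK := (hwm.mono_measure hle).aemeasurable
    obtain ⟨Cη, hCη⟩ := hK.exists_bound_of_continuousOn hη.smooth.continuous.continuousOn
    obtain ⟨C, hC⟩ := hK.exists_bound_of_continuousOn (hη.fderiv_cont e).continuousOn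
    set s : ℕ → ℝ := fun n => 1 / ((n:ℝ) + 1) with hs
    have hs0 : ∀ n, 0 < s n := fun n => by simp only [hs]; positivity
    have hsl : Tendsto s atTop (𝓝 0) := tendsto_one_div_add_atTop_nhds_zero_nat
    have hl : Tendsto (fun n => ∫ x in K, Real.arctan (w x / (u x + s n)) * fderiv ℝ η x e) atTop
        (𝓝 (∫ x in K, Real.arctan (w x / u x) * fderiv ℝ η x e)) := by
      refine tendsto_integral_of_dominated_convergence (fun _ => Real.pi / 2 * C) (fun n => ?_)
        (integrable_const _) (fun n => ?_) ?_
      · refine AEStronglyMeasurable.mul (AEMeasurable.aestronglyMeasurable ?_)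
          (hη.fderiv_cont e).aestronglyMeasurable
        exact Real.measurable_arctan.comp_aemeasurable (by fun_prop)
      · filter_upwards [ae_restrict_mem hK.measurableSet] with x hx
        rw [norm_mul]
        refine mul_le_mul ?_ (hC x hx) (norm_nonneg _) (by positivity)
        exact (abs_le.2 ⟨(Real.neg_pi_div_two_lt_arctan _).le, (Real.arctan_lt_pi_div_two _).le⟩)
      · filter_upwards [hposK] with x hx
        refine Tendsto.mul_const _ ((Real.continuous_arctan.tendsto _).comp ?_)
        have := hsl.const_add (u x)
        rw [add_zero] at this
        exact tendsto_const_nhds.div this hx.ne'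
    have hr : Tendsto (fun n => -∫ x in K, (η x * ((u x + s n) / ((u x + s n) ^ 2 + w x ^ 2)) *
        ⟪W x, e⟫ - η x * (w x / ((u x + s n) ^ 2 + w x ^ 2)) * ⟪G x, e⟫)) atTop (𝓝 0) := by
      -- the integrand equals `η s w / ((u + s)² + w²) ⟪u⁻¹ G, e⟫`, dominated by `|η| |u⁻¹ G| |e|`
      have e1 : ∀ n, ∫ x in K, (η x * ((u x + s n) / ((u x + s n) ^ 2 + w x ^ 2)) *
          ⟪W x, e⟫ - η x * (w x / ((u x + s n) ^ 2 + w x ^ 2)) * ⟪G x, e⟫) =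
          ∫ x in K, η x * (s n * w x / ((u x + s n) ^ 2 + w x ^ 2)) * ⟪(u x)⁻¹ • G x, e⟫ := by
        intro n
        refine integral_congr_ae ?_
        filter_upwards [hposK, hpropK] with x hx hx'
        have h1 : W x = (u x)⁻¹ • (w x • G x) := by
          rw [← hx', smul_smul, inv_mul_cancel₀ hx.ne', one_smul]
        have h2 : (u x + s n) ^ 2 + w x ^ 2 ≠ 0 := by have := hs0 n; positivity
        rw [h1, inner_smul_left, inner_smul_left, inner_smul_left]
        simp only [RCLike.conj_to_real]
        field_simp
        ring
      simp only [e1]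
      have hlogK := hlog.integrableOn_compact_subset hKU hK
      have hi := LocallyIntegrableOn.inner_const hlog e |>.integrableOn_compact_subset hKU hK
      rw [← neg_zero]
      refine Tendsto.neg ?_
      have hz : ∫ x in K, (0:ℝ) = 0 := integral_zero _ _
      rw [← hz]
      refine tendsto_integral_of_dominated_convergence
        (fun x => Cη * ‖⟪(u x)⁻¹ • G x, e⟫‖) (fun n => ?_) (hi.norm.const_mul _) (fun n => ?_) ?_
      · refine AEStronglyMeasurable.mul (AEMeasurable.aestronglyMeasurable ?_) hi.1
        have := hη.smooth.continuous.measurable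
        fun_prop
      · filter_upwards [ae_restrict_mem hK.measurableSet, hposK] with x hx hx0
        rw [norm_mul, norm_mul]
        refine mul_le_mul_of_nonneg_right ?_ (norm_nonneg _)
        rw [← mul_one Cη]
        refine mul_le_mul (hCη x hx) ?_ (norm_nonneg _) ((norm_nonneg _).trans (hCη x hx))
        have h2 : 0 < (u x + s n) ^ 2 + w x ^ 2 := by have := hs0 n; positivity
        rw [Real.norm_eq_abs, abs_div, abs_of_pos h2, div_le_one h2, abs_mul, abs_of_pos (hs0 n)]
        nlinarith [sq_nonneg (s n - |w x|), sq_abs (w x), hs0 n, abs_nonneg (w x),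
          mul_pos hx0 (hs0 n)]
      · filter_upwards [hposK] with x hx
        have h1 := hsl.const_add (u x)
        rw [add_zero] at h1
        have h2 : Tendsto (fun n => s n * w x / ((u x + s n) ^ 2 + w x ^ 2)) atTop
            (𝓝 (0 * w x / (u x ^ 2 + w x ^ 2))) :=
          (hsl.mul_const _).div ((h1.pow 2).add_const _) (by positivity)
        rw [zero_mul, zero_div] at h2
        simpa using (h2.const_mul (η x)).mul_const ⟪(u x)⁻¹ • G x, e⟫
    have h0 := tendsto_nhds_unique hl (hr.congr fun n =>
      (integral_arctan_div hU hu hw (hpos.mono fun x hx => hx.le) (hs0 n) hη e).symm)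
    rw [← h0]
    refine setIntegral_eq_of_subset_of_forall_sdiff_eq_zero hU.measurableSet hKU fun x hx => ?_
    rw [image_eq_zero_of_notMem_tsupport (f := fun y => fderiv ℝ η y e)
      fun h' => hx.2 (IsTest.fderiv_supp e h'), mul_zero]
  obtain ⟨c, hc⟩ := eq_const_of_weakGradient_zero hU hUc hpair
  refine ⟨Real.tan c, ?_⟩
  filter_upwards [hc, hpos] with x hx hx0
  rw [← hx, Real.tan_arctan]
  field_simp

end Quotient


/-! ### Uniqueness of the minimizer -/

section Uniqueness

variable {N : ℕ} [Fact (2 ≤ N)]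

set_option linter.unusedSectionVars false

variable {Ω : Set (Sph N)} {ρ : ℝ} {u : EuclideanSpace ℝ (Fin N) → ℝ}
  {G : EuclideanSpace ℝ (Fin N) → EuclideanSpace ℝ (Fin N)} {v : ℝ → ℝ} {φ : Sph N → ℝ}
  {A : Sph N → EuclideanSpace ℝ (Fin N)}

lemma ae_cone_of_ae_sphere (hΩ : MeasurableSet Ω) (hρ : 0 ≤ ρ) {p : Sph N → Prop}
    (h : ∀ᵐ θ ∂((surf N).restrict Ω), p θ) : ∀ᵐ x ∂(volume.restrict (cone Ω ρ)), p (dir x) := by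
  rw [ae_cone_iff hΩ hρ]
  have h1 := (Measure.quasiMeasurePreserving_snd (μ := (volume : Measure ℝ).restrict (Ioi ρ))
    (ν := (surf N).restrict Ω)).ae h
  filter_upwards [ae_polMeasure_mem hΩ ρ, h1] with q hq hq'
  rwa [dir_pol (hρ.trans_lt hq.1)]

lemma ae_sphere_of_ae_cone (hΩ : MeasurableSet Ω) (hρ : 0 ≤ ρ) {p : Sph N → Prop}
    (h : ∀ᵐ x ∂(volume.restrict (cone Ω ρ)), p (dir x)) : ∀ᵐ θ ∂((surf N).restrict Ω), p θ := by
  rw [ae_cone_iff hΩ hρ] at h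
  refine ae_of_ae_polMeasure_snd (ρ := ρ) ?_
  filter_upwards [ae_polMeasure_mem hΩ ρ, h] with q hq hq'
  rwa [dir_pol (hρ.trans_lt hq.1)] at hq'

lemma aestronglyMeasurable_comp_dir {F : Type*} [NormedAddCommGroup F] (hΩ : MeasurableSet Ω)
    (hρ : 0 ≤ ρ) {f : Sph N → F} (hf : AEStronglyMeasurable f ((surf N).restrict Ω)) :
    AEStronglyMeasurable (fun x => f (dir x)) (volume.restrict (cone Ω ρ)) := by
  rw [aestronglyMeasurable_cone_iff hΩ hρ]
  have h1 := hf.comp_quasiMeasurePreserving (Measure.quasiMeasurePreserving_snd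
    (μ := (volume : Measure ℝ).restrict (Ioi ρ)) (ν := (surf N).restrict Ω))
  refine h1.congr ?_
  filter_upwards [ae_polMeasure_mem hΩ ρ] with q hq
  rw [dir_pol (hρ.trans_lt hq.1)]; rfl

/-- A locally bounded weight turns `L²` functions of the direction into integrable functions on the
cone, with a bound. -/
lemma exists_lintegral_mul_dir_le (hΩ : IsOpen Ω) (hρ : 0 ≤ ρ)
    {b : EuclideanSpace ℝ (Fin N) → ℝ} (hb : Continuous b) (hbc : HasCompactSupport b)
    (hbU : tsupport b ⊆ cone Ω ρ) :
    ∃ C : ℝ≥0∞, C ≠ ⊤ ∧ ∀ f : Sph N → ℝ, AEStronglyMeasurable f ((surf N).restrict Ω) →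
      ∫⁻ x in cone Ω ρ, ‖b x * f (dir x)‖ₑ ≤ C * eLpNorm f 2 ((surf N).restrict Ω) := by
  obtain ⟨I, L, hI, hIρ, -, -, hK⟩ := exists_compact_pol hρ hbc hbU
  obtain ⟨M, hM⟩ := hb.bounded_above_of_compact_support hbc
  have hM0 : 0 ≤ M := (norm_nonneg _).trans (hM 0)
  have hΩm := hΩ.measurableSet
  have hIint : IntegrableOn (fun r : ℝ => r ^ (N - 1)) I :=
    (continuous_pow _).continuousOn.integrableOn_compact hI
  set c : ℝ≥0∞ := ∫⁻ r in Ioi ρ, I.indicator (fun r => ENNReal.ofReal (r ^ (N - 1))) r with hc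
  have hct : c ≠ ⊤ := by
    rw [hc, lintegral_indicator hI.measurableSet]
    refine ((lintegral_mono' (Measure.restrict_mono le_rfl Measure.restrict_le_self)
      fun r => ?_).trans_lt hIint.2).ne
    exact Real.ofReal_le_enorm _
  have hfin : IsFiniteMeasure ((surf N).restrict Ω) := by unfold surf; infer_instance
  refine ⟨ENNReal.ofReal M * c * ((surf N).restrict Ω univ) ^ (1 / (1:ℝ≥0∞).toReal -
    1 / (2:ℝ≥0∞).toReal), ENNReal.mul_ne_top (ENNReal.mul_ne_top ENNReal.ofReal_ne_top hct)
      (ENNReal.rpow_ne_top_of_nonneg (by norm_num) (measure_ne_top _ _)), fun f hf => ?_⟩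
  have hm : AEStronglyMeasurable (fun x => b x * f (dir x)) (volume.restrict (cone Ω ρ)) :=
    hb.aestronglyMeasurable.mul (aestronglyMeasurable_comp_dir hΩm hρ hf)
  calc ∫⁻ x in cone Ω ρ, ‖b x * f (dir x)‖ₑ
      = ∫⁻ q, ENNReal.ofReal (q.1 ^ (N - 1)) * ‖b (pol q) * f (dir (pol q))‖ₑ ∂(polMeasure Ω ρ) :=
        lintegral_cone hΩm hρ hm.enorm
    _ ≤ ∫⁻ q, (ENNReal.ofReal M * I.indicator (fun r => ENNReal.ofReal (r ^ (N - 1))) q.1) *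
          ‖f q.2‖ₑ ∂(polMeasure Ω ρ) := by
        refine lintegral_mono_ae ?_
        filter_upwards [ae_polMeasure_mem hΩm ρ] with q hq
        have h0 : 0 < q.1 := hρ.trans_lt hq.1
        rw [dir_pol h0]
        by_cases hqI : q.1 ∈ I
        · rw [indicator_of_mem hqI, enorm_mul, ← mul_assoc, mul_comm (ENNReal.ofReal M)]
          refine mul_le_mul' (mul_le_mul' le_rfl ?_) le_rfl
          rw [← ofReal_norm]
          exact ENNReal.ofReal_le_ofReal (hM _)
        · have : b (pol q) = 0 := by
            refine image_eq_zero_of_notMem_tsupport fun h' => hqI ?_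
            obtain ⟨p, hp, hpq⟩ := hK h'
            have hp0 : 0 < p.1 := hρ.trans_lt (hIρ hp.1)
            have := congrArg norm hpq
            rw [norm_pol _ hp0.le, norm_pol _ h0.le] at this
            rw [← this]; exact hp.1
          simp [this]
    _ = ENNReal.ofReal M * c * ∫⁻ θ in Ω, ‖f θ‖ₑ ∂(surf N) := by
        have hmI : Measurable (I.indicator fun r : ℝ => ENNReal.ofReal (r ^ (N - 1))) :=
          Measurable.indicator (by fun_prop) hI.measurableSet
        unfold polMeasure
        rw [lintegral_prod_mul (f := fun r => ENNReal.ofReal M *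
          I.indicator (fun r => ENNReal.ofReal (r ^ (N - 1))) r) (g := fun θ => ‖f θ‖ₑ)
          (hmI.const_mul _).aemeasurable hf.enorm, lintegral_const_mul _ hmI]
    _ ≤ _ := by
        rw [← eLpNorm_one_eq_lintegral_enorm, mul_assoc _ (_ ^ _ : ℝ≥0∞)]
        refine mul_le_mul' le_rfl ?_
        rw [mul_comm]
        exact eLpNorm_le_eLpNorm_mul_rpow_measure_univ one_le_two hf

lemma integrable_mul_dir (hΩ : IsOpen Ω) (hρ : 0 ≤ ρ)
    {b : EuclideanSpace ℝ (Fin N) → ℝ} (hb : Continuous b) (hbc : HasCompactSupport b)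
    (hbU : tsupport b ⊆ cone Ω ρ) {f : Sph N → ℝ} (hf : MemLp f 2 ((surf N).restrict Ω)) :
    Integrable (fun x => b x * f (dir x)) (volume.restrict (cone Ω ρ)) := by
  obtain ⟨C, hC, h⟩ := exists_lintegral_mul_dir_le hΩ hρ hb hbc hbU
  exact ⟨hb.aestronglyMeasurable.mul (aestronglyMeasurable_comp_dir hΩ.measurableSet hρ hf.1),
    (h f hf.1).trans_lt (ENNReal.mul_lt_top hC.lt_top hf.2)⟩

/-- Convergence in `L²(Ω)` implies convergence of the integrals over the cone against a compactly
supported weight. -/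
lemma tendsto_integral_mul_dir (hΩ : IsOpen Ω) (hρ : 0 ≤ ρ)
    {b : EuclideanSpace ℝ (Fin N) → ℝ} (hb : Continuous b) (hbc : HasCompactSupport b)
    (hbU : tsupport b ⊆ cone Ω ρ) {f : ℕ → Sph N → ℝ} {g : Sph N → ℝ}
    (hf : ∀ n, MemLp (f n) 2 ((surf N).restrict Ω)) (hg : MemLp g 2 ((surf N).restrict Ω))
    (hfg : Tendsto (fun n => eLpNorm (fun θ => f n θ - g θ) 2 ((surf N).restrict Ω)) atTop (𝓝 0)) :
    Tendsto (fun n => ∫ x in cone Ω ρ, b x * f n (dir x)) atTop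
      (𝓝 (∫ x in cone Ω ρ, b x * g (dir x))) := by
  obtain ⟨C, hC, h⟩ := exists_lintegral_mul_dir_le hΩ hρ hb hbc hbU
  refine tendsto_integral_of_L1 _ (integrable_mul_dir hΩ hρ hb hbc hbU hg).1
    (Eventually.of_forall fun n => integrable_mul_dir hΩ hρ hb hbc hbU (hf n)) ?_
  have h1 : Tendsto (fun n => C * eLpNorm (fun θ => f n θ - g θ) 2 ((surf N).restrict Ω)) atTop
      (𝓝 0) := by
    simpa using ENNReal.Tendsto.const_mul hfg (Or.inr hC)
  refine tendsto_of_tendsto_of_tendsto_of_le_of_le tendsto_const_nhds h1 (fun _ => zero_le)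
    fun n => ?_
  refine le_trans (le_of_eq ?_) (h (fun θ => f n θ - g θ) ((hf n).1.sub hg.1))
  simp only [mul_sub]

lemma integrableOn_of_memLp_sphere {F : Type*} [NormedAddCommGroup F] {f : Sph N → F}
    (hf : MemLp f 2 ((surf N).restrict Ω)) (L : Set (Sph N)) (hLΩ : L ⊆ Ω) :
    IntegrableOn f L (surf N) := by
  have hfin : IsFiniteMeasure ((surf N).restrict Ω) := by unfold surf; infer_instance
  have h1 : IntegrableOn f Ω (surf N) := hf.integrable one_le_two
  exact h1.mono_set hLΩ

/-- The homogeneous extension of a function in `H¹_0(Ω)` has the expected weak gradient. -/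
lemma MemH10.isWeakPair (h : MemH10 Ω φ A) (hΩ : IsOpen Ω) (hρ : 0 ≤ ρ) :
    IsWeakPair (cone Ω ρ) (fun x => φ (dir x)) (fun x => ‖x‖⁻¹ • A (dir x)) := by
  have l1 : LocallyIntegrableOn (fun x => φ (dir x)) (cone Ω ρ) := by
    simpa using locallyIntegrableOn_polar_prod (a := fun _ => 1) hΩ hρ
      (fun I hI _ => continuousOn_const.integrableOn_compact hI)
      (fun L _ hLΩ => integrableOn_of_memLp_sphere h.memLp L hLΩ)
  have l2 : LocallyIntegrableOn (fun x => ‖x‖⁻¹ • A (dir x)) (cone Ω ρ) :=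
    locallyIntegrableOn_polar_prod (a := fun r => r⁻¹) hΩ hρ
      (fun I hI hIρ => (continuousOn_id.inv₀ fun r hr =>
        (hρ.trans_lt (hIρ hr)).ne').integrableOn_compact hI)
      (fun L _ hLΩ => integrableOn_of_memLp_sphere h.memLp_grad L hLΩ)
  obtain ⟨Ψ, hΨ, h1, h2⟩ := h.approx
  refine IsWeakPair.of_integral_fderiv l1 l2 fun η hη e => ?_
  have hη' : IsTest (cone Ω ρ) fun x => η x * ‖x‖⁻¹ := hη.mul_smooth fun x hx =>
    ((contDiffAt_norm ℝ (ne_zero_of_mem_cone hρ hx)).inv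
      (norm_ne_zero_iff.2 (ne_zero_of_mem_cone hρ hx)))
  have t1 := tendsto_integral_mul_dir hΩ hρ (hη.fderiv_cont e) (hη.fderiv_compact e)
    ((IsTest.fderiv_supp e).trans hη.supp)
    (fun n => memLp_of_continuous (hΨ n).continuous 2 Ω) h.memLp h1
  have h2e : Tendsto (fun n => eLpNorm (fun θ : Sph N => ⟪sphereGrad (Ψ n) θ, e⟫ - ⟪A θ, e⟫) 2
      ((surf N).restrict Ω)) atTop (𝓝 0) := by
    have h3 : Tendsto (fun n => ENNReal.ofReal ‖e‖ * eLpNorm (fun θ : Sph N =>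
        sphereGrad (Ψ n) θ - A θ) 2 ((surf N).restrict Ω)) atTop (𝓝 0) := by
      simpa using ENNReal.Tendsto.const_mul h2 (Or.inr (ENNReal.ofReal_ne_top (r := ‖e‖)))
    refine tendsto_of_tendsto_of_tendsto_of_le_of_le tendsto_const_nhds h3 (fun _ => zero_le)
      fun n => ?_
    refine eLpNorm_le_mul_eLpNorm_of_ae_le_mul (ae_of_all _ fun x => ?_) 2
    rw [← inner_sub_left, mul_comm]
    exact norm_inner_le_norm _ _
  have t2 := tendsto_integral_mul_dir hΩ hρ hη'.smooth.continuous hη'.compact hη'.supp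
    (f := fun n (θ : Sph N) => ⟪sphereGrad (Ψ n) θ, e⟫) (g := fun θ => ⟪A θ, e⟫)
    (fun n => memLp_of_continuous ((continuous_sphereGrad (hΨ n).1).inner continuous_const) 2 Ω)
    (h.memLp_grad.inner_const e) h2e
  have e1 : ∀ n, ∫ x in cone Ω ρ, fderiv ℝ η x e * Ψ n (dir x) =
      -∫ x in cone Ω ρ, η x * ‖x‖⁻¹ * ⟪sphereGrad (Ψ n) (dir x), e⟫ := by
    intro n
    have hp := isWeakPair_of_contDiffOn (isOpen_cone hΩ hρ)
      (fun x hx => contDiffAt_hom (hΨ n).1 (ne_zero_of_mem_cone hρ hx))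
    have := hp.integral_fderiv hη e
    have hm := (isOpen_cone hΩ hρ).measurableSet
    have e2 : ∫ x in cone Ω ρ, hom (Ψ n) x * fderiv ℝ η x e =
        ∫ x in cone Ω ρ, fderiv ℝ η x e * Ψ n (dir x) := setIntegral_congr_fun hm fun x hx => by
      rw [hom_eq_dir (ne_zero_of_mem_cone hρ hx), mul_comm]
    have e3 : ∫ x in cone Ω ρ, η x * ⟪gradient (hom (Ψ n)) x, e⟫ =
        ∫ x in cone Ω ρ, η x * ‖x‖⁻¹ * ⟪sphereGrad (Ψ n) (dir x), e⟫ :=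
      setIntegral_congr_fun hm fun x hx => by
        rw [gradient_hom (hΨ n).1 (ne_zero_of_mem_cone hρ hx), inner_smul_left, ← mul_assoc]
        rfl
    rw [← e2, this, e3]
  have := tendsto_nhds_unique t1 (t2.neg.congr fun n => (e1 n).symm)
  simp only [mul_comm (fderiv ℝ η _ e)] at this
  rw [this]
  congr 1
  refine integral_congr_ae (ae_of_all _ fun x => ?_)
  simp only [inner_smul_left, RCLike.conj_to_real]
  ring

namespace IsSeparatedSuper

/-- The logarithmic gradient of `φ` is locally integrable, by Picone's inequality with a function
that is locally constant. -/
lemma integrableOn_log_gradient (h : IsSeparatedSuper Ω ρ u G v φ A) (L : Set (Sph N))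
    (hL : IsCompact L) (hLΩ : L ⊆ Ω) : IntegrableOn (fun θ => (φ θ)⁻¹ • A θ) L (surf N) := by
  suffices hs : LocallyIntegrableOn (fun θ => (φ θ)⁻¹ • A θ) Ω (surf N) from
    hs.integrableOn_compact_subset hLΩ hL
  intro θ₀ hθ₀
  obtain ⟨ε, hε, hball⟩ := Metric.isOpen_iff.1 h.isOpen θ₀ hθ₀
  let f : ContDiffBump (θ₀ : EuclideanSpace ℝ (Fin N)) :=
    { rIn := ε / 4, rOut := ε / 2, rIn_pos := by positivity, rIn_lt_rOut := by linarith }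
  have hcl : tsupport (fun θ : Sph N => f θ) ⊆ Metric.closedBall θ₀ (ε / 2) := by
    refine closure_minimal (fun θ hθ => ?_) Metric.isClosed_closedBall
    have : (θ : EuclideanSpace ℝ (Fin N)) ∈ Function.support f := hθ
    rw [f.support_eq] at this
    exact (Metric.mem_ball.1 this).le
  have hΨ : IsSphereTest Ω f := ⟨f.contDiff,
    hcl.trans ((Metric.closedBall_subset_ball (by linarith)).trans hball)⟩
  have hm : AEStronglyMeasurable (fun θ : Sph N => (f θ / φ θ) • A θ) ((surf N).restrict Ω) :=
    (hΨ.continuous.measurable.aemeasurable.div h.φ_aesm.aemeasurable).aestronglyMeasurable.smul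
      h.A_aesm
  have hg := memLp_of_continuous (continuous_sphereGrad hΨ.1) 2 Ω
  have hd : MemLp (fun θ : Sph N => sphereGrad f θ - (f θ / φ θ) • A θ) 2
      ((surf N).restrict Ω) := by
    refine ⟨hg.1.sub hm, ?_⟩
    have h1 := (h.sphere_picone hΨ).trans_lt ENNReal.ofReal_lt_top
    rw [← eLpNorm_two_eq] at h1
    exact (ENNReal.pow_lt_top_iff.1 h1).resolve_right (by norm_num)
  have hq : MemLp (fun θ : Sph N => (f θ / φ θ) • A θ) 2 ((surf N).restrict Ω) := by
    refine (hg.sub hd).ae_eq (ae_of_all _ fun θ => ?_)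
    simp
  have hsub : Metric.ball θ₀ (ε / 4) ⊆ Ω := (Metric.ball_subset_ball (by linarith)).trans hball
  refine ⟨Metric.ball θ₀ (ε / 4), mem_nhdsWithin_of_mem_nhds (Metric.ball_mem_nhds _ (by positivity)),
    (integrableOn_of_memLp_sphere hq _ hsub).congr ?_⟩
  filter_upwards [ae_restrict_mem Metric.isOpen_ball.measurableSet] with θ hθ
  have : f (θ : EuclideanSpace ℝ (Fin N)) = 1 :=
    f.one_of_mem_closedBall (Metric.mem_closedBall.2 (Metric.mem_ball.1 hθ).le)
  rw [this, one_div]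

/-- Equality in Picone's inequality: the gradient of a minimizer is proportional to that of `φ`.
Picone's inequality passes from test functions to the minimizer by Fatou's lemma. -/
lemma gradient_eq_of_energy_eq (h : IsSeparatedSuper Ω ρ u G v φ A) {φ₁ : Sph N → ℝ}
    {G₁ : Sph N → EuclideanSpace ℝ (Fin N)} (h1 : MemH10 Ω φ₁ G₁)
    (hE : ∫ θ in Ω, ‖G₁ θ‖ ^ 2 ∂(surf N) =
      dirichletEigenvalue Ω * ∫ θ in Ω, φ₁ θ ^ 2 ∂(surf N)) :
    ∀ᵐ θ ∂((surf N).restrict Ω), G₁ θ = (φ₁ θ / φ θ) • A θ := by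
  obtain ⟨Ψ, hΨ, a1, a2⟩ := h1.approx
  have c1 : Tendsto (fun n => (hΨ n).toL2) atTop (𝓝 (h1.memLp.toLp φ₁)) := tendsto_toLp _ _ a1
  have c2 : Tendsto (fun n => (hΨ n).gradL2) atTop (𝓝 (h1.memLp_grad.toLp G₁)) :=
    tendsto_toLp _ _ a2
  have hR : Tendsto (fun n => ENNReal.ofReal ((∫ θ in Ω, ‖sphereGrad (Ψ n) θ‖ ^ 2 ∂(surf N)) -
      dirichletEigenvalue Ω * ∫ θ in Ω, Ψ n θ ^ 2 ∂(surf N))) atTop (𝓝 0) := by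
    have := ((c2.norm.pow 2).sub ((c1.norm.pow 2).const_mul (dirichletEigenvalue Ω)))
    simp only [IsSphereTest.norm_toL2_sq, IsSphereTest.norm_gradL2_sq, norm_toLp_sq] at this
    have h0 : (∫ θ in Ω, ‖G₁ θ‖ ^ 2 ∂(surf N)) -
        dirichletEigenvalue Ω * ∫ θ in Ω, ‖φ₁ θ‖ ^ 2 ∂(surf N) = 0 := by
      rw [hE]; simp
    rw [h0] at this
    have h2 := (ENNReal.continuous_ofReal.tendsto _).comp this
    rw [ENNReal.ofReal_zero] at h2
    exact h2
  -- a subsequence along which the functions and their gradients converge almost everywhere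
  obtain ⟨ns, hns, hae1⟩ := (tendstoInMeasure_of_tendsto_eLpNorm two_ne_zero
    (fun n => (memLp_of_continuous (hΨ n).continuous 2 Ω).1) h1.memLp.1 a1).exists_seq_tendsto_ae
  obtain ⟨ms, hms, hae2⟩ := (tendstoInMeasure_of_tendsto_eLpNorm two_ne_zero
    (fun n => (memLp_of_continuous (continuous_sphereGrad (hΨ (ns n)).1) 2 Ω).1) h1.memLp_grad.1
    (a2.comp hns.tendsto_atTop)).exists_seq_tendsto_ae
  have hks : Tendsto (fun n => ns (ms n)) atTop atTop := hns.tendsto_atTop.comp hms.tendsto_atTop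
  have hmeas : ∀ n, AEMeasurable (fun θ : Sph N =>
      ‖sphereGrad (Ψ n) θ - (Ψ n θ / φ θ) • A θ‖ₑ ^ 2) ((surf N).restrict Ω) := fun n => by
    have hm : AEStronglyMeasurable (fun θ : Sph N => (Ψ n θ / φ θ) • A θ) ((surf N).restrict Ω) :=
      ((hΨ n).continuous.measurable.aemeasurable.div
        h.φ_aesm.aemeasurable).aestronglyMeasurable.smul h.A_aesm
    exact ((continuous_sphereGrad (hΨ n).1).aestronglyMeasurable.sub hm).enorm.pow_const 2
  have hF : ∫⁻ θ in Ω, ‖G₁ θ - (φ₁ θ / φ θ) • A θ‖ₑ ^ 2 ∂(surf N) ≤ 0 := by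
    calc ∫⁻ θ in Ω, ‖G₁ θ - (φ₁ θ / φ θ) • A θ‖ₑ ^ 2 ∂(surf N)
        = ∫⁻ θ in Ω, liminf (fun n => ‖sphereGrad (Ψ (ns (ms n))) θ -
            (Ψ (ns (ms n)) θ / φ θ) • A θ‖ₑ ^ 2) atTop ∂(surf N) := by
          refine lintegral_congr_ae ?_
          filter_upwards [hae1, hae2] with θ hθ1 hθ2
          have t1 : Tendsto (fun n => (Ψ (ns (ms n)) θ / φ θ) • A θ) atTop
              (𝓝 ((φ₁ θ / φ θ) • A θ)) :=
            ((hθ1.comp hms.tendsto_atTop).div_const _).smul_const _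
          exact (ENNReal.Tendsto.pow ((continuous_enorm.tendsto _).comp (hθ2.sub t1))).liminf_eq.symm
      _ ≤ liminf (fun n => ∫⁻ θ in Ω, ‖sphereGrad (Ψ (ns (ms n))) θ -
            (Ψ (ns (ms n)) θ / φ θ) • A θ‖ₑ ^ 2 ∂(surf N)) atTop :=
          lintegral_liminf_le' fun n => hmeas _
      _ ≤ liminf (fun n => ENNReal.ofReal
            ((∫ θ in Ω, ‖sphereGrad (Ψ (ns (ms n))) θ‖ ^ 2 ∂(surf N)) -
              dirichletEigenvalue Ω * ∫ θ in Ω, Ψ (ns (ms n)) θ ^ 2 ∂(surf N))) atTop :=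
          liminf_le_liminf (Eventually.of_forall fun n => h.sphere_picone (hΨ _))
      _ = 0 := (hR.comp hks).liminf_eq
  have hm : AEMeasurable (fun θ => ‖G₁ θ - (φ₁ θ / φ θ) • A θ‖ₑ ^ 2) ((surf N).restrict Ω) :=
    (h1.memLp_grad.1.sub ((h1.memLp.1.aemeasurable.div
      h.φ_aesm.aemeasurable).aestronglyMeasurable.smul h.A_aesm)).enorm.pow_const 2
  have h0 := (lintegral_eq_zero_iff' hm).1 (le_antisymm hF zero_le)
  filter_upwards [h0] with θ hθ
  have : ‖G₁ θ - (φ₁ θ / φ θ) • A θ‖ₑ = 0 := by simpa using hθ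
  exact sub_eq_zero.1 (enorm_eq_zero.1 this)

/-- A function in `H¹_0(Ω)` that attains `λ₁` is a multiple of `φ`. -/
theorem eq_const_mul (h : IsSeparatedSuper Ω ρ u G v φ A) {φ₁ : Sph N → ℝ}
    {G₁ : Sph N → EuclideanSpace ℝ (Fin N)} (h1 : MemH10 Ω φ₁ G₁)
    (hE : ∫ θ in Ω, ‖G₁ θ‖ ^ 2 ∂(surf N) =
      dirichletEigenvalue Ω * ∫ θ in Ω, φ₁ θ ^ 2 ∂(surf N)) :
    ∃ k : ℝ, ∀ᵐ θ ∂((surf N).restrict Ω), φ₁ θ = k * φ θ := by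
  have hρ := h.nonneg
  have hΩm := h.isOpen.measurableSet
  have hposC := ae_cone_of_ae_sphere hΩm hρ h.φpos
  obtain ⟨k, hk⟩ := eq_const_mul_of_gradients (isOpen_cone h.isOpen hρ)
    (isPreconnected_cone h.isConnected hρ) h.angular (h1.isWeakPair h.isOpen hρ) hposC
    (by
      filter_upwards [ae_cone_of_ae_sphere hΩm hρ (h.gradient_eq_of_energy_eq h1 hE), hposC]
        with x hx hx0
      rw [hx, smul_smul, smul_smul, smul_smul]
      congr 1
      field_simp)
    (by
      have := locallyIntegrableOn_polar_prod (a := fun r => r⁻¹) h.isOpen hρ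
        (fun I hI hIρ => (continuousOn_id.inv₀ fun r hr =>
          (hρ.trans_lt (hIρ hr)).ne').integrableOn_compact hI)
        h.integrableOn_log_gradient
      refine LocallyIntegrableOn.congr_on this (ae_of_all _ fun x => ?_)
      rw [smul_comm])
  exact ⟨k, ae_sphere_of_ae_cone hΩm hρ hk⟩

end IsSeparatedSuper

end Uniqueness


/-! ### The radial equation -/

section Radial

variable {N : ℕ} [Fact (2 ≤ N)]

set_option linter.unusedSectionVars false

variable {Ω : Set (Sph N)} {ρ : ℝ} {u : EuclideanSpace ℝ (Fin N) → ℝ}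
  {G : EuclideanSpace ℝ (Fin N) → EuclideanSpace ℝ (Fin N)} {v : ℝ → ℝ} {φ : Sph N → ℝ}
  {A : Sph N → EuclideanSpace ℝ (Fin N)} {Ψ : EuclideanSpace ℝ (Fin N) → ℝ}

/-- The radial derivative of `u`, averaged over the sphere with weight `Ψ`. -/
noncomputable def radialTrace (Ω : Set (Sph N))
    (G : EuclideanSpace ℝ (Fin N) → EuclideanSpace ℝ (Fin N))
    (Ψ : EuclideanSpace ℝ (Fin N) → ℝ) (r : ℝ) : ℝ :=
  ∫ θ in Ω, Ψ θ * ⟪G (pol (r, θ)), (θ : EuclideanSpace ℝ (Fin N))⟫ ∂(surf N)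

lemma integrable_sphere_mul (hΩ : MeasurableSet Ω) {f b : Sph N → ℝ}
    (hf : ∀ L, IsCompact L → L ⊆ Ω → IntegrableOn f L (surf N)) (hb : Continuous b)
    (hbΩ : tsupport b ⊆ Ω) : Integrable (fun θ => b θ * f θ) ((surf N).restrict Ω) := by
  have hL : IsCompact (tsupport b) := (isClosed_tsupport b).isCompact
  have h1 : IntegrableOn (fun θ => b θ * f θ) (tsupport b) (surf N) :=
    (hf _ hL hbΩ).continuousOn_mul hb.continuousOn hL
  refine IntegrableOn.of_forall_sdiff_eq_zero h1 hΩ fun θ hθ => ?_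
  rw [image_eq_zero_of_notMem_tsupport hθ.2, zero_mul]

lemma integrable_sphere_inner (hΩ : MeasurableSet Ω)
    (hf : ∀ L, IsCompact L → L ⊆ Ω → IntegrableOn A L (surf N)) (hΨ : IsSphereTest Ω Ψ) :
    Integrable (fun θ => ⟪A θ, sphereGrad Ψ θ⟫) ((surf N).restrict Ω) := by
  set L := tsupport fun θ : Sph N => Ψ θ
  have hL : IsCompact L := (isClosed_tsupport _).isCompact
  have hc := continuous_sphereGrad hΨ.1
  obtain ⟨C, hC⟩ := hL.exists_bound_of_continuousOn hc.continuousOn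
  have h0 := hf L hL hΨ.2
  have h1 : IntegrableOn (fun θ => ⟪A θ, sphereGrad Ψ θ⟫) L (surf N) := by
    refine (h0.norm.mul_const C).mono' (h0.1.inner hc.aestronglyMeasurable) ?_
    filter_upwards [ae_restrict_mem hL.measurableSet] with θ hθ
    exact (norm_inner_le_norm _ _).trans (mul_le_mul_of_nonneg_left (hC θ hθ) (norm_nonneg _))
  refine IntegrableOn.of_forall_sdiff_eq_zero h1 hΩ fun θ hθ => ?_
  rw [sphereGrad_eq_zero hΨ.1 hθ.2, inner_zero_right]

/-- The integrand of `radialTrace` on `I × Ω`. -/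
lemma integrable_radialTrace (hΩ : IsOpen Ω) (hρ : 0 ≤ ρ)
    (hG : LocallyIntegrableOn G (cone Ω ρ)) (hΨ : IsSphereTest Ω Ψ) {I : Set ℝ} (hI : IsCompact I)
    (hIρ : I ⊆ Ioi ρ) :
    Integrable (fun p : ℝ × Sph N => Ψ p.2 * ⟪G (pol p), (p.2 : EuclideanSpace ℝ (Fin N))⟫)
      ((volume.restrict I).prod ((surf N).restrict Ω)) := by
  set L := tsupport fun θ : Sph N => Ψ θ with hLdef
  have hL : IsCompact L := (isClosed_tsupport _).isCompact
  have h1 := IsSeparated.integrable_pol hG hΩ hρ hI hIρ hL hΨ.2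
  obtain ⟨C, hC⟩ := hL.exists_bound_of_continuousOn hΨ.continuous.continuousOn
  have hc : Continuous fun p : ℝ × Sph N => Ψ p.2 := hΨ.continuous.comp continuous_snd
  have hc2 : Continuous fun p : ℝ × Sph N => (p.2 : EuclideanSpace ℝ (Fin N)) := by fun_prop
  rw [Measure.prod_restrict] at h1 ⊢
  have h2 : IntegrableOn (fun p : ℝ × Sph N =>
      Ψ p.2 * ⟪G (pol p), (p.2 : EuclideanSpace ℝ (Fin N))⟫) (I ×ˢ L) (volume.prod (surf N)) := by
    refine (h1.norm.const_mul C).mono'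
      (hc.aestronglyMeasurable.mul (h1.1.inner hc2.aestronglyMeasurable)) ?_
    filter_upwards [ae_restrict_mem (hI.measurableSet.prod hL.measurableSet)] with p hp
    rw [norm_mul]
    refine mul_le_mul (hC _ hp.2) ((norm_inner_le_norm _ _).trans ?_) (norm_nonneg _)
      ((norm_nonneg _).trans (hC _ hp.2))
    rw [norm_sph, mul_one]
  refine IntegrableOn.of_forall_sdiff_eq_zero h2 (hI.measurableSet.prod hΩ.measurableSet)
    fun p hp => ?_
  have : p.2 ∉ L := fun h => hp.2 ⟨hp.1.1, h⟩
  rw [image_eq_zero_of_notMem_tsupport (f := fun θ : Sph N => Ψ θ) this, zero_mul]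

lemma integrable_mul_radialTrace (hΩ : IsOpen Ω) (hρ : 0 ≤ ρ)
    (hG : LocallyIntegrableOn G (cone Ω ρ)) (hΨ : IsSphereTest Ω Ψ) {κ : ℝ → ℝ}
    (hκ : Continuous κ) (hκc : HasCompactSupport κ) (hκρ : tsupport κ ⊆ Ioi ρ) :
    Integrable (fun p : ℝ × Sph N => κ p.1 *
      (Ψ p.2 * ⟪G (pol p), (p.2 : EuclideanSpace ℝ (Fin N))⟫)) (polMeasure Ω ρ) := by
  have h1 := integrable_radialTrace hΩ hρ hG hΨ hκc hκρ
  obtain ⟨C, hC⟩ := hκ.bounded_above_of_compact_support hκc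
  have h2 := h1.bdd_mul (c := C) (f := fun p : ℝ × Sph N => κ p.1)
    (hκ.comp continuous_fst).aestronglyMeasurable (ae_of_all _ fun p => hC p.1)
  unfold polMeasure
  rw [Measure.prod_restrict] at h2 ⊢
  refine IntegrableOn.of_forall_sdiff_eq_zero h2 (measurableSet_Ioi.prod hΩ.measurableSet)
    fun p hp => ?_
  have : p.1 ∉ tsupport κ := fun h => hp.2 ⟨h, hp.1.2⟩
  rw [image_eq_zero_of_notMem_tsupport this, zero_mul]

lemma integral_mul_radialTrace (hΩ : IsOpen Ω) (hρ : 0 ≤ ρ)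
    (hG : LocallyIntegrableOn G (cone Ω ρ)) (hΨ : IsSphereTest Ω Ψ) {κ : ℝ → ℝ}
    (hκ : Continuous κ) (hκc : HasCompactSupport κ) (hκρ : tsupport κ ⊆ Ioi ρ) :
    ∫ p, κ p.1 * (Ψ p.2 * ⟪G (pol p), (p.2 : EuclideanSpace ℝ (Fin N))⟫) ∂(polMeasure Ω ρ) =
      ∫ r in Ioi ρ, κ r * radialTrace Ω G Ψ r := by
  have h1 := integrable_mul_radialTrace hΩ hρ hG hΨ hκ hκc hκρ
  unfold polMeasure at h1 ⊢
  rw [integral_prod _ h1]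
  simp only [integral_const_mul]
  rfl

/-- The Cauchy–Schwarz inequality. -/
lemma sq_integral_mul_le {α : Type*} {mα : MeasurableSpace α} {μ : Measure α} {f g : α → ℝ}
    (hf : MemLp f 2 μ) (hg : MemLp g 2 μ) :
    (∫ x, f x * g x ∂μ) ^ 2 ≤ (∫ x, f x ^ 2 ∂μ) * ∫ x, g x ^ 2 ∂μ := by
  have h1 := real_inner_mul_inner_self_le (hg.toLp g) (hf.toLp f)
  rw [real_inner_self_eq_norm_sq, real_inner_self_eq_norm_sq, norm_toLp_sq, norm_toLp_sq,
    inner_toLp] at h1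
  simpa [sq, mul_comm] using h1

namespace IsSeparatedSuper

/-- The weak derivative of `v`: Euler's relation for `κ(|x|) Ψ(x/|x|)` with `κ = η r⁻ᴺ`, for which
`r κ' + N κ = r^{-(N-1)} η'`. -/
lemma isWeakPair_radial (h : IsSeparatedSuper Ω ρ u G v φ A) (hΨ : IsSphereTest Ω Ψ)
    (hS : ∫ θ in Ω, φ θ * Ψ θ ∂(surf N) = 1) :
    IsWeakPair (Ioi ρ) v (radialTrace Ω G Ψ) := by
  have hN : 2 ≤ N := Fact.out
  have hρ := h.nonneg
  have hΩm := h.isOpen.measurableSet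
  have lv := h.toIsSeparated.locallyIntegrableOn_v h.isOpen h.isConnected.nonempty hρ
  have lg : LocallyIntegrableOn (radialTrace Ω G Ψ) (Ioi ρ) := by
    rw [locallyIntegrableOn_iff isOpen_Ioi.isLocallyClosed]
    exact fun I hIρ hI =>
      (integrable_radialTrace h.isOpen hρ h.weak.locG hΨ hI hIρ).integral_prod_left
  refine IsWeakPair.of_integral_fderiv lv lg fun η hη e => ?_
  set κ : ℝ → ℝ := fun r => η r * (r ^ N)⁻¹ with hκdef
  have hκ : IsTest (Ioi ρ) κ := hη.mul_smooth fun r hr =>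
    (contDiffAt_id.pow N).inv (pow_ne_zero _ (hρ.trans_lt hr).ne')
  have hη_eq : ∀ r, ρ < r → η r = r ^ N * κ r := fun r hr => by
    have : r ^ N ≠ 0 := pow_ne_zero _ (hρ.trans_lt hr).ne'
    rw [hκdef]; field_simp
  have hpow : ∀ r : ℝ, r ^ N = r ^ (N - 1) * r := fun r => by
    rw [← pow_succ]; congr 1; omega
  have hηd : ∀ r, ρ < r → deriv η r = r ^ (N - 1) * (r * deriv κ r + N * κ r) := fun r hr => by
    have h1 : η =ᶠ[𝓝 r] fun r => r ^ N * κ r := by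
      filter_upwards [isOpen_Ioi.mem_nhds hr] with s hs using hη_eq s hs
    have h2 : HasDerivAt (fun r => r ^ N * κ r) (N * r ^ (N - 1) * κ r + r ^ N * deriv κ r) r :=
      (hasDerivAt_pow N r).mul (hκ.differentiable r).hasDerivAt
    rw [h1.deriv_eq, h2.deriv, hpow]
    ring
  have hw := isTest_prodTest hρ hκ hΨ
  obtain ⟨-, hE⟩ := h.weak.integral_euler hw
  have e1 : ∫ x in cone Ω ρ, u x * (fderiv ℝ (prodTest κ Ψ) x x + N * prodTest κ Ψ x) =
      ∫ r in Ioi ρ, v r * deriv η r := by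
    have e0 : ∫ r in Ioi ρ, v r * deriv η r =
        (∫ r in Ioi ρ, v r * deriv η r) * ∫ θ in Ω, φ θ * Ψ θ ∂(surf N) := by rw [hS, mul_one]
    rw [integral_cone hΩm hρ, e0, ← integral_prod_mul (fun r => v r * deriv η r) (fun θ : Sph N => φ θ * Ψ θ)]
    refine integral_congr_ae ?_
    filter_upwards [ae_polMeasure_mem hΩm ρ] with q hq
    have h0 : 0 < q.1 := hρ.trans_lt hq.1
    have hu : u (pol q) = v q.1 * φ q.2 := h.eq q.1 hq.1 q.2 hq.2
    have e3 : fderiv ℝ (prodTest κ Ψ) (pol q) (pol q) = q.1 * deriv κ q.1 * Ψ q.2 := by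
      rw [← inner_gradient_left, gradient_prodTest hΨ.1 h0 (hκ.differentiable _), pol,
        inner_smul_right, inner_add_left, inner_smul_left, inner_smul_left, inner_sphereGrad_self,
        real_inner_self_eq_norm_sq, norm_sph]
      simp only [RCLike.conj_to_real]
      ring
    rw [e3, prodTest_pol h0, hu, hηd _ hq.1, smul_eq_mul]
    ring
  have e2 : ∫ x in cone Ω ρ, prodTest κ Ψ x * ⟪G x, x⟫ =
      ∫ r in Ioi ρ, η r * radialTrace Ω G Ψ r := by
    rw [integral_cone hΩm hρ, ← integral_mul_radialTrace h.isOpen hρ h.weak.locG hΨ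
      hη.smooth.continuous hη.compact hη.supp]
    refine integral_congr_ae ?_
    filter_upwards [ae_polMeasure_mem hΩm ρ] with q hq
    have h0 : 0 < q.1 := hρ.trans_lt hq.1
    have e3 : ⟪G (pol q), pol q⟫ = q.1 * ⟪G (pol q), (q.2 : EuclideanSpace ℝ (Fin N))⟫ := by
      conv_lhs => rw [pol, inner_smul_right]
      rfl
    rw [e3, prodTest_pol h0, hη_eq _ hq.1, smul_eq_mul, hpow]
    ring
  rw [e1, e2] at hE
  have e4 : ∀ r, fderiv ℝ η r e = e * deriv η r := fun r => by
    rw [← fderiv_apply_one_eq_deriv]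
    conv_lhs => rw [← mul_one e, ← smul_eq_mul, map_smul, smul_eq_mul]
  simp only [e4, mul_left_comm _ e]
  rw [integral_const_mul, hE, mul_neg, ← integral_const_mul]
  congr 1
  refine integral_congr_ae (ae_of_all _ fun r => ?_)
  simp only [real_inner_comm]
  simp
  ring

/-- `v` is locally square integrable: on almost every ray it is a multiple of `u`. -/
lemma memLp_radial (h : IsSeparatedSuper Ω ρ u G v φ A) (I : Set ℝ) (hI : IsCompact I)
    (hIρ : I ⊆ Ioi ρ) : MemLp v 2 (volume.restrict I) := by
  have hρ := h.nonneg
  have hΩm := h.isOpen.measurableSet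
  obtain ⟨θ₀, hθ₀⟩ := h.isConnected.nonempty
  obtain ⟨ε, hε, hball⟩ := Metric.nhds_basis_closedBall.mem_iff.1 (h.isOpen.mem_nhds hθ₀)
  set L := Metric.closedBall θ₀ ε with hLdef
  have hL : IsCompact L := Metric.isClosed_closedBall.isCompact
  have hKc : pol '' (I ×ˢ L) ⊆ cone Ω ρ := by
    rintro x ⟨p, hp, rfl⟩
    exact pol_mem_cone hρ (hIρ hp.1) (hball hp.2)
  have hu2 := (h.mem.memLp _ ((hI.prod hL).image continuous_pol) hKc).integrable_sq
  have hi := ((integrableOn_pol_image_iff hΩm hρ hI hIρ hL hball).1 hu2).prod_left_ae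
  have hne : (ae ((surf N).restrict L)).NeBot := by
    rw [ae_neBot, Ne, Measure.restrict_eq_zero]
    exact (Metric.measure_closedBall_pos (surf N) θ₀ hε).ne'
  have hp : ∀ᵐ θ ∂((surf N).restrict L), 0 < φ θ :=
    ae_mono (Measure.restrict_mono hball le_rfl) h.φpos
  obtain ⟨θ, ⟨h1, h2⟩, h3⟩ := (Eventually.and (Eventually.and hi hp)
    (ae_restrict_mem hL.measurableSet)).exists
  have hvm : AEStronglyMeasurable v (volume.restrict I) :=
    (h.toIsSeparated.integrableOn_v h.isOpen h.isConnected.nonempty hρ I hI hIρ).1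
  rw [memLp_two_iff_integrable_sq hvm]
  refine (h1.mul_const (φ θ ^ 2)⁻¹).congr ?_
  filter_upwards [ae_restrict_mem hI.measurableSet] with r hr
  have : u (pol (r, θ)) = v r * φ θ := h.eq r (hIρ hr) θ (hball h3)
  rw [this, mul_pow, mul_assoc, mul_inv_cancel₀ (pow_ne_zero 2 h2.ne'), mul_one]

/-- The averaged radial derivative is locally square integrable. -/
lemma memLp_radialTrace (h : IsSeparatedSuper Ω ρ u G v φ A) (hΨ : IsSphereTest Ω Ψ) (I : Set ℝ)
    (hI : IsCompact I) (hIρ : I ⊆ Ioi ρ) : MemLp (radialTrace Ω G Ψ) 2 (volume.restrict I) := by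
  have hρ := h.nonneg
  have hΩm := h.isOpen.measurableSet
  set L := tsupport fun θ : Sph N => Ψ θ with hLdef
  have hL : IsCompact L := (isClosed_tsupport _).isCompact
  have hLΩ : L ⊆ Ω := hΨ.2
  have hKc : pol '' (I ×ˢ L) ⊆ cone Ω ρ := by
    rintro x ⟨p, hp, rfl⟩
    exact pol_mem_cone hρ (hIρ hp.1) (hLΩ hp.2)
  have hG1 := IsSeparated.integrable_pol h.weak.locG h.isOpen hρ hI hIρ hL hLΩ
  have hG2 := (integrableOn_pol_image_iff hΩm hρ hI hIρ hL hLΩ).1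
    (h.mem.memLp_grad _ ((hI.prod hL).image continuous_pol) hKc).norm.integrable_sq
  have hgm : AEStronglyMeasurable (radialTrace Ω G Ψ) (volume.restrict I) :=
    (integrable_radialTrace h.isOpen hρ h.weak.locG hΨ hI hIρ).integral_prod_left.1
  rw [memLp_two_iff_integrable_sq hgm]
  have hΨ2 : MemLp (fun θ : Sph N => Ψ θ) 2 ((surf N).restrict L) :=
    memLp_of_continuous hΨ.continuous 2 L
  refine (hG2.integral_prod_left.const_mul (∫ θ in L, Ψ θ ^ 2 ∂(surf N))).mono' (hgm.pow 2) ?_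
  filter_upwards [hG1.prod_right_ae, hG2.prod_right_ae] with r h1 h2
  have hm : AEStronglyMeasurable (fun θ : Sph N =>
      ⟪G (pol (r, θ)), (θ : EuclideanSpace ℝ (Fin N))⟫) ((surf N).restrict L) :=
    h1.1.inner continuous_subtype_val.aestronglyMeasurable
  have hle : ∀ θ : Sph N, ‖⟪G (pol (r, θ)), (θ : EuclideanSpace ℝ (Fin N))⟫‖ ≤
      ‖G (pol (r, θ))‖ := fun θ => by
    simpa [norm_sph] using norm_inner_le_norm (𝕜 := ℝ) (G (pol (r, θ)))
      (θ : EuclideanSpace ℝ (Fin N))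
  have hg : MemLp (fun θ : Sph N => ⟪G (pol (r, θ)), (θ : EuclideanSpace ℝ (Fin N))⟫) 2
      ((surf N).restrict L) := by
    have h3 : MemLp (fun θ : Sph N => G (pol (r, θ))) 2 ((surf N).restrict L) :=
      (memLp_two_iff_integrable_sq_norm h1.1).2 h2
    exact h3.norm.mono hm (ae_of_all _ fun θ => by rw [norm_norm]; exact hle θ)
  have e : radialTrace Ω G Ψ r =
      ∫ θ in L, Ψ θ * ⟪G (pol (r, θ)), (θ : EuclideanSpace ℝ (Fin N))⟫ ∂(surf N) := by
    refine setIntegral_eq_of_subset_of_forall_sdiff_eq_zero hΩm hLΩ fun θ hθ => ?_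
    rw [image_eq_zero_of_notMem_tsupport (f := fun θ : Sph N => Ψ θ) hθ.2, zero_mul]
  rw [Real.norm_of_nonneg (sq_nonneg _), e]
  refine (sq_integral_mul_le hΨ2 hg).trans ?_
  refine mul_le_mul_of_nonneg_left ?_ (integral_nonneg fun _ => sq_nonneg _)
  refine integral_mono hg.integrable_sq h2 fun θ => ?_
  have := hle θ
  rw [Real.norm_eq_abs] at this
  exact sq_le_sq' (by linarith [neg_abs_le ⟪G (pol (r, θ)), (θ : EuclideanSpace ℝ (Fin N))⟫])
    ((le_abs_self _).trans this)

/-- The radial inequality for a smooth test function `η`: the super-solution in the cone is tested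
with `η(|x|) Ψ(x/|x|)`, and the angular terms combine by the eigenvalue equation for `φ`. -/
lemma radial_inequality (h : IsSeparatedSuper Ω ρ u G v φ A) (hΨ : IsSphereTest Ω Ψ)
    (hΨ0 : ∀ x, 0 ≤ Ψ x) (hS : ∫ θ in Ω, φ θ * Ψ θ ∂(surf N) = 1)
    (hA : ∫ θ in Ω, ⟪A θ, sphereGrad Ψ θ⟫ ∂(surf N) = dirichletEigenvalue Ω) {η : ℝ → ℝ}
    (hη : IsTest (Ioi ρ) η) (hη0 : ∀ r, 0 ≤ η r) :
    0 ≤ ∫ r in Ioi ρ, r ^ (N - 1) *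
      (radialTrace Ω G Ψ r * deriv η r - hardyConst N / r ^ 2 * v r * η r) := by
  have hρ := h.nonneg
  have hΩm := h.isOpen.measurableSet
  set lam := dirichletEigenvalue Ω with hlam
  have lv := h.toIsSeparated.locallyIntegrableOn_v h.isOpen h.isConnected.nonempty hρ
  have hw := isTest_prodTest hρ hη hΨ
  have hz := h.super _ _ (hw.isSobolevTest (isOpen_cone h.isOpen hρ))
    (ae_of_all _ fun x => mul_nonneg (hη0 _) (hΨ0 _))
  rw [integral_cone hΩm hρ] at hz
  set κ₁ : ℝ → ℝ := fun r => r ^ (N - 1) * deriv η r with hκ₁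
  set κ₂ : ℝ → ℝ := fun r => η r * (r ^ (N - 1) / r ^ 2) with hκ₂
  have h2 : IsTest (Ioi ρ) κ₂ := hη.mul_smooth fun r hr =>
    (contDiffAt_id.pow _).div (contDiffAt_id.pow 2) (pow_ne_zero 2 (hρ.trans_lt hr).ne')
  have hd : Continuous (deriv η) := hη.smooth.continuous_deriv (by simp)
  have h1c : Continuous κ₁ := (continuous_pow _).mul hd
  have h1t : tsupport κ₁ ⊆ tsupport η :=
    (tsupport_mul_subset_right (f := fun r : ℝ => r ^ (N - 1))).trans (tsupport_deriv_subset)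
  have h1s : HasCompactSupport κ₁ := hη.compact.of_isClosed_subset (isClosed_tsupport _) h1t
  have iv : IntegrableOn (fun r => v r * κ₂ r) (Ioi ρ) :=
    (LocallyIntegrableOn.integrable_mul lv h2.smooth.continuous h2.compact h2.supp).integrableOn
  have ig : IntegrableOn (fun r => κ₁ r * radialTrace Ω G Ψ r) (Ioi ρ) := by
    have := LocallyIntegrableOn.integrable_smul (h.isWeakPair_radial hΨ hS).locG h1c h1s
      (h1t.trans hη.supp)
    exact this.integrableOn
  have iφ : Integrable (fun θ : Sph N => φ θ * Ψ θ) ((surf N).restrict Ω) := by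
    simpa only [mul_comm] using integrable_sphere_mul hΩm (h.integrableOn_φ h.isOpen hρ)
      hΨ.continuous hΨ.2
  have iA := integrable_sphere_inner hΩm h.integrableOn_grad hΨ
  have k1 := integrable_mul_radialTrace h.isOpen hρ h.weak.locG hΨ h1c h1s (h1t.trans hη.supp)
  have k2 := iv.mul_prod iA
  have k3 := (iv.mul_prod iφ).const_mul (hardyConst N + lam)
  have k23 := Integrable.sub k2 k3
  simp only [Pi.sub_def] at k23
  have e1 : ∀ᵐ q ∂(polMeasure Ω ρ), q.1 ^ (N - 1) • ((1:ℝ) *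
      (⟪G (pol q), gradient (prodTest η Ψ) (pol q)⟫ -
        (hardyConst N + lam) / ‖pol q‖ ^ 2 * u (pol q) * prodTest η Ψ (pol q))) =
      κ₁ q.1 * (Ψ q.2 * ⟪G (pol q), (q.2 : EuclideanSpace ℝ (Fin N))⟫) +
      ((v q.1 * κ₂ q.1) * ⟪A q.2, sphereGrad Ψ q.2⟫ -
        (hardyConst N + lam) * ((v q.1 * κ₂ q.1) * (φ q.2 * Ψ q.2))) := by
    filter_upwards [ae_polMeasure_mem hΩm ρ, h.gradient_eq] with q hq hGq
    have h0 : 0 < q.1 := hρ.trans_lt hq.1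
    have hu : u (pol q) = v q.1 * φ q.2 := h.eq q.1 hq.1 q.2 hq.2
    have hi : ⟪G (pol q), sphereGrad Ψ q.2⟫ = v q.1 / q.1 * ⟪A q.2, sphereGrad Ψ q.2⟫ := by
      rw [hGq, inner_add_left, inner_smul_left, inner_smul_left,
        real_inner_comm _ (q.2 : EuclideanSpace ℝ (Fin N)), inner_sphereGrad_self]
      simp
    rw [gradient_prodTest hΨ.1 h0 (hη.differentiable _), prodTest_pol h0, norm_pol _ h0.le, hu,
      inner_add_right, inner_smul_right, inner_smul_right, hi, smul_eq_mul, hκ₁, hκ₂]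
    field_simp
    ring
  rw [integral_congr_ae e1] at hz
  have e2 := integral_mul_radialTrace h.isOpen hρ h.weak.locG hΨ h1c h1s (h1t.trans hη.supp)
  unfold polMeasure at hz e2 k1
  rw [integral_add k1 k23, integral_sub k2 k3, integral_const_mul, e2,
    integral_prod_mul (fun r => v r * κ₂ r) (fun θ => ⟪A θ, sphereGrad Ψ θ⟫),
    integral_prod_mul (fun r => v r * κ₂ r) (fun θ : Sph N => φ θ * Ψ θ), hS, hA] at hz
  have e3 : ∫ r in Ioi ρ, r ^ (N - 1) *
      (radialTrace Ω G Ψ r * deriv η r - hardyConst N / r ^ 2 * v r * η r) =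
      (∫ r in Ioi ρ, κ₁ r * radialTrace Ω G Ψ r) - hardyConst N * ∫ r in Ioi ρ, v r * κ₂ r := by
    rw [← integral_const_mul, ← integral_sub ig (iv.const_mul _)]
    refine integral_congr_ae (ae_of_all _ fun r => ?_)
    simp only [hκ₁, hκ₂]
    ring
  rw [e3]
  linarith

end IsSeparatedSuper

/-- A compact subset of a half-line has a neighbourhood on which some test function is `1`. -/
lemma exists_cutoff {K : Set ℝ} (hK : IsCompact K) (hKρ : K ⊆ Ioi ρ) :
    ∃ χ : ℝ → ℝ, IsTest (Ioi ρ) χ ∧ (∀ r, 0 ≤ χ r) ∧ ∀ r ∈ K, χ =ᶠ[𝓝 r] 1 := by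
  rcases K.eq_empty_or_nonempty with rfl | hne
  · exact ⟨0, ⟨contDiff_const, HasCompactSupport.zero, by simp⟩, by simp, by simp⟩
  obtain ⟨a, haK, ha⟩ := hK.exists_isLeast hne
  obtain ⟨b, hbK, hb⟩ := hK.exists_isGreatest hne
  have hρa : ρ < a := hKρ haK
  have hab : a ≤ b := ha hbK
  let f : ContDiffBump ((a + b) / 2 : ℝ) :=
    { rIn := (b - a) / 2 + (a - ρ) / 3
      rOut := (b - a) / 2 + (a - ρ) / 2
      rIn_pos := by linarith
      rIn_lt_rOut := by linarith }
  refine ⟨f, ⟨f.contDiff, f.hasCompactSupport, fun r hr => ?_⟩, fun r => f.nonneg, fun r hr => ?_⟩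
  · rw [f.tsupport_eq, Metric.mem_closedBall, Real.dist_eq, abs_le] at hr
    have h1 : -((b - a) / 2 + (a - ρ) / 2) ≤ r - (a + b) / 2 := hr.1
    simp only [mem_Ioi]
    linarith
  · refine f.eventuallyEq_one_of_mem_ball ?_
    have h1 := ha hr
    have h2 := hb hr
    rw [Metric.mem_ball, Real.dist_eq, abs_lt]
    change -((b - a) / 2 + (a - ρ) / 3) < _ ∧ _ < (b - a) / 2 + (a - ρ) / 3
    constructor <;> linarith

lemma tendsto_integral_mul_of_L2 {α : Type*} {mα : MeasurableSpace α} {μ : Measure α}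
    {f : ℕ → α → ℝ} {g a : α → ℝ} (hf : ∀ n, MemLp (f n) 2 μ) (hg : MemLp g 2 μ) (ha : MemLp a 2 μ)
    (hfg : Tendsto (fun n => eLpNorm (fun x => f n x - g x) 2 μ) atTop (𝓝 0)) :
    Tendsto (fun n => ∫ x, a x * f n x ∂μ) atTop (𝓝 (∫ x, a x * g x ∂μ)) := by
  have h1 := Tendsto.inner (𝕜 := ℝ) (tendsto_toLp hf hg hfg)
    (tendsto_const_nhds (x := ha.toLp a) (f := atTop))
  simp only [inner_toLp] at h1
  exact h1

/-- The inequality for smooth test functions extends to Sobolev test functions, by mollification. -/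
lemma isRadialSuperSolution_of_smooth (hρ : 0 ≤ ρ) {g : ℝ → ℝ} (hv : MemH1Loc (Ioi ρ) v g)
    (h : ∀ η : ℝ → ℝ, IsTest (Ioi ρ) η → (∀ r, 0 ≤ η r) →
      0 ≤ ∫ r in Ioi ρ, r ^ (N - 1) * (g r * deriv η r - hardyConst N / r ^ 2 * v r * η r)) :
    IsRadialSuperSolution N ρ v := by
  refine ⟨g, hv, fun ζ Z hζ hζ0 => ?_⟩
  obtain ⟨K₀, hK₀, hK₀ρ, hζK⟩ := hζ.support
  -- the mollifications of `ζ` need not vanish outside a compact subset of the half-line: they are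
  -- multiplied by `χ`
  obtain ⟨χ, hχ, hχ0, hχ1⟩ := exists_cutoff hK₀ hK₀ρ
  set K := tsupport χ with hKdef
  have hK : IsCompact K := hχ.compact
  have hKρ : K ⊆ Ioi ρ := hχ.supp
  have hK₀K : K₀ ⊆ K := fun r hr => subset_tsupport χ (by
    rw [Function.mem_support, (hχ1 r hr).eq_of_nhds]; simp)
  have hζL : ∀ K' : Set ℝ, IsCompact K' → K' ⊆ Ioi ρ → MemLp ζ 2 (volume.restrict K') :=
    fun K' _ h' => hζ.memLp.mono_measure (Measure.restrict_mono h' le_rfl)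
  have hZL : ∀ K' : Set ℝ, IsCompact K' → K' ⊆ Ioi ρ → MemLp Z 2 (volume.restrict K') :=
    fun K' _ h' => hζ.memLp_grad.mono_measure (Measure.restrict_mono h' le_rfl)
  -- the weak derivative of `ζ` vanishes outside the support of `ζ`
  have hZ0 : ∀ᵐ r ∂(volume.restrict (Ioi ρ)), r ∉ K₀ → Z r = 0 := by
    have hpair := (MemH1Loc.mk hζL hZL hζ.weak).isWeakPair isOpen_Ioi
    have hV : IsOpen (Ioi ρ \ K₀) := isOpen_Ioi.sdiff hK₀.isClosed
    have h1 : IsWeakPair (Ioi ρ \ K₀) 0 Z := (hpair.mono sdiff_subset).congr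
      ((ae_restrict_iff' hV.measurableSet).2 (ae_of_all _ fun r hr => hζK r hr.2))
      (ae_of_all _ fun _ => rfl)
    have h2 : IsWeakPair (Ioi ρ \ K₀) 0 (0 : ℝ → ℝ) := by
      refine ⟨locallyIntegrable_zero.locallyIntegrableOn _,
        locallyIntegrable_zero.locallyIntegrableOn _, fun η _ _ _ => by simp⟩
    have h3 := (ae_restrict_iff' hV.measurableSet).1 (h1.unique hV h2)
    rw [ae_restrict_iff' measurableSet_Ioi]
    filter_upwards [h3] with r hr hrρ hrK using hr ⟨hrρ, hrK⟩
  obtain ⟨f, hfs, hf1, hf2, -, hf0, -⟩ := exists_smooth_approx isOpen_Ioi hK hKρ (p := 2) (by simp)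
    hζL hZL hζ.weak
  simp only [gradient_eq_deriv'] at hf2
  have hχc := hχ.smooth.continuous
  have hχd : Continuous (deriv χ) := hχ.smooth.continuous_deriv (by simp)
  have hη : ∀ n, IsTest (Ioi ρ) fun r => χ r * f n r := fun n =>
    hχ.mul_smooth fun r _ => (hfs n).contDiffAt
  have hηd : ∀ n r, deriv (fun r => χ r * f n r) r = deriv χ r * f n r + χ r * deriv (f n) r :=
    fun n r => deriv_fun_mul (hχ.differentiable r) ((hfs n).differentiable (by simp) r)
  -- the coefficients of `f n` and of its derivative
  have mulc : ∀ {b w : ℝ → ℝ}, ContinuousOn b K → MemLp w 2 (volume.restrict K) →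
      MemLp (fun r => b r * w r) 2 (volume.restrict K) := fun {b w} hb hw => by
    obtain ⟨C, hC⟩ := hK.exists_bound_of_continuousOn hb
    refine hw.of_le_mul (c := C) ((hb.aestronglyMeasurable hK.measurableSet).mul hw.1) ?_
    filter_upwards [ae_restrict_mem hK.measurableSet] with r hr
    rw [norm_mul]
    exact mul_le_mul_of_nonneg_right (hC r hr) (norm_nonneg _)
  have hr0 : ∀ r ∈ K, r ^ 2 ≠ 0 := fun r hr => pow_ne_zero 2 (hρ.trans_lt (hKρ hr)).ne'
  set α : ℝ → ℝ := fun r => (r ^ (N - 1) * deriv χ r) * g r -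
    (r ^ (N - 1) * (hardyConst N / r ^ 2) * χ r) * v r with hα
  set β : ℝ → ℝ := fun r => (r ^ (N - 1) * χ r) * g r with hβ
  have mα : MemLp α 2 (volume.restrict K) :=
    (mulc (by fun_prop) (hv.memLp_grad K hK hKρ)).sub
      (mulc (((continuous_pow _).continuousOn.mul (continuousOn_const.div
        (continuous_pow 2).continuousOn hr0)).mul hχc.continuousOn) (hv.memLp K hK hKρ))
  have mβ : MemLp β 2 (volume.restrict K) := mulc (by fun_prop) (hv.memLp_grad K hK hKρ)
  have hfin : IsFiniteMeasure (volume.restrict K) := ⟨by simpa using hK.measure_lt_top⟩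
  have mc : ∀ {b : ℝ → ℝ}, Continuous b → MemLp b 2 (volume.restrict K) := fun {b} hb => by
    simpa using mulc hb.continuousOn (memLp_const (1:ℝ))
  have mf : ∀ n, MemLp (f n) 2 (volume.restrict K) := fun n => mc (hfs n).continuous
  have mf' : ∀ n, MemLp (deriv (f n)) 2 (volume.restrict K) := fun n =>
    mc ((hfs n).continuous_deriv (by simp))
  have t := (tendsto_integral_mul_of_L2 mf (hζL K hK hKρ) mα hf1).add
    (tendsto_integral_mul_of_L2 mf' (hZL K hK hKρ) mβ hf2)
  have hn : ∀ n, 0 ≤ (∫ r in K, α r * f n r) + ∫ r in K, β r * deriv (f n) r := fun n => by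
    refine (h _ (hη n) fun r => mul_nonneg (hχ0 r) (hf0 hζ0 n r)).trans_eq ?_
    have i1 : IntegrableOn (fun r => α r * f n r) K := mα.integrable_mul (mf n)
    have i2 : IntegrableOn (fun r => β r * deriv (f n) r) K := mβ.integrable_mul (mf' n)
    rw [← integral_add i1 i2]
    rw [setIntegral_eq_of_subset_of_forall_sdiff_eq_zero measurableSet_Ioi hKρ]
    · refine integral_congr_ae (ae_of_all _ fun r => ?_)
      simp only [hηd, hα, hβ]
      ring
    · intro r hr
      have h1 : χ r = 0 := image_eq_zero_of_notMem_tsupport hr.2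
      have h2 : deriv χ r = 0 :=
        image_eq_zero_of_notMem_tsupport fun h' => hr.2 (tsupport_deriv_subset h')
      simp [hηd, h1, h2]
  have hlim := ge_of_tendsto' t hn
  refine hlim.trans_eq ?_
  have i1 : IntegrableOn (fun r => α r * ζ r) K := mα.integrable_mul (hζL K hK hKρ)
  have i2 : IntegrableOn (fun r => β r * Z r) K := mβ.integrable_mul (hZL K hK hKρ)
  have hZK := ae_mono (Measure.restrict_mono hKρ le_rfl) hZ0
  rw [← integral_add i1 i2, setIntegral_eq_of_subset_of_ae_sdiff_eq_zero
    (s := K) measurableSet_Ioi.nullMeasurableSet hKρ]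
  · refine integral_congr_ae ?_
    filter_upwards [hZK] with r hr
    by_cases hrK : r ∈ K₀
    · have h1 : χ r = 1 := (hχ1 r hrK).eq_of_nhds
      have h2 : deriv χ r = 0 := by
        rw [(hχ1 r hrK).deriv_eq]; exact deriv_const _ _
      simp only [hα, hβ, h1, h2]
      simp
      ring
    · simp [hr hrK, hζK r hrK]
  · filter_upwards [(ae_restrict_iff' measurableSet_Ioi).1 hZ0] with r hr hrm
    have hrK : r ∉ K₀ := fun h' => hrm.2 (hK₀K h')
    simp [hr hrm.1 hrK, hζK r hrK]

/-- If `φ` solves the eigenvalue equation, then `v` is a super-solution of the radial equation. -/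
theorem IsSeparatedSuper.isRadialSuperSolution (h : IsSeparatedSuper Ω ρ u G v φ A)
    (hA : ∀ Ψ, IsSphereTest Ω Ψ → ∫ θ in Ω, ⟪A θ, sphereGrad Ψ θ⟫ ∂(surf N) =
      dirichletEigenvalue Ω * ∫ θ in Ω, φ θ * Ψ θ ∂(surf N)) :
    IsRadialSuperSolution N ρ v := by
  obtain ⟨Ψ, hΨ, hΨ0, V, hV, hVne, hVΩ, hpos⟩ := exists_sphereTest h.isOpen h.isConnected.nonempty
  have hΩm := h.isOpen.measurableSet
  set S := ∫ θ in Ω, φ θ * Ψ θ ∂(surf N) with hSdef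
  have iφ : Integrable (fun θ : Sph N => φ θ * Ψ θ) ((surf N).restrict Ω) := by
    simpa only [mul_comm] using integrable_sphere_mul hΩm (h.integrableOn_φ h.isOpen h.nonneg)
      hΨ.continuous hΨ.2
  have hS : 0 < S := by
    rw [hSdef, integral_pos_iff_support_of_nonneg_ae
      (h.φpos.mono fun θ hθ => mul_nonneg hθ.le (hΨ0 _)) iφ]
    have h1 : 0 < (surf N).restrict Ω V := by
      rw [Measure.restrict_apply hV.measurableSet, inter_eq_left.2 hVΩ]
      exact hV.measure_pos _ hVne
    refine h1.trans_le (measure_mono_ae ?_)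
    filter_upwards [h.φpos] with θ hθ hθV
    exact (mul_pos hθ (hpos θ hθV)).ne'
  -- normalise the angular test function
  have h0 : IsSphereTest Ω fun _ => (0:ℝ) := ⟨contDiff_const, by simp [tsupport]⟩
  have hΨ' := h0.add_smul hΨ S⁻¹
  have hS' : ∫ θ in Ω, φ θ * (0 + S⁻¹ * Ψ θ) ∂(surf N) = 1 := by
    simp only [zero_add, mul_left_comm (φ _)]
    rw [integral_const_mul, ← hSdef, inv_mul_cancel₀ hS.ne']
  have hA' := hA _ hΨ'
  rw [hS', mul_one] at hA'
  exact isRadialSuperSolution_of_smooth h.nonneg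
    ⟨h.memLp_radial, h.memLp_radialTrace hΨ', (h.isWeakPair_radial hΨ' hS').weak⟩
    fun η hη hη0 => h.radial_inequality hΨ' (fun x => by have := hΨ0 x; positivity) hS' hA' hη hη0

end Radial


/-! ### Normalization and the separation of variables -/

lemma IsSuperSolution.const_mul {E : Type*} [NormedAddCommGroup E] [InnerProductSpace ℝ E]
    [CompleteSpace E] [MeasureSpace E] {U : Set E} {w V u : E → ℝ} (h : IsSuperSolution U w V u)
    {c : ℝ} (hc : 0 ≤ c) : IsSuperSolution U w V (fun x => c * u x) := by
  obtain ⟨G, hG, hsup⟩ := h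
  refine ⟨fun x => c • G x, ⟨fun K h1 h2 => (hG.memLp K h1 h2).const_mul c,
    fun K h1 h2 => (hG.memLp_grad K h1 h2).const_smul c, fun η h1 h2 h3 => ?_⟩,
    fun ζ Z hζ h0 => ?_⟩
  · simp only [mul_smul, smul_comm _ c]
    rw [integral_smul, integral_smul, hG.weak η h1 h2 h3, smul_neg]
  · have h1 := mul_nonneg hc (hsup ζ Z hζ h0)
    rw [← integral_const_mul] at h1
    refine h1.trans_eq (integral_congr_ae (ae_of_all _ fun x => ?_))
    simp only [inner_smul_left, RCLike.conj_to_real]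
    ring

section Final

variable {N : ℕ} [Fact (2 ≤ N)]

set_option linter.unusedSectionVars false

variable {Ω : Set (Sph N)} {ρ : ℝ} {u : EuclideanSpace ℝ (Fin N) → ℝ}
  {G : EuclideanSpace ℝ (Fin N) → EuclideanSpace ℝ (Fin N)} {v : ℝ → ℝ} {φ : Sph N → ℝ}
  {A : Sph N → EuclideanSpace ℝ (Fin N)}

lemma MemH10.const_smul (h : MemH10 Ω φ A) (t : ℝ) :
    MemH10 Ω (fun θ => t * φ θ) (fun θ => t • A θ) := by
  obtain ⟨Ψ, hΨ, h1, h2⟩ := h.approx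
  have h0 : IsSphereTest Ω fun _ : EuclideanSpace ℝ (Fin N) => (0:ℝ) :=
    ⟨contDiff_const, by simp [tsupport]⟩
  have hg0 : ∀ θ : Sph N, sphereGrad (fun _ : EuclideanSpace ℝ (Fin N) => (0:ℝ)) θ = 0 :=
    fun θ => by simp [sphereGrad, gradient_fun_const]
  refine ⟨h.memLp.const_mul t, h.memLp_grad.const_smul t, fun n x => 0 + t * Ψ n x,
    fun n => h0.add_smul (hΨ n) t, ?_, ?_⟩
  · have h3 := ENNReal.Tendsto.const_mul h1 (Or.inr (enorm_ne_top (x := t)))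
    rw [mul_zero] at h3
    refine h3.congr fun n => ?_
    rw [← eLpNorm_const_smul]
    congr 1
    ext θ
    simp only [Pi.smul_apply, smul_eq_mul]
    ring
  · have h3 := ENNReal.Tendsto.const_mul h2 (Or.inr (enorm_ne_top (x := t)))
    rw [mul_zero] at h3
    refine h3.congr fun n => ?_
    rw [← eLpNorm_const_smul]
    congr 1
    ext1 θ
    rw [sphereGrad_add_smul contDiff_const (hΨ n).1, hg0, zero_add, Pi.smul_apply, smul_sub]

lemma ae_sphere_neBot (hΩ : IsOpen Ω) (hne : Ω.Nonempty) :
    (ae ((surf N).restrict Ω)).NeBot := by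
  rw [ae_neBot, Ne, Measure.restrict_eq_zero]
  exact (hΩ.measure_pos (surf N) hne).ne'

/-- The factors of a positive product have a common constant sign. -/
lemma exists_sign (hΩ : IsOpen Ω) (hne : Ω.Nonempty) (hρ : 0 ≤ ρ)
    (huvφ : ∀ r : ℝ, ρ < r → ∀ θ ∈ Ω, u (r • (θ : EuclideanSpace ℝ (Fin N))) = v r * φ θ)
    (hpos : ∀ᵐ x ∂(volume.restrict (cone Ω ρ)), 0 < u x) :
    ∃ s : ℝ, s * s = 1 ∧ (∀ᵐ r ∂(volume.restrict (Ioi ρ)), 0 < s * v r) ∧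
      ∀ᵐ θ ∂((surf N).restrict Ω), 0 < s * φ θ := by
  have hΩm := hΩ.measurableSet
  have hb := ae_sphere_neBot hΩ hne
  have hne' : (ae ((volume : Measure ℝ).restrict (Ioi ρ))).NeBot := by
    rw [ae_neBot, Ne, Measure.restrict_eq_zero, Real.volume_Ioi]; simp
  have h1 : ∀ᵐ q ∂(polMeasure Ω ρ), 0 < v q.1 * φ q.2 := by
    rw [ae_cone_iff hΩm hρ] at hpos
    filter_upwards [hpos, ae_polMeasure_mem hΩm ρ] with q hq hq'
    rwa [← huvφ q.1 hq'.1 q.2 hq'.2]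
  unfold polMeasure at h1
  have h2 := Measure.ae_ae_of_ae_prod h1
  obtain ⟨r₀, hr₀⟩ := h2.exists
  have hv : ∀ s : ℝ, s * s = 1 → (∀ᵐ θ ∂((surf N).restrict Ω), 0 < s * φ θ) →
      ∀ᵐ r ∂(volume.restrict (Ioi ρ)), 0 < s * v r := fun s hs hφ => by
    filter_upwards [h2] with r hr
    obtain ⟨θ, ht1, ht2⟩ := (Eventually.and hr hφ).exists
    refine pos_of_mul_pos_left (b := s * φ θ) ?_ ht2.le
    calc 0 < v r * φ θ := ht1
      _ = (s * s) * (v r * φ θ) := by rw [hs, one_mul]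
      _ = _ := by ring
  rcases lt_trichotomy (v r₀) 0 with h0 | h0 | h0
  · have hφ : ∀ᵐ θ ∂((surf N).restrict Ω), 0 < (-1:ℝ) * φ θ := by
      filter_upwards [hr₀] with θ hθ
      have := neg_of_mul_pos_right hθ h0.le
      linarith
    exact ⟨-1, by norm_num, hv _ (by norm_num) hφ, hφ⟩
  · obtain ⟨θ, hθ⟩ := hr₀.exists
    simp [h0] at hθ
  · have hφ : ∀ᵐ θ ∂((surf N).restrict Ω), 0 < (1:ℝ) * φ θ := by
      filter_upwards [hr₀] with θ hθ
      rw [one_mul]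
      exact pos_of_mul_pos_right hθ h0.le
    exact ⟨1, by norm_num, hv _ (by norm_num) hφ, hφ⟩

/-- There is a radial weight with the normalization required in `isWeakPair_angular`. -/
lemma IsSeparated.exists_normalized (h : IsSeparated Ω ρ u G v φ) (hΩ : IsOpen Ω)
    (hne : Ω.Nonempty) (hρ : 0 ≤ ρ) :
    ∃ m : ℝ → ℝ, IsTest (Ioi ρ) m ∧ ∫ t in Ioi ρ, v t * (m t * t⁻¹) = 1 := by
  have hIρ : Icc (ρ + 1) (ρ + 2) ⊆ Ioi ρ := fun x hx => by
    have := hx.1; simp only [mem_Ioi]; linarith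
  obtain ⟨χ, hχ, hχ0, hχ1⟩ := exists_cutoff isCompact_Icc hIρ
  have hχt : IsTest (Ioi ρ) fun t => χ t * t⁻¹ := hχ.mul_smooth fun t ht =>
    contDiffAt_inv ℝ (hρ.trans_lt ht).ne'
  have hi : IntegrableOn (fun t => v t * (χ t * t⁻¹)) (Ioi ρ) :=
    (LocallyIntegrableOn.integrable_mul (h.locallyIntegrableOn_v hΩ hne hρ)
      hχt.smooth.continuous hχt.compact hχt.supp).integrableOn
  set M := ∫ t in Ioi ρ, v t * (χ t * t⁻¹) with hM
  have hM0 : 0 < M := by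
    have h0 : 0 ≤ᵐ[volume.restrict (Ioi ρ)] fun t => v t * (χ t * t⁻¹) := by
      filter_upwards [h.vpos, ae_restrict_mem measurableSet_Ioi] with t ht htρ
      exact mul_nonneg ht.le (mul_nonneg (hχ0 t) (inv_nonneg.2 (hρ.trans htρ.le)))
    rw [hM, integral_pos_iff_support_of_nonneg_ae h0 hi]
    have h1 : 0 < (volume.restrict (Ioi ρ)) (Icc (ρ + 1) (ρ + 2)) := by
      rw [Measure.restrict_apply measurableSet_Icc, inter_eq_left.2 hIρ, Real.volume_Icc]
      simp
    refine h1.trans_le (measure_mono_ae ?_)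
    filter_upwards [h.vpos, ae_restrict_mem measurableSet_Ioi] with t ht htρ htI
    have h2 : χ t = 1 := (hχ1 t htI).eq_of_nhds
    exact mul_ne_zero ht.ne' (by rw [h2, one_mul]; exact inv_ne_zero (hρ.trans_lt htρ).ne')
  refine ⟨fun t => χ t * M⁻¹, hχ.mul_smooth fun _ _ => contDiffAt_const, ?_⟩
  have : ∀ t, v t * (χ t * M⁻¹ * t⁻¹) = M⁻¹ * (v t * (χ t * t⁻¹)) := fun t => by ring
  simp only [this]
  rw [integral_const_mul, ← hM, inv_mul_cancel₀ hM0.ne']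

/-- The eigenvalue equation for `φ₁ = k φ` gives that of `φ`. -/
lemma IsSeparatedSuper.eigenvalue_equation (h : IsSeparatedSuper Ω ρ u G v φ A) {φ₁ : Sph N → ℝ}
    {G₁ : Sph N → EuclideanSpace ℝ (Fin N)} (h1 : MemH10 Ω φ₁ G₁)
    (hEL : ∀ Ψ : EuclideanSpace ℝ (Fin N) → ℝ, IsSphereTest Ω Ψ →
      ∫ θ in Ω, ⟪G₁ θ, sphereGrad Ψ θ⟫ ∂(surf N) =
        dirichletEigenvalue Ω * ∫ θ in Ω, φ₁ θ * Ψ θ ∂(surf N))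
    {k : ℝ} (hk0 : k ≠ 0) (hk : ∀ᵐ θ ∂((surf N).restrict Ω), φ₁ θ = k * φ θ)
    (Ψ : EuclideanSpace ℝ (Fin N) → ℝ) (hΨ : IsSphereTest Ω Ψ) :
    ∫ θ in Ω, ⟪A θ, sphereGrad Ψ θ⟫ ∂(surf N) =
      dirichletEigenvalue Ω * ∫ θ in Ω, φ θ * Ψ θ ∂(surf N) := by
  have hG := h.gradient_eq_of_energy_eq h1 (h1.energy_eq hEL)
  have e1 : ∫ θ in Ω, ⟪G₁ θ, sphereGrad Ψ θ⟫ ∂(surf N) =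
      k * ∫ θ in Ω, ⟪A θ, sphereGrad Ψ θ⟫ ∂(surf N) := by
    rw [← integral_const_mul]
    refine integral_congr_ae ?_
    filter_upwards [hG, hk, h.φpos] with θ a1 a2 a3
    rw [a1, a2, mul_div_assoc, div_self a3.ne', mul_one, inner_smul_left]
    rfl
  have e2 : ∫ θ in Ω, φ₁ θ * Ψ θ ∂(surf N) = k * ∫ θ in Ω, φ θ * Ψ θ ∂(surf N) := by
    rw [← integral_const_mul]
    refine integral_congr_ae ?_
    filter_upwards [hk] with θ a2
    rw [a2, mul_assoc]
  have := hEL Ψ hΨ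
  rw [e1, e2, mul_left_comm] at this
  exact mul_left_cancel₀ hk0 this

/-- A principal eigenfunction exists: the minimizer of the Rayleigh quotient is a multiple of `φ`,
hence has a constant sign. -/
lemma IsSeparatedSuper.exists_principal (h : IsSeparatedSuper Ω ρ u G v φ A) :
    ∃ φ₁ : Sph N → ℝ, IsPrincipalEigenfunction Ω φ₁ := by
  obtain ⟨φ₀, G₀, h0, hnorm, hEL⟩ := exists_minimizer h.isOpen h.isConnected.nonempty
  obtain ⟨k, hk⟩ := h.eq_const_mul h0 (h0.energy_eq hEL)
  have hk0 : k ≠ 0 := by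
    rintro rfl
    have : ∫ θ in Ω, φ₀ θ ^ 2 ∂(surf N) = 0 :=
      integral_eq_zero_of_ae (by filter_upwards [hk] with θ hθ; simp [hθ])
    rw [hnorm] at this
    exact one_ne_zero this
  set t := |k| / k with ht
  have htk : t * k = |k| := div_mul_cancel₀ _ hk0
  have ht2 : t ^ 2 = 1 := by rw [ht, div_pow, sq_abs, div_self (pow_ne_zero 2 hk0)]
  refine ⟨fun θ => t * φ₀ θ, ?_, ?_, fun θ => t • G₀ θ, h0.const_smul t, fun Ψ hΨ => ?_⟩
  · filter_upwards [hk, h.φpos] with θ h1 h2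
    rw [h1, ← mul_assoc, htk]
    exact mul_pos (abs_pos.2 hk0) h2
  · simp only [mul_pow, ht2, one_mul]
    exact hnorm
  · simp only [inner_smul_left, RCLike.conj_to_real, mul_assoc]
    rw [integral_const_mul, integral_const_mul, hEL Ψ hΨ, mul_left_comm]

end Final

end ConeHardy

theorem mainTheorem8 (N : ℕ) (hN : 2 ≤ N) (Ω : Set (ConeHardy.Sph N)) (hΩ : IsOpen Ω)
    (hΩc : IsConnected Ω) (ρ : ℝ) (hρ : 0 ≤ ρ)
    (u : EuclideanSpace ℝ (Fin N) → ℝ) (v : ℝ → ℝ) (φ : ConeHardy.Sph N → ℝ)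
    (huvφ : ∀ r : ℝ, ρ < r → ∀ θ ∈ Ω, u (r • (θ : EuclideanSpace ℝ (Fin N))) = v r * φ θ)
    (hpos : ∀ᵐ x ∂(volume.restrict (ConeHardy.cone Ω ρ)), 0 < u x)
    (hu : ConeHardy.IsConeSuperSolution Ω ρ u) :
    (∃ φ₁ : ConeHardy.Sph N → ℝ, ConeHardy.IsPrincipalEigenfunction Ω φ₁) ∧
    ∀ φ₁ : ConeHardy.Sph N → ℝ, ConeHardy.IsPrincipalEigenfunction Ω φ₁ →
      ∃ c : ℝ, c ≠ 0 ∧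
        (∀ᵐ θ ∂((ConeHardy.surf N).restrict Ω), φ θ = c * φ₁ θ) ∧
        (∀ᵐ r ∂(volume.restrict (Ioi ρ)), 0 < c * v r) ∧
        ConeHardy.IsRadialSuperSolution N ρ (fun r => c * v r) := by
  have : Fact (2 ≤ N) := ⟨hN⟩
  obtain ⟨G, hmem, hsup⟩ := hu
  have hweak := hmem.isWeakPair (ConeHardy.isOpen_cone hΩ hρ)
  obtain ⟨s, hs, hv, hφ⟩ := ConeHardy.exists_sign hΩ hΩc.nonempty hρ huvφ hpos
  have hsep : ConeHardy.IsSeparated Ω ρ u G (fun r => s * v r) (fun θ => s * φ θ) :=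
    { weak := hweak
      eq := fun r hr θ hθ => by
        rw [huvφ r hr θ hθ, mul_mul_mul_comm, hs, one_mul]
      vpos := hv
      φpos := hφ }
  obtain ⟨m, hm, hm1⟩ := hsep.exists_normalized hΩ hΩc.nonempty hρ
  have h : ConeHardy.IsSeparatedSuper Ω ρ u G (fun r => s * v r) (fun θ => s * φ θ)
      (ConeHardy.angGrad ρ m G (fun r => s * v r) (fun θ => s * φ θ)) :=
    { hsep with
      isOpen := hΩ
      isConnected := hΩc
      nonneg := hρ
      mem := hmem
      super := hsup
      pos := hpos
      integrableOn_grad := fun L hL hLΩ => hsep.integrableOn_angGrad hΩ hρ hm L hL hLΩ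
      angular := hsep.isWeakPair_angular hΩ hρ hm hm1 }
  refine ⟨h.exists_principal, fun φ₁ ⟨hφ₁, _, G₁, h1, hEL⟩ => ?_⟩
  obtain ⟨k, hk⟩ := h.eq_const_mul h1 (h1.energy_eq hEL)
  have hk0 : 0 < k := by
    have := ConeHardy.ae_sphere_neBot hΩ hΩc.nonempty
    obtain ⟨θ, ⟨a1, a2⟩, a3⟩ := (Eventually.and (Eventually.and hk hφ) hφ₁).exists
    rw [a1] at a3
    exact pos_of_mul_pos_left a3 a2.le
  have hs0 : s ≠ 0 := fun h0 => by simp [h0] at hs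
  have hR := h.isRadialSuperSolution (h.eigenvalue_equation h1 hEL hk0.ne' hk)
  have hc : ∀ r, s / k * v r = k⁻¹ * (s * v r) := fun r => by ring
  -- `φ₁ = k s φ` with `s² = 1`, so that `φ = (s / k) φ₁`
  refine ⟨s / k, div_ne_zero hs0 hk0.ne', ?_, ?_, ?_⟩
  · filter_upwards [hk] with θ hθ
    rw [hθ, div_mul_eq_mul_div, mul_left_comm s k, mul_div_cancel_left₀ _ hk0.ne', ← mul_assoc, hs,
      one_mul]
  · filter_upwards [hv] with r hr
    rw [hc]
    exact mul_pos (inv_pos.2 hk0) hr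
  · simp only [hc]
    exact ConeHardy.IsSuperSolution.const_mul hR (inv_pos.2 hk0).le
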